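/- Let $N\ge 1$ and $q\in\mathbb C$, $q\neq 0,\pm1$. Let $E_{ab}$ be the matrix units of size $N$ and $$R_q(u)=(uq-q^{-1})\sum_a E_{aa}\otimes E_{aa}+(u-1)\sum_{a<b}(E_{aa}\otimes E_{bb}+E_{bb}\otimes E_{aa})+(q-q^{-1})\sum_{a<b}(u\,E_{ab}\otimes E_{ba}+E_{ba}\otimes E_{ab}).$$ The quantum loop algebra $U_q(\widetilde{\mathfrak{gl}}_N)$ is the unital associative $\mathbb C$-algebra with generators $L^{(\pm s)}_{ab}$, $1\le a,b\le N$, $s\ge 0$ (with $L^{(+0)}_{ab}$, $L^{(-0)}_{ab}$ distinct generators), organized in series $L^\pm_{ab}(u)=\sum_{s\ge 0}L^{(\pm s)}_{ab}u^{\pm s}$ and matrices $L^\pm(u)=\sum_{a,b} E_{ab}\otimes L^\pm_{ab}(u)$, with relations $L^{(+0)}_{ab}=L^{(-0)}_{ba}=0$ for $a<b$, $L^{(-0)}_{aa}L^{(+0)}_{aa}=L^{(+0)}_{aa}L^{(-0)}_{aa}=1$, and $$R_q^{(12)}(u/v)\,(L^\mu(u))^{(1)}(L^\nu(v))^{(2)}=(L^\nu(v))^{(2)}(L^\mu(u))^{(1)}R_q^{(12)}(u/v),\qquad(\mu,\nu)=(+,+),(+,-),(-,-).$$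 The coproduct is $\Delta:L^\pm_{ab}(u)\mapsto\sum_c L^\pm_{cb}(u)\otimes L^\pm_{ac}(u)$. The subalgebra $U_q^-(\widetilde{\mathfrak{gl}}_N)$ generated by the coefficients of the series $L^-_{ab}(u)$ satisfies $\Delta(U_q^-)\subset U_q^-\otimes U_q^-$, so tensor products of $U_q^-$-modules are $U_q^-$-modules. A vector $v$ of a $U_q^-$-module is weight singular if $L^-_{ba}(u)v=0$ for all $a<b$ and $v$ is an eigenvector of $L^-_{11}(u),\dots,L^-_{NN}(u)$, with eigenvalues $\langle L^-_{aa}(u)v\rangle\in\mathbb C[[u^{-1}]]$. For $\xi=(\xi^1,\dots,\xi^{N-1})\in\mathbb Z_{\ge0}^{N-1}$ put $|\xi|=\sum_a\xi^a$, $\xi^{<a}=\xi^1+\dots+\xi^{a-1}$. For formal variables $t=(t^1_1,\dots,t^1_{\xi^1};\dots;t^{N-1}_1,\dots,t^{N-1}_{\xi^{N-1}})$ let $$\widehat{\mathbb B}_\xi(t)=(\mathrm{tr}^{\otimes|\xi|}\otimes\mathrm{id})\Bigl((L^-(t^1_1))^{(1,|\xi|+1)}\cdots(L^-(t^{N-1}_{\xi^{N-1}}))^{(|\xi|,|\xi|+1)}\prod_{(a,i)<(b,j)}R_q^{(\xi^{<b}+j,\;\xi^{<a}+i)}(t^b_j/t^a_i)\;E_{21}^{\otimes\xi^1}\otimes\cdots\otimes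 E_{N,N-1}^{\otimes\xi^{N-1}}\otimes1\Bigr),$$ where pairs are ordered lexicographically, the factor of $\{(a,i)<(b,j)\}$ stands to the left of that of $\{(c,k)<(d,l)\}$ if $(a,i)<(c,k)$, or $(a,i)=(c,k)$ and $(b,j)<(d,l)$; and let $$\mathbb B_\xi(t)=\widehat{\mathbb B}_\xi(t)\prod_{a=1}^{N-1}\prod_{1\le i<j\le\xi^a}\frac{t^a_i}{q\,t^a_j-q^{-1}t^a_i}\prod_{1\le a<b<N}\prod_{i=1}^{\xi^a}\prod_{j=1}^{\xi^b}\frac{t^a_i}{t^b_j-t^a_i}.$$ For $\eta\in\mathbb Z_{\ge0}^{N-1}$ with $\eta\le\xi$ componentwise put $t_{[\eta]}=(t^a_i)_{1\le i\le\eta^a}$ and $t_{(\eta,\xi]}=(t^a_i)_{\eta^a<i\le\xi^a}$. Let $[r]_q=(q^r-q^{-r})/(q-q^{-1})$, $[r]_q!=[1]_q\cdots[r]_q$. For $\tau=(\tau^1,\dots,\tau^{N-1})\in S_\xi:=S_{\xi^1}\times\dots\times S_{\xi^{N-1}}$ let $t^\tau$ be the collection with $t^a_{\tau^a(i)}$ at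 the place $(a,i)$, and $$\overline{\mathrm{Sym}}{}^{\,\xi}_{\,t}f(t)=\sum_{\tau\in S_\xi}(fW)(t^\tau),\qquad W(t)=\prod_{a=1}^{N-1}\prod_{1\le i<j\le\xi^a}\frac{q^{-1}t^a_i-q\,t^a_j}{t^a_i-t^a_j}.$$ Theorem. Let $V_1,V_2$ be $U_q^-(\widetilde{\mathfrak{gl}}_N)$-modules and $v_1\in V_1$, $v_2\in V_2$ weight singular vectors. For $\eta\le\xi$ set $$F_\eta(t)=\prod_{a=1}^{N-2}\prod_{i=1}^{\eta^{a+1}}\prod_{j=\eta^a+1}^{\xi^a}\frac{q\,t^{a+1}_i-q^{-1}t^a_j}{t^{a+1}_i-t^a_j}\;\prod_{a=1}^{N-1}\Bigl(\prod_{i=1}^{\eta^a}\langle L^-_{aa}(t^a_i)v_2\rangle\prod_{j=\eta^a+1}^{\xi^a}\langle L^-_{a+1,a+1}(t^a_j)v_1\rangle\Bigr)\;\mathbb B_\eta(t_{[\eta]})v_1\otimes\mathbb B_{\xi-\eta}(t_{(\eta,\xi]})v_2.$$ (i) If $[\xi^a]_q!\ne0$ for all $a$ (in particular if $q$ is not a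 root of unity), then $$\mathbb B_\xi(t)(v_1\otimes v_2)=\sum_{\eta\le\xi}\;\prod_{a=1}^{N-1}\frac1{[\xi^a-\eta^a]_q!\,[\eta^a]_q!}\;\;\overline{\mathrm{Sym}}{}^{\,\xi}_{\,t}\bigl[F_\eta(t)\bigr].$$ (ii) For every $q\ne0,\pm1$, roots of unity included, $$\mathbb B_\xi(t)(v_1\otimes v_2)=\sum_{\eta\le\xi}\;\sum_{\tau}\;(F_\eta W_\eta)(t^\tau),\qquad W_\eta(t)=\prod_{a=1}^{N-1}\prod_{i=1}^{\eta^a}\prod_{j=\eta^a+1}^{\xi^a}\frac{q^{-1}t^a_i-q\,t^a_j}{t^a_i-t^a_j},$$ where $\tau$ runs over the representatives of the cosets of $\prod_a S_{\eta^a}\times S_{\xi^a-\eta^a}$ in $S_\xi$ such that each $\tau^a$ is increasing on $\{1,\dots,\eta^a\}$ and on $\{\eta^a+1,\dots,\xi^a\}$. On the left sides $\mathbb B_\xi(t)$ acts in $V_1\otimes V_2$. The identities hold as identities of formal series with coefficients in $V_1\otimes V_2$: the variables are given any linear order, and expressions are regarded as series in the $(t^a_i)^{-1}$ with integer exponent vectors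 and with support well-ordered lexicographically, which amounts to expanding all rational functions in the region where each variable is much larger than all later ones. -/

import Mathlib

open scoped TensorProduct Kronecker

namespace QLoop

/-! ### The trigonometric R-matrix -/

section RMatrix

variable {R : Type*} [CommRing R] [Algebra ℂ R]

/-- The matrix unit `E_{ab}` (row `a`, column `b`). -/
abbrev matUnit (N : ℕ) (R : Type*) [Zero R] [One R] (a b : Fin N) : Matrix (Fin N) (Fin N) R :=
  Matrix.single a b 1

/-- The homogeneous form `v R_q(u/v)` of the trigonometric R-matrix of `gl_N`. -/
noncomputable def rMatHom (N : ℕ) (q : ℂ) (u v : R) : Matrix (Fin N × Fin N) (Fin N × Fin N) R :=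
  (q • u - q⁻¹ • v) • ∑ a, matUnit N R a a ⊗ₖ matUnit N R a a
  + (u - v) • ∑ a, ∑ b ∈ Finset.Ioi a,
      (matUnit N R a a ⊗ₖ matUnit N R b b + matUnit N R b b ⊗ₖ matUnit N R a a)
  + (q - q⁻¹) • ∑ a, ∑ b ∈ Finset.Ioi a,
      (u • (matUnit N R a b ⊗ₖ matUnit N R b a) + v • (matUnit N R b a ⊗ₖ matUnit N R a b))

/-- The trigonometric R-matrix
`R_q(u) = (uq - q⁻¹) ∑_a E_aa ⊗ E_aa + (u - 1) ∑_{a<b} (E_aa ⊗ E_bb + E_bb ⊗ E_aa)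
  + (q - q⁻¹) ∑_{a<b} (u E_ab ⊗ E_ba + E_ba ⊗ E_ab)`. -/
noncomputable def rMat (N : ℕ) (q : ℂ) (u : R) : Matrix (Fin N × Fin N) (Fin N × Fin N) R :=
  rMatHom N q u 1

end RMatrix

/-! ### Generating series in two variables and the RLL relation

`A⟦x⟧⟦y⟧` is `PowerSeries (PowerSeries A)`; the inner variable is `x`, the outer one is `y`. -/

section RLL

/-- Power series in two central variables `x` (inner) and `y` (outer). -/
abbrev PS2 (A : Type*) := PowerSeries (PowerSeries A)

/-- The variable `x`. -/
noncomputable def psX : PS2 ℂ := PowerSeries.C PowerSeries.X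

/-- The variable `y`. -/
noncomputable def psY : PS2 ℂ := PowerSeries.X

variable {A : Type*} [Ring A] [Algebra ℂ A] {B : Type*} [Ring B] [Algebra ℂ B] {N : ℕ}

/-- Coefficientwise application of a ring homomorphism to series in `x`, `y`. -/
noncomputable def mapPS2 {A B : Type*} [Semiring A] [Semiring B] (f : A →+* B) :
    PS2 A →+* PS2 B :=
  PowerSeries.map (PowerSeries.map f)

/-- The matrix of series `∑_s ℓ_{ab}(s) x^s`. -/
noncomputable def serX (l : Fin N → Fin N → ℕ → A) : Matrix (Fin N) (Fin N) (PS2 A) :=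
  fun a b => PowerSeries.C (PowerSeries.mk (l a b))

/-- The matrix of series `∑_s ℓ_{ab}(s) y^s`. -/
noncomputable def serY (l : Fin N → Fin N → ℕ → A) : Matrix (Fin N) (Fin N) (PS2 A) :=
  fun a b => PowerSeries.map PowerSeries.C (PowerSeries.mk (l a b))

/-- A scalar matrix of series regarded as a matrix of series with coefficients in `A`. -/
noncomputable def scalarPS2 (A : Type*) [Ring A] [Algebra ℂ A] {ι : Type*}
    (M : Matrix ι ι (PS2 ℂ)) : Matrix ι ι (PS2 A) :=
  M.map (mapPS2 (algebraMap ℂ A))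

/-- The left side `R^{(12)} L(x)^{(1)} L'(y)^{(2)}` of the RLL relation. -/
noncomputable def rllLeft (R : Matrix (Fin N × Fin N) (Fin N × Fin N) (PS2 ℂ))
    (l l' : Fin N → Fin N → ℕ → A) : Matrix (Fin N × Fin N) (Fin N × Fin N) (PS2 A) :=
  scalarPS2 A R * (serX l ⊗ₖ 1) * (1 ⊗ₖ serY l')

/-- The right side `L'(y)^{(2)} L(x)^{(1)} R^{(12)}` of the RLL relation. -/
noncomputable def rllRight (R : Matrix (Fin N × Fin N) (Fin N × Fin N) (PS2 ℂ))
    (l l' : Fin N → Fin N → ℕ → A) : Matrix (Fin N × Fin N) (Fin N × Fin N) (PS2 A) :=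
  (1 ⊗ₖ serY l') * (serX l ⊗ₖ 1) * scalarPS2 A R

end RLL

/-! ### The quantum loop algebra -/

/-- The two signs labelling the series `L^+` and `L^-`. -/
inductive Sgn : Type
  | plus : Sgn
  | minus : Sgn

/-- Labels of the generators `L_{ab}^{(±s)}`, `1 ≤ a, b ≤ N`, `s ≥ 0`. -/
abbrev Gen (N : ℕ) := Sgn × Fin N × Fin N × ℕ

noncomputable section

/-- The free generators. -/
def freeGen (N : ℕ) (μ : Sgn) (a b : Fin N) (s : ℕ) : FreeAlgebra ℂ (Gen N) :=
  FreeAlgebra.ι ℂ (μ, a, b, s)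

open Sgn in
/-- The defining relations of `U_q(\tilde{gl}_N)`. The relation
`R_q^{(12)}(u/v) (L^μ(u))^{(1)} (L^ν(v))^{(2)} = (L^ν(v))^{(2)} (L^μ(u))^{(1)} R_q^{(12)}(u/v)`
is imposed coefficient by coefficient, with the denominator of `R_q(u/v)` cleared:
`x = u` for `μ = +`, `x = u⁻¹` for `μ = -`, `y = v` for `ν = +`, `y = v⁻¹` for `ν = -`,
so that `u/v` is respectively `x/y`, `(xy)/1`, `y/x` for `(μ,ν) = (+,+), (+,-), (-,-)`. -/
inductive Rel (N : ℕ) (q : ℂ) : FreeAlgebra ℂ (Gen N) → FreeAlgebra ℂ (Gen N) → Prop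
  | plus_zero (a b : Fin N) (h : a < b) : Rel N q (freeGen N plus a b 0) 0
  | minus_zero (a b : Fin N) (h : a < b) : Rel N q (freeGen N minus b a 0) 0
  | minus_mul_plus (a : Fin N) : Rel N q (freeGen N minus a a 0 * freeGen N plus a a 0) 1
  | plus_mul_minus (a : Fin N) : Rel N q (freeGen N plus a a 0 * freeGen N minus a a 0) 1
  | rll_plus_plus (i j : Fin N × Fin N) (r s : ℕ) : Rel N q
      (PowerSeries.coeff r (PowerSeries.coeff s
        (rllLeft (rMatHom N q psX psY) (freeGen N plus) (freeGen N plus) i j)))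
      (PowerSeries.coeff r (PowerSeries.coeff s
        (rllRight (rMatHom N q psX psY) (freeGen N plus) (freeGen N plus) i j)))
  | rll_plus_minus (i j : Fin N × Fin N) (r s : ℕ) : Rel N q
      (PowerSeries.coeff r (PowerSeries.coeff s
        (rllLeft (rMatHom N q (psX * psY) 1) (freeGen N plus) (freeGen N minus) i j)))
      (PowerSeries.coeff r (PowerSeries.coeff s
        (rllRight (rMatHom N q (psX * psY) 1) (freeGen N plus) (freeGen N minus) i j)))
  | rll_minus_minus (i j : Fin N × Fin N) (r s : ℕ) : Rel N q
      (PowerSeries.coeff r (PowerSeries.coeff s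
        (rllLeft (rMatHom N q psY psX) (freeGen N minus) (freeGen N minus) i j)))
      (PowerSeries.coeff r (PowerSeries.coeff s
        (rllRight (rMatHom N q psY psX) (freeGen N minus) (freeGen N minus) i j)))

/-- The quantum loop algebra `U_q(\tilde{gl}_N)`. -/
def Uq (N : ℕ) (q : ℂ) : Type := RingQuot (Rel N q)

instance (N : ℕ) (q : ℂ) : Ring (Uq N q) := inferInstanceAs (Ring (RingQuot (Rel N q)))

instance (N : ℕ) (q : ℂ) : Algebra ℂ (Uq N q) :=
  inferInstanceAs (Algebra ℂ (RingQuot (Rel N q)))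

/-- The quotient map from the free algebra. -/
def toUq (N : ℕ) (q : ℂ) : FreeAlgebra ℂ (Gen N) →ₐ[ℂ] Uq N q :=
  RingQuot.mkAlgHom ℂ (Rel N q)

lemma toUq_rel {N : ℕ} {q : ℂ} {x y : FreeAlgebra ℂ (Gen N)} (h : Rel N q x y) :
    toUq N q x = toUq N q y :=
  RingQuot.mkAlgHom_rel ℂ h

/-- The generators `L_{ab}^{(±s)}` of `U_q(\tilde{gl}_N)`. -/
def Lgen (N : ℕ) (q : ℂ) (μ : Sgn) (a b : Fin N) (s : ℕ) : Uq N q :=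
  toUq N q (freeGen N μ a b s)

/-! ### Universal property -/

section Universal

open Sgn

variable {A : Type*} [Ring A] [Algebra ℂ A] {B : Type*} [Ring B] [Algebra ℂ B] {N : ℕ} {q : ℂ}

/-- Elements of an algebra that satisfy the defining relations of `U_q(\tilde{gl}_N)`. -/
structure SatisfiesRel (N : ℕ) (q : ℂ) (l : Sgn → Fin N → Fin N → ℕ → A) : Prop where
  plus_zero : ∀ a b, a < b → l plus a b 0 = 0
  minus_zero : ∀ a b, a < b → l minus b a 0 = 0
  minus_mul_plus : ∀ a, l minus a a 0 * l plus a a 0 = 1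
  plus_mul_minus : ∀ a, l plus a a 0 * l minus a a 0 = 1
  rll_plus_plus : rllLeft (rMatHom N q psX psY) (l plus) (l plus)
    = rllRight (rMatHom N q psX psY) (l plus) (l plus)
  rll_plus_minus : rllLeft (rMatHom N q (psX * psY) 1) (l plus) (l minus)
    = rllRight (rMatHom N q (psX * psY) 1) (l plus) (l minus)
  rll_minus_minus : rllLeft (rMatHom N q psY psX) (l minus) (l minus)
    = rllRight (rMatHom N q psY psX) (l minus) (l minus)

lemma mapPS2_coeff (f : A →ₐ[ℂ] B) (x : PS2 A) (r s : ℕ) :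
    PowerSeries.coeff r (PowerSeries.coeff s (mapPS2 (f : A →+* B) x))
      = f (PowerSeries.coeff r (PowerSeries.coeff s x)) := by
  simp [mapPS2]

lemma serX_map (f : A →ₐ[ℂ] B) (l : Fin N → Fin N → ℕ → A) :
    (serX l).map (mapPS2 (f : A →+* B)) = serX (fun a b s => f (l a b s)) := by
  ext a b s r
  simp only [Matrix.map_apply, mapPS2_coeff]
  simp only [serX, PowerSeries.coeff_C]
  split_ifs <;> simp

lemma serY_map (f : A →ₐ[ℂ] B) (l : Fin N → Fin N → ℕ → A) :
    (serY l).map (mapPS2 (f : A →+* B)) = serY (fun a b s => f (l a b s)) := by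
  ext a b s r
  simp only [Matrix.map_apply, mapPS2_coeff]
  simp only [serY, PowerSeries.coeff_map, PowerSeries.coeff_mk, PowerSeries.coeff_C]
  split_ifs <;> simp

lemma scalarPS2_map (f : A →ₐ[ℂ] B) {ι : Type*} (M : Matrix ι ι (PS2 ℂ)) :
    (scalarPS2 A M).map (mapPS2 (f : A →+* B)) = scalarPS2 B M := by
  ext a b s r
  simp only [Matrix.map_apply, mapPS2_coeff, scalarPS2]
  simp [mapPS2]

lemma kron_one_map {A B : Type*} [Ring A] [Ring B] (g : PS2 A →+* PS2 B) (M : Matrix (Fin N) (Fin N) (PS2 A)) :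
    (M ⊗ₖ (1 : Matrix (Fin N) (Fin N) (PS2 A))).map g
      = M.map g ⊗ₖ (1 : Matrix (Fin N) (Fin N) (PS2 B)) := by
  ext i j
  simp only [Matrix.map_apply, Matrix.kroneckerMap_apply, map_mul, Matrix.one_apply]
  split_ifs <;> simp

lemma one_kron_map {A B : Type*} [Ring A] [Ring B] (g : PS2 A →+* PS2 B) (M : Matrix (Fin N) (Fin N) (PS2 A)) :
    ((1 : Matrix (Fin N) (Fin N) (PS2 A)) ⊗ₖ M).map g
      = (1 : Matrix (Fin N) (Fin N) (PS2 B)) ⊗ₖ M.map g := by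
  ext i j
  simp only [Matrix.map_apply, Matrix.kroneckerMap_apply, map_mul, Matrix.one_apply]
  split_ifs <;> simp

lemma rllLeft_map (f : A →ₐ[ℂ] B) (R : Matrix (Fin N × Fin N) (Fin N × Fin N) (PS2 ℂ))
    (l l' : Fin N → Fin N → ℕ → A) :
    (rllLeft R l l').map (mapPS2 (f : A →+* B))
      = rllLeft R (fun a b s => f (l a b s)) (fun a b s => f (l' a b s)) := by
  simp only [rllLeft, Matrix.map_mul, scalarPS2_map, kron_one_map, one_kron_map, serX_map,
    serY_map]

lemma rllRight_map (f : A →ₐ[ℂ] B) (R : Matrix (Fin N × Fin N) (Fin N × Fin N) (PS2 ℂ))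
    (l l' : Fin N → Fin N → ℕ → A) :
    (rllRight R l l').map (mapPS2 (f : A →+* B))
      = rllRight R (fun a b s => f (l a b s)) (fun a b s => f (l' a b s)) := by
  simp only [rllRight, Matrix.map_mul, scalarPS2_map, kron_one_map, one_kron_map, serX_map,
    serY_map]

lemma rll_of_coeff (f : FreeAlgebra ℂ (Gen N) →ₐ[ℂ] B)
    (R : Matrix (Fin N × Fin N) (Fin N × Fin N) (PS2 ℂ)) (l l' : Fin N → Fin N → ℕ → _)
    (h : ∀ i j r s, f (PowerSeries.coeff r (PowerSeries.coeff s (rllLeft R l l' i j)))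
      = f (PowerSeries.coeff r (PowerSeries.coeff s (rllRight R l l' i j)))) :
    rllLeft R (fun a b s => f (l a b s)) (fun a b s => f (l' a b s))
      = rllRight R (fun a b s => f (l a b s)) (fun a b s => f (l' a b s)) := by
  rw [← rllLeft_map, ← rllRight_map]
  ext i j s r
  simp only [Matrix.map_apply, mapPS2_coeff, h]

lemma coeff_of_rll (f : FreeAlgebra ℂ (Gen N) →ₐ[ℂ] B)
    (R : Matrix (Fin N × Fin N) (Fin N × Fin N) (PS2 ℂ)) (l l' : Fin N → Fin N → ℕ → _)
    (h : rllLeft R (fun a b s => f (l a b s)) (fun a b s => f (l' a b s))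
      = rllRight R (fun a b s => f (l a b s)) (fun a b s => f (l' a b s))) (i j r s) :
    f (PowerSeries.coeff r (PowerSeries.coeff s (rllLeft R l l' i j)))
      = f (PowerSeries.coeff r (PowerSeries.coeff s (rllRight R l l' i j))) := by
  rw [← rllLeft_map, ← rllRight_map] at h
  have := congrArg (fun x => PowerSeries.coeff r (PowerSeries.coeff s x)) (congrFun₂ h i j)
  simpa only [Matrix.map_apply, mapPS2_coeff] using this

/-- The generators of `U_q(\tilde{gl}_N)` satisfy the defining relations. -/
lemma satisfiesRel_Lgen (N : ℕ) (q : ℂ) : SatisfiesRel N q (Lgen N q) where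
  plus_zero a b h := by
    simpa [Lgen] using toUq_rel (Rel.plus_zero (q := q) a b h)
  minus_zero a b h := by
    simpa [Lgen] using toUq_rel (Rel.minus_zero (q := q) a b h)
  minus_mul_plus a := by
    simpa [Lgen] using toUq_rel (Rel.minus_mul_plus (q := q) a)
  plus_mul_minus a := by
    simpa [Lgen] using toUq_rel (Rel.plus_mul_minus (q := q) a)
  rll_plus_plus := rll_of_coeff (toUq N q) _ _ _
    fun i j r s => toUq_rel (Rel.rll_plus_plus i j r s)
  rll_plus_minus := rll_of_coeff (toUq N q) _ _ _
    fun i j r s => toUq_rel (Rel.rll_plus_minus i j r s)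
  rll_minus_minus := rll_of_coeff (toUq N q) _ _ _
    fun i j r s => toUq_rel (Rel.rll_minus_minus i j r s)

/-- The homomorphism of the free algebra given by a family of elements. -/
def freeLift (l : Sgn → Fin N → Fin N → ℕ → A) : FreeAlgebra ℂ (Gen N) →ₐ[ℂ] A :=
  FreeAlgebra.lift ℂ fun g => l g.1 g.2.1 g.2.2.1 g.2.2.2

@[simp] lemma freeLift_freeGen (l : Sgn → Fin N → Fin N → ℕ → A) (μ : Sgn) (a b : Fin N)
    (s : ℕ) : freeLift l (freeGen N μ a b s) = l μ a b s := by
  simp [freeLift, freeGen]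

/-- The homomorphism of `U_q(\tilde{gl}_N)` given by elements satisfying the relations. -/
def lift (l : Sgn → Fin N → Fin N → ℕ → A) (h : SatisfiesRel N q l) : Uq N q →ₐ[ℂ] A :=
  RingQuot.liftAlgHom ℂ ⟨freeLift l, by
    intro x y hxy
    induction hxy with
    | plus_zero a b hab => simpa using h.plus_zero a b hab
    | minus_zero a b hab => simpa using h.minus_zero a b hab
    | minus_mul_plus a => simpa using h.minus_mul_plus a
    | plus_mul_minus a => simpa using h.plus_mul_minus a
    | rll_plus_plus i j r s =>
      exact coeff_of_rll _ _ _ _ (by simpa using h.rll_plus_plus) i j r s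
    | rll_plus_minus i j r s =>
      exact coeff_of_rll _ _ _ _ (by simpa using h.rll_plus_minus) i j r s
    | rll_minus_minus i j r s =>
      exact coeff_of_rll _ _ _ _ (by simpa using h.rll_minus_minus) i j r s⟩

@[simp] lemma lift_Lgen (l : Sgn → Fin N → Fin N → ℕ → A) (h : SatisfiesRel N q l)
    (μ : Sgn) (a b : Fin N) (s : ℕ) : lift l h (Lgen N q μ a b s) = l μ a b s := by
  refine (RingQuot.liftAlgHom_mkAlgHom_apply (S := ℂ) (freeLift l) _ _).trans ?_
  simp

end Universal

/-! ### The coproduct -/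

section Coproduct

open Sgn

variable {A : Type*} [Ring A] [Algebra ℂ A] {B : Type*} [Ring B] [Algebra ℂ B] {N : ℕ} {q : ℂ}

/-- The coefficients of `∑_c L_{cb}(u) ⊗ L_{ac}(u)`. -/
def tensorCoeff (l : Fin N → Fin N → ℕ → A) (m : Fin N → Fin N → ℕ → B) (a b : Fin N) (s : ℕ) :
    A ⊗[ℂ] B :=
  ∑ c, ∑ ij ∈ Finset.HasAntidiagonal.antidiagonal s, l c b ij.1 ⊗ₜ[ℂ] m a c ij.2

lemma serX_tensorCoeff (l : Fin N → Fin N → ℕ → A) (m : Fin N → Fin N → ℕ → B) :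
    serX (tensorCoeff l m) = fun a b => ∑ c,
      serX (fun a b s => (Algebra.TensorProduct.includeLeft : A →ₐ[ℂ] A ⊗[ℂ] B) (l a b s)) c b *
      serX (fun a b s => (Algebra.TensorProduct.includeRight : B →ₐ[ℂ] A ⊗[ℂ] B) (m a b s)) a c
    := by
  funext a b
  simp only [serX, ← map_mul, ← map_sum]
  congr 1
  ext s
  simp [tensorCoeff, PowerSeries.coeff_mul]

lemma serY_tensorCoeff (l : Fin N → Fin N → ℕ → A) (m : Fin N → Fin N → ℕ → B) :
    serY (tensorCoeff l m) = fun a b => ∑ c,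
      serY (fun a b s => (Algebra.TensorProduct.includeLeft : A →ₐ[ℂ] A ⊗[ℂ] B) (l a b s)) c b *
      serY (fun a b s => (Algebra.TensorProduct.includeRight : B →ₐ[ℂ] A ⊗[ℂ] B) (m a b s)) a c
    := by
  funext a b
  simp only [serY, ← map_mul, ← map_sum]
  congr 1
  ext s
  simp [tensorCoeff, PowerSeries.coeff_mul]

lemma map_commute {A B C : Type*} [Ring A] [Ring B] [Ring C] (f : A →+* C) (g : B →+* C)
    (h : ∀ a b, Commute (f a) (g b)) (x : PowerSeries A) (y : PowerSeries B) :
    Commute (PowerSeries.map f x) (PowerSeries.map g y) := by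
  refine PowerSeries.ext fun n => ?_
  rw [PowerSeries.coeff_mul, PowerSeries.coeff_mul, ← Finset.Nat.sum_antidiagonal_swap]
  refine Finset.sum_congr rfl fun p _ => ?_
  simpa using (h _ _).eq

/-- Coefficientwise images under homomorphisms with commuting ranges commute. -/
lemma mapPS2_commute {C : Type*} [Ring C] [Algebra ℂ C] (f : A →ₐ[ℂ] C) (g : B →ₐ[ℂ] C)
    (h : ∀ a b, Commute (f a) (g b)) (x : PS2 A) (y : PS2 B) :
    Commute (mapPS2 (f : A →+* C) x) (mapPS2 (g : B →+* C) y) := by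
  exact map_commute _ _ (map_commute _ _ h) x y

lemma mul_kron_one {S : Type*} [Ring S] (M M' : Matrix (Fin N) (Fin N) S) :
    ((M * M') ⊗ₖ (1 : Matrix (Fin N) (Fin N) S)) = (M ⊗ₖ 1) * (M' ⊗ₖ 1) := by
  ext ⟨a, b⟩ ⟨c, d⟩
  simp only [Matrix.kroneckerMap_apply, Matrix.mul_apply, Fintype.sum_prod_type, Matrix.one_apply]
  by_cases h : b = d <;> simp [h]

lemma one_kron_mul {S : Type*} [Ring S] (M M' : Matrix (Fin N) (Fin N) S) :
    ((1 : Matrix (Fin N) (Fin N) S) ⊗ₖ (M * M')) = (1 ⊗ₖ M) * (1 ⊗ₖ M') := by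
  ext ⟨a, b⟩ ⟨c, d⟩
  simp only [Matrix.kroneckerMap_apply, Matrix.mul_apply, Fintype.sum_prod_type, Matrix.one_apply]
  by_cases h : a = c <;> simp [h]

lemma kron_commute {S : Type*} [Ring S] (M M' : Matrix (Fin N) (Fin N) S)
    (h : ∀ a b c d, Commute (M a b) (M' c d)) :
    (M ⊗ₖ (1 : Matrix (Fin N) (Fin N) S)) * (1 ⊗ₖ M') = (1 ⊗ₖ M') * (M ⊗ₖ 1) := by
  ext ⟨a, b⟩ ⟨c, d⟩
  simp [Matrix.kroneckerMap_apply, Matrix.mul_apply, Fintype.sum_prod_type, Matrix.one_apply,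
    (h a c b d).eq]

lemma rll_tensorCoeff (R : Matrix (Fin N × Fin N) (Fin N × Fin N) (PS2 ℂ))
    (l l' : Fin N → Fin N → ℕ → A) (m m' : Fin N → Fin N → ℕ → B)
    (hl : rllLeft R l l' = rllRight R l l') (hm : rllLeft R m m' = rllRight R m m') :
    rllLeft R (tensorCoeff l m) (tensorCoeff l' m')
      = rllRight R (tensorCoeff l m) (tensorCoeff l' m') := by
  set iL : A →ₐ[ℂ] A ⊗[ℂ] B := Algebra.TensorProduct.includeLeft with hiL
  set iR : B →ₐ[ℂ] A ⊗[ℂ] B := Algebra.TensorProduct.includeRight with hiR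
  have hc : ∀ a b, Commute (iL a) (iR b) := fun a b => by
    simp [Commute, SemiconjBy, hiL, hiR]
  have hl2 := congrArg (fun M => M.map (mapPS2 (iL : A →+* A ⊗[ℂ] B))) hl
  have hm2 := congrArg (fun M => M.map (mapPS2 (iR : B →+* A ⊗[ℂ] B))) hm
  simp only [rllLeft_map, rllRight_map] at hl2 hm2
  simp only [rllLeft, rllRight] at hl2 hm2 ⊢
  set P := serX (fun a b s => iL (l a b s)) with hP
  set P' := serY (fun a b s => iL (l' a b s)) with hP'
  set Q := serX (fun a b s => iR (m a b s)) with hQ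
  set Q' := serY (fun a b s => iR (m' a b s)) with hQ'
  have cPQ : ∀ a b c d, Commute (P a b) (Q c d) := fun a b c d => by
    rw [hP, hQ, ← serX_map, ← serX_map]; exact mapPS2_commute iL iR hc _ _
  have cPQ' : ∀ a b c d, Commute (P a b) (Q' c d) := fun a b c d => by
    rw [hP, hQ', ← serX_map, ← serY_map]; exact mapPS2_commute iL iR hc _ _
  have cP'Q : ∀ a b c d, Commute (P' a b) (Q c d) := fun a b c d => by
    rw [hP', hQ, ← serY_map, ← serX_map]; exact mapPS2_commute iL iR hc _ _
  have cP'Q' : ∀ a b c d, Commute (P' a b) (Q' c d) := fun a b c d => by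
    rw [hP', hQ', ← serY_map, ← serY_map]; exact mapPS2_commute iL iR hc _ _
  have eX : serX (tensorCoeff l m) = Q * P := by
    rw [serX_tensorCoeff]
    funext a b
    rw [Matrix.mul_apply]
    exact Finset.sum_congr rfl fun c _ => (cPQ c b a c).eq
  have eY : serY (tensorCoeff l' m') = Q' * P' := by
    rw [serY_tensorCoeff]
    funext a b
    rw [Matrix.mul_apply]
    exact Finset.sum_congr rfl fun c _ => (cP'Q' c b a c).eq
  rw [eX, eY, mul_kron_one, one_kron_mul]
  have k1 := kron_commute P Q' cPQ'
  have k2 := kron_commute Q P' (fun a b c d => (cP'Q c d a b).symm)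
  set Rm := scalarPS2 (A ⊗[ℂ] B) R
  calc Rm * ((Q ⊗ₖ 1) * (P ⊗ₖ 1)) * ((1 ⊗ₖ Q') * (1 ⊗ₖ P'))
      = Rm * (Q ⊗ₖ 1) * ((P ⊗ₖ 1) * (1 ⊗ₖ Q')) * (1 ⊗ₖ P') := by simp only [mul_assoc]
    _ = (Rm * (Q ⊗ₖ 1) * (1 ⊗ₖ Q')) * (P ⊗ₖ 1) * (1 ⊗ₖ P') := by rw [k1]; simp only [mul_assoc]
    _ = (1 ⊗ₖ Q') * (Q ⊗ₖ 1) * (Rm * (P ⊗ₖ 1) * (1 ⊗ₖ P')) := by rw [hm2]; simp only [mul_assoc]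
    _ = (1 ⊗ₖ Q') * ((Q ⊗ₖ 1) * (1 ⊗ₖ P')) * (P ⊗ₖ 1) * Rm := by rw [hl2]; simp only [mul_assoc]
    _ = (1 ⊗ₖ Q') * (1 ⊗ₖ P') * ((Q ⊗ₖ 1) * (P ⊗ₖ 1)) * Rm := by rw [k2]; simp only [mul_assoc]

lemma satisfiesRel_tensorCoeff (l : Sgn → Fin N → Fin N → ℕ → A)
    (m : Sgn → Fin N → Fin N → ℕ → B) (hl : SatisfiesRel N q l) (hm : SatisfiesRel N q m) :
    SatisfiesRel N q (fun μ => tensorCoeff (l μ) (m μ)) where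
  plus_zero a b h := by
    simp only [tensorCoeff, Finset.Nat.antidiagonal_zero, Finset.sum_singleton]
    refine Finset.sum_eq_zero fun c _ => ?_
    rcases lt_or_ge c b with hc | hc
    · simp [hl.plus_zero c b hc]
    · simp [hm.plus_zero a c (h.trans_le hc)]
  minus_zero a b h := by
    simp only [tensorCoeff, Finset.Nat.antidiagonal_zero, Finset.sum_singleton]
    refine Finset.sum_eq_zero fun c _ => ?_
    rcases lt_or_ge a c with hc | hc
    · simp [hl.minus_zero a c hc]
    · simp [hm.minus_zero c b (hc.trans_lt h)]
  minus_mul_plus a := by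
    simp only [tensorCoeff, Finset.Nat.antidiagonal_zero, Finset.sum_singleton]
    rw [Finset.sum_eq_single a, Finset.sum_eq_single a]
    · simp [hl.minus_mul_plus, hm.minus_mul_plus, Algebra.TensorProduct.one_def]
    · intro c _ hc
      rcases lt_or_gt_of_ne hc with hc | hc
      · simp [hl.plus_zero c a hc]
      · simp [hm.plus_zero a c hc]
    · simp
    · intro c _ hc
      rcases lt_or_gt_of_ne hc with hc | hc
      · simp [hm.minus_zero c a hc]
      · simp [hl.minus_zero a c hc]
    · simp
  plus_mul_minus a := by
    simp only [tensorCoeff, Finset.Nat.antidiagonal_zero, Finset.sum_singleton]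
    rw [Finset.sum_eq_single a, Finset.sum_eq_single a]
    · simp [hl.plus_mul_minus, hm.plus_mul_minus, Algebra.TensorProduct.one_def]
    · intro c _ hc
      rcases lt_or_gt_of_ne hc with hc | hc
      · simp [hm.minus_zero c a hc]
      · simp [hl.minus_zero a c hc]
    · simp
    · intro c _ hc
      rcases lt_or_gt_of_ne hc with hc | hc
      · simp [hl.plus_zero c a hc]
      · simp [hm.plus_zero a c hc]
    · simp
  rll_plus_plus := rll_tensorCoeff _ _ _ _ _ hl.rll_plus_plus hm.rll_plus_plus
  rll_plus_minus := rll_tensorCoeff _ _ _ _ _ hl.rll_plus_minus hm.rll_plus_minus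
  rll_minus_minus := rll_tensorCoeff _ _ _ _ _ hl.rll_minus_minus hm.rll_minus_minus

/-- The coproduct `Δ : L^±_{ab}(u) ↦ ∑_c L^±_{cb}(u) ⊗ L^±_{ac}(u)`. -/
def comul (N : ℕ) (q : ℂ) : Uq N q →ₐ[ℂ] Uq N q ⊗[ℂ] Uq N q :=
  lift (fun μ => tensorCoeff (Lgen N q μ) (Lgen N q μ))
    (satisfiesRel_tensorCoeff _ _ (satisfiesRel_Lgen N q) (satisfiesRel_Lgen N q))

lemma comul_Lgen (μ : Sgn) (a b : Fin N) (s : ℕ) :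
    comul N q (Lgen N q μ a b s) = ∑ c, ∑ ij ∈ Finset.HasAntidiagonal.antidiagonal s,
      Lgen N q μ c b ij.1 ⊗ₜ[ℂ] Lgen N q μ a c ij.2 :=
  lift_Lgen _ _ μ a b s

end Coproduct

/-! ### The subalgebra generated by the coefficients of `L^-(u)` -/

section Minus

/-- `U_q^-(\tilde{gl}_N)`, the subalgebra of `U_q(\tilde{gl}_N)` generated by the coefficients of
the series `L^-_{ab}(u)`. -/
def Uminus (N : ℕ) (q : ℂ) : Subalgebra ℂ (Uq N q) :=
  Algebra.adjoin ℂ (Set.range fun g : Fin N × Fin N × ℕ => Lgen N q Sgn.minus g.1 g.2.1 g.2.2)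

variable {N : ℕ} {q : ℂ}

/-- The coefficient `L_{ab}^{(-s)}` of `u^{-s}` in `L^-_{ab}(u)`. -/
def Lm (N : ℕ) (q : ℂ) (a b : Fin N) (s : ℕ) : Uminus N q :=
  ⟨Lgen N q Sgn.minus a b s, Algebra.subset_adjoin ⟨(a, b, s), rfl⟩⟩

/-- The natural map `U_q^- ⊗ U_q^- → U_q ⊗ U_q`. -/
def minusTensor (N : ℕ) (q : ℂ) : Uminus N q ⊗[ℂ] Uminus N q →ₐ[ℂ] Uq N q ⊗[ℂ] Uq N q :=
  Algebra.TensorProduct.map (Uminus N q).val (Uminus N q).val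

lemma minusTensor_injective (N : ℕ) (q : ℂ) : Function.Injective (minusTensor N q) :=
  TensorProduct.map_injective_of_flat_flat (Uminus N q).val.toLinearMap
    (Uminus N q).val.toLinearMap Subtype.val_injective Subtype.val_injective

lemma comul_mem (x : Uminus N q) :
    comul N q (x : Uq N q) ∈ (minusTensor N q).range := by
  have h : Uminus N q ≤ (minusTensor N q).range.comap (comul N q) := by
    refine Algebra.adjoin_le ?_
    rintro _ ⟨⟨a, b, s⟩, rfl⟩
    refine ⟨∑ c, ∑ ij ∈ Finset.HasAntidiagonal.antidiagonal s,
      Lm N q c b ij.1 ⊗ₜ[ℂ] Lm N q a c ij.2, ?_⟩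
    simp [comul_Lgen, minusTensor, Lm]
  exact h x.2

/-- The coproduct `U_q^- → U_q^- ⊗ U_q^-`: the restriction of `Δ`, which takes values in
`U_q^- ⊗ U_q^- ⊆ U_q ⊗ U_q`. -/
def comulMinus (N : ℕ) (q : ℂ) : Uminus N q →ₐ[ℂ] Uminus N q ⊗[ℂ] Uminus N q :=
  (AlgEquiv.ofInjective (minusTensor N q) (minusTensor_injective N q)).symm.toAlgHom.comp
    (((comul N q).comp (Uminus N q).val).codRestrict _ comul_mem)

lemma minusTensor_comulMinus (x : Uminus N q) :
    minusTensor N q (comulMinus N q x) = comul N q (x : Uq N q) :=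
  congrArg Subtype.val (AlgEquiv.apply_symm_apply
    (AlgEquiv.ofInjective (minusTensor N q) (minusTensor_injective N q)) _)

lemma comulMinus_Lm (a b : Fin N) (s : ℕ) :
    comulMinus N q (Lm N q a b s) = ∑ c, ∑ ij ∈ Finset.HasAntidiagonal.antidiagonal s,
      Lm N q c b ij.1 ⊗ₜ[ℂ] Lm N q a c ij.2 := by
  apply minusTensor_injective
  rw [minusTensor_comulMinus]
  simp [comul_Lgen, minusTensor, Lm]

end Minus

/-! ### Formal variables and series

`σ` is a finite, linearly ordered set of formal variables `t_p`. Vector-valued expressions in the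
`t_p` are Hahn series whose exponents, those of `t_p⁻¹`, lie in `ℤ^σ` with the lexicographic order.
With complex coefficients these series form a field, which contains `ℂ(t)` and the power series in
the `t_p⁻¹`; rational functions are thereby expanded in the region `|t_p| ≫ |t_{p'}|`, `p < p'`. -/

section Series

variable {σ : Type*} [Fintype σ] [LinearOrder σ]

/-- Exponents of monomials in the variables `t_p⁻¹`. -/
abbrev Expo (σ : Type*) := Lex (σ → ℤ)

/-- Formal series in the `t_p⁻¹` with coefficients in `A`. -/
abbrev Ser (σ : Type*) [LinearOrder σ] (A : Type*) [Zero A] := HahnSeries (Expo σ) A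

/-- Formal series in the `t_p⁻¹` with coefficients in the vector space `V`, a vector space over the
field `Ser σ ℂ`. -/
abbrev VSer (σ : Type*) [LinearOrder σ] (V : Type*) [AddCommGroup V] [Module ℂ V] :=
  HahnModule (Expo σ) ℂ V

/-- The variable `t_p`. -/
def tvar (p : σ) : Ser σ ℂ := HahnSeries.single (toLex (-Pi.single p 1)) 1

lemma expo_strictMono (p : σ) :
    StrictMono (fun s : ℕ => (toLex (Pi.single p (s : ℤ)) : Expo σ)) := fun _ _ h =>
  Pi.toLex_strictMono (Pi.single_strictMono p (Int.ofNat_lt.mpr h))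

/-- The exponents of the powers `t_p^{-s}`. -/
def expoEmb (p : σ) : ℕ ↪o Expo σ :=
  OrderEmbedding.ofStrictMono _ (expo_strictMono p)

/-- The series `∑_{s ≥ 0} c_s t_p^{-s}`. -/
def seriesAt {A : Type*} [Zero A] (p : σ) (c : ℕ → A) : Ser σ A :=
  HahnSeries.embDomain (expoEmb p) ⟨c, (Set.IsWF.of_wellFoundedLT _).isPWO⟩

/-- Scalar series as series with coefficients in an algebra. -/
def scal (A : Type*) [Ring A] [Algebra ℂ A] : Ser σ ℂ →+* Ser σ A where
  toFun x := x.map (algebraMap ℂ A)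
  map_one' := HahnSeries.map_one (algebraMap ℂ A).toMonoidWithZeroHom
  map_mul' _ _ := HahnSeries.map_mul (algebraMap ℂ A).toNonUnitalRingHom
  map_zero' := by ext; simp
  map_add' _ _ := by ext; simp

/-- The tensor product of vector-valued series,
`(∑ f_i t^{-i}) ⊗ (∑ g_j t^{-j}) = ∑ (f_i ⊗ g_j) t^{-i-j}`. -/
def tmulSer {V W : Type*} [AddCommGroup V] [Module ℂ V] [AddCommGroup W] [Module ℂ W]
    (f : VSer σ V) (g : VSer σ W) : VSer σ (V ⊗[ℂ] W) :=
  HahnModule.of ℂ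
    { coeff := fun a => ∑ ij ∈ Finset.antidiagonal
        ((HahnModule.of ℂ).symm f).isPWO_support ((HahnModule.of ℂ).symm g).isPWO_support a,
        ((HahnModule.of ℂ).symm f).coeff ij.1 ⊗ₜ[ℂ] ((HahnModule.of ℂ).symm g).coeff ij.2
      isPWO_support' := by
        refine (Finset.isPWO_support_antidiagonal
          (hs := ((HahnModule.of ℂ).symm f).isPWO_support)
          (ht := ((HahnModule.of ℂ).symm g).isPWO_support)).mono ?_
        intro a ha
        by_contra h
        apply ha
        have h0 := Finset.not_nonempty_iff_eq_empty.mp h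
        simp only [h0, Finset.sum_empty] }

end Series

/-! ### The weight function

Throughout `N = n + 1`. The indices `a = 1, …, N - 1` are the elements of `Fin n`, and `a`, `a + 1`
as indices in `{1, …, N}` are `a.castSucc`, `a.succ`. -/

section WeightFunction

variable {n : ℕ} {q : ℂ} {σ : Type*} [Fintype σ] [LinearOrder σ]

/-- The pairs `(a, i)` with `1 ≤ a ≤ N - 1`, `1 ≤ i ≤ ξ^a`, ordered lexicographically. -/
abbrev Pos (ξ : Fin n → ℕ) := Σₗ a : Fin n, Fin (ξ a)

/-- The pair `(a, i)`. -/
def pos {ξ : Fin n → ℕ} (a : Fin n) (i : Fin (ξ a)) : Pos ξ := toLex ⟨a, i⟩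

/-- The superscript `a` of the pair `(a, i)`. -/
def Pos.color {ξ : Fin n → ℕ} (p : Pos ξ) : Fin n := (ofLex p).1

/-- The product of the `f p` over all `p`, with `f p` to the left of `f p'` for `p < p'`. -/
def orderedProd {ι M : Type*} [Fintype ι] [LinearOrder ι] [Monoid M] (f : ι → M) : M :=
  ((Finset.univ.sort (· ≤ ·)).map f).prod

open Classical in
/-- `M^{(p)}`: the matrix `M` acting in the tensor factor `p` of `(ℂ^N)^{⊗ι}`, whose standard basis
is indexed by functions `ι → {1, …, N}`. -/
def leg {ι : Type*} {N : ℕ} {A : Type*} [Zero A] (p : ι) (M : Matrix (Fin N) (Fin N) A) :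
    Matrix (ι → Fin N) (ι → Fin N) A :=
  Matrix.of fun f g => if ∀ r, r ≠ p → f r = g r then M (f p) (g p) else 0

open Classical in
/-- `M^{(p p')}` for `p ≠ p'`: the first tensor factor of `M` acts in the tensor factor `p` of
`(ℂ^N)^{⊗ι}`, the second one in the tensor factor `p'`. -/
def leg₂ {ι : Type*} {N : ℕ} {A : Type*} [Zero A] (p p' : ι)
    (M : Matrix (Fin N × Fin N) (Fin N × Fin N) A) : Matrix (ι → Fin N) (ι → Fin N) A :=
  Matrix.of fun f g =>
    if ∀ r, r ≠ p → r ≠ p' → f r = g r then M (f p, f p') (g p, g p') else 0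

/-- The matrix `L^-(t_p)`. -/
def LmMat (N : ℕ) (q : ℂ) (p : σ) : Matrix (Fin N) (Fin N) (Ser σ (Uminus N q)) :=
  Matrix.of fun a b => seriesAt p (Lm N q a b)

/-- The ordered product of the R-matrices `R_q^{(p' p)}(t_{p'} / t_p)` over all pairs `p < p'`,
with the pairs `(p, p')` ordered lexicographically from left to right. -/
def rProd (q : ℂ) {ξ : Fin n → ℕ} (t : Pos ξ → σ) :
    Matrix (Pos ξ → Fin (n + 1)) (Pos ξ → Fin (n + 1)) (Ser σ ℂ) :=
  orderedProd fun p : Pos ξ => orderedProd fun p' : Pos ξ =>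
    if p < p' then leg₂ p' p (rMat (n + 1) q (tvar (t p') / tvar (t p))) else 1

open Classical in
/-- The matrix `E_{21}^{⊗ξ^1} ⊗ … ⊗ E_{N,N-1}^{⊗ξ^{N-1}}`. -/
def lowerMat (ξ : Fin n → ℕ) (A : Type*) [Zero A] [One A] :
    Matrix (Pos ξ → Fin (n + 1)) (Pos ξ → Fin (n + 1)) A :=
  Matrix.of fun f g => if ∀ p, f p = p.color.succ ∧ g p = p.color.castSucc then 1 else 0

/-- The series `\hat{𝔹}_ξ(t)`; the formal variable at the place `(a, i)` is `t_{t (a, i)}`. -/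
def bHat (q : ℂ) {ξ : Fin n → ℕ} (t : Pos ξ → σ) : Ser σ (Uminus (n + 1) q) :=
  Matrix.trace (orderedProd (fun p : Pos ξ => leg p (LmMat (n + 1) q (t p)))
    * (rProd q t).map (scal (Uminus (n + 1) q)) * lowerMat ξ (Ser σ (Uminus (n + 1) q)))

/-- The normalization factor relating `𝔹_ξ(t)` to `\hat{𝔹}_ξ(t)`. -/
def bFactor (q : ℂ) {ξ : Fin n → ℕ} (t : Pos ξ → σ) : Ser σ ℂ :=
  (∏ a, ∏ j : Fin (ξ a), ∏ i ∈ Finset.Iio j,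
    tvar (t (pos a i)) / (q • tvar (t (pos a j)) - q⁻¹ • tvar (t (pos a i))))
  * ∏ b, ∏ a ∈ Finset.Iio b, ∏ i : Fin (ξ a), ∏ j : Fin (ξ b),
    tvar (t (pos a i)) / (tvar (t (pos b j)) - tvar (t (pos a i)))

/-- The series `𝔹_ξ(t)`. -/
def bSer (q : ℂ) {ξ : Fin n → ℕ} (t : Pos ξ → σ) : Ser σ (Uminus (n + 1) q) :=
  scal (Uminus (n + 1) q) (bFactor q t) * bHat q t

variable {V : Type*} [AddCommGroup V] [Module ℂ V]
  {W : Type*} [AddCommGroup W] [Module ℂ W]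

/-- The vector-valued weight function `𝔹_ξ(t) v`, where `ρ` is the action of `U_q^-` on `V`. -/
def weightFn (ρ : Uminus (n + 1) q →ₐ[ℂ] Module.End ℂ V) {ξ : Fin n → ℕ} (t : Pos ξ → σ) (v : V) :
    VSer σ V :=
  HahnModule.of ℂ ((bSer q t).map (ρ.toLinearMap.flip v))

/-- The action of `U_q^-` on the tensor product of two modules. -/
def tensorRep {N : ℕ} {q : ℂ} (ρ₁ : Uminus N q →ₐ[ℂ] Module.End ℂ V)
    (ρ₂ : Uminus N q →ₐ[ℂ] Module.End ℂ W) : Uminus N q →ₐ[ℂ] Module.End ℂ (V ⊗[ℂ] W) :=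
  Module.endTensorEndAlgHom.comp ((Algebra.TensorProduct.map ρ₁ ρ₂).comp (comulMinus N q))

lemma tensorRep_Lm {N : ℕ} {q : ℂ} (ρ₁ : Uminus N q →ₐ[ℂ] Module.End ℂ V)
    (ρ₂ : Uminus N q →ₐ[ℂ] Module.End ℂ W) (a b : Fin N) (s : ℕ) (x : V) (y : W) :
    tensorRep ρ₁ ρ₂ (Lm N q a b s) (x ⊗ₜ[ℂ] y)
      = ∑ c, ∑ ij ∈ Finset.HasAntidiagonal.antidiagonal s,
        ρ₁ (Lm N q c b ij.1) x ⊗ₜ[ℂ] ρ₂ (Lm N q a c ij.2) y := by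
  simp [tensorRep, comulMinus_Lm, Module.endTensorEndAlgHom_apply]

/-- `v` is a weight singular vector: `L^-_{ba}(u) v = 0` for `a < b`, and `v` is an eigenvector of
all `L^-_{aa}(u)`; the eigenvalue `⟨L^-_{aa}(u) v⟩` is `∑_s ℓ_a(s) u^{-s}`. -/
structure IsWeightSingular {N : ℕ} {q : ℂ} (ρ : Uminus N q →ₐ[ℂ] Module.End ℂ V) (v : V)
    (l : Fin N → ℕ → ℂ) : Prop where
  ne_zero : v ≠ 0
  singular : ∀ a b s, a < b → ρ (Lm N q b a s) v = 0
  eigen : ∀ a s, ρ (Lm N q a a s) v = l a s • v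

/-! ### The ingredients of the coproduct formula -/

/-- The `q`-number `[r]_q`. -/
def qNum (q : ℂ) (r : ℕ) : ℂ := (q ^ r - q⁻¹ ^ r) / (q - q⁻¹)

/-- The `q`-factorial `[r]_q!`. -/
def qFact (q : ℂ) (r : ℕ) : ℂ := ∏ i ∈ Finset.range r, qNum q (i + 1)

/-- The collections `η` of nonnegative integers with `ξ - η` nonnegative. -/
abbrev Sub (ξ : Fin n → ℕ) := (a : Fin n) → Fin (ξ a + 1)

/-- `η` as a collection of integers. -/
def Sub.val {ξ : Fin n → ℕ} (η : Sub ξ) (a : Fin n) : ℕ := (η a : ℕ)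

/-- `t_{[η]}`: the variables `t^a_i` with `1 ≤ i ≤ η^a`. -/
def headVars {ξ : Fin n → ℕ} (η : Sub ξ) (t : Pos ξ → σ) : Pos η.val → σ := fun p =>
  t (pos p.color ((ofLex p).2.castLE (Nat.lt_succ_iff.mp (η p.color).isLt)))

/-- `t_{(η,ξ]}`: the variables `t^a_i` with `η^a < i ≤ ξ^a`. -/
def tailVars {ξ : Fin n → ℕ} (η : Sub ξ) (t : Pos ξ → σ) : Pos (ξ - η.val) → σ := fun p =>
  t (pos p.color ⟨η.val p.color + ((ofLex p).2 : ℕ), Nat.add_lt_of_lt_sub' (ofLex p).2.isLt⟩)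

/-- The product `W_{ξ^1}(t^1) ⋯ W_{ξ^{N-1}}(t^{N-1})`, where
`W_k(t_1, …, t_k) = ∏_{i<j} (q⁻¹ t_i - q t_j) / (t_i - t_j)`. -/
def wProd (q : ℂ) {ξ : Fin n → ℕ} (t : Pos ξ → σ) : Ser σ ℂ :=
  ∏ a, ∏ j : Fin (ξ a), ∏ i ∈ Finset.Iio j,
    (q⁻¹ • tvar (t (pos a i)) - q • tvar (t (pos a j)))
      / (tvar (t (pos a i)) - tvar (t (pos a j)))

/-- The part of `wProd` with `i ≤ η^a < j`. -/
def wCross (q : ℂ) {ξ : Fin n → ℕ} (η : Sub ξ) (t : Pos ξ → σ) : Ser σ ℂ :=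
  ∏ a, ∏ i : Fin (ξ a) with i.val < η.val a, ∏ j : Fin (ξ a) with η.val a ≤ j.val,
    (q⁻¹ • tvar (t (pos a i)) - q • tvar (t (pos a j)))
      / (tvar (t (pos a i)) - tvar (t (pos a j)))

/-- The collection `(t^a_{τ^a(i)})` of permuted variables. -/
def permVars {ξ : Fin n → ℕ} (t : Pos ξ → σ) (τ : (a : Fin n) → Equiv.Perm (Fin (ξ a))) :
    Pos ξ → σ := fun p => t (pos p.color (τ p.color (ofLex p).2))

/-- `Sym_t^ξ f(t)`, the sum over `S_{ξ^1} × ⋯ × S_{ξ^{N-1}}`. -/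
def symm {ξ : Fin n → ℕ} {X : Type*} [AddCommMonoid X] (f : (Pos ξ → σ) → X) (t : Pos ξ → σ) : X :=
  ∑ τ : (a : Fin n) → Equiv.Perm (Fin (ξ a)), f (permVars t τ)

/-- The `q`-symmetrization `\overline{Sym}_t^ξ f(t)`. -/
def qSymm (q : ℂ) {ξ : Fin n → ℕ} (f : (Pos ξ → σ) → VSer σ V) (t : Pos ξ → σ) : VSer σ V :=
  symm (fun s => wProd q s • f s) t

open Classical in
/-- The representatives of the cosets of `∏_a S_{η^a} × S_{ξ^a - η^a}` in `∏_a S_{ξ^a}` that are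
increasing on `{1, …, η^a}` and on `{η^a + 1, …, ξ^a}` for every `a`. -/
def shuffles {ξ : Fin n → ℕ} (η : Sub ξ) : Finset ((a : Fin n) → Equiv.Perm (Fin (ξ a))) :=
  Finset.univ.filter fun τ => ∀ a (i j : Fin (ξ a)), i < j →
    ((j : ℕ) < η.val a ∨ η.val a ≤ (i : ℕ)) → τ a i < τ a j

/-- The scalar factor in the square brackets of the coproduct formula. -/
def bracketScalar (q : ℂ) (l₁ l₂ : Fin (n + 1) → ℕ → ℂ) {ξ : Fin n → ℕ} (η : Sub ξ)
    (t : Pos ξ → σ) : Ser σ ℂ :=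
  (∏ a : Fin n, ∏ b : Fin n with b.val = a.val + 1,
    ∏ i : Fin (ξ b) with i.val < η.val b, ∏ j : Fin (ξ a) with η.val a ≤ j.val,
      (q • tvar (t (pos b i)) - q⁻¹ • tvar (t (pos a j)))
        / (tvar (t (pos b i)) - tvar (t (pos a j))))
  * ∏ a : Fin n,
      ((∏ i : Fin (ξ a) with i.val < η.val a, seriesAt (t (pos a i)) (l₂ a.castSucc))
      * ∏ j : Fin (ξ a) with η.val a ≤ j.val, seriesAt (t (pos a j)) (l₁ a.succ))

/-- The expression in the square brackets of the coproduct formula. -/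
def bracket (ρ₁ : Uminus (n + 1) q →ₐ[ℂ] Module.End ℂ V)
    (ρ₂ : Uminus (n + 1) q →ₐ[ℂ] Module.End ℂ W) (v₁ : V) (v₂ : W) (l₁ l₂ : Fin (n + 1) → ℕ → ℂ)
    {ξ : Fin n → ℕ} (η : Sub ξ) (t : Pos ξ → σ) : VSer σ (V ⊗[ℂ] W) :=
  bracketScalar q l₁ l₂ η t •
    tmulSer (weightFn ρ₁ (headVars η t) v₁) (weightFn ρ₂ (tailVars η t) v₂)

end WeightFunction

end

end QLoop

/-! The weight function is rewritten as a nested Bethe vector `BV`, defined by recursion on the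
rank, and the theorem becomes a coproduct formula `BV_mul` for nested Bethe vectors over an
arbitrary field of scalars. Only the Yang–Baxter equation and the RLL relations enter that formula;
the quantum loop algebra returns at the end, with the Hahn series field as the field of scalars.
Rational functions are elements of this field, so permuting the variables raises no question of
expansion.

In a tensor product the matrix `L(u)` acts as the product `L₂(u) L₁(u)` of two families with
commuting entries. The first step of the recursion for `BV` takes the first row of the ordered
product of all `L₂(t_p) L₁(t_p)`, in separate tensor factors, with `p` running over the labels of
the first level; this product equals `(∏ L₂)(∏ L₁)`. Between the two products stands a sum over all
intermediate indices, and it is organized by a resolution of the identity (`exists_resolution`): `1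
= ∑_I c_I⁻¹ G_I π_I X_I`. Here `π_I` projects onto the basis vectors whose index is the first one
exactly in the factors from `I`, and `G_I`, `X_I` are products of normalized R-matrices. It is
obtained by factorization: two products of block triangular matrices, `headSort` and `tailSort`,
have a block diagonal product whose blocks are nonzero scalars `c_I` times invertible products of
R-matrices (`exists_headSort_mul_tailSort`), and inverting this product gives the resolution.

By the RLL relations `G_I` moves to the left of `∏ L₂`, where it meets a row with constant indices
and acts as the identity, and `X_I` moves to the right of `∏ L₁`. With `H` the labels in `I` and `T`
the others, the projection leaves `B₂(T) A₂(H) B₁(H) D₁(T) X_I`, where `A`, `B`, `D` are the corner,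
the rest of the first row and the complementary block of `L` (`exists_headB_split`). The remaining
factor is the Bethe vector of the next level, applied to a singular vector. Passing `X_I` through it
only reorders the dressing R-matrices. On singular vectors the block of `L₂ L₁` may be replaced by
the product of the blocks (`BV_blockD_mul`). Passing `D₁(T)` redistributes the dressing, so that the
block of `L₁` is dressed by `H` and that of `L₂` by `T` (`legProd_blockD_mul_BV`), and passing
`A₂(H)` changes nothing (`corner_mul_BV`). Both then become eigenvalues, and induction applies to
the dressed blocks, which again form two commuting families satisfying RLL. The device behind all
these passages is `BV_intertwine`: a linear map intertwining the entries of `L`, on subspaces that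
may shrink as labels are used up, intertwines Bethe vectors. The accumulated coefficients are
brought to closed form in `splitCoeff_eq`.

The definition of the weight function by a trace is connected with `BV` in `legProd_mul_nestR_apply`
and `mapSer_bSer`: R-matrices within one level disappear because one index is constant there, and
R-matrices between levels become the dressing. The scalar factor in the definition of the weight
function is exactly the one that normalizes these R-matrices (`bFactor_mul`).

The outcome is a sum over families of subsets of labels. Since `BV` is symmetric in the labels of
each level (`BV_perm`), the summand attached to a permutation depends only on which labels come
first. Each family of subsets arises from exactly one shuffle, which gives (ii). In the full
symmetrization it arises from all arrangements of the two parts, and the remaining weights add up to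
`q`-factorials by a partial fraction identity (`sum_prod_div_sub`, `sum_arr_wgt`); dividing by them
gives (i). -/

namespace QLoop

noncomputable section

/-! ### Matrices acting on a part of the index -/

section EmbMat

/-- An index type `Γ` that is locally a product of `β` (read off by `ev`) with a rest
(two indices with the same rest are related by `rel`). -/
structure PartialEval (Γ β : Type*) where
  ev : Γ → β
  rel : Γ → Γ → Prop
  ins : Γ → β → Γ
  rel_equiv : Equivalence rel
  rel_ins : ∀ γ b, rel γ (ins γ b)
  ev_ins : ∀ γ b, ev (ins γ b) = b
  ins_ev : ∀ γ γ', rel γ γ' → ins γ (ev γ') = γ'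

variable {Γ β β' : Type*} {A B : Type*}

open Classical in
/-- The matrix `M` acting on the `β` part of the index. -/
def embMat (e : PartialEval Γ β) [Zero A] (M : Matrix β β A) : Matrix Γ Γ A :=
  Matrix.of fun f g => if e.rel f g then M (e.ev f) (e.ev g) else 0

lemma embMat_one (e : PartialEval Γ β) [DecidableEq Γ] [DecidableEq β] [Zero A] [One A] :
    embMat e (1 : Matrix β β A) = 1 := by
  classical
  ext f h
  simp only [embMat, Matrix.of_apply, Matrix.one_apply]
  by_cases hfh : f = h
  · subst hfh; simp [e.rel_equiv.refl f]
  · by_cases hr : e.rel f h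
    · have : e.ev f ≠ e.ev h := fun h' => hfh (by
        rw [← e.ins_ev _ _ (e.rel_equiv.refl f), h', e.ins_ev _ _ hr])
      simp [hfh, this]
    · simp [hfh, hr]

lemma embMat_map (e : PartialEval Γ β) [Zero A] [Zero B] (φ : A → B) (hφ : φ 0 = 0)
    (M : Matrix β β A) : (embMat e M).map φ = embMat e (M.map φ) := by
  classical
  ext f h
  simp only [embMat, Matrix.map_apply, Matrix.of_apply]
  split_ifs <;> simp [hφ]

lemma embMat_smul (e : PartialEval Γ β) [Semiring A] {S : Type*} [SMulZeroClass S A] (c : S)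
    (M : Matrix β β A) : embMat e (c • M) = c • embMat e M := by
  classical
  ext f h
  simp only [embMat, Matrix.smul_apply, Matrix.of_apply]
  split_ifs <;> simp

lemma embMat_add (e : PartialEval Γ β) [Semiring A]
    (M M' : Matrix β β A) : embMat e (M + M') = embMat e M + embMat e M' := by
  classical
  ext f h
  simp only [embMat, Matrix.add_apply, Matrix.of_apply]
  split_ifs <;> simp

variable [Fintype Γ] [Fintype β] [Fintype β']

/-- The indices related to `f` are the `e.ins f b`, each for exactly one `b`, so the sum over `Γ`
becomes a sum over `β`. -/
lemma embMat_mul_apply (e : PartialEval Γ β) [NonUnitalNonAssocSemiring A] (M : Matrix β β A)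
    (X : Matrix Γ Γ A) (f h : Γ) :
    (embMat e M * X) f h = ∑ b, M (e.ev f) b * X (e.ins f b) h := by
  classical
  rw [Matrix.mul_apply]
  simp only [embMat, Matrix.of_apply, ite_mul, zero_mul]
  rw [← Finset.sum_filter]
  symm
  refine Finset.sum_bij' (fun b _ => e.ins f b) (fun g _ => e.ev g) ?_ ?_ ?_ ?_ ?_
  · intro b _; simp [e.rel_ins]
  · intro g _; simp
  · intro b _; simp [e.ev_ins]
  · intro g hg; exact e.ins_ev _ _ (by simpa using hg)
  · intro b _; simp [e.ev_ins]

lemma embMat_mul (e : PartialEval Γ β) [NonUnitalNonAssocSemiring A] (M M' : Matrix β β A) :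
    embMat e (M * M') = embMat e M * embMat e M' := by
  classical
  ext f h
  rw [embMat_mul_apply]
  simp only [embMat, Matrix.of_apply, Matrix.mul_apply, e.ev_ins]
  by_cases hr : e.rel f h
  · have : ∀ b, e.rel (e.ins f b) h := fun b => e.rel_equiv.trans
      (e.rel_equiv.symm (e.rel_ins f b)) hr
    simp [hr, this]
  · have : ∀ b, ¬ e.rel (e.ins f b) h := fun b h' => hr (e.rel_equiv.trans (e.rel_ins f b) h')
    simp [hr, this]

/-- Two parts of the index that are independent of each other. -/
structure PartialEval.Indep (e : PartialEval Γ β) (e' : PartialEval Γ β') : Prop where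
  ev_ins : ∀ f b, e'.ev (e.ins f b) = e'.ev f
  ev_ins' : ∀ f b, e.ev (e'.ins f b) = e.ev f
  ins_comm : ∀ f b b', e'.ins (e.ins f b) b' = e.ins (e'.ins f b') b

lemma embMat_commute {e : PartialEval Γ β} {e' : PartialEval Γ β'} (he : e.Indep e') [Semiring A]
    (M : Matrix β β A) (M' : Matrix β' β' A) (h : ∀ a b c d, Commute (M a b) (M' c d)) :
    Commute (embMat e M) (embMat e' M') := by
  classical
  -- The trailing `1` brings both sides to a form in which `embMat_mul_apply` can be used twice.
  have h1 : embMat e M * (embMat e' M' * 1) = embMat e' M' * (embMat e M * 1) := by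
    ext f k
    rw [embMat_mul_apply, embMat_mul_apply]
    simp only [embMat_mul_apply, he.ev_ins, he.ev_ins', Finset.mul_sum]
    rw [Finset.sum_comm]
    refine Finset.sum_congr rfl fun b' _ => Finset.sum_congr rfl fun b _ => ?_
    rw [← mul_assoc, ← mul_assoc, (h _ _ _ _).eq, he.ins_comm]
  rw [mul_one, mul_one] at h1
  exact h1

end EmbMat

/-! ### Matrices acting in one, two or three tensor factors -/

section Legs

variable {ι : Type*} {N : ℕ} {A B : Type*}

open Classical in
/-- The part `p` of an index `ι → Fin N`. -/
def legEval (p : ι) : PartialEval (ι → Fin N) (Fin N) where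
  ev f := f p
  rel f g := ∀ r, r ≠ p → f r = g r
  ins f b := Function.update f p b
  rel_equiv := ⟨fun _ _ _ => rfl, fun h r hr => (h r hr).symm,
    fun h h' r hr => (h r hr).trans (h' r hr)⟩
  rel_ins f b r hr := by simp [hr]
  ev_ins f b := by simp
  ins_ev f g h := by
    funext r
    by_cases hr : r = p
    · subst hr; simp
    · simp [hr, h r hr]

open Classical in
/-- The parts `p`, `p'` of an index `ι → Fin N`. -/
def legEval₂ {p p' : ι} (hp : p ≠ p') : PartialEval (ι → Fin N) (Fin N × Fin N) where
  ev f := (f p, f p')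
  rel f g := ∀ r, r ≠ p → r ≠ p' → f r = g r
  ins f b := Function.update (Function.update f p b.1) p' b.2
  rel_equiv := ⟨fun _ _ _ _ => rfl, fun h r hr hr' => (h r hr hr').symm,
    fun h h' r hr hr' => (h r hr hr').trans (h' r hr hr')⟩
  rel_ins f b r hr hr' := by simp [hr, hr']
  ev_ins f b := by simp [hp]
  ins_ev f g h := by
    funext r
    by_cases hr : r = p'
    · subst hr; simp
    · by_cases hr' : r = p
      · subst hr'; simp [hr]
      · simp [hr, hr', h r hr' hr]

open Classical in
/-- The parts `p`, `p'`, `p''` of an index `ι → Fin N`. -/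
def legEval₃ {p p' p'' : ι} (h1 : p ≠ p') (h2 : p ≠ p'') (h3 : p' ≠ p'') :
    PartialEval (ι → Fin N) (Fin N × Fin N × Fin N) where
  ev f := (f p, f p', f p'')
  rel f g := ∀ r, r ≠ p → r ≠ p' → r ≠ p'' → f r = g r
  ins f b := Function.update (Function.update (Function.update f p b.1) p' b.2.1) p'' b.2.2
  rel_equiv := ⟨fun _ _ _ _ _ => rfl, fun h r hr hr' h'' => (h r hr hr' h'').symm,
    fun h h' r hr hr' h'' => (h r hr hr' h'').trans (h' r hr hr' h'')⟩
  rel_ins f b r hr hr' h'' := by simp [hr, hr', h'']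
  ev_ins f b := by simp [h1, h2, h3]
  ins_ev f g h := by
    funext r
    by_cases hr'' : r = p''
    · subst hr''; simp
    · by_cases hr' : r = p'
      · subst hr'; simp [hr'']
      · by_cases hr : r = p
        · subst hr; simp [hr', hr'']
        · simp [hr, hr', hr'', h r hr hr' hr'']

lemma leg_eq [Zero A] (p : ι) (M : Matrix (Fin N) (Fin N) A) : leg p M = embMat (legEval p) M := by
  ext f g; simp only [leg, embMat, legEval, Matrix.of_apply]; congr!

lemma leg₂_eq [Zero A] {p p' : ι} (hp : p ≠ p') (M : Matrix (Fin N × Fin N) (Fin N × Fin N) A) :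
    leg₂ p p' M = embMat (legEval₂ hp) M := by
  ext f g; simp only [leg₂, embMat, legEval₂, Matrix.of_apply]; congr!

lemma leg_map [Zero A] [Zero B] (φ : A → B) (hφ : φ 0 = 0) (p : ι) (M : Matrix (Fin N) (Fin N) A) :
    (leg p M).map φ = leg p (M.map φ) := by
  rw [leg_eq, leg_eq, embMat_map _ _ hφ]

lemma leg₂_map [Zero A] [Zero B] (φ : A → B) (hφ : φ 0 = 0) (p p' : ι)
    (M : Matrix (Fin N × Fin N) (Fin N × Fin N) A) :
    (leg₂ p p' M).map φ = leg₂ p p' (M.map φ) := by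
  ext f g
  simp only [leg₂, Matrix.map_apply, Matrix.of_apply]
  split_ifs <;> simp [hφ]

lemma indep_leg_leg {p p' : ι} (h : p ≠ p') :
    (legEval (N := N) p).Indep (legEval p') where
  ev_ins f b := by simp [legEval, h.symm]
  ev_ins' f b := by simp [legEval, h]
  ins_comm f b b' := by
    classical
    simp only [legEval]
    rw [Function.update_comm h]

lemma indep_leg_leg₂ {p i j : ι} (hij : i ≠ j) (hi : p ≠ i) (hj : p ≠ j) :
    (legEval (N := N) p).Indep (legEval₂ hij) where
  ev_ins f b := by simp [legEval, legEval₂, hi.symm, hj.symm]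
  ev_ins' f b := by simp [legEval, legEval₂, hi, hj]
  ins_comm f b b' := by
    classical
    simp only [legEval, legEval₂]
    rw [Function.update_comm hi, Function.update_comm hj]

lemma indep_leg₂_leg₂ {i j k l : ι} (hij : i ≠ j) (hkl : k ≠ l) (hik : i ≠ k) (hil : i ≠ l)
    (hjk : j ≠ k) (hjl : j ≠ l) :
    (legEval₂ (N := N) hij).Indep (legEval₂ hkl) where
  ev_ins f b := by simp [legEval₂, hik.symm, hil.symm, hjk.symm, hjl.symm]
  ev_ins' f b := by simp [legEval₂, hik, hil, hjk, hjl]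
  ins_comm f b b' := by
    classical
    simp only [legEval₂]
    rw [Function.update_comm hjk, Function.update_comm hik, Function.update_comm hjl,
      Function.update_comm hil]

/-- Together with `leg_eq_leg₂_right` this carries relations written with Kronecker products over to
chosen tensor factors. -/
lemma leg_eq_leg₂_left [Semiring A] {p p' : ι} (hp : p ≠ p') (M : Matrix (Fin N) (Fin N) A) :
    leg p M = leg₂ p p' (M ⊗ₖ (1 : Matrix (Fin N) (Fin N) A)) := by
  classical
  ext f g
  simp only [leg, leg₂, Matrix.of_apply, Matrix.kroneckerMap_apply, Matrix.one_apply]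
  by_cases h : f p' = g p'
  · have : (∀ r, r ≠ p → f r = g r) ↔ (∀ r, r ≠ p → r ≠ p' → f r = g r) :=
      ⟨fun H r hr _ => H r hr, fun H r hr => by
        by_cases hr' : r = p'
        · rw [hr', h]
        · exact H r hr hr'⟩
    simp [h, this]
  · have : ¬ ∀ r, r ≠ p → f r = g r := fun H => h (H p' hp.symm)
    simp [h, this]

lemma leg_eq_leg₂_right [Semiring A] {p p' : ι} (hp : p ≠ p') (M : Matrix (Fin N) (Fin N) A) :
    leg p' M = leg₂ p p' ((1 : Matrix (Fin N) (Fin N) A) ⊗ₖ M) := by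
  classical
  ext f g
  simp only [leg, leg₂, Matrix.of_apply, Matrix.kroneckerMap_apply, Matrix.one_apply]
  by_cases h : f p = g p
  · have : (∀ r, r ≠ p' → f r = g r) ↔ (∀ r, r ≠ p → r ≠ p' → f r = g r) :=
      ⟨fun H r _ hr => H r hr, fun H r hr => by
        by_cases hr' : r = p
        · rw [hr', h]
        · exact H r hr' hr⟩
    simp [h, this]
  · have : ¬ ∀ r, r ≠ p' → f r = g r := fun H => h (H p hp)
    simp [h, this]

lemma leg₂_smul [Semiring A] {S : Type*} [SMulZeroClass S A] {p p' : ι} (c : S)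
    (M : Matrix (Fin N × Fin N) (Fin N × Fin N) A) :
    leg₂ p p' (c • M) = c • leg₂ p p' M := by
  ext f g
  simp only [leg₂, Matrix.of_apply, Matrix.smul_apply]
  split_ifs <;> simp

variable [Fintype ι]

lemma leg_mul_apply [DecidableEq ι] [NonUnitalNonAssocSemiring A] (p : ι) (M : Matrix (Fin N) (Fin N) A)
    (X : Matrix (ι → Fin N) (ι → Fin N) A) (f h : ι → Fin N) :
    (leg p M * X) f h = ∑ b, M (f p) b * X (Function.update f p b) h := by
  rw [leg_eq, embMat_mul_apply]
  simp only [legEval]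
  refine Finset.sum_congr rfl fun b _ => ?_
  congr!

lemma leg_mul [DecidableEq ι] [NonUnitalNonAssocSemiring A] (p : ι) (M M' : Matrix (Fin N) (Fin N) A) :
    leg p (M * M') = leg p M * leg p M' := by
  simp only [leg_eq, embMat_mul]

lemma leg₂_mul [DecidableEq ι] [NonUnitalNonAssocSemiring A] {p p' : ι} (hp : p ≠ p')
    (M M' : Matrix (Fin N × Fin N) (Fin N × Fin N) A) :
    leg₂ p p' (M * M') = leg₂ p p' M * leg₂ p p' M' := by
  simp only [leg₂_eq hp, embMat_mul]

lemma leg_one [DecidableEq ι] [Semiring A] (p : ι) :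
    leg p (1 : Matrix (Fin N) (Fin N) A) = 1 := by
  rw [leg_eq, embMat_one]

lemma leg₂_one [DecidableEq ι] [Semiring A] {p p' : ι} (hp : p ≠ p') :
    leg₂ p p' (1 : Matrix (Fin N × Fin N) (Fin N × Fin N) A) = 1 := by
  rw [leg₂_eq hp, embMat_one]

lemma leg_commute_leg [DecidableEq ι] [Semiring A] {p p' : ι} (hp : p ≠ p')
    (M M' : Matrix (Fin N) (Fin N) A) (h : ∀ a b c d, Commute (M a b) (M' c d)) :
    Commute (leg p M) (leg p' M') := by
  rw [leg_eq, leg_eq]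
  exact embMat_commute (indep_leg_leg hp) _ _ h

lemma leg_commute_leg₂ [DecidableEq ι] [Semiring A] {p i j : ι} (hij : i ≠ j) (hi : p ≠ i) (hj : p ≠ j)
    (M : Matrix (Fin N) (Fin N) A) (M' : Matrix (Fin N × Fin N) (Fin N × Fin N) A)
    (h : ∀ a b c d, Commute (M a b) (M' c d)) :
    Commute (leg p M) (leg₂ i j M') := by
  rw [leg_eq, leg₂_eq hij]
  exact embMat_commute (indep_leg_leg₂ hij hi hj) _ _ h

lemma leg₂_commute_leg₂ [DecidableEq ι] [Semiring A] {i j k l : ι} (hij : i ≠ j) (hkl : k ≠ l) (hik : i ≠ k)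
    (hil : i ≠ l) (hjk : j ≠ k) (hjl : j ≠ l)
    (M : Matrix (Fin N × Fin N) (Fin N × Fin N) A) (M' : Matrix (Fin N × Fin N) (Fin N × Fin N) A)
    (h : ∀ a b c d, Commute (M a b) (M' c d)) :
    Commute (leg₂ i j M) (leg₂ k l M') := by
  rw [leg₂_eq hij, leg₂_eq hkl]
  exact embMat_commute (indep_leg₂_leg₂ hij hkl hik hil hjk hjl) _ _ h

/-- The ordered product of matrices acting in the tensor factors from a list. -/
def legProd [DecidableEq ι] [Semiring A] (X : ι → Matrix (Fin N) (Fin N) A) (l : List ι) :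
    Matrix (ι → Fin N) (ι → Fin N) A :=
  (l.map fun p => leg p (X p)).prod

/-- Each factor acts in its own coordinate, so the intermediate indices are forced and no summation
remains. The order of the list matters only for the order of the entries, which need not commute. -/
lemma legProd_apply [DecidableEq ι] [Semiring A] (X : ι → Matrix (Fin N) (Fin N) A) {l : List ι} (hl : l.Nodup)
    (f g : ι → Fin N) :
    legProd X l f g = if ∀ r, r ∉ l → f r = g r then (l.map fun p => X p (f p) (g p)).prod
      else 0 := by
  induction l generalizing f with
  | nil =>
    simp only [legProd, List.map_nil, List.prod_nil, Matrix.one_apply, List.not_mem_nil,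
      not_false_eq_true, forall_const, funext_iff]
  | cons p l ih =>
    obtain ⟨hp, hl⟩ := List.nodup_cons.mp hl
    have e : legProd X (p :: l) = leg p (X p) * legProd X l := by simp [legProd]
    rw [e, leg_mul_apply]
    simp only [ih hl]
    have hmap : ∀ b, (l.map fun r => X r (Function.update f p b r) (g r))
        = l.map fun r => X r (f r) (g r) := fun b => List.map_congr_left fun r hr => by
      rw [Function.update_of_ne]; rintro rfl; exact hp hr
    simp only [hmap]
    rw [Finset.sum_eq_single (g p)]
    · have : (∀ r, r ∉ l → Function.update f p (g p) r = g r) ↔ ∀ r, r ∉ p :: l → f r = g r := by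
        constructor
        · intro H r hr
          simp only [List.mem_cons, not_or] at hr
          simpa [hr.1] using H r hr.2
        · intro H r hr
          by_cases hrp : r = p
          · subst hrp; simp
          · rw [Function.update_of_ne hrp]; exact H r (by simp [hrp, hr])
      simp only [this]
      split_ifs <;> simp
    · intro b _ hb
      rw [if_neg, mul_zero]
      intro H
      exact hb (by simpa using H p hp)
    · simp

end Legs

end

end QLoop

namespace QLoop

noncomputable section

/-! ### The R-matrix and the Yang–Baxter equation -/

section RMatrix

variable {K : Type*} [Field K] {N : ℕ}

/-- The diagonal coefficients of the R-matrix. -/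
def wR (Q u v : K) (a b : Fin N) : K := if a = b then Q * u - Q⁻¹ * v else u - v

/-- The off-diagonal coefficients of the R-matrix. -/
def gR (Q u v : K) (a b : Fin N) : K :=
  if a = b then 0 else if a < b then (Q - Q⁻¹) * u else (Q - Q⁻¹) * v

/-- The Kronecker delta. -/
def dl (K : Type*) [Field K] (a b : Fin N) : K := if a = b then 1 else 0

/-- The homogeneous R-matrix `v R_q(u/v)`. -/
def RM (N : ℕ) (Q u v : K) : Matrix (Fin N × Fin N) (Fin N × Fin N) K := Matrix.of fun i j =>
  wR Q u v i.1 i.2 * (dl K i.1 j.1 * dl K i.2 j.2)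
    + gR Q u v i.1 i.2 * (dl K i.1 j.2 * dl K i.2 j.1)

lemma sum_dl (a : Fin N) (F : Fin N → K) : ∑ e, dl K a e * F e = F a := by
  simp [dl]

/-- A row of the R-matrix has at most two nonzero entries. With this and the two one-sided versions,
the sums in the Yang–Baxter equation reduce to a few terms. -/
lemma RM_sum_right (Q u v : K) (a b : Fin N) (F : Fin N → Fin N → K) :
    ∑ e, ∑ f, RM N Q u v (a, b) (e, f) * F e f
      = wR Q u v a b * F a b + gR Q u v a b * F b a := by
  simp only [RM, Matrix.of_apply, add_mul, Finset.sum_add_distrib]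
  congr 1
  · rw [← sum_dl a (fun e => wR Q u v a b * F e b)]
    refine Finset.sum_congr rfl fun e _ => ?_
    rw [← sum_dl b (fun f => wR Q u v a b * F e f), Finset.mul_sum]
    exact Finset.sum_congr rfl fun f _ => by ring
  · rw [← sum_dl b (fun e => gR Q u v a b * F e a)]
    refine Finset.sum_congr rfl fun e _ => ?_
    rw [← sum_dl a (fun f => gR Q u v a b * F e f), Finset.mul_sum]
    exact Finset.sum_congr rfl fun f _ => by ring

lemma RM_sum_snd (Q u v : K) (a b c : Fin N) (F : Fin N → K) :
    ∑ g, RM N Q u v (a, b) (c, g) * F g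
      = wR Q u v a b * dl K a c * F b + gR Q u v a b * dl K b c * F a := by
  simp only [RM, Matrix.of_apply, add_mul, Finset.sum_add_distrib]
  congr 1
  · rw [← sum_dl b (fun f => wR Q u v a b * dl K a c * F f)]
    exact Finset.sum_congr rfl fun f _ => by ring
  · rw [← sum_dl a (fun f => gR Q u v a b * dl K b c * F f)]
    exact Finset.sum_congr rfl fun f _ => by ring

lemma RM_sum_fst (Q u v : K) (a b c : Fin N) (F : Fin N → K) :
    ∑ e, RM N Q u v (a, b) (e, c) * F e
      = wR Q u v a b * dl K b c * F a + gR Q u v a b * dl K a c * F b := by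
  simp only [RM, Matrix.of_apply, add_mul, Finset.sum_add_distrib]
  congr 1
  · rw [← sum_dl a (fun f => wR Q u v a b * dl K b c * F f)]
    exact Finset.sum_congr rfl fun f _ => by ring
  · rw [← sum_dl b (fun f => gR Q u v a b * dl K a c * F f)]
    exact Finset.sum_congr rfl fun f _ => by ring

/-- The Yang–Baxter equation in components. -/
lemma yangBaxter {Q : K} (hQ : Q ≠ 0) (u v w : K) (a b c a' b' c' : Fin N) :
    ∑ e, ∑ f, RM N Q u v (a, b) (e, f) *
        ∑ g, RM N Q u w (e, c) (a', g) * RM N Q v w (f, g) (b', c')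
      = ∑ f, ∑ g, RM N Q v w (b, c) (f, g) *
        ∑ e, RM N Q u w (a, g) (e, c') * RM N Q u v (e, f) (a', b') := by
  -- Replacing `Q⁻¹` by a letter with `Q * P = 1` turns the claim into a polynomial identity modulo
  -- one relation.
  obtain ⟨P, hP⟩ : ∃ P, Q⁻¹ = P := ⟨_, rfl⟩
  have hPQ : Q * P = 1 := by rw [← hP]; exact mul_inv_cancel₀ hQ
  rw [RM_sum_right Q u v a b fun e f => ∑ g, RM N Q u w (e, c) (a', g) * RM N Q v w (f, g) (b', c'),
    RM_sum_right Q v w b c fun f g => ∑ e, RM N Q u w (a, g) (e, c') * RM N Q u v (e, f) (a', b')]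
  simp only [RM_sum_snd, RM_sum_fst]
  simp only [RM, Matrix.of_apply, wR, gR, hP]
  -- The coefficients depend only on the relative order of `a`, `b`, `c`. Inconsistent combinations
  -- are discarded; in the others a polynomial identity with free Kronecker deltas remains.
  rcases lt_trichotomy a b with h1 | h1 | h1 <;> rcases lt_trichotomy b c with h2 | h2 | h2 <;>
  rcases lt_trichotomy a c with h3 | h3 | h3 <;>
  first
  | (exfalso; omega)
  | (subst_vars
     simp only [*, lt_self_iff_false, LT.lt.ne, LT.lt.ne', LT.lt.not_gt, if_true, if_false]
     grind)


/-- Unitarity of the R-matrix up to a scalar: a `2 × 2` computation on the span of `e_a ⊗ e_b` and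
`e_b ⊗ e_a`. The scalar is the product of the two normalizing factors used in `Rhat`. -/
lemma RM_mul_swap {Q : K} (hQ : Q ≠ 0) (u v : K) :
    RM N Q u v * (RM N Q v u).submatrix Prod.swap Prod.swap
      = ((Q * u - Q⁻¹ * v) * (Q * v - Q⁻¹ * u)) • (1 : Matrix (Fin N × Fin N) (Fin N × Fin N) K) := by
  ext ⟨a, b⟩ ⟨a', b'⟩
  rw [Matrix.mul_apply, Fintype.sum_prod_type]
  rw [RM_sum_right Q u v a b
    fun e f => (RM N Q v u).submatrix Prod.swap Prod.swap (e, f) (a', b')]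
  have h1 : (1 : Matrix (Fin N × Fin N) (Fin N × Fin N) K) (a, b) (a', b')
      = dl K a a' * dl K b b' := by
    simp only [Matrix.one_apply, dl, Prod.mk.injEq]
    split_ifs <;> simp_all
  obtain ⟨P, hP⟩ : ∃ P, Q⁻¹ = P := ⟨_, rfl⟩
  have hPQ : Q * P = 1 := by rw [← hP]; exact mul_inv_cancel₀ hQ
  simp only [Matrix.smul_apply, h1, smul_eq_mul, Matrix.submatrix_apply, Prod.swap_prod_mk, RM,
    Matrix.of_apply, wR, gR, hP]
  rcases lt_trichotomy a b with h1 | h1 | h1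
  · simp only [h1.ne, h1.ne', h1, h1.not_gt, if_true, if_false]; grind
  · subst h1; simp only [lt_self_iff_false, if_true, if_false]; grind
  · simp only [h1.ne, h1.ne', h1, h1.not_gt, if_true, if_false]; grind

/-- The R-matrix `R(u/z)` as an `L`-operator: the indices of the first tensor factor are the indices
of the `L`-operator. -/
def Laux (N : ℕ) (Q u z : K) : Matrix (Fin N) (Fin N) (Matrix (Fin N) (Fin N) K) :=
  Matrix.of fun a b => Matrix.of fun c d => RM N Q u z (a, c) (b, d)

/-- The left side `R^{(12)} M^{(1)} M'^{(2)}` of an RLL relation. -/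
def rllL {A : Type*} [Ring A] [Algebra K A] (R : Matrix (Fin N × Fin N) (Fin N × Fin N) K)
    (M M' : Matrix (Fin N) (Fin N) A) : Matrix (Fin N × Fin N) (Fin N × Fin N) A :=
  R.map (algebraMap K A) * (M ⊗ₖ 1) * (1 ⊗ₖ M')

/-- The right side `M'^{(2)} M^{(1)} R^{(12)}` of an RLL relation. -/
def rllR {A : Type*} [Ring A] [Algebra K A] (R : Matrix (Fin N × Fin N) (Fin N × Fin N) K)
    (M M' : Matrix (Fin N) (Fin N) A) : Matrix (Fin N × Fin N) (Fin N × Fin N) A :=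
  (1 ⊗ₖ M') * (M ⊗ₖ 1) * R.map (algebraMap K A)

lemma rllL_apply {A : Type*} [Ring A] [Algebra K A]
    (R : Matrix (Fin N × Fin N) (Fin N × Fin N) K)
    (M M' : Matrix (Fin N) (Fin N) A) (a b a' b' : Fin N) :
    rllL R M M' (a, b) (a', b') = ∑ e, ∑ f, R (a, b) (e, f) • (M e a' * M' f b') := by
  have h1 : (M ⊗ₖ (1 : Matrix (Fin N) (Fin N) A)) * (1 ⊗ₖ M') = Matrix.of fun i j =>
      M i.1 j.1 * M' i.2 j.2 := by
    ext ⟨i, j⟩ ⟨k, l⟩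
    simp [Matrix.mul_apply, Fintype.sum_prod_type, Matrix.one_apply]
  rw [rllL, mul_assoc, h1, Matrix.mul_apply, Fintype.sum_prod_type]
  simp [Algebra.smul_def]

lemma rllR_apply {A : Type*} [Ring A] [Algebra K A]
    (R : Matrix (Fin N × Fin N) (Fin N × Fin N) K)
    (M M' : Matrix (Fin N) (Fin N) A) (a b a' b' : Fin N) :
    rllR R M M' (a, b) (a', b') = ∑ e, ∑ f, R (e, f) (a', b') • (M' b f * M a e) := by
  have h1 : ((1 : Matrix (Fin N) (Fin N) A) ⊗ₖ M') * (M ⊗ₖ 1) = Matrix.of fun i j =>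
      M' i.2 j.2 * M i.1 j.1 := by
    ext ⟨i, j⟩ ⟨k, l⟩
    simp [Matrix.mul_apply, Fintype.sum_prod_type, Matrix.one_apply]
  rw [rllR, h1, Matrix.mul_apply, Fintype.sum_prod_type]
  simp only [Matrix.of_apply, Matrix.map_apply, Algebra.smul_def, Algebra.commutes]

/-- The Yang–Baxter equation with the third space taken as the space on which the entries of the
`L`-operators act. -/
lemma rll_Laux {Q : K} (hQ : Q ≠ 0) (u v z : K) :
    rllL (RM N Q u v) (Laux N Q u z) (Laux N Q v z)
      = rllR (RM N Q u v) (Laux N Q u z) (Laux N Q v z) := by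
  refine Matrix.ext fun ⟨a, b⟩ ⟨a', b'⟩ => ?_
  rw [rllL_apply, rllR_apply]
  refine Matrix.ext fun c c' => ?_
  have h := yangBaxter hQ u v z a b c a' b' c'
  simp only [Matrix.sum_apply, Matrix.smul_apply, Matrix.mul_apply, Laux, Matrix.of_apply,
    smul_eq_mul]
  rw [h]
  simp only [Finset.mul_sum]
  calc _ = ∑ f, ∑ i, ∑ g, RM N Q v z (b, c) (f, g)
        * (RM N Q u z (a, g) (i, c') * RM N Q u v (i, f) (a', b')) :=
        Finset.sum_congr rfl fun f _ => Finset.sum_comm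
    _ = _ := by
        rw [Finset.sum_comm]
        exact Finset.sum_congr rfl fun i _ => Finset.sum_congr rfl fun f _ =>
          Finset.sum_congr rfl fun g _ => by ring

/-- The Yang–Baxter equation with the first space taken as the auxiliary one: an R-matrix in the two
other spaces interchanges two neighbouring dressing factors. -/
lemma Laux_exchange {Q : K} (hQ : Q ≠ 0) (u z w : K) (a c : Fin N) :
    RM N Q z w * ∑ b, (((1 : Matrix (Fin N) (Fin N) K) ⊗ₖ Laux N Q u w a b)
        * (Laux N Q u z b c ⊗ₖ 1))
      = (∑ b, (Laux N Q u z a b ⊗ₖ (1 : Matrix (Fin N) (Fin N) K)) * (1 ⊗ₖ Laux N Q u w b c))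
        * RM N Q z w := by
  refine Matrix.ext fun ⟨i, j⟩ ⟨i', j'⟩ => ?_
  have h := yangBaxter hQ u z w a i j c i' j'
  have h1 : ∀ b, ((1 : Matrix (Fin N) (Fin N) K) ⊗ₖ Laux N Q u w a b)
        * (Laux N Q u z b c ⊗ₖ 1) = Matrix.of fun p r =>
        RM N Q u w (a, p.2) (b, r.2) * RM N Q u z (b, p.1) (c, r.1) := fun b => by
    ext ⟨i, j⟩ ⟨k, l⟩
    simp [Matrix.mul_apply, Fintype.sum_prod_type, Matrix.one_apply, Laux]
  have h2 : ∀ b, (Laux N Q u z a b ⊗ₖ (1 : Matrix (Fin N) (Fin N) K)) * (1 ⊗ₖ Laux N Q u w b c)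
      = Matrix.of fun p r =>
        RM N Q u z (a, p.1) (b, r.1) * RM N Q u w (b, p.2) (c, r.2) := fun b => by
    ext ⟨i, j⟩ ⟨k, l⟩
    simp [Matrix.mul_apply, Fintype.sum_prod_type, Matrix.one_apply, Laux]
  simp only [h1, h2, Matrix.mul_apply, Matrix.sum_apply, Fintype.sum_prod_type, Matrix.of_apply]
  refine h.symm.trans ?_
  simp only [Finset.mul_sum, Finset.sum_mul]
  rw [Finset.sum_comm]
  refine Finset.sum_congr rfl fun f _ => ?_
  rw [Finset.sum_comm]
  exact Finset.sum_congr rfl fun g _ => Finset.sum_congr rfl fun e _ => by ring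

end RMatrix

end

end QLoop

namespace QLoop

noncomputable section

set_option linter.unusedSectionVars false

/-! ### R-matrices acting in tensor factors labelled by `Λ` -/

/-- Spectral parameters `x p` labelled by `Λ`, and the quantum parameter `Q`, in general position. -/
structure Par (Λ K : Type*) [Field K] where
  Q : K
  x : Λ → K
  Q_ne_zero : Q ≠ 0
  x_ne : ∀ i j, i ≠ j → x i ≠ x j
  Qx_ne : ∀ i j, i ≠ j → Q * x i - Q⁻¹ * x j ≠ 0

section Exchange

variable {Λ K : Type*} [Field K] (P : Par Λ K) {N : ℕ}

/-- The normalized R-matrix acting in the tensor factors `i`, `j`. -/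
def Rhat (N : ℕ) (i j : Λ) : Matrix (Λ → Fin N) (Λ → Fin N) K :=
  (P.Q * P.x i - P.Q⁻¹ * P.x j)⁻¹ • leg₂ i j (RM N P.Q (P.x i) (P.x j))

lemma Rhat_eq (N : ℕ) (i j : Λ) : Rhat P N i j
    = leg₂ i j ((P.Q * P.x i - P.Q⁻¹ * P.x j)⁻¹ • RM N P.Q (P.x i) (P.x j)) := by
  rw [leg₂_smul, Rhat]

variable [Fintype Λ] [DecidableEq Λ]

lemma leg₂_symm (i j : Λ) (M : Matrix (Fin N × Fin N) (Fin N × Fin N) K) :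
    leg₂ j i M = leg₂ i j (M.submatrix Prod.swap Prod.swap) := by
  ext f g
  simp only [leg₂, Matrix.of_apply, Matrix.submatrix_apply, Prod.swap_prod_mk]
  have : (∀ r, r ≠ j → r ≠ i → f r = g r) ↔ (∀ r, r ≠ i → r ≠ j → f r = g r) :=
    ⟨fun H r h h' => H r h' h, fun H r h h' => H r h' h⟩
  simp only [this]
  congr!

lemma Rhat_mul_Rhat {i j : Λ} (hij : i ≠ j) : Rhat P N i j * Rhat P N j i = 1 := by
  rw [Rhat, Rhat, leg₂_symm i j, Matrix.smul_mul, Matrix.mul_smul, ← leg₂_mul hij,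
    RM_mul_swap P.Q_ne_zero, leg₂_smul, leg₂_one hij, smul_smul, smul_smul]
  have h1 := P.Qx_ne i j hij
  have h2 := P.Qx_ne j i hij.symm
  rw [← mul_inv, inv_mul_cancel₀ (mul_ne_zero h1 h2), one_smul]

/-- A matrix acting in two of three tensor factors. -/
lemma leg₂_eq_leg₃ {i j k : Λ} (hij : i ≠ j) (hik : i ≠ k) (hjk : j ≠ k)
    (M : Matrix (Fin N × Fin N) (Fin N × Fin N) K) :
    leg₂ i j M = embMat (legEval₃ hij hik hjk) (Matrix.of fun s t =>
        M (s.1, s.2.1) (t.1, t.2.1) * dl K s.2.2 t.2.2) ∧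
    leg₂ i k M = embMat (legEval₃ hij hik hjk) (Matrix.of fun s t =>
        M (s.1, s.2.2) (t.1, t.2.2) * dl K s.2.1 t.2.1) ∧
    leg₂ j k M = embMat (legEval₃ hij hik hjk) (Matrix.of fun s t =>
        M (s.2.1, s.2.2) (t.2.1, t.2.2) * dl K s.1 t.1) := by
  classical
  have key : ∀ (a b c : Λ) (f g : Λ → Fin N), (∀ r, r ≠ a → r ≠ b → f r = g r) ↔
      ((∀ r, r ≠ a → r ≠ b → r ≠ c → f r = g r) ∧ (c ≠ a → c ≠ b → f c = g c)) := by
    intro a b c f g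
    refine ⟨fun H => ⟨fun r h h' _ => H r h h', H c⟩, fun H r h h' => ?_⟩
    by_cases hr : r = c
    · subst hr; exact H.2 h h'
    · exact H.1 r h h' hr
  have perm1 : ∀ f g : Λ → Fin N, (∀ r, r ≠ i → r ≠ k → r ≠ j → f r = g r) ↔
      (∀ r, r ≠ i → r ≠ j → r ≠ k → f r = g r) := fun f g =>
    ⟨fun H r h h' h'' => H r h h'' h', fun H r h h' h'' => H r h h'' h'⟩
  have perm2 : ∀ f g : Λ → Fin N, (∀ r, r ≠ j → r ≠ k → r ≠ i → f r = g r) ↔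
      (∀ r, r ≠ i → r ≠ j → r ≠ k → f r = g r) := fun f g =>
    ⟨fun H r h h' h'' => H r h' h'' h, fun H r h h' h'' => H r h'' h h'⟩
  refine ⟨?_, ?_, ?_⟩ <;> ext f g <;>
    simp only [leg₂, embMat, legEval₃, Matrix.of_apply, dl, mul_ite, mul_one, mul_zero]
  · simp only [key i j k f g, hik.symm, hjk.symm, ne_eq, not_false_eq_true, true_imp_iff]
    by_cases h1 : f k = g k <;> simp [h1]
  · simp only [key i k j f g, hij.symm, hjk, ne_eq, not_false_eq_true, true_imp_iff]
    have := perm1 f g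
    simp only [ne_eq] at this
    by_cases h1 : f j = g j <;> simp [h1, this]
  · simp only [key j k i f g, hij, hik, ne_eq, not_false_eq_true, true_imp_iff]
    have := perm2 f g
    simp only [ne_eq] at this
    by_cases h1 : f i = g i <;> simp [h1, this]

/-- All matrices act in the factors `i`, `j`, `k` only, so `embMat` reduces the claim to
`yangBaxter`; the normalizing scalars on the two sides agree. -/
lemma Rhat_yangBaxter {i j k : Λ} (hij : i ≠ j) (hik : i ≠ k) (hjk : j ≠ k) :
    Rhat P N i j * Rhat P N i k * Rhat P N j k = Rhat P N j k * Rhat P N i k * Rhat P N i j := by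
  simp only [Rhat, Matrix.smul_mul, Matrix.mul_smul]
  rw [(leg₂_eq_leg₃ hij hik hjk _).1, (leg₂_eq_leg₃ hij hik hjk _).2.1,
    (leg₂_eq_leg₃ hij hik hjk _).2.2]
  simp only [← embMat_mul]
  rw [smul_smul, smul_smul, smul_smul, smul_smul]
  congr 1
  · ring
  congr 1
  refine Matrix.ext fun ⟨a, b, c⟩ ⟨a', b', c'⟩ => ?_
  have h := yangBaxter P.Q_ne_zero (P.x i) (P.x j) (P.x k) a b c a' b' c'
  rw [mul_assoc, mul_assoc]
  simp only [Matrix.mul_apply, Fintype.sum_prod_type, Matrix.of_apply, dl, mul_ite, mul_one,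
    mul_zero, ite_mul, zero_mul, Finset.sum_ite_eq, Finset.sum_ite_eq', Finset.mem_univ, if_true,
    Finset.sum_ite_irrel, Finset.sum_const_zero]
  rw [h]

/-- A matrix with the property that its nonzero entries connect an index `f` with `f` or with
`f` permuted by a transposition. -/
lemma leg₂_RM_apply_ne_zero {i j : Λ} (hij : i ≠ j) {Q u v : K} {f g : Λ → Fin N}
    (h : leg₂ i j (RM N Q u v) f g ≠ 0) : g = f ∨ g = f ∘ Equiv.swap i j := by
  simp only [leg₂, Matrix.of_apply, ne_eq, ite_eq_right_iff, Classical.not_imp] at h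
  obtain ⟨h1, h2⟩ := h
  by_cases h3 : f i = g i ∧ f j = g j
  · left
    funext r
    by_cases hr : r = i
    · rw [hr, h3.1]
    by_cases hr' : r = j
    · rw [hr', h3.2]
    exact (h1 r hr hr').symm
  · right
    have h4 : f i = g j ∧ f j = g i := by
      by_contra h4
      apply h2
      simp only [RM, Matrix.of_apply, dl]
      rw [not_and_or] at h3 h4
      rcases h3 with h3 | h3 <;> rcases h4 with h4 | h4 <;> simp [h3, h4]
    funext r
    by_cases hr : r = i
    · subst hr; simp [h4.2]
    by_cases hr' : r = j
    · subst hr'; simp [h4.1]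
    simp [Equiv.swap_apply_of_ne_of_ne hr hr', h1 r hr hr']

lemma Rhat_apply_ne_zero {i j : Λ} (hij : i ≠ j) {f g : Λ → Fin N}
    (h : Rhat P N i j f g ≠ 0) : g = f ∨ g = f ∘ Equiv.swap i j := by
  refine leg₂_RM_apply_ne_zero (Q := P.Q) (u := P.x i) (v := P.x j) hij fun h' => h ?_
  rw [Rhat, Matrix.smul_apply, h', smul_zero]

/-- Weight conservation: the nonzero entries of the R-matrix join an index only to itself and to its
transposition. -/
lemma Rhat_commute_diagonal {i j : Λ} (hij : i ≠ j) (D : (Λ → Fin N) → K)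
    (hD : ∀ f, D (f ∘ Equiv.swap i j) = D f) :
    Commute (Rhat P N i j) (Matrix.diagonal D) := by
  refine Matrix.ext fun f g => ?_
  rw [Matrix.mul_diagonal, Matrix.diagonal_mul]
  by_cases h : Rhat P N i j f g = 0
  · simp [h]
  · rcases Rhat_apply_ne_zero P hij h with rfl | rfl
    · ring
    · rw [hD]; ring

/-! ### Matrices acting in the tensor factors from a list -/

/-- Matrices generated by those acting in one or two tensor factors from the list `l`. -/
inductive IsLocal (l : List Λ) : Matrix (Λ → Fin N) (Λ → Fin N) K → Prop
  | leg (p : Λ) (hp : p ∈ l) (M : Matrix (Fin N) (Fin N) K) : IsLocal l (leg p M)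
  | leg₂ (p p' : Λ) (hp : p ∈ l) (hp' : p' ∈ l) (h : p ≠ p')
      (M : Matrix (Fin N × Fin N) (Fin N × Fin N) K) : IsLocal l (leg₂ p p' M)
  | one : IsLocal l 1
  | mul (X Y : Matrix (Λ → Fin N) (Λ → Fin N) K) (hX : IsLocal l X) (hY : IsLocal l Y) :
      IsLocal l (X * Y)
  | add (X Y : Matrix (Λ → Fin N) (Λ → Fin N) K) (hX : IsLocal l X) (hY : IsLocal l Y) :
      IsLocal l (X + Y)
  | smul (c : K) (X : Matrix (Λ → Fin N) (Λ → Fin N) K) (hX : IsLocal l X) : IsLocal l (c • X)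

lemma IsLocal.mono {l l' : List Λ} (h : l ⊆ l') {X : Matrix (Λ → Fin N) (Λ → Fin N) K}
    (hX : IsLocal l X) : IsLocal l' X := by
  induction hX with
  | leg p hp M => exact .leg p (h hp) M
  | leg₂ p p' hp hp' hpp' M => exact .leg₂ p p' (h hp) (h hp') hpp' M
  | one => exact .one
  | mul X Y _ _ hX hY => exact .mul X Y hX hY
  | add X Y _ _ hX hY => exact .add X Y hX hY
  | smul c X _ hX => exact .smul c X hX

/-- Entrywise image of a matrix over the base field. -/
abbrev kMap {K : Type*} [Field K] {J : Type*} (A : Type*) [Ring A] [Algebra K A]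
    (X : Matrix J J K) : Matrix J J A := X.map (algebraMap K A)

lemma IsLocal.commute_leg {A : Type*} [Ring A] [Algebra K A] {l : List Λ}
    {X : Matrix (Λ → Fin N) (Λ → Fin N) K} (hX : IsLocal l X) {i : Λ} (hi : i ∉ l)
    (M : Matrix (Fin N) (Fin N) A) : Commute (kMap A X) (QLoop.leg i M) := by
  have hne : ∀ p ∈ l, i ≠ p := fun p hp h => hi (h ▸ hp)
  induction hX with
  | leg p hp M' =>
    rw [kMap, leg_map _ (map_zero _)]
    exact (leg_commute_leg (hne p hp) _ _ fun a b c d => (Algebra.commutes _ _).symm).symm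
  | leg₂ p p' hp hp' hpp' M' =>
    rw [kMap, leg₂_map _ (map_zero _)]
    exact (leg_commute_leg₂ hpp' (hne p hp) (hne p' hp') _ _
      fun a b c d => (Algebra.commutes _ _).symm).symm
  | one => rw [kMap, Matrix.map_one _ (map_zero _) (map_one _)]; exact Commute.one_left _
  | mul X Y _ _ hX hY => rw [kMap, Matrix.map_mul]; exact hX.mul_left hY
  | add X Y _ _ hX hY =>
    rw [kMap, Matrix.map_add _ (map_add _)]; exact hX.add_left hY
  | smul c X _ hX =>
    have : kMap A (c • X) = c • kMap A X := by
      ext f g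
      change algebraMap K A (c * X f g) = c • algebraMap K A (X f g)
      rw [map_mul, ← Algebra.smul_def]
    rw [this]; exact hX.smul_left c

lemma IsLocal.commute_leg₂ {l : List Λ}
    {X : Matrix (Λ → Fin N) (Λ → Fin N) K} (hX : IsLocal l X) {i j : Λ} (hij : i ≠ j)
    (hi : i ∉ l) (hj : j ∉ l) (M : Matrix (Fin N × Fin N) (Fin N × Fin N) K) :
    Commute X (QLoop.leg₂ i j M) := by
  have hne : ∀ p ∈ l, p ≠ i := fun p hp h => hi (h ▸ hp)
  have hne' : ∀ p ∈ l, p ≠ j := fun p hp h => hj (h ▸ hp)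
  induction hX with
  | leg p hp M' =>
    exact (leg_commute_leg₂ hij (hne p hp) (hne' p hp) _ _ fun a b c d => mul_comm _ _)
  | leg₂ p p' hp hp' hpp' M' =>
    exact leg₂_commute_leg₂ hpp' hij (hne p hp) (hne' p hp) (hne p' hp') (hne' p' hp') _ _
      fun a b c d => mul_comm _ _
  | one => exact Commute.one_left _
  | mul X Y _ _ hX hY => exact hX.mul_left hY
  | add X Y _ _ hX hY => exact hX.add_left hY
  | smul c X _ hX => exact hX.smul_left c

lemma IsLocal.commute_leg' {l : List Λ}
    {X : Matrix (Λ → Fin N) (Λ → Fin N) K} (hX : IsLocal l X) {i : Λ} (hi : i ∉ l)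
    (M : Matrix (Fin N) (Fin N) K) : Commute X (QLoop.leg i M) := by
  have := hX.commute_leg hi M
  rwa [kMap, Algebra.algebraMap_self, RingHom.coe_id, Matrix.map_id] at this

lemma isLocal_Rhat {l : List Λ} {i j : Λ} (hij : i ≠ j) (hi : i ∈ l) (hj : j ∈ l) :
    IsLocal l (Rhat P N i j) := by
  rw [Rhat_eq]; exact .leg₂ i j hi hj hij _

lemma IsLocal.commute_Rhat {l : List Λ}
    {X : Matrix (Λ → Fin N) (Λ → Fin N) K} (hX : IsLocal l X) {i j : Λ} (hij : i ≠ j)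
    (hi : i ∉ l) (hj : j ∉ l) : Commute X (Rhat P N i j) := by
  rw [Rhat_eq]; exact hX.commute_leg₂ hij hi hj _

/-! ### Exchange matrices -/

/-- `Exch P N l l' X`: the matrix `X` is a product of normalized R-matrices which exchanges the
order `l` of `L`-operators for the order `l'`. -/
inductive Exch (P : Par Λ K) (N : ℕ) :
    List Λ → List Λ → Matrix (Λ → Fin N) (Λ → Fin N) K → Prop
  | refl (l : List Λ) : Exch P N l l 1
  | swap (l l' : List Λ) (i j : Λ) : Exch P N (l ++ i :: j :: l') (l ++ j :: i :: l') (Rhat P N i j)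
  | trans {l l' l'' : List Λ} {X Y : Matrix (Λ → Fin N) (Λ → Fin N) K} (hX : Exch P N l l' X)
      (hY : Exch P N l' l'' Y) : Exch P N l l'' (Y * X)

variable {P}

lemma Exch.perm {l l' : List Λ} {X : Matrix (Λ → Fin N) (Λ → Fin N) K} (h : Exch P N l l' X) :
    l.Perm l' := by
  induction h with
  | refl l => rfl
  | swap l l' i j => exact List.Perm.append_left _ (List.Perm.swap _ _ _)
  | trans _ _ h h' => exact h.trans h'

lemma Exch.append {l l' : List Λ} {X : Matrix (Λ → Fin N) (Λ → Fin N) K} (h : Exch P N l l' X)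
    (a b : List Λ) : Exch P N (a ++ l ++ b) (a ++ l' ++ b) X := by
  induction h with
  | refl l => exact .refl _
  | swap l l' i j =>
    have := Exch.swap (P := P) (N := N) (a ++ l) (l' ++ b) i j
    simpa using this
  | trans _ _ h h' => exact h.trans h'

lemma Exch.cons {l l' : List Λ} {X : Matrix (Λ → Fin N) (Λ → Fin N) K} (h : Exch P N l l' X)
    (a : Λ) : Exch P N (a :: l) (a :: l') X := by
  simpa using h.append [a] []

lemma nodup_swap_ne {l l' : List Λ} {i j : Λ} (h : (l ++ i :: j :: l').Nodup) : i ≠ j := by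
  have := (List.nodup_append.mp h).2.1
  simp only [List.nodup_cons, List.mem_cons, not_or] at this
  exact this.1.1

lemma Exch.isLocal {l l' : List Λ} {X : Matrix (Λ → Fin N) (Λ → Fin N) K} (h : Exch P N l l' X)
    (hl : l.Nodup) : IsLocal l X := by
  induction h with
  | refl l => exact .one
  | swap l l' i j => exact isLocal_Rhat P (nodup_swap_ne hl) (by simp) (by simp)
  | trans hX hY h h' =>
    exact .mul _ _ ((h' (hX.perm.nodup_iff.mp hl)).mono hX.perm.symm.subset) (h hl)

/-- The inverse undoes the elementary exchanges in the opposite order, each by unitarity, so it is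
an exchange matrix too. -/
lemma Exch.inverse {l l' : List Λ} {X : Matrix (Λ → Fin N) (Λ → Fin N) K} (h : Exch P N l l' X)
    (hl : l.Nodup) : ∃ Y, Exch P N l' l Y ∧ X * Y = 1 ∧ Y * X = 1 := by
  induction h with
  | refl l => exact ⟨1, .refl l, mul_one _, mul_one _⟩
  | swap l l' i j =>
    have hij := nodup_swap_ne hl
    exact ⟨_, .swap l l' j i, Rhat_mul_Rhat P hij, Rhat_mul_Rhat P hij.symm⟩
  | @trans l l' l'' X X' hX hX' h h' =>
    obtain ⟨Y, hY, h1, h2⟩ := h hl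
    obtain ⟨Y', hY', h1', h2'⟩ := h' (hX.perm.nodup_iff.mp hl)
    refine ⟨_, hY'.trans hY, ?_, ?_⟩
    · rw [mul_assoc, ← mul_assoc X, h1, one_mul, h1']
    · rw [mul_assoc, ← mul_assoc Y', h2', one_mul, h2]

lemma Exch.commute_diagonal {l l' : List Λ} {X : Matrix (Λ → Fin N) (Λ → Fin N) K}
    (h : Exch P N l l' X) (hl : l.Nodup) (D : (Λ → Fin N) → K)
    (hD : ∀ i ∈ l, ∀ j ∈ l, ∀ f, D (f ∘ Equiv.swap i j) = D f) :
    Commute X (Matrix.diagonal D) := by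
  induction h with
  | refl l => exact Commute.one_left _
  | swap l l' i j =>
    exact Rhat_commute_diagonal P (nodup_swap_ne hl) D (hD i (by simp) j (by simp))
  | trans hX hY h h' =>
    exact (h' (hX.perm.nodup_iff.mp hl) fun i hi j hj => hD i (hX.perm.symm.subset hi) j
      (hX.perm.symm.subset hj)).mul_left (h hl hD)

variable (P N)

/-- The exchange matrix which moves `k` from the left of the list `l` to its right. -/
def thru (k : Λ) : List Λ → Matrix (Λ → Fin N) (Λ → Fin N) K
  | [] => 1
  | j :: l => thru k l * Rhat P N k j

/-- The exchange matrix which moves `k` from the right of the list `l` to its left. -/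
def thruInv (k : Λ) : List Λ → Matrix (Λ → Fin N) (Λ → Fin N) K
  | [] => 1
  | j :: l => Rhat P N j k * thruInv k l

lemma exch_thru (k : Λ) (l : List Λ) : Exch P N (k :: l) (l ++ [k]) (thru P N k l) := by
  induction l with
  | nil => exact .refl _
  | cons j l ih => exact (Exch.swap [] l k j).trans (ih.cons j)

lemma exch_thruInv (k : Λ) (l : List Λ) : Exch P N (l ++ [k]) (k :: l) (thruInv P N k l) := by
  induction l with
  | nil => exact .refl _
  | cons j l ih => exact (ih.cons j).trans (Exch.swap [] l j k)

variable {P N}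

lemma thru_mul_thruInv {k : Λ} {l : List Λ} (hk : k ∉ l) :
    thru P N k l * thruInv P N k l = 1 := by
  induction l with
  | nil => exact mul_one _
  | cons j l ih =>
    simp only [List.mem_cons, not_or] at hk
    rw [thru, thruInv, mul_assoc, ← mul_assoc (Rhat P N k j), Rhat_mul_Rhat P hk.1, one_mul,
      ih hk.2]

lemma isLocal_thru {k : Λ} {l : List Λ} (hk : k ∉ l) (hl : l.Nodup) :
    IsLocal (k :: l) (thru P N k l) :=
  (exch_thru P N k l).isLocal (List.nodup_cons.mpr ⟨hk, hl⟩)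

lemma isLocal_thruInv {k : Λ} {l : List Λ} (hk : k ∉ l) (hl : l.Nodup) :
    IsLocal (k :: l) (thruInv P N k l) :=
  ((exch_thruInv P N k l).isLocal (by
    rw [(List.perm_append_singleton k l).nodup_iff]
    exact List.nodup_cons.mpr ⟨hk, hl⟩)).mono (List.perm_append_singleton k l).subset

/-- Moving two labels through a list in either order is the Yang–Baxter equation repeated for each
member; matrices sharing no label are commuted past each other. -/
lemma thru_yangBaxter {k k' : Λ} {l : List Λ} (hkk' : k ≠ k') (hk : k ∉ l) (hk' : k' ∉ l)
    (hl : l.Nodup) :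
    thru P N k' l * thru P N k l * Rhat P N k k'
      = Rhat P N k k' * (thru P N k l * thru P N k' l) := by
  induction l with
  | nil => simp [thru]
  | cons j l ih =>
    simp only [List.mem_cons, not_or] at hk hk'
    obtain ⟨hj, hl⟩ := List.nodup_cons.mp hl
    have c1 : Commute (thru P N k l) (Rhat P N k' j) :=
      (isLocal_thru hk.2 hl).commute_Rhat P hk'.1 (by simp [hkk'.symm, hk'.2])
        (by simp [Ne.symm hk.1, hj])
    have c2 : Commute (thru P N k' l) (Rhat P N k j) :=
      (isLocal_thru hk'.2 hl).commute_Rhat P hk.1 (by simp [hkk', hk.2])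
        (by simp [Ne.symm hk'.1, hj])
    have yb := Rhat_yangBaxter P (N := N) hkk' hk.1 hk'.1
    rw [thru, thru]
    calc _ = thru P N k' l * (Rhat P N k' j * thru P N k l) * Rhat P N k j * Rhat P N k k' := by
          simp only [mul_assoc]
      _ = thru P N k' l * thru P N k l * (Rhat P N k' j * Rhat P N k j * Rhat P N k k') := by
          rw [← c1.eq]; simp only [mul_assoc]
      _ = (thru P N k' l * thru P N k l * Rhat P N k k') * Rhat P N k j * Rhat P N k' j := by
          rw [← yb]; simp only [mul_assoc]
      _ = Rhat P N k k' * (thru P N k l * (thru P N k' l * Rhat P N k j) * Rhat P N k' j) := by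
          rw [ih hk.2 hk'.2 hl]; simp only [mul_assoc]
      _ = _ := by rw [c2.eq]; simp only [mul_assoc]

lemma thruInv_yangBaxter {k k' : Λ} {l : List Λ} (hkk' : k ≠ k') (hk : k ∉ l) (hk' : k' ∉ l)
    (hl : l.Nodup) :
    Rhat P N k' k * (thruInv P N k l * thruInv P N k' l)
      = thruInv P N k' l * thruInv P N k l * Rhat P N k' k := by
  induction l with
  | nil => simp [thruInv]
  | cons j l ih =>
    simp only [List.mem_cons, not_or] at hk hk'
    obtain ⟨hj, hl⟩ := List.nodup_cons.mp hl
    have c1 : Commute (thruInv P N k l) (Rhat P N j k') :=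
      (isLocal_thruInv hk.2 hl).commute_Rhat P (Ne.symm hk'.1) (by simp [Ne.symm hk.1, hj])
        (by simp [hkk'.symm, hk'.2])
    have c2 : Commute (thruInv P N k' l) (Rhat P N j k) :=
      (isLocal_thruInv hk'.2 hl).commute_Rhat P (Ne.symm hk.1) (by simp [Ne.symm hk'.1, hj])
        (by simp [hkk', hk.2])
    have yb := Rhat_yangBaxter P (N := N) (Ne.symm hk'.1) (Ne.symm hk.1) hkk'.symm
    rw [thruInv, thruInv]
    calc _ = Rhat P N k' k * Rhat P N j k * (thruInv P N k l * Rhat P N j k')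
            * thruInv P N k' l := by simp only [mul_assoc]
      _ = Rhat P N k' k * Rhat P N j k * Rhat P N j k' * (thruInv P N k l * thruInv P N k' l) := by
          rw [c1.eq]; simp only [mul_assoc]
      _ = Rhat P N j k' * Rhat P N j k * (Rhat P N k' k * (thruInv P N k l * thruInv P N k' l)) := by
          rw [← yb]; simp only [mul_assoc]
      _ = Rhat P N j k' * (Rhat P N j k * thruInv P N k' l) * thruInv P N k l * Rhat P N k' k := by
          rw [ih hk.2 hk'.2 hl]; simp only [mul_assoc]
      _ = _ := by rw [← c2.eq]; simp only [mul_assoc]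

end Exchange

end

end QLoop

namespace QLoop

noncomputable section

set_option linter.unusedSectionVars false

/-! ### The resolution of the identity -/

section Resolution

variable {Λ K : Type*} [Field K] {P : Par Λ K} {m : ℕ} [Fintype Λ] [DecidableEq Λ]

open Classical in
/-- The projection onto the span of the basis vectors with property `φ`. -/
def pr (K : Type*) [Field K] {J : Type*} [DecidableEq J] (φ : J → Prop) : Matrix J J K :=
  Matrix.diagonal fun f => if φ f then 1 else 0

lemma pr_mul_pr {J : Type*} [Fintype J] [DecidableEq J] (φ ψ : J → Prop) :
    pr K φ * pr K ψ = pr K fun f => φ f ∧ ψ f := by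
  classical
  rw [pr, pr, Matrix.diagonal_mul_diagonal, pr]
  congr 1
  funext f
  by_cases h1 : φ f <;> by_cases h2 : ψ f <;> simp [h1, h2]

lemma pr_commute {J : Type*} [Fintype J] [DecidableEq J] (φ ψ : J → Prop) :
    Commute (pr K φ) (pr K ψ) := by
  rw [Commute, SemiconjBy, pr_mul_pr, pr_mul_pr]
  simp only [and_comm]

lemma pr_congr {J : Type*} [DecidableEq J] {φ ψ : J → Prop} (h : ∀ f, φ f ↔ ψ f) : pr K φ = pr K ψ := by
  congr 1; funext f; exact propext (h f)

lemma pr_false {J : Type*} [DecidableEq J] {φ : J → Prop} (h : ∀ f, ¬ φ f) : pr K φ = 0 := by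
  classical
  rw [pr, ← Matrix.diagonal_zero]
  congr 1; funext f; simp [h f]

/-- The projection onto the basis vectors with first index in the factor `p`. -/
abbrev prZ (K : Type*) [Field K] {Λ : Type*} [Fintype Λ] [DecidableEq Λ] {m : ℕ} (p : Λ) :
    Matrix (Λ → Fin (m + 1)) (Λ → Fin (m + 1)) K := pr K fun f => f p = 0

/-- The projection onto the basis vectors with an index other than the first one in the
factor `p`. -/
abbrev prS (K : Type*) [Field K] {Λ : Type*} [Fintype Λ] [DecidableEq Λ] {m : ℕ} (p : Λ) :
    Matrix (Λ → Fin (m + 1)) (Λ → Fin (m + 1)) K := pr K fun f => f p ≠ 0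

lemma prZ_mul_prS (p : Λ) : prZ (m := m) K p * prS K p = 0 := by
  rw [pr_mul_pr]; exact pr_false (by simp)

lemma prS_mul_prZ (p : Λ) : prS (m := m) K p * prZ K p = 0 := by
  rw [pr_mul_pr]; exact pr_false (by simp)

lemma prZ_mul_prZ (p : Λ) : prZ (m := m) K p * prZ K p = prZ K p := by
  rw [pr_mul_pr]; exact pr_congr (by simp)

lemma prS_mul_prS (p : Λ) : prS (m := m) K p * prS K p = prS K p := by
  rw [pr_mul_pr]; exact pr_congr (by simp)

lemma pr_eq_leg (p : Λ) (φ : Fin (m + 1) → Prop) :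
    pr K (fun f : Λ → Fin (m + 1) => φ (f p)) = leg p (pr K φ) := by
  classical
  ext f g
  simp only [pr, leg, Matrix.of_apply, Matrix.diagonal_apply]
  by_cases h : f = g
  · subst h; simp
  · by_cases h' : ∀ r, r ≠ p → f r = g r
    · have : f p ≠ g p := fun hp => h (funext fun r => by
        by_cases hr : r = p
        · rw [hr, hp]
        · exact h' r hr)
      simp [h, this]
    · simp [h, h']

lemma isLocal_pr {l : List Λ} {p : Λ} (hp : p ∈ l) (φ : Fin (m + 1) → Prop) :
    IsLocal l (pr K fun f : Λ → Fin (m + 1) => φ (f p)) := by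
  rw [pr_eq_leg]; exact .leg p hp _

lemma IsLocal.commute_pr {l : List Λ} {X : Matrix (Λ → Fin (m + 1)) (Λ → Fin (m + 1)) K}
    (hX : IsLocal l X) {p : Λ} (hp : p ∉ l) (φ : Fin (m + 1) → Prop) :
    Commute X (pr K fun f : Λ → Fin (m + 1) => φ (f p)) := by
  rw [pr_eq_leg]; exact hX.commute_leg' hp _

variable (P) in
/-- The ratio of the diagonal coefficients of the R-matrix. -/
def fR (i j : Λ) : K := (P.x i - P.x j) / (P.Q * P.x i - P.Q⁻¹ * P.x j)

lemma fR_ne_zero {i j : Λ} (h : i ≠ j) : fR P i j ≠ 0 :=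
  div_ne_zero (sub_ne_zero.mpr (P.x_ne i j h)) (P.Qx_ne i j h)

lemma swap_eq_iff {i j : Λ} {N : ℕ} (f : Λ → Fin N) :
    f = f ∘ Equiv.swap i j ↔ f i = f j := by
  constructor
  · intro h; conv_lhs => rw [h]
    simp
  · intro h; funext r
    simp only [Function.comp_apply, Equiv.swap_apply_def]
    split_ifs with h1 h2
    · rw [h1, h]
    · rw [h2, h]
    · rfl

lemma Rhat_apply_self {i j : Λ} {N : ℕ} (f : Λ → Fin N) : Rhat P N i j f f
    = (P.Q * P.x i - P.Q⁻¹ * P.x j)⁻¹ * wR P.Q (P.x i) (P.x j) (f i) (f j) := by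
  simp only [Rhat, Matrix.smul_apply, leg₂, Matrix.of_apply, RM, smul_eq_mul]
  rw [if_pos (fun _ _ _ => trivial)]
  by_cases h : f i = f j
  · simp [dl, h, gR]
  · simp [dl, h]

/-- The off-diagonal part of the R-matrix does not contribute: it would take the zero index from
place `j` to place `i`, which `prS K i` excludes. What survives is the diagonal coefficient for
unequal indices, after normalization. -/
lemma prZ_Rhat_prS {i j : Λ} (hij : i ≠ j) :
    prZ (m := m) K j * Rhat P _ i j * prS K i = fR P i j • (prS K i * prZ K j) := by
  classical
  refine Matrix.ext fun f g => ?_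
  rw [pr_mul_pr]
  simp only [prZ, prS, pr]
  rw [Matrix.mul_diagonal, Matrix.diagonal_mul, Matrix.smul_apply,
    Matrix.diagonal_apply]
  by_cases h : Rhat P (m + 1) i j f g = 0
  · rw [h]
    by_cases hfg : f = g
    · subst hfg
      rw [if_pos rfl]
      by_cases h' : f i ≠ 0 ∧ f j = 0
      · exfalso
        rw [Rhat_apply_self, h'.2, wR, if_neg h'.1] at h
        exact fR_ne_zero (P := P) hij (by rw [fR, div_eq_inv_mul]; exact h)
      · simp [h']
    · simp [hfg]
  · rcases Rhat_apply_ne_zero P hij h with rfl | rfl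
    · rw [if_pos rfl, Rhat_apply_self]
      by_cases h1 : g i = 0 <;> by_cases h2 : g j = 0 <;> simp [h1, h2, wR, fR, div_eq_inv_mul]
    · by_cases h1 : f i = f j
      · rw [← (swap_eq_iff f).mpr h1]
        by_cases h2 : f j = 0 <;> simp [h1, h2]
      · have : f ≠ f ∘ Equiv.swap i j := fun h' => h1 ((swap_eq_iff f).mp h')
        by_cases h2 : f j = 0 <;> simp [h2, this]

/-- The normalization is chosen so that the R-matrix fixes tensors with equal indices at `i` and
`j`. -/
lemma Rhat_prZ_prZ {i j : Λ} (hij : i ≠ j) :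
    Rhat P _ i j * (prZ (m := m) K i * prZ K j) = prZ K i * prZ K j := by
  classical
  refine Matrix.ext fun f g => ?_
  rw [pr_mul_pr, pr, Matrix.mul_diagonal, Matrix.diagonal_apply]
  by_cases hg : g i = 0 ∧ g j = 0
  · rw [if_pos hg, mul_one]
    by_cases hfg : f = g
    · subst hfg
      rw [Rhat_apply_self, hg.1, hg.2, wR, if_pos rfl, if_pos rfl, if_pos ⟨rfl, rfl⟩,
        inv_mul_cancel₀ (P.Qx_ne i j hij)]
    · rw [if_neg hfg]
      by_contra h
      rcases Rhat_apply_ne_zero P hij h with rfl | rfl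
      · exact hfg rfl
      · simp only [Function.comp_apply, Equiv.swap_apply_left, Equiv.swap_apply_right] at hg
        exact hfg ((swap_eq_iff f).mpr (hg.2.trans hg.1.symm))
  · rw [if_neg hg, mul_zero]
    split_ifs with h1 h2
    · subst h1; exact absurd h2 hg
    · rfl
    · rfl

lemma Rhat_prS_prS {i j : Λ} (hij : i ≠ j) :
    Commute (Rhat P _ i j) (prS (m := m) K i * prS K j) := by
  rw [pr_mul_pr]
  refine Rhat_commute_diagonal P hij _ fun f => ?_
  simp [and_comm]

variable (P m) in
/-- The product of the block triangular matrices that bring the tensor factors with first index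
to the left. -/
def headSort : List Λ → Matrix (Λ → Fin (m + 1)) (Λ → Fin (m + 1)) K
  | [] => 1
  | k :: l => headSort l * (prZ K k + prS K k * thru P _ k l)

variable (P m) in
/-- The product of the block triangular matrices that bring the tensor factors with first index
to the right. -/
def tailSort : List Λ → Matrix (Λ → Fin (m + 1)) (Λ → Fin (m + 1)) K
  | [] => 1
  | k :: l => (prS K k + thruInv P _ k l * prZ K k) * tailSort l

variable (P m) in
/-- The diagonal form of the lower block of `thru`. -/
def lowerDiag (k : Λ) : List Λ → Matrix (Λ → Fin (m + 1)) (Λ → Fin (m + 1)) K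
  | [] => prS K k
  | j :: l => (fR P k j • prZ K j + Rhat P _ k j * prS K j * prS K k) * lowerDiag k l

variable (P m) in
/-- The diagonal form of the upper block of `thruInv`. -/
def upperDiag (k : Λ) : List Λ → Matrix (Λ → Fin (m + 1)) (Λ → Fin (m + 1)) K
  | [] => prZ K k
  | j :: l => upperDiag k l * (prZ K j + fR P j k • prS K j)

lemma isLocal_prZ {l : List Λ} {p : Λ} (hp : p ∈ l) : IsLocal l (prZ (m := m) K p) :=
  isLocal_pr hp fun a => a = 0

lemma isLocal_prS {l : List Λ} {p : Λ} (hp : p ∈ l) : IsLocal l (prS (m := m) K p) :=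
  isLocal_pr hp fun a => a ≠ 0

lemma IsLocal.commute_prZ {l : List Λ} {X : Matrix (Λ → Fin (m + 1)) (Λ → Fin (m + 1)) K}
    (hX : IsLocal l X) {p : Λ} (hp : p ∉ l) : Commute X (prZ K p) := hX.commute_pr hp fun a => a = 0

lemma IsLocal.commute_prS {l : List Λ} {X : Matrix (Λ → Fin (m + 1)) (Λ → Fin (m + 1)) K}
    (hX : IsLocal l X) {p : Λ} (hp : p ∉ l) : Commute X (prS K p) := hX.commute_pr hp fun a => a ≠ 0


lemma isLocal_headSort {l : List Λ} (hl : l.Nodup) : IsLocal l (headSort P m l) := by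
  induction l with
  | nil => exact .one
  | cons k l ih =>
    obtain ⟨hk, hl⟩ := List.nodup_cons.mp hl
    exact .mul _ _ ((ih hl).mono (List.subset_cons_self _ _)) (.add _ _ (isLocal_prZ (by simp))
      (.mul _ _ (isLocal_prS (by simp)) (isLocal_thru hk hl)))

lemma isLocal_tailSort {l : List Λ} (hl : l.Nodup) : IsLocal l (tailSort P m l) := by
  induction l with
  | nil => exact .one
  | cons k l ih =>
    obtain ⟨hk, hl⟩ := List.nodup_cons.mp hl
    exact .mul _ _ (.add _ _ (isLocal_prS (by simp))
      (.mul _ _ (isLocal_thruInv hk hl) (isLocal_prZ (by simp))))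
      ((ih hl).mono (List.subset_cons_self _ _))

lemma isLocal_lowerDiag {k : Λ} {l : List Λ} (hk : k ∉ l) :
    IsLocal (k :: l) (lowerDiag P m k l) := by
  induction l with
  | nil => exact isLocal_prS (by simp)
  | cons j l ih =>
    simp only [List.mem_cons, not_or] at hk
    refine .mul _ _ (.add _ _ (.smul _ _ (isLocal_prZ (by simp)))
      (.mul _ _ (.mul _ _ (isLocal_Rhat P hk.1 (by simp) (by simp)) (isLocal_prS (by simp)))
      (isLocal_prS (by simp)))) ((ih hk.2).mono ?_)
    intro a ha; simp only [List.mem_cons] at ha ⊢; tauto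

/-- One member `j` of the list is treated at a time. On the part with first index at `j` only the
scalar `fR P k j` survives, by `prZ_Rhat_prS`. On the complementary part the R-matrix of `k` and `j`
moves to the left by the Yang–Baxter equation and stays there. The matrices moved to the left
commute with the rest of `headSort` because the labels `j` and `k` do not occur in it. -/
lemma headSort_mul_lower {k : Λ} {l : List Λ} (hk : k ∉ l) (hl : l.Nodup) :
    headSort P m l * (prS K k * thru P _ k l * prS K k) = lowerDiag P m k l * headSort P m l := by
  induction l with
  | nil => simp [headSort, thru, lowerDiag, prS_mul_prS]
  | cons j l ih =>
    simp only [List.mem_cons, not_or] at hk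
    obtain ⟨hj, hl⟩ := List.nodup_cons.mp hl
    have hkl : (k :: l).Nodup := List.nodup_cons.mpr ⟨hk.2, hl⟩
    have hjk : j ∉ k :: l := by simp [Ne.symm hk.1, hj]
    have hkj : k ∉ j :: l := by simp [hk.1, hk.2]
    set Z := prZ (m := m) K j
    set S := prS (m := m) K j
    set S' := prS (m := m) K k
    set T := thru P (m + 1) k l with hT
    set T' := thru P (m + 1) j l with hT'
    set R := Rhat P (m + 1) k j with hR
    have locT : IsLocal (k :: l) T := isLocal_thru hk.2 hl
    have locT' : IsLocal (j :: l) T' := isLocal_thru hj hl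
    have hZT : Commute T Z := locT.commute_prZ hjk
    have hST : Commute T S := locT.commute_prS hjk
    have hS'T' : Commute T' S' := locT'.commute_prS hkj
    have hZS' : Commute S' Z := pr_commute _ _
    have hSS' : Commute S' S := pr_commute _ _
    set D := S' * T * S' with hD
    have hDZ : Commute D Z := ((hZS'.mul_left hZT).mul_left hZS')
    have hDS : Commute D S := ((hSS'.mul_left hST).mul_left hSS')
    have key : (Z + S * T') * (S' * (T * R) * S')
        = (fR P k j • Z + R * S * S') * D * (Z + S * T') := by
      have e1 : Z * (S' * (T * R) * S') = fR P k j • (D * Z) := by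
        calc _ = (Z * S') * T * R * S' := by simp only [mul_assoc]
          _ = S' * (Z * T) * R * S' := by rw [← hZS'.eq]; simp only [mul_assoc]
          _ = S' * T * (Z * R * S') := by rw [← hZT.eq]; simp only [mul_assoc]
          _ = _ := by rw [prZ_Rhat_prS hk.1, mul_smul_comm]; simp only [hD, mul_assoc]; rfl
      have e2 : S * T' * (S' * (T * R) * S') = R * S * S' * D * (S * T') := by
        have yb : T' * T * R = R * (T * T') := thru_yangBaxter hk.1 hk.2 hj hl
        have cR : Commute R (S' * S) := Rhat_prS_prS hk.1
        have idS : S' * S' = S' := prS_mul_prS k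
        have idS2 : S * S = S := prS_mul_prS j
        calc _ = S * (T' * S') * T * R * S' := by simp only [mul_assoc]
          _ = S * S' * (T' * T * R) * S' := by rw [hS'T'.eq]; simp only [mul_assoc]
          _ = (S' * S) * R * T * (T' * S') := by rw [yb, ← hSS'.eq]; simp only [mul_assoc]
          _ = R * (S' * S) * T * S' * T' := by
              rw [← cR.eq, hS'T'.eq]; simp only [mul_assoc]
          _ = R * ((S * S) * ((S' * S') * T * S')) * T' := by
              rw [idS, idS2, hSS'.eq]; simp only [mul_assoc]
          _ = R * (S * (S' * S) * D) * T' := by rw [hSS'.eq]; simp only [hD, mul_assoc]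
          _ = R * (S * S') * (D * S) * T' := by rw [hDS.eq]; simp only [mul_assoc]
          _ = _ := by simp only [mul_assoc]
      have e3 : Z * (Z + S * T') = Z := by
        rw [mul_add, ← mul_assoc, prZ_mul_prS, prZ_mul_prZ, zero_mul, add_zero]
      have e4 : S * (Z + S * T') = S * T' := by
        rw [mul_add, ← mul_assoc, prS_mul_prZ, prS_mul_prS, zero_add]
      have e5 : fR P k j • Z * D * (Z + S * T') = fR P k j • (D * Z) := by
        rw [smul_mul_assoc, smul_mul_assoc, ← hDZ.eq, mul_assoc, e3]
      have e6 : R * S * S' * D * (Z + S * T') = R * S * S' * D * (S * T') := by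
        have idS2 : S * S = S := prS_mul_prS j
        calc _ = R * (S * S) * S' * D * (Z + S * T') := by rw [idS2]
          _ = R * S * (S' * S) * D * (Z + S * T') := by rw [hSS'.eq]; simp only [mul_assoc]
          _ = R * S * S' * D * (S * (Z + S * T')) := by
              rw [mul_assoc (R * S * S') D, ← mul_assoc D S, hDS.eq]; simp only [mul_assoc]
          _ = _ := by rw [e4]
      rw [add_mul, e1, e2, add_mul, add_mul, e5, e6]
    have c1 : Commute (headSort P m l) (fR P k j • Z + R * S * S') := by
      have h := isLocal_headSort (P := P) (m := m) hl
      exact ((h.commute_prZ hj).smul_right _).add_right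
        (((h.commute_Rhat P hk.1 hk.2 hj).mul_right (h.commute_prS hj)).mul_right
          (h.commute_prS hk.2))
    rw [headSort, thru, lowerDiag]
    calc _ = headSort P m l * ((Z + S * T') * (S' * (T * R) * S')) := by simp only [mul_assoc]; rfl
      _ = (headSort P m l * (fR P k j • Z + R * S * S')) * D * (Z + S * T') := by
          rw [key]; simp only [mul_assoc]
      _ = (fR P k j • Z + R * S * S') * (headSort P m l * D) * (Z + S * T') := by
          rw [c1.eq]; simp only [mul_assoc]
      _ = _ := by rw [ih hk.2 hl]; simp only [mul_assoc]; rfl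

/-- The mirror image of `headSort_mul_lower`. Here the remaining R-matrix meets `Z * Z'`, on which
it is the identity, so that this block becomes diagonal with scalar entries. -/
lemma upper_mul_tailSort {k : Λ} {l : List Λ} (hk : k ∉ l) (hl : l.Nodup) :
    (prZ K k * thruInv P _ k l * prZ K k) * tailSort P m l
      = tailSort P m l * upperDiag P m k l := by
  induction l with
  | nil => simp [tailSort, thruInv, upperDiag, prZ_mul_prZ]
  | cons j l ih =>
    simp only [List.mem_cons, not_or] at hk
    obtain ⟨hj, hl⟩ := List.nodup_cons.mp hl
    have hjk : j ∉ k :: l := by simp [Ne.symm hk.1, hj]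
    have hkj : k ∉ j :: l := by simp [hk.1, hk.2]
    set Z := prZ (m := m) K j
    set S := prS (m := m) K j
    set Z' := prZ (m := m) K k
    set T := thruInv P (m + 1) k l with hT
    set T' := thruInv P (m + 1) j l with hT'
    set R := Rhat P (m + 1) j k with hR
    have locT : IsLocal (k :: l) T := isLocal_thruInv hk.2 hl
    have locT' : IsLocal (j :: l) T' := isLocal_thruInv hj hl
    have hZT : Commute T Z := locT.commute_prZ hjk
    have hST : Commute T S := locT.commute_prS hjk
    have hZ'T' : Commute T' Z' := locT'.commute_prZ hkj
    have hZZ' : Commute Z' Z := pr_commute _ _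
    have hSZ' : Commute Z' S := pr_commute _ _
    set A := Z' * T * Z' with hA
    have hAZ : Commute A Z := ((hZZ'.mul_left hZT).mul_left hZZ')
    have hAS : Commute A S := ((hSZ'.mul_left hST).mul_left hSZ')
    have idZ : Z * Z = Z := prZ_mul_prZ j
    have idS : S * S = S := prS_mul_prS j
    have ZS : Z * S = 0 := prZ_mul_prS j
    have SZ : S * Z = 0 := prS_mul_prZ j
    have key : (Z' * (R * T) * Z') * (S + T' * Z) = (S + T' * Z) * A * (Z + fR P j k • S) := by
      have e1 : (Z' * (R * T) * Z') * S = fR P j k • (S * A) := by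
        calc _ = Z' * R * T * (Z' * S) := by simp only [mul_assoc]
          _ = Z' * R * (T * S) * Z' := by rw [hSZ'.eq]; simp only [mul_assoc]
          _ = (Z' * R * S) * T * Z' := by rw [hST.eq]; simp only [mul_assoc]
          _ = _ := by
            rw [prZ_Rhat_prS (Ne.symm hk.1), smul_mul_assoc, smul_mul_assoc]
            simp only [hA, mul_assoc]; rfl
      have e2 : (Z' * (R * T) * Z') * (T' * Z) = T' * Z * A := by
        have yb : R * (T * T') = T' * T * R := thruInv_yangBaxter hk.1 hk.2 hj hl
        have rz : R * (Z * Z') = Z * Z' := Rhat_prZ_prZ (Ne.symm hk.1)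
        calc _ = Z' * R * T * (Z' * T') * Z := by simp only [mul_assoc]
          _ = Z' * (R * (T * T')) * (Z' * Z) := by rw [← hZ'T'.eq]; simp only [mul_assoc]
          _ = (Z' * T') * T * (R * (Z * Z')) := by rw [yb, hZZ'.eq]; simp only [mul_assoc]
          _ = T' * Z' * T * (Z' * Z) := by rw [rz, ← hZ'T'.eq, hZZ'.eq]
          _ = T' * (A * Z) := by simp only [hA, mul_assoc]
          _ = _ := by rw [hAZ.eq, mul_assoc]
      have e3 : (S + T' * Z) * A * Z = T' * Z * A := by
        calc _ = (S + T' * Z) * (A * Z) := by rw [mul_assoc]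
          _ = (S * Z + T' * (Z * Z)) * A := by
              rw [hAZ.eq, ← mul_assoc, add_mul]; simp only [mul_assoc]
          _ = _ := by rw [SZ, idZ, zero_add]
      have e4 : (S + T' * Z) * A * S = S * A := by
        calc _ = (S + T' * Z) * (A * S) := by rw [mul_assoc]
          _ = (S * S + T' * (Z * S)) * A := by
              rw [hAS.eq, ← mul_assoc, add_mul]; simp only [mul_assoc]
          _ = _ := by rw [ZS, idS, mul_zero, add_zero]
      rw [mul_add, e1, e2, mul_add, e3, mul_smul_comm, e4]
      exact add_comm _ _
    have c1 : Commute (tailSort P m l) (Z + fR P j k • S) := by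
      have h := isLocal_tailSort (P := P) (m := m) hl
      exact (h.commute_prZ hj).add_right ((h.commute_prS hj).smul_right _)
    rw [tailSort, thruInv, upperDiag]
    calc _ = ((Z' * (R * T) * Z') * (S + T' * Z)) * tailSort P m l := by
          simp only [mul_assoc]; rfl
      _ = (S + T' * Z) * A * ((Z + fR P j k • S) * tailSort P m l) := by
          rw [key]; simp only [mul_assoc]
      _ = (S + T' * Z) * (A * tailSort P m l) * (Z + fR P j k • S) := by
          rw [← c1.eq]; simp only [mul_assoc]
      _ = _ := by rw [ih hk.2 hl]; simp only [mul_assoc]; rfl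

/-- With complementary projections `Z`, `S` and `T` the exchange matrix of `k`, one has `(Z + S T)(S
+ T⁻¹ Z) = Z T⁻¹ Z + S T S`: the mixed terms contain `Z S` or `S T T⁻¹ Z = S Z` and vanish. The two
diagonal blocks are then carried outside. -/
lemma headSort_mul_tailSort_cons {k : Λ} {l : List Λ} (hk : k ∉ l) (hl : l.Nodup) :
    headSort P m (k :: l) * tailSort P m (k :: l)
      = headSort P m l * tailSort P m l * upperDiag P m k l
        + lowerDiag P m k l * (headSort P m l * tailSort P m l) := by
  have hT := thru_mul_thruInv (P := P) (N := m + 1) hk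
  have e : (prZ K k + prS K k * thru P _ k l) * (prS K k + thruInv P _ k l * prZ K k)
      = prZ (m := m) K k * thruInv P _ k l * prZ K k + prS K k * thru P _ k l * prS K k := by
    rw [add_mul, mul_add, mul_add, prZ_mul_prS, zero_add, mul_assoc (prS K k) _ (_ * _),
      ← mul_assoc (thru P _ k l), hT, one_mul, prS_mul_prZ, add_zero]
    simp only [mul_assoc]
  rw [headSort, tailSort]
  calc _ = headSort P m l * ((prZ K k + prS K k * thru P _ k l)
        * (prS K k + thruInv P _ k l * prZ K k)) * tailSort P m l := by simp only [mul_assoc]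
    _ = headSort P m l * ((prZ (m := m) K k * thruInv P _ k l * prZ K k) * tailSort P m l)
        + headSort P m l * (prS K k * thru P _ k l * prS K k) * tailSort P m l := by
        rw [e, mul_add, add_mul]; simp only [mul_assoc]
    _ = _ := by
        rw [upper_mul_tailSort hk hl, headSort_mul_lower hk hl]; simp only [mul_assoc]

end Resolution

end

end QLoop

namespace QLoop

noncomputable section

set_option linter.unusedSectionVars false

/-! ### The blocks of the sorting matrices and the resolution of the identity -/

section Resolution

variable {Λ K : Type*} [Field K] {P : Par Λ K} {m : ℕ} [Fintype Λ] [DecidableEq Λ]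

/-- The members of the list `l` in `I`. -/
def headL (l : List Λ) (I : Finset Λ) : List Λ := l.filter (· ∈ I)

/-- The members of the list `l` outside `I`. -/
def tailL (l : List Λ) (I : Finset Λ) : List Λ := l.filter (· ∉ I)

lemma headL_cons_mem {k : Λ} {I : Finset Λ} (h : k ∈ I) (l : List Λ) :
    headL (k :: l) I = k :: headL l I := by simp [headL, h]

lemma headL_cons_not_mem {k : Λ} {I : Finset Λ} (h : k ∉ I) (l : List Λ) :
    headL (k :: l) I = headL l I := by simp [headL, h]

lemma tailL_cons_mem {k : Λ} {I : Finset Λ} (h : k ∈ I) (l : List Λ) :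
    tailL (k :: l) I = tailL l I := by simp [tailL, h]

lemma tailL_cons_not_mem {k : Λ} {I : Finset Λ} (h : k ∉ I) (l : List Λ) :
    tailL (k :: l) I = k :: tailL l I := by simp [tailL, h]

lemma mem_headL {l : List Λ} {I : Finset Λ} {p : Λ} : p ∈ headL l I ↔ p ∈ l ∧ p ∈ I := by
  simp [headL]

lemma mem_tailL {l : List Λ} {I : Finset Λ} {p : Λ} : p ∈ tailL l I ↔ p ∈ l ∧ p ∉ I := by
  simp [tailL]

lemma headL_append_tailL_perm (l : List Λ) (I : Finset Λ) : (headL l I ++ tailL l I).Perm l := by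
  have := List.filter_append_perm (fun p => decide (p ∈ I)) l
  simpa [headL, tailL] using this

/-- The projection onto the basis vectors for which `I` is the set of factors from `l` with first
index. -/
def prI (K : Type*) [Field K] {Λ : Type*} [Fintype Λ] [DecidableEq Λ] {m : ℕ} (l : List Λ)
    (I : Finset Λ) :
    Matrix (Λ → Fin (m + 1)) (Λ → Fin (m + 1)) K := pr K fun f => ∀ p ∈ l, (f p = 0 ↔ p ∈ I)

lemma prI_nil (I : Finset Λ) : prI (m := m) K [] I = 1 := by
  classical
  rw [prI, pr, ← Matrix.diagonal_one]; congr 1; funext f; simp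

lemma prI_cons_mem {k : Λ} {I : Finset Λ} (h : k ∈ I) (l : List Λ) :
    prI (m := m) K (k :: l) I = prZ K k * prI K l I := by
  rw [prI, prI, pr_mul_pr]
  exact pr_congr (by simp [h])

lemma prI_cons_not_mem {k : Λ} {I : Finset Λ} (h : k ∉ I) (l : List Λ) :
    prI (m := m) K (k :: l) I = prS K k * prI K l I := by
  rw [prI, prI, pr_mul_pr]
  exact pr_congr (by simp [h])

lemma prI_commute_pr (l : List Λ) (I : Finset Λ) (φ : (Λ → Fin (m + 1)) → Prop) :
    Commute (prI K l I) (pr K φ) := pr_commute _ _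

lemma sum_prI (l : List Λ) : ∑ I ∈ l.toFinset.powerset, prI (m := m) K l I = 1 := by
  classical
  refine Matrix.ext fun f g => ?_
  rw [Matrix.sum_apply]
  by_cases hfg : f = g
  · subst hfg
    rw [Matrix.one_apply_eq, Finset.sum_eq_single (l.toFinset.filter fun p => f p = 0)]
    · simp only [prI, pr, Matrix.diagonal_apply_eq, ite_eq_left_iff, zero_ne_one, imp_false,
        not_not]
      intro p hp; simp [hp]
    · intro I hI hne
      simp only [prI, pr, Matrix.diagonal_apply_eq, ite_eq_right_iff, one_ne_zero, imp_false]
      intro H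
      apply hne
      ext p
      simp only [Finset.mem_filter, List.mem_toFinset]
      refine ⟨fun hp => ?_, fun hp => (H p hp.1).mp hp.2⟩
      have hpl : p ∈ l := by simpa using Finset.mem_powerset.mp hI hp
      exact ⟨hpl, (H p hpl).mpr hp⟩
    · intro h; exact absurd (Finset.mem_powerset.mpr (Finset.filter_subset _ _)) h
  · rw [Matrix.one_apply_ne hfg]
    exact Finset.sum_eq_zero fun I _ => Matrix.diagonal_apply_ne _ hfg

/-- An exchange among labels outside `I` permutes nonzero indices only, so the set of factors with
first index does not change. -/
lemma Exch.commute_prI {l T T' : List Λ} {I : Finset Λ}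
    {X : Matrix (Λ → Fin (m + 1)) (Λ → Fin (m + 1)) K}
    (h : Exch P (m + 1) T T' X) (hT : T.Nodup) (hTl : ∀ p ∈ T, p ∈ l ∧ p ∉ I) :
    Commute X (prI K l I) := by
  refine h.commute_diagonal hT _ fun i hi j hj f => ?_
  have key : ∀ f : Λ → Fin (m + 1), (∀ p ∈ l, (f p = 0 ↔ p ∈ I)) →
      ∀ p ∈ l, ((f ∘ Equiv.swap i j) p = 0 ↔ p ∈ I) := by
    intro f H p hp
    simp only [Function.comp_apply, Equiv.swap_apply_def]
    split_ifs with h1 h2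
    · subst h1; simp [(H j (hTl j hj).1), (hTl j hj).2, (hTl p hi).2]
    · subst h2; simp [(H i (hTl i hi).1), (hTl i hi).2, (hTl p hj).2]
    · exact H p hp
  have : (∀ p ∈ l, ((f ∘ Equiv.swap i j) p = 0 ↔ p ∈ I)) ↔ (∀ p ∈ l, (f p = 0 ↔ p ∈ I)) :=
    ⟨fun H => by simpa [Function.comp_assoc, ← Equiv.coe_trans, funext_iff] using key _ H,
      key f⟩
  congr 1
  exact propext this

/-- On the block of `I` each factor `prZ + prS * thru` of `headSort` becomes `1` if its label lies
in `I`, and otherwise moves its label to the far right. The labels outside `I` therefore end up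
reversed. -/
lemma exists_exch_headSort {l : List Λ} (hl : l.Nodup) (I : Finset Λ) :
    ∃ H, Exch P (m + 1) l (headL l I ++ (tailL l I).reverse) H ∧
      prI K l I * headSort P m l = prI K l I * H := by
  induction l with
  | nil => exact ⟨1, .refl _, rfl⟩
  | cons k l ih =>
    obtain ⟨hk, hl⟩ := List.nodup_cons.mp hl
    obtain ⟨H, hH, e⟩ := ih hl
    have locH := hH.isLocal hl
    have locS := isLocal_headSort (P := P) (m := m) hl
    by_cases h : k ∈ I
    · refine ⟨H, ?_, ?_⟩
      · rw [headL_cons_mem h, tailL_cons_mem h]; exact hH.cons k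
      · have hz : prZ K k * (prZ K k + prS K k * thru P _ k l) = prZ (m := m) K k := by
          rw [mul_add, ← mul_assoc, prZ_mul_prS, prZ_mul_prZ, zero_mul, add_zero]
        rw [prI_cons_mem h, headSort]
        calc _ = prI K l I * (prZ K k * headSort P m l) * (prZ K k + prS K k * thru P _ k l) := by
              rw [← (prI_commute_pr l I _).eq]; simp only [mul_assoc]
          _ = prI K l I * headSort P m l * prZ K k := by
              rw [← (locS.commute_prZ hk).eq, mul_assoc, mul_assoc, hz, mul_assoc]
          _ = _ := by
              rw [e, mul_assoc, (locH.commute_prZ hk).eq, ← mul_assoc, (prI_commute_pr l I _).eq]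
    · refine ⟨H * thru P _ k l, ?_, ?_⟩
      · rw [headL_cons_not_mem h, tailL_cons_not_mem h, List.reverse_cons, ← List.append_assoc]
        exact (exch_thru P _ k l).trans (by simpa using hH.append [] [k])
      · have hz : prS K k * (prZ K k + prS K k * thru P _ k l)
            = prS (m := m) K k * thru P _ k l := by
          rw [mul_add, ← mul_assoc, prS_mul_prZ, prS_mul_prS, zero_add]
        rw [prI_cons_not_mem h, headSort]
        calc _ = prI K l I * (prS K k * headSort P m l) * (prZ K k + prS K k * thru P _ k l) := by
              rw [← (prI_commute_pr l I _).eq]; simp only [mul_assoc]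
          _ = prI K l I * headSort P m l * prS K k * thru P _ k l := by
              rw [← (locS.commute_prS hk).eq]; simp only [mul_assoc]; rw [hz]
          _ = prI K l I * (H * prS K k) * thru P _ k l := by rw [e, mul_assoc (prI K l I)]
          _ = prI K l I * prS K k * (H * thru P _ k l) := by
              rw [(locH.commute_prS hk).eq]; simp only [mul_assoc]
          _ = _ := by rw [(prI_commute_pr l I _).eq]

/-- As for `headSort`, with the projection on the right: the labels in `I` are brought back from the
right end, where they stand in reversed order. -/
lemma exists_exch_tailSort {l : List Λ} (hl : l.Nodup) (I : Finset Λ) :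
    ∃ G, Exch P (m + 1) (tailL l I ++ (headL l I).reverse) l G ∧
      tailSort P m l * prI K l I = G * prI K l I := by
  induction l with
  | nil => exact ⟨1, .refl _, rfl⟩
  | cons k l ih =>
    obtain ⟨hk, hl⟩ := List.nodup_cons.mp hl
    obtain ⟨G, hG, e⟩ := ih hl
    have hperm : (tailL l I ++ (headL l I).reverse).Perm l := hG.perm
    have locG : IsLocal l G := (hG.isLocal (hperm.nodup_iff.mpr hl)).mono hperm.subset
    have locS := isLocal_tailSort (P := P) (m := m) hl
    by_cases h : k ∈ I
    · refine ⟨thruInv P _ k l * G, ?_, ?_⟩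
      · rw [headL_cons_mem h, tailL_cons_mem h, List.reverse_cons, ← List.append_assoc]
        have h1 := hG.append [] [k]
        rw [List.nil_append, List.nil_append] at h1
        exact h1.trans (exch_thruInv P _ k l)
      · have hz : (prS K k + thruInv P _ k l * prZ K k) * prZ (m := m) K k
            = thruInv P _ k l * prZ K k := by
          rw [add_mul, mul_assoc, prZ_mul_prZ, prS_mul_prZ, zero_add]
        rw [prI_cons_mem h, tailSort]
        calc _ = (prS K k + thruInv P _ k l * prZ K k) * (tailSort P m l * prZ K k)
                * prI K l I := by simp only [mul_assoc]
          _ = thruInv P _ k l * prZ K k * tailSort P m l * prI K l I := by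
              rw [(locS.commute_prZ hk).eq, ← mul_assoc _ (prZ K k), hz]
          _ = thruInv P _ k l * (prZ K k * G) * prI K l I := by
              rw [mul_assoc _ _ (prI K l I), e]; simp only [mul_assoc]
          _ = _ := by rw [← (locG.commute_prZ hk).eq]; simp only [mul_assoc]
    · refine ⟨G, ?_, ?_⟩
      · rw [headL_cons_not_mem h, tailL_cons_not_mem h, List.cons_append]
        exact hG.cons k
      · have hz : (prS K k + thruInv P _ k l * prZ K k) * prS (m := m) K k = prS K k := by
          rw [add_mul, mul_assoc, prZ_mul_prS, prS_mul_prS, mul_zero, add_zero]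
        rw [prI_cons_not_mem h, tailSort]
        calc _ = (prS K k + thruInv P _ k l * prZ K k) * (tailSort P m l * prS K k)
                * prI K l I := by simp only [mul_assoc]
          _ = prS K k * tailSort P m l * prI K l I := by
              rw [(locS.commute_prS hk).eq, ← mul_assoc _ (prS K k), hz]
          _ = prS K k * G * prI K l I := by rw [mul_assoc, e, ← mul_assoc]
          _ = _ := by rw [← (locG.commute_prS hk).eq]; simp only [mul_assoc]

variable (P) in
/-- The eigenvalue of the block diagonal matrix `headSort * tailSort`. -/
def blockCoeff (l : List Λ) (I : Finset Λ) : K :=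
  ((headL l I).map fun i => ((tailL l I).map fun j => fR P j i).prod).prod

lemma upperDiag_mul_prI (k : Λ) {l : List Λ} (hl : l.Nodup) (I : Finset Λ) :
    upperDiag P m k l * prI K l I
      = ((tailL l I).map fun j => fR P j k).prod • (prZ K k * prI K l I) := by
  induction l with
  | nil => simp [upperDiag, prI_nil, tailL]
  | cons j l ih =>
    obtain ⟨hj, hl⟩ := List.nodup_cons.mp hl
    by_cases h : j ∈ I
    · have hz : (prZ K j + fR P j k • prS K j) * prZ (m := m) K j = prZ K j := by
        rw [add_mul, smul_mul_assoc, prZ_mul_prZ, prS_mul_prZ, smul_zero, add_zero]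
      rw [prI_cons_mem h, upperDiag, tailL_cons_mem h, mul_assoc, ← mul_assoc _ (prZ K j), hz,
        ← (prI_commute_pr l I _).eq, ← mul_assoc, ih hl, smul_mul_assoc, mul_assoc]
    · have hz : (prZ K j + fR P j k • prS K j) * prS (m := m) K j = fR P j k • prS K j := by
        rw [add_mul, smul_mul_assoc, prS_mul_prS, prZ_mul_prS, zero_add]
      rw [prI_cons_not_mem h, upperDiag, tailL_cons_not_mem h, mul_assoc, ← mul_assoc _ (prS K j),
        hz, smul_mul_assoc, mul_smul_comm, ← (prI_commute_pr l I _).eq, ← mul_assoc, ih hl,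
        smul_mul_assoc, mul_assoc, List.map_cons, List.prod_cons, smul_smul]

lemma thru_append_singleton {N : ℕ} (k j : Λ) (l : List Λ) :
    thru P N k (l ++ [j]) = Rhat P N k j * thru P N k l := by
  induction l with
  | nil => simp [thru]
  | cons i l ih => rw [List.cons_append, thru, ih, thru, mul_assoc]

/-- A member of `I` contributes a scalar and any other member an R-matrix. In `lowerDiag` the
R-matrix of the first member stands leftmost, in `thru` that of the last one, whence the reversed
list. -/
lemma lowerDiag_mul_prI {k : Λ} {l : List Λ} (hk : k ∉ l) (hl : l.Nodup) (I : Finset Λ) :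
    lowerDiag P m k l * (prI K l I * prS K k)
      = ((headL l I).map fun i => fR P k i).prod •
        (thru P _ k (tailL l I).reverse * (prI K l I * prS K k)) := by
  induction l with
  | nil => simp [lowerDiag, prI_nil, headL, tailL, thru, prS_mul_prS]
  | cons j l ih =>
    simp only [List.mem_cons, not_or] at hk
    obtain ⟨hj, hl⟩ := List.nodup_cons.mp hl
    have hjk : j ∉ k :: l := by simp [Ne.symm hk.1, hj]
    have locD : IsLocal (k :: l) (lowerDiag P m k l) := isLocal_lowerDiag hk.2
    have hsub : k :: (tailL l I).reverse ⊆ k :: l := by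
      intro a ha
      simp only [List.mem_cons, List.mem_reverse, mem_tailL] at ha ⊢
      tauto
    have hkT : k ∉ (tailL l I).reverse := by simp [mem_tailL, hk.2]
    have ndT : (tailL l I).reverse.Nodup := List.nodup_reverse.mpr (hl.filter _)
    have locT := (isLocal_thru (P := P) (N := m + 1) hkT ndT).mono hsub
    have cDZ := locD.commute_prZ hjk
    have cDS := locD.commute_prS hjk
    have cTZ := locT.commute_prZ hjk
    have cTS := locT.commute_prS hjk
    have ih := ih hk.2 hl
    set Z := prZ (m := m) K j
    set S := prS (m := m) K j
    set S' := prS (m := m) K k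
    set D := lowerDiag P m k l
    set p := prI (m := m) K l I
    set T := thru P (m + 1) k (tailL l I).reverse
    have cSS : Commute S' S := pr_commute _ _
    by_cases h : j ∈ I
    · have hz : (fR P k j • Z + Rhat P _ k j * S * S') * Z = fR P k j • Z := by
        have e1 : S' * Z = Z * S' := (pr_commute _ _).eq
        have e2 : S * Z = 0 := prS_mul_prZ j
        have e3 : Z * Z = Z := prZ_mul_prZ j
        rw [add_mul, smul_mul_assoc, e3, mul_assoc, e1, mul_assoc, ← mul_assoc S, e2, zero_mul,
          mul_zero, add_zero]
      rw [prI_cons_mem h, lowerDiag, headL_cons_mem h, tailL_cons_mem h, List.map_cons,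
        List.prod_cons]
      change (fR P k j • Z + Rhat P _ k j * S * S') * D * (Z * p * S') = _ • (T * (Z * p * S'))
      calc _ = (fR P k j • Z + Rhat P _ k j * S * S') * (D * Z) * (p * S') := by
            simp only [mul_assoc]
        _ = (fR P k j • Z + Rhat P _ k j * S * S') * Z * (D * (p * S')) := by
            rw [cDZ.eq]; simp only [mul_assoc]
        _ = (fR P k j * ((headL l I).map fun i => fR P k i).prod) • (Z * T * (p * S')) := by
            rw [hz, ih, smul_mul_assoc, mul_smul_comm, smul_smul, mul_assoc]
        _ = _ := by rw [← cTZ.eq]; simp only [mul_assoc]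
    · have idS : S * S = S := prS_mul_prS j
      -- The span of the basis vectors with nonzero indices at `k` and at the tail labels is
      -- preserved by `T` and contains the range of `p * S'`. This makes the inner factor `S'`
      -- superfluous (`hT`).
      set E : Matrix (Λ → Fin (m + 1)) (Λ → Fin (m + 1)) K :=
        pr K fun f => ∀ r ∈ k :: (tailL l I).reverse, f r ≠ 0
      have cTE : Commute T E := by
        refine (exch_thru P _ k (tailL l I).reverse).commute_diagonal
          (List.nodup_cons.mpr ⟨hkT, ndT⟩) _ fun a ha b hb f => ?_
        congr 1
        have key : ∀ f : Λ → Fin (m + 1), (∀ r ∈ k :: (tailL l I).reverse, f r ≠ 0) →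
            ∀ r ∈ k :: (tailL l I).reverse, (f ∘ Equiv.swap a b) r ≠ 0 := by
          intro f H r hr
          simp only [Function.comp_apply, Equiv.swap_apply_def]
          split_ifs
          exacts [H b hb, H a ha, H r hr]
        exact propext ⟨fun H => by
          simpa [Function.comp_assoc, ← Equiv.coe_trans] using key _ H, key f⟩
      have hE : E * (p * S') = p * S' := by
        simp only [E, p, S', prI, prS, pr_mul_pr]
        refine pr_congr fun f => ⟨fun H => H.2, fun H => ⟨fun r hr => ?_, H⟩⟩
        rcases List.mem_cons.mp hr with rfl | hr
        · exact H.2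
        · rw [List.mem_reverse, mem_tailL] at hr
          exact fun h0 => hr.2 ((H.1 r hr.1).mp h0)
      have hE' : S' * E = E := by
        simp only [E, S', prS, pr_mul_pr]
        exact pr_congr fun f => ⟨fun H => H.2, fun H => ⟨H k (by simp), H⟩⟩
      have hT : S' * (T * (p * S')) = T * (p * S') := by
        rw [← hE, ← mul_assoc T, cTE.eq, mul_assoc, ← mul_assoc, hE']
      have hz : (fR P k j • Z + Rhat P _ k j * S * S') * S = Rhat P _ k j * S' * S := by
        have e2 : Z * S = 0 := prZ_mul_prS j
        rw [add_mul, smul_mul_assoc, e2, smul_zero, zero_add, mul_assoc, cSS.eq, mul_assoc,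
          ← mul_assoc S, idS, mul_assoc, cSS.eq]
      rw [prI_cons_not_mem h, lowerDiag, headL_cons_not_mem h, tailL_cons_not_mem h,
        List.reverse_cons, thru_append_singleton]
      change (fR P k j • Z + Rhat P _ k j * S * S') * D * (S * p * S')
        = _ • (Rhat P _ k j * T * (S * p * S'))
      calc _ = (fR P k j • Z + Rhat P _ k j * S * S') * (D * S) * (p * S') := by
            simp only [mul_assoc]
        _ = (fR P k j • Z + Rhat P _ k j * S * S') * S * (D * (p * S')) := by
            rw [cDS.eq]; simp only [mul_assoc]
        _ = ((headL l I).map fun i => fR P k i).prod •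
            (Rhat P _ k j * (S * (S' * (T * (p * S'))))) := by
            rw [hz, ih, mul_smul_comm, mul_assoc, mul_assoc, ← mul_assoc S', cSS.eq, mul_assoc]
        _ = _ := by rw [hT, ← mul_assoc S, ← cTS.eq]; simp only [mul_assoc]

lemma blockCoeff_ne_zero {l : List Λ} (I : Finset Λ) : blockCoeff P l I ≠ 0 := by
  rw [blockCoeff, ne_eq, List.prod_eq_zero_iff, List.mem_map]
  rintro ⟨i, hi, h⟩
  rw [List.prod_eq_zero_iff, List.mem_map] at h
  obtain ⟨j, hj, h⟩ := h
  refine fR_ne_zero (P := P) ?_ h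
  rintro rfl
  exact (mem_tailL.mp hj).2 (mem_headL.mp hi).2

lemma lowerDiag_mul_prZ {k : Λ} {l : List Λ} (hk : k ∉ l) :
    lowerDiag P m k l * prZ K k = 0 := by
  induction l with
  | nil => rw [lowerDiag, prS_mul_prZ]
  | cons j l ih =>
    simp only [List.mem_cons, not_or] at hk
    rw [lowerDiag, mul_assoc, ih hk.2, mul_zero]

lemma upperDiag_mul_prS {k : Λ} {l : List Λ} (hk : k ∉ l) :
    upperDiag P m k l * prS K k = 0 := by
  induction l with
  | nil => rw [upperDiag, prZ_mul_prS]
  | cons j l ih =>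
    simp only [List.mem_cons, not_or] at hk
    have c : Commute (prZ K j + fR P j k • prS K j) (prS (m := m) K k) :=
      (pr_commute _ _).add_left ((pr_commute _ _).smul_left _)
    rw [upperDiag, mul_assoc, c.eq, ← mul_assoc, ih hk.2, zero_mul]

/-- The product `headSort * tailSort` is block diagonal. -/
lemma exists_headSort_mul_tailSort {l : List Λ} (hl : l.Nodup) (I : Finset Λ) :
    ∃ Y, Exch P (m + 1) (tailL l I) (tailL l I).reverse Y ∧
      headSort P m l * tailSort P m l * prI K l I = blockCoeff P l I • (Y * prI K l I) := by
  induction l with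
  | nil => exact ⟨1, .refl _, by simp [headSort, tailSort, blockCoeff, headL]⟩
  | cons k l ih =>
    obtain ⟨hk, hl⟩ := List.nodup_cons.mp hl
    obtain ⟨Y, hY, e⟩ := ih hl
    have hW : IsLocal l (headSort P m l * tailSort P m l) :=
      .mul _ _ (isLocal_headSort hl) (isLocal_tailSort hl)
    have locY : IsLocal l Y := (hY.isLocal (hl.filter _)).mono (List.filter_subset_self _)
    have cY : Commute Y (prI K l I) := hY.commute_prI (hl.filter _) fun p hp => mem_tailL.mp hp
    rw [headSort_mul_tailSort_cons hk hl]
    set W := headSort P m l * tailSort P m l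
    set p := prI (m := m) K l I with hp
    -- Only one of the two summands survives: the upper one, a scalar, if `k` lies in `I`, and
    -- otherwise the lower one, which also moves `k` through the reversed tail.
    by_cases h : k ∈ I
    · refine ⟨Y, by rwa [tailL_cons_mem h], ?_⟩
      have cWZ := hW.commute_prZ hk
      have cpZ : Commute p (prZ K k) := prI_commute_pr _ _ _
      have hz : lowerDiag P m k l * W * (prZ K k * p) = 0 := by
        rw [mul_assoc, ← mul_assoc W, cWZ.eq, mul_assoc (prZ K k), ← mul_assoc _ (prZ K k),
          lowerDiag_mul_prZ hk, zero_mul]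
      have hU : upperDiag P m k l * (prZ K k * p)
          = ((tailL l I).map fun j => fR P j k).prod • (p * prZ K k) := by
        rw [← cpZ.eq, ← mul_assoc, hp, upperDiag_mul_prI k hl, ← hp, smul_mul_assoc, ← cpZ.eq,
          mul_assoc, prZ_mul_prZ]
      rw [prI_cons_mem h, ← hp, add_mul, hz, add_zero, mul_assoc W, hU, mul_smul_comm, ← mul_assoc,
        e, smul_mul_assoc, smul_smul, mul_assoc, cpZ.eq]
      congr 1
      rw [blockCoeff, blockCoeff, headL_cons_mem h, tailL_cons_mem h, List.map_cons, List.prod_cons]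
    · refine ⟨thru P _ k (tailL l I).reverse * Y, ?_, ?_⟩
      · rw [tailL_cons_not_mem h, List.reverse_cons]
        exact (hY.cons k).trans (exch_thru P _ k _)
      have cWS := hW.commute_prS hk
      have cpS : Commute p (prS K k) := prI_commute_pr _ _ _
      have cYS := locY.commute_prS hk
      have hz : W * upperDiag P m k l * (prS K k * p) = 0 := by
        rw [mul_assoc, ← mul_assoc _ _ p, upperDiag_mul_prS hk, zero_mul, mul_zero]
      rw [prI_cons_not_mem h, ← hp, add_mul, hz, zero_add]
      calc _ = lowerDiag P m k l * (prS K k * (W * p)) := by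
            rw [mul_assoc, ← mul_assoc W, cWS.eq, mul_assoc (prS K k)]
        _ = blockCoeff P l I • (lowerDiag P m k l * (p * prS K k) * Y) := by
            rw [e, cY.eq, mul_smul_comm, mul_smul_comm, cpS.eq]; simp only [mul_assoc]
        _ = _ := by
            rw [hp, lowerDiag_mul_prI hk hl, ← hp, smul_mul_assoc, smul_smul, mul_comm, cpS.eq]
            congr 1
            · rw [blockCoeff, blockCoeff, headL_cons_not_mem h, tailL_cons_not_mem h]
              simp only [List.map_cons, List.prod_cons, List.prod_map_mul]
            · rw [mul_assoc, mul_assoc, mul_assoc, ← cY.eq, ← mul_assoc _ Y, ← cYS.eq, mul_assoc]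

/-- The resolution of the identity by the projections `prI`. -/
lemma exists_resolution {l : List Λ} (hl : l.Nodup) :
    ∃ G X : Finset Λ → Matrix (Λ → Fin (m + 1)) (Λ → Fin (m + 1)) K,
      (∀ I, Exch P (m + 1) (tailL l I ++ (headL l I).reverse) l (G I)) ∧
      (∀ I, Exch P (m + 1) l (headL l I ++ tailL l I) (X I)) ∧
      1 = ∑ I ∈ l.toFinset.powerset, (blockCoeff P l I)⁻¹ • (G I * prI K l I * X I) := by
  choose Y hY eY using fun I => exists_headSort_mul_tailSort (P := P) (m := m) hl I
  choose H hH eH using fun I => exists_exch_headSort (P := P) (m := m) hl I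
  choose G hG eG using fun I => exists_exch_tailSort (P := P) (m := m) hl I
  choose Y' hY' eY1 eY2 using fun I => (hY I).inverse (hl.filter _)
  refine ⟨G, fun I => Y' I * H I, hG, fun I => (hH I).trans (by
    simpa using (hY' I).append (headL l I) []), ?_⟩
  have cY : ∀ I, Commute (Y' I) (prI K l I) := fun I =>
    (hY' I).commute_prI (List.nodup_reverse.mpr (hl.filter _))
      fun p hp => mem_tailL.mp (List.mem_reverse.mp hp)
  -- The block diagonal matrix `headSort * tailSort` is inverted block by block. For square matrices
  -- a one-sided inverse is two-sided, so the factors may be rotated to express `1` as `tailSort`,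
  -- the inverse blocks and `headSort`, in this order.
  have key : headSort P m l * (tailSort P m l * ∑ I ∈ l.toFinset.powerset,
      (blockCoeff P l I)⁻¹ • (prI K l I * Y' I)) = 1 := by
    rw [← sum_prI (m := m) (K := K) l, Finset.mul_sum, Finset.mul_sum]
    refine Finset.sum_congr rfl fun I _ => ?_
    rw [mul_smul_comm, mul_smul_comm]
    simp only [← mul_assoc]
    rw [eY, smul_mul_assoc, smul_smul, inv_mul_cancel₀ (blockCoeff_ne_zero I), one_smul,
      mul_assoc, ← (cY I).eq, ← mul_assoc, eY1, one_mul]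
  rw [← mul_eq_one_comm.mp key, Finset.mul_sum, Finset.sum_mul]
  refine Finset.sum_congr rfl fun I _ => ?_
  rw [mul_smul_comm, smul_mul_assoc]
  congr 1
  calc _ = (tailSort P m l * prI K l I) * (Y' I * headSort P m l) := by simp only [mul_assoc]
    _ = G I * (prI K l I * Y' I) * headSort P m l := by rw [eG]; simp only [mul_assoc]
    _ = G I * Y' I * (prI K l I * headSort P m l) := by rw [← (cY I).eq]; simp only [mul_assoc]
    _ = G I * (Y' I * prI K l I) * H I := by rw [eH]; simp only [mul_assoc]
    _ = _ := by rw [(cY I).eq]; simp only [mul_assoc]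

end Resolution

end

end QLoop

namespace QLoop

noncomputable section

set_option linter.unusedSectionVars false

/-! ### RLL relations -/

section RLLClosure

variable {K : Type*} [Field K] {N : ℕ} {A : Type*} [Ring A] [Algebra K A]
  {B : Type*} [Ring B] [Algebra K B]

lemma RM_smul_sum_right (Q u v : K) (a b : Fin N) (F : Fin N → Fin N → A) :
    ∑ e, ∑ f, RM N Q u v (a, b) (e, f) • F e f
      = wR Q u v a b • F a b + gR Q u v a b • F b a := by
  simp only [RM, Matrix.of_apply, add_smul, Finset.sum_add_distrib, dl, mul_ite, mul_one, mul_zero,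
    ite_smul, zero_smul]
  congr 1
  · rw [Finset.sum_eq_single a (fun e _ he => Finset.sum_eq_zero fun f _ => by simp [he.symm])
      (by simp), Finset.sum_eq_single b (fun f _ hf => by simp [hf.symm]) (by simp)]
    simp
  · rw [Finset.sum_eq_single b (fun e _ he => Finset.sum_eq_zero fun f _ => by simp [he.symm])
      (by simp), Finset.sum_eq_single a (fun f _ hf => by simp [hf.symm]) (by simp)]
    simp

lemma RM_smul_sum_left (Q u v : K) (a b : Fin N) (F : Fin N → Fin N → A) :
    ∑ e, ∑ f, RM N Q u v (e, f) (a, b) • F e f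
      = wR Q u v a b • F a b + gR Q u v b a • F b a := by
  simp only [RM, Matrix.of_apply, add_smul, Finset.sum_add_distrib, dl, mul_ite, mul_one, mul_zero,
    ite_smul, zero_smul]
  congr 1
  · rw [Finset.sum_eq_single a (fun e _ he => Finset.sum_eq_zero fun f _ => by simp [he])
      (by simp), Finset.sum_eq_single b (fun f _ hf => by simp [hf]) (by simp)]
    simp
  · rw [Finset.sum_eq_single b (fun e _ he => Finset.sum_eq_zero fun f _ => by simp [he])
      (by simp), Finset.sum_eq_single a (fun f _ hf => by simp [hf]) (by simp)]
    simp

/-- The RLL relation with spectral parameters `u`, `v`. -/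
def IsRLL (Q u v : K) (M M' : Matrix (Fin N) (Fin N) A) : Prop :=
  rllL (RM N Q u v) M M' = rllR (RM N Q u v) M M'

lemma isRLL_iff {Q u v : K} {M M' : Matrix (Fin N) (Fin N) A} :
    IsRLL Q u v M M' ↔ ∀ a b a' b',
      wR Q u v a b • (M a a' * M' b b') + gR Q u v a b • (M b a' * M' a b')
        = wR Q u v a' b' • (M' b b' * M a a') + gR Q u v b' a' • (M' b a' * M a b') := by
  rw [IsRLL, ← Matrix.ext_iff, Prod.forall]
  refine forall₂_congr fun a b => ?_
  rw [Prod.forall]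
  refine forall₂_congr fun a' b' => ?_
  rw [rllL_apply, rllR_apply, RM_smul_sum_right _ _ _ _ _ fun e f => M e a' * M' f b',
    RM_smul_sum_left _ _ _ _ _ fun e f => M' b f * M a e]

lemma IsRLL.map {Q u v : K} {M M' : Matrix (Fin N) (Fin N) A} (h : IsRLL Q u v M M')
    (φ : A →ₐ[K] B) : IsRLL Q u v (M.map φ) (M'.map φ) := by
  rw [isRLL_iff] at h ⊢
  intro a b a' b'
  have := congrArg φ (h a b a' b')
  simpa using this

lemma IsRLL.smul {Q u v : K} {M M' : Matrix (Fin N) (Fin N) A} (h : IsRLL Q u v M M') (c c' : K) :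
    IsRLL Q u v (c • M) (c' • M') := by
  rw [isRLL_iff] at h ⊢
  intro a b a' b'
  have := congrArg (fun x => (c * c') • x) (h a b a' b')
  simp only [Matrix.smul_apply, smul_mul_smul_comm, smul_add, smul_smul] at this ⊢
  rw [mul_comm c' c]
  simpa only [mul_comm (c * c')] using this

/-- The relation for four indices involves entries with those indices only, and the coefficients of
the R-matrix depend only on equality and order, which `Fin.succ` respects. -/
lemma IsRLL.block {Q u v : K} {M M' : Matrix (Fin (N + 1)) (Fin (N + 1)) A}
    (h : IsRLL Q u v M M') :
    IsRLL Q u v (M.submatrix Fin.succ Fin.succ) (M'.submatrix Fin.succ Fin.succ) := by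
  rw [isRLL_iff] at h ⊢
  intro a b a' b'
  have := h a.succ b.succ a'.succ b'.succ
  simpa [wR, gR] using this

/-- The mechanism of the coproduct: commuting entries let the two RLL relations be used one after
the other. It serves here to dress `L`-operators by R-matrices. -/
lemma IsRLL.mul {Q u v : K} {M M' X X' : Matrix (Fin N) (Fin N) A} (h : IsRLL Q u v M M')
    (h' : IsRLL Q u v X X') (c1 : ∀ a b c d, Commute (X a b) (M' c d))
    (c2 : ∀ a b c d, Commute (M a b) (X' c d)) :
    IsRLL Q u v (M * X) (M' * X') := by
  unfold IsRLL rllL rllR at *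
  have k1 := kron_commute X M' c1
  have k2 := kron_commute M X' c2
  rw [mul_kron_one, one_kron_mul]
  set Rm := (RM N Q u v).map (algebraMap K A)
  calc Rm * ((M ⊗ₖ 1) * (X ⊗ₖ 1)) * ((1 ⊗ₖ M') * (1 ⊗ₖ X'))
      = Rm * (M ⊗ₖ 1) * ((X ⊗ₖ 1) * (1 ⊗ₖ M')) * (1 ⊗ₖ X') := by simp only [mul_assoc]
    _ = (Rm * (M ⊗ₖ 1) * (1 ⊗ₖ M')) * (X ⊗ₖ 1) * (1 ⊗ₖ X') := by rw [k1]; simp only [mul_assoc]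
    _ = (1 ⊗ₖ M') * (M ⊗ₖ 1) * (Rm * (X ⊗ₖ 1) * (1 ⊗ₖ X')) := by rw [h]; simp only [mul_assoc]
    _ = (1 ⊗ₖ M') * ((M ⊗ₖ 1) * (1 ⊗ₖ X')) * (X ⊗ₖ 1) * Rm := by rw [h']; simp only [mul_assoc]
    _ = (1 ⊗ₖ M') * (1 ⊗ₖ X') * ((M ⊗ₖ 1) * (X ⊗ₖ 1)) * Rm := by rw [k2]; simp only [mul_assoc]

lemma isRLL_one {Q u v : K} : IsRLL Q u v (1 : Matrix (Fin N) (Fin N) A) 1 := by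
  unfold IsRLL rllL rllR
  simp

end RLLClosure

/-! ### Nested Bethe vectors -/

section BetheVector

variable {Λ : Type} [Fintype Λ] [DecidableEq Λ] {K : Type*} [Field K] (P : Par Λ K) {N n : ℕ}
  {A : Type*} [Ring A] [Algebra K A] {B : Type*} [Ring B] [Algebra K B]

/-- Elements of an algebra as scalar matrices. -/
def diagHom (K A J : Type*) [Field K] [Ring A] [Algebra K A] [Fintype J] [DecidableEq J] :
    A →ₐ[K] Matrix J J A :=
  { Matrix.scalar J with
    commutes' := fun r => by
      ext
      simp [Matrix.algebraMap_matrix_apply, Matrix.diagonal_apply] }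

lemma diagHom_apply {J : Type*} [Fintype J] [DecidableEq J] (a : A) :
    diagHom K A J a = Matrix.diagonal fun _ => a := rfl

lemma diagHom_mul_apply {J : Type*} [Fintype J] [DecidableEq J] (a : A) (X : Matrix J J A)
    (i j : J) : (diagHom K A J a * X) i j = a * X i j := by
  rw [diagHom_apply, Matrix.diagonal_mul]

lemma mul_diagHom_apply {J : Type*} [Fintype J] [DecidableEq J] (a : A) (X : Matrix J J A)
    (i j : J) : (X * diagHom K A J a) i j = X i j * a := by
  rw [diagHom_apply, Matrix.mul_diagonal]

lemma diagHom_commute {J : Type*} [Fintype J] [DecidableEq J] {a : A} {X : Matrix J J A}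
    (h : ∀ i j, Commute a (X i j)) : Commute (diagHom K A J a) X := by
  refine Matrix.ext fun i j => ?_
  rw [diagHom_mul_apply, mul_diagHom_apply, (h i j).eq]

/-- Scalar matrices as matrices over an algebra. -/
def kHom (K A J : Type*) [Field K] [Ring A] [Algebra K A] [Fintype J] [DecidableEq J] :
    Matrix J J K →ₐ[K] Matrix J J A :=
  (Algebra.ofId K A).mapMatrix

lemma kHom_eq {J : Type*} [Fintype J] [DecidableEq J] (X : Matrix J J K) :
    kHom K A J X = kMap A X := rfl

lemma kHom_apply {J : Type*} [Fintype J] [DecidableEq J] (X : Matrix J J K) (i j : J) :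
    kHom K A J X i j = algebraMap K A (X i j) := rfl

lemma diagHom_commute_kHom {J : Type*} [Fintype J] [DecidableEq J] (a : A) (X : Matrix J J K) :
    Commute (diagHom K A J a) (kHom K A J X) :=
  diagHom_commute fun _ _ => (Algebra.commutes _ _).symm

/-- The homomorphism `M ↦ M^{(p)}`. -/
def legHom (A : Type*) [Ring A] [Algebra K A] (p : Λ) :
    Matrix (Fin N) (Fin N) A →ₐ[K] Matrix (Λ → Fin N) (Λ → Fin N) A where
  toFun M := leg p M
  map_one' := leg_one p
  map_mul' := leg_mul p
  map_zero' := by ext; simp [leg]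
  map_add' M M' := by simp only [leg_eq, embMat_add]
  commutes' r := by
    rw [Algebra.algebraMap_eq_smul_one, leg_eq, embMat_smul, embMat_one,
      Algebra.algebraMap_eq_smul_one]

/-- The normalized R-matrix of the auxiliary parameter of `p` and of the tensor factor `i`. -/
def auxR (N : ℕ) (p i : Λ) : Matrix (Fin N) (Fin N) (Matrix (Λ → Fin N) (Λ → Fin N) K) :=
  (P.x p - P.x i)⁻¹ • (Laux N P.Q (P.x p) (P.x i)).map (legHom (K := K) K i)

/-- The product of the matrices `auxR` over the tensor factors from a list. -/
def chainR (N : ℕ) (p : Λ) : List Λ → Matrix (Fin N) (Fin N) (Matrix (Λ → Fin N) (Λ → Fin N) K)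
  | [] => 1
  | i :: l => chainR N p l * auxR P N p i

/-- The first row of `L`, without its first entry. -/
def headB (L : Λ → Matrix (Fin (n + 2)) (Fin (n + 2)) A) (p : Λ) :
    Matrix (Fin (n + 1)) (Fin (n + 1)) A :=
  Matrix.of fun a b => if a = 0 then L p 0 b.succ else 0

/-- The lower right block of `L`. -/
def blockD (L : Λ → Matrix (Fin (n + 2)) (Fin (n + 2)) A) (p : Λ) :
    Matrix (Fin (n + 1)) (Fin (n + 1)) A := (L p).submatrix Fin.succ Fin.succ

/-- The `L`-matrix of the next nesting level, dressed by the tensor factors from the list `l`. -/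
def dressD (l : List Λ) (D : Λ → Matrix (Fin N) (Fin N) A) (p : Λ) :
    Matrix (Fin N) (Fin N) (Matrix (Λ → Fin N) (Λ → Fin N) A) :=
  (D p).map (diagHom K A (Λ → Fin N)) * (chainR P N p l).map (kHom K A (Λ → Fin N))

end BetheVector

/-! ### Nested Bethe vectors and linear maps intertwining their `L`-matrices -/

section BV

universe u

variable {Λ : Type} [Fintype Λ] [DecidableEq Λ] {K : Type*} [Field K] (P : Par Λ K)

/-- The nested Bethe vector. -/
def BV : (n : ℕ) → {A : Type u} → [Ring A] → [Algebra K A] → (Fin n → List Λ) →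
    (Λ → Matrix (Fin (n + 1)) (Fin (n + 1)) A) → A
  | 0, _, _, _, _, _ => 1
  | n + 1, _, _, _, ls, L =>
    (legProd (headB L) (ls 0) * BV n (fun a => ls a.succ) (dressD P (ls 0) (blockD L))) 0 0

variable {P} {A B : Type u} [Ring A] [Algebra K A] [Ring B] [Algebra K B] {n N : ℕ}

lemma dressD_mul_apply (l : List Λ) (D : Λ → Matrix (Fin N) (Fin N) A) (p : Λ) (a b : Fin N)
    (w : Matrix (Λ → Fin N) (Λ → Fin N) A) (f g : Λ → Fin N) :
    (dressD P l D p a b * w) f g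
      = ∑ c, ∑ h, chainR P N p l c b f h • (D p a c * w h g) := by
  have e : dressD P l D p a b = ∑ c, diagHom K A (Λ → Fin N) (D p a c)
      * kHom K A (Λ → Fin N) (chainR P N p l c b) := by rw [dressD, Matrix.mul_apply]; rfl
  rw [e, Finset.sum_mul, Matrix.sum_apply]
  refine Finset.sum_congr rfl fun c _ => ?_
  rw [mul_assoc, diagHom_mul_apply, Matrix.mul_apply, Finset.mul_sum]
  refine Finset.sum_congr rfl fun h _ => ?_
  rw [kHom_apply, ← Algebra.smul_def, mul_smul_comm]

/-- Matrices with entries in a submodule. -/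
def matSub {J : Type*} (W : Submodule K A) : Submodule K (Matrix J J A) where
  carrier := {M | ∀ i j, M i j ∈ W}
  add_mem' h h' i j := W.add_mem (h i j) (h' i j)
  zero_mem' _ _ := W.zero_mem
  smul_mem' c _ h i j := W.smul_mem c (h i j)

/-- `T` intertwines `L` and `L'` on the subspaces `W S`, where applying `L p` to `W S` removes the
label `p` from `S`. -/
def Intertwines (T : A →ₗ[K] B) (W : Set Λ → Submodule K A) (U : Set Λ)
    (L : Λ → Matrix (Fin N) (Fin N) A) (L' : Λ → Matrix (Fin N) (Fin N) B) : Prop :=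
  ∀ (S : Set Λ), ∀ p ∈ U, p ∉ S → ∀ w ∈ W (insert p S), ∀ a b,
    L p a b * w ∈ W S ∧ T (L p a b * w) = L' p a b * T w

lemma Intertwines.block {T : A →ₗ[K] B} {W : Set Λ → Submodule K A} {U : Set Λ}
    {L : Λ → Matrix (Fin (n + 2)) (Fin (n + 2)) A} {L' : Λ → Matrix (Fin (n + 2)) (Fin (n + 2)) B}
    (h : Intertwines T W U L L') : Intertwines T W U (blockD L) (blockD L') :=
  fun S p hp hpS w hw a b => h S p hp hpS w hw a.succ b.succ

lemma Intertwines.headB {T : A →ₗ[K] B} {W : Set Λ → Submodule K A} {U : Set Λ}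
    {L : Λ → Matrix (Fin (n + 2)) (Fin (n + 2)) A} {L' : Λ → Matrix (Fin (n + 2)) (Fin (n + 2)) B}
    (h : Intertwines T W U L L') : Intertwines T W U (headB L) (headB L') := by
  intro S p hp hpS w hw a b
  simp only [QLoop.headB, Matrix.of_apply]
  split_ifs
  · exact h S p hp hpS w hw 0 b.succ
  · simp

/-- An entry of the dressed matrix is a `K`-linear combination of entries of `D p`, and a linear map
respects it entrywise. -/
lemma Intertwines.dressD {T : A →ₗ[K] B} {W : Set Λ → Submodule K A} {U : Set Λ}
    {D : Λ → Matrix (Fin N) (Fin N) A} {D' : Λ → Matrix (Fin N) (Fin N) B}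
    (h : Intertwines T W U D D') (l : List Λ) :
    Intertwines T.mapMatrix (fun S => matSub (W S)) U (dressD P l D) (dressD P l D') := by
  intro S p hp hpS w hw a b
  refine ⟨fun f g => ?_, Matrix.ext fun f g => ?_⟩
  · rw [dressD_mul_apply]
    exact Submodule.sum_mem _ fun c _ => Submodule.sum_mem _ fun k _ =>
      Submodule.smul_mem _ _ (h S p hp hpS _ (hw k g) a c).1
  · rw [LinearMap.mapMatrix_apply, Matrix.map_apply, dressD_mul_apply, dressD_mul_apply]
    simp only [map_sum, map_smul]
    refine Finset.sum_congr rfl fun c _ => Finset.sum_congr rfl fun k _ => ?_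
    rw [(h S p hp hpS _ (hw k g) a c).2]
    rfl

lemma Intertwines.leg {T : A →ₗ[K] B} {W : Set Λ → Submodule K A} {U : Set Λ}
    {L : Λ → Matrix (Fin N) (Fin N) A} {L' : Λ → Matrix (Fin N) (Fin N) B}
    (h : Intertwines T W U L L') {S : Set Λ} {p : Λ} (hp : p ∈ U) (hpS : p ∉ S)
    {w : Matrix (Λ → Fin N) (Λ → Fin N) A} (hw : w ∈ matSub (W (insert p S))) :
    leg p (L p) * w ∈ matSub (W S) ∧
      T.mapMatrix (QLoop.leg p (L p) * w) = QLoop.leg p (L' p) * T.mapMatrix w := by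
  refine ⟨fun f g => ?_, Matrix.ext fun f g => ?_⟩
  · rw [leg_mul_apply]
    exact Submodule.sum_mem _ fun c _ => (h S p hp hpS _ (hw _ g) _ _).1
  · rw [LinearMap.mapMatrix_apply, Matrix.map_apply, leg_mul_apply, leg_mul_apply, map_sum]
    refine Finset.sum_congr rfl fun c _ => ?_
    rw [(h S p hp hpS _ (hw _ g) _ _).2]
    rfl

/-- The factors act from right to left, each releasing its own label. Distinctness of the labels is
needed for this count. -/
lemma Intertwines.legProd {T : A →ₗ[K] B} {W : Set Λ → Submodule K A} {U : Set Λ}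
    {L : Λ → Matrix (Fin N) (Fin N) A} {L' : Λ → Matrix (Fin N) (Fin N) B}
    (h : Intertwines T W U L L') {l : List Λ} (hl : l.Nodup) {S : Set Λ} (hlU : ∀ p ∈ l, p ∈ U)
    (hlS : ∀ p ∈ l, p ∉ S)
    {w : Matrix (Λ → Fin N) (Λ → Fin N) A} (hw : w ∈ matSub (W (S ∪ {p | p ∈ l}))) :
    legProd L l * w ∈ matSub (W S) ∧
      T.mapMatrix (QLoop.legProd L l * w) = QLoop.legProd L' l * T.mapMatrix w := by
  induction l generalizing S with
  | nil =>
    simp only [List.not_mem_nil, Set.ofPred_false, Set.union_empty] at hw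
    simpa [QLoop.legProd] using hw
  | cons p l ih =>
    obtain ⟨hp, hl⟩ := List.nodup_cons.mp hl
    have hset : S ∪ {r | r ∈ p :: l} = insert p S ∪ {r | r ∈ l} := by
      ext r; simp only [Set.mem_union, Set.mem_ofPred_eq, List.mem_cons, Set.mem_insert_iff]; tauto
    rw [hset] at hw
    have h1 := ih hl (S := insert p S) (fun r hr => hlU r (by simp [hr]))
      (fun r hr => by
        rw [Set.mem_insert_iff, not_or]
        exact ⟨fun e => hp (e ▸ hr), hlS r (by simp [hr])⟩) hw
    have h2 := h.leg (hlU p (by simp)) (hlS p (by simp)) h1.1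
    have e : ∀ {C : Type u} [Ring C] (X : Λ → Matrix (Fin N) (Fin N) C),
      QLoop.legProd X (p :: l) = QLoop.leg p (X p) * QLoop.legProd X l := by
      intro C _ X; simp [QLoop.legProd]
    rw [e, e, mul_assoc, mul_assoc, h2.2, h1.2]
    exact ⟨h2.1, rfl⟩

/-- The labels occurring in a family of lists are distinct. -/
structure Distinct {n : ℕ} (ls : Fin n → List Λ) : Prop where
  nodup : ∀ a, (ls a).Nodup
  disjoint : ∀ a b, a ≠ b → ∀ p ∈ ls a, p ∉ ls b

lemma Distinct.tail {ls : Fin (n + 1) → List Λ} (h : Distinct ls) :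
    Distinct fun a : Fin n => ls a.succ :=
  ⟨fun a => h.nodup _, fun a b hab => h.disjoint _ _ (by simpa using hab)⟩

lemma mul_single_apply {J : Type*} [Fintype J] [DecidableEq J] (X : Matrix J J A) (i j : J)
    (w : A) (f : J) : (X * Matrix.single i j w) f j = X f i * w := by
  simp [Matrix.mul_apply, Matrix.single_apply]

/-- Taking a row, passing to the block, dressing and multiplying in tensor factors all respect
intertwiners, and every label is used exactly once. The dependence of the subspace on the labels
still to be applied is what permits relations, such as those moving the first column, that require
distinct spectral parameters. -/
lemma BV_intertwine {T : A →ₗ[K] B} {W : Set Λ → Submodule K A} {U : Set Λ}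
    {L : Λ → Matrix (Fin (n + 1)) (Fin (n + 1)) A} {L' : Λ → Matrix (Fin (n + 1)) (Fin (n + 1)) B}
    (h : Intertwines T W U L L') {ls : Fin n → List Λ} (hls : Distinct ls) {S : Set Λ}
    (hU : ∀ a, ∀ p ∈ ls a, p ∈ U) (hS : ∀ a, ∀ p ∈ ls a, p ∉ S) {w : A}
    (hw : w ∈ W (S ∪ {p | ∃ a, p ∈ ls a})) :
    BV P n ls L * w ∈ W S ∧ T (BV P n ls L * w) = BV P n ls L' * T w := by
  induction n generalizing A B S with
  | zero =>
    simp only [IsEmpty.exists_iff, Set.ofPred_false, Set.union_empty] at hw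
    simpa [BV] using hw
  | succ n ih =>
    have hset : S ∪ {p | ∃ a, p ∈ ls a} = (S ∪ {p | p ∈ ls 0}) ∪ {p | ∃ a : Fin n, p ∈ ls a.succ} := by
      ext p; simp only [Set.mem_union, Set.mem_ofPred_eq, Fin.exists_fin_succ, or_assoc]
    rw [hset] at hw
    -- The vector of the next level: multiplying by it on the right and taking the corner entry
    -- multiplies the corner entry by `w`.
    set v : Matrix (Λ → Fin (n + 1)) (Λ → Fin (n + 1)) A := Matrix.single 0 0 w with hv
    have hv' : v ∈ matSub (W ((S ∪ {p | p ∈ ls 0}) ∪ {p | ∃ a : Fin n, p ∈ ls a.succ})) := by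
      intro i j
      rw [hv, Matrix.single_apply]
      split_ifs
      · exact hw
      · exact Submodule.zero_mem _
    have h1 := ih (h.block.dressD (P := P) (ls 0)) hls.tail (S := S ∪ {p | p ∈ ls 0})
      (fun a p hp => hU a.succ p hp) (fun a p hp => by
        rw [Set.mem_union, not_or]
        exact ⟨hS _ p hp, hls.disjoint _ _ (Fin.succ_ne_zero a) p hp⟩) hv'
    have h2 := h.headB.legProd (hls.nodup 0) (hU 0) (hS 0) h1.1
    have e : ∀ {C : Type u} [Ring C] [Algebra K C]
        (M : Λ → Matrix (Fin (n + 1 + 1)) (Fin (n + 1 + 1)) C) (w : C), BV P (n + 1) ls M * w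
        = (QLoop.legProd (QLoop.headB M) (ls 0) * (BV P n (fun a => ls a.succ)
          (QLoop.dressD P (ls 0) (blockD M)) * Matrix.single 0 0 w) :
            Matrix (Λ → Fin (n + 1)) (Λ → Fin (n + 1)) C) 0 0 := by
      intro C _ _ M w
      rw [← mul_assoc, mul_single_apply, BV]
    have hT : T.mapMatrix v = Matrix.single 0 0 (T w) := by
      rw [hv, LinearMap.mapMatrix_apply, Matrix.map_single]
    rw [e, e, ← hv, ← hT]
    refine ⟨h2.1 0 0, ?_⟩
    rw [← h1.2, ← h2.2]
    rfl

end BV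

end

end QLoop

namespace QLoop

noncomputable section

set_option linter.unusedSectionVars false

/-! ### RLL relations for dressed matrices and the action of exchange matrices -/

section Dressing

universe u

variable {Λ : Type} [Fintype Λ] [DecidableEq Λ] {K : Type*} [Field K] {P : Par Λ K} {N n : ℕ}
  {A : Type u} [Ring A] [Algebra K A]

lemma auxR_apply (p i : Λ) (a b : Fin N) : auxR P N p i a b
    = (P.x p - P.x i)⁻¹ • leg i (Laux N P.Q (P.x p) (P.x i) a b) := rfl

lemma isRLL_auxR (p p' i : Λ) :
    IsRLL P.Q (P.x p) (P.x p') (auxR P N p i) (auxR P N p' i) := by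
  have h : IsRLL P.Q (P.x p) (P.x p') (Laux N P.Q (P.x p) (P.x i)) (Laux N P.Q (P.x p') (P.x i)) :=
    rll_Laux P.Q_ne_zero _ _ _
  exact (h.map (legHom (K := K) K i)).smul _ _

lemma commute_auxR_leg {i j : Λ} (hij : i ≠ j) (p : Λ) (a b : Fin N)
    (M : Matrix (Fin N) (Fin N) A) :
    Commute (kHom K A (Λ → Fin N) (auxR P N p i a b)) (leg j M) := by
  rw [auxR_apply, map_smul]
  refine Commute.smul_left ?_ _
  rw [kHom_eq, kMap, leg_map _ (map_zero _)]
  exact leg_commute_leg hij _ _ fun _ _ _ _ => Algebra.commutes _ _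

lemma commute_chainR_leg {l : List Λ} {j : Λ} (hj : j ∉ l) (p : Λ) (a b : Fin N)
    (M : Matrix (Fin N) (Fin N) A) :
    Commute (kHom K A (Λ → Fin N) (chainR P N p l a b)) (leg j M) := by
  induction l generalizing a b with
  | nil =>
    rw [chainR, Matrix.one_apply]
    split_ifs <;> simp
  | cons i l ih =>
    simp only [List.mem_cons, not_or] at hj
    rw [chainR, Matrix.mul_apply, map_sum]
    refine Commute.sum_left _ _ _ fun c _ => ?_
    rw [map_mul]
    exact (ih hj.2 a c).mul_left (commute_auxR_leg (Ne.symm hj.1) p c b M)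

lemma commute_chainR_auxR {l : List Λ} {j : Λ} (hj : j ∉ l) (p p' : Λ) (a b c d : Fin N) :
    Commute (chainR P N p l a b) (auxR P N p' j c d) := by
  rw [auxR_apply]
  refine Commute.smul_right ?_ _
  have := commute_chainR_leg (P := P) hj p a b (Laux N P.Q (P.x p') (P.x j) c d)
  rwa [kHom_eq, kMap, Algebra.algebraMap_self, RingHom.coe_id, Matrix.map_id] at this

lemma commute_chainR_chainR {l l' : List Λ} (h : ∀ j ∈ l', j ∉ l) (p p' : Λ) (a b c d : Fin N) :
    Commute (chainR P N p l a b) (chainR P N p' l' c d) := by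
  induction l' generalizing c d with
  | nil =>
    rw [chainR, Matrix.one_apply]
    split_ifs <;> simp
  | cons i l' ih =>
    rw [chainR, Matrix.mul_apply]
    refine Commute.sum_right _ _ _ fun e _ => ?_
    exact (ih (fun j hj => h j (by simp [hj])) c e).mul_right
      (commute_chainR_auxR (h i (by simp)) p p' a b e d)

/-- A product of R-matrices in different tensor factors is a product of `L`-operators with commuting
entries, so `IsRLL.mul` applies repeatedly. -/
lemma isRLL_chainR (p p' : Λ) {l : List Λ} (hl : l.Nodup) :
    IsRLL P.Q (P.x p) (P.x p') (chainR P N p l) (chainR P N p' l) := by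
  induction l with
  | nil => exact isRLL_one
  | cons i l ih =>
    obtain ⟨hi, hl⟩ := List.nodup_cons.mp hl
    exact (ih hl).mul (isRLL_auxR p p' i) (fun a b c d => (commute_chainR_auxR hi p' p c d a b).symm)
      fun a b c d => commute_chainR_auxR hi p p' a b c d

lemma chainR_append (p : Λ) (l l' : List Λ) :
    chainR P N p (l ++ l') = chainR P N p l' * chainR P N p l := by
  induction l with
  | nil => simp [chainR]
  | cons i l ih => rw [List.cons_append, chainR, ih, chainR, mul_assoc]

lemma isRLL_dressD {D : Λ → Matrix (Fin N) (Fin N) A} {p p' : Λ}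
    (h : IsRLL P.Q (P.x p) (P.x p') (D p) (D p')) {l : List Λ} (hl : l.Nodup) :
    IsRLL P.Q (P.x p) (P.x p') (dressD P l D p) (dressD P l D p') := by
  refine (h.map _).mul ((isRLL_chainR p p' hl).map _) (fun a b c d => ?_) fun a b c d => ?_
  · exact (diagHom_commute_kHom _ _).symm
  · exact diagHom_commute_kHom _ _

lemma leg_rll {i j : Λ} (hij : i ≠ j) {M M' : Matrix (Fin N) (Fin N) A}
    (h : IsRLL P.Q (P.x i) (P.x j) M M') :
    kMap A (Rhat P N i j) * (leg i M * leg j M') = leg j M' * leg i M * kMap A (Rhat P N i j) := by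
  have e : kMap A (Rhat P N i j) = algebraMap K _ (P.Q * P.x i - P.Q⁻¹ * P.x j)⁻¹ *
      leg₂ i j ((RM N P.Q (P.x i) (P.x j)).map (algebraMap K A)) := by
    rw [← leg₂_map _ (map_zero _), ← Algebra.smul_def]
    refine Matrix.ext fun f g => ?_
    change algebraMap K A ((P.Q * P.x i - P.Q⁻¹ * P.x j)⁻¹ * leg₂ i j (RM N P.Q (P.x i) (P.x j)) f g)
      = (P.Q * P.x i - P.Q⁻¹ * P.x j)⁻¹ • algebraMap K A (leg₂ i j (RM N P.Q (P.x i) (P.x j)) f g)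
    rw [map_mul, Algebra.smul_def]
  have h' : leg₂ i j ((RM N P.Q (P.x i) (P.x j)).map (algebraMap K A)) * (leg i M * leg j M')
      = leg j M' * leg i M * leg₂ i j ((RM N P.Q (P.x i) (P.x j)).map (algebraMap K A)) := by
    rw [leg_eq_leg₂_left hij M, leg_eq_leg₂_right hij M', ← leg₂_mul hij, ← leg₂_mul hij,
      ← leg₂_mul hij, ← leg₂_mul hij, ← mul_assoc]
    exact congrArg _ h
  rw [e, mul_assoc, h', ← mul_assoc, Algebra.commutes, mul_assoc]

lemma legProd_append (L : Λ → Matrix (Fin N) (Fin N) A) (l l' : List Λ) :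
    legProd L (l ++ l') = legProd L l * legProd L l' := by
  simp [legProd]

lemma legProd_cons (L : Λ → Matrix (Fin N) (Fin N) A) (p : Λ) (l : List Λ) :
    legProd L (p :: l) = leg p (L p) * legProd L l := by
  simp [legProd]

/-- The RLL relations for the labels from `U`. -/
def RLL (P : Par Λ K) (U : Set Λ) (L : Λ → Matrix (Fin N) (Fin N) A) : Prop :=
  ∀ p ∈ U, ∀ p' ∈ U, p ≠ p' → IsRLL P.Q (P.x p) (P.x p') (L p) (L p')

lemma RLL.block {U : Set Λ} {L : Λ → Matrix (Fin (n + 2)) (Fin (n + 2)) A} (h : RLL P U L) :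
    RLL P U (blockD L) := fun p hp p' hp' hne => (h p hp p' hp' hne).block

lemma RLL.dress {U : Set Λ} {L : Λ → Matrix (Fin N) (Fin N) A} (h : RLL P U L)
    {l : List Λ} (hl : l.Nodup) :
    RLL P U (dressD P l L) := fun p hp p' hp' hne => isRLL_dressD (h p hp p' hp' hne) hl

lemma IsLocal.commute_legProd {l l' : List Λ} {X : Matrix (Λ → Fin N) (Λ → Fin N) K}
    (hX : IsLocal l X) (h : ∀ i ∈ l', i ∉ l) (L : Λ → Matrix (Fin N) (Fin N) A) :
    Commute (kMap A X) (legProd L l') := by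
  induction l' with
  | nil => exact Commute.one_right _
  | cons i l' ih =>
    rw [legProd_cons]
    exact (hX.commute_leg (h i (by simp)) _).mul_right (ih fun j hj => h j (by simp [hj]))

/-- The reason for introducing `Exch`: an elementary swap is the RLL relation of two neighbouring
factors, and the R-matrix passes all other factors, with which it shares no label. -/
lemma Exch.legProd {l l' : List Λ} {X : Matrix (Λ → Fin N) (Λ → Fin N) K} (h : Exch P N l l' X)
    (hl : l.Nodup) {U : Set Λ} (hU : ∀ p ∈ l, p ∈ U) {L : Λ → Matrix (Fin N) (Fin N) A}
    (hL : RLL P U L) :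
    kMap A X * legProd L l = QLoop.legProd L l' * kMap A X := by
  induction h with
  | refl l => rw [← kHom_eq, map_one, one_mul, mul_one]
  | swap l l' i j =>
    have hij := nodup_swap_ne hl
    have hij' : IsLocal [i, j] (Rhat P N i j) := isLocal_Rhat P hij (by simp) (by simp)
    rw [List.nodup_append] at hl
    obtain ⟨h1, h2, h3⟩ := hl
    have c1 := hij'.commute_legProd (l' := l) (by
      intro k hk hk'
      simp only [List.mem_cons, List.not_mem_nil, or_false] at hk'
      rcases hk' with rfl | rfl
      · exact h3 k hk k (by simp) rfl
      · exact h3 k hk k (by simp) rfl) L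
    have c2 := hij'.commute_legProd (l' := l') (by
      intro k hk hk'
      simp only [List.mem_cons, List.not_mem_nil, or_false] at hk'
      simp only [List.nodup_cons, List.mem_cons, not_or] at h2
      rcases hk' with rfl | rfl
      · exact h2.1.2 hk
      · exact h2.2.1 hk) L
    have e := leg_rll hij (hL i (hU i (by simp)) j (hU j (by simp)) hij)
    rw [legProd_append, legProd_append, legProd_cons, legProd_cons, legProd_cons, legProd_cons]
    calc _ = (kMap A (Rhat P N i j) * QLoop.legProd L l) * (leg i (L i) * leg j (L j))
          * QLoop.legProd L l' := by simp only [mul_assoc]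
      _ = QLoop.legProd L l * (kMap A (Rhat P N i j) * (leg i (L i) * leg j (L j)))
          * QLoop.legProd L l' := by rw [c1.eq]; simp only [mul_assoc]
      _ = QLoop.legProd L l * (leg j (L j) * leg i (L i)) * (kMap A (Rhat P N i j)
          * QLoop.legProd L l') := by rw [e]; simp only [mul_assoc]
      _ = _ := by rw [c2.eq]; simp only [mul_assoc]
  | @trans l l' l'' X Y hX hY h h' =>
    rw [← kHom_eq, map_mul, kHom_eq, kHom_eq, mul_assoc, h hl hU, ← mul_assoc,
      h' (hX.perm.nodup_iff.mp hl) (fun p hp => hU p (hX.perm.symm.subset hp)), mul_assoc]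

/-! ### Exchange matrices on special vectors -/

lemma Rhat_apply_const {i j : Λ} (hij : i ≠ j) {f : Λ → Fin N} (hf : f i = f j) :
    Rhat P N i j f f = 1 := by
  have h : Rhat P N i j f f
      = (P.Q * P.x i - P.Q⁻¹ * P.x j)⁻¹ * wR P.Q (P.x i) (P.x j) (f i) (f j) := by
    simp only [Rhat, Matrix.smul_apply, leg₂, Matrix.of_apply, RM, smul_eq_mul]
    rw [if_pos (fun _ _ _ => trivial)]
    simp [dl, hf, gR]
  rw [h, wR, if_pos hf, inv_mul_cancel₀ (P.Qx_ne i j hij)]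

/-- A normalized R-matrix acts as the identity on a pair of equal indices, from either side. This is
how exchange matrices disappear next to the first row and next to the corner vector. -/
lemma Exch.const_apply {l l' : List Λ} {X : Matrix (Λ → Fin N) (Λ → Fin N) K}
    (h : Exch P N l l' X) (hl : l.Nodup) {f : Λ → Fin N} (hf : ∀ i ∈ l, ∀ j ∈ l, f i = f j)
    (g : Λ → Fin N) : X f g = (1 : Matrix (Λ → Fin N) (Λ → Fin N) K) f g ∧
      X g f = (1 : Matrix (Λ → Fin N) (Λ → Fin N) K) g f := by
  induction h generalizing g with
  | refl l => exact ⟨rfl, rfl⟩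
  | swap l l' i j =>
    have hij := nodup_swap_ne hl
    have hfij : f i = f j := hf i (by simp) j (by simp)
    have hsw : f ∘ Equiv.swap i j = f := ((swap_eq_iff f).mpr hfij).symm
    constructor
    · by_cases hfg : f = g
      · subst hfg; rw [Rhat_apply_const hij hfij, Matrix.one_apply_eq]
      · rw [Matrix.one_apply_ne hfg]
        by_contra h0
        rcases Rhat_apply_ne_zero P hij h0 with rfl | rfl
        · exact hfg rfl
        · exact hfg hsw.symm
    · by_cases hfg : g = f
      · subst hfg; rw [Rhat_apply_const hij hfij, Matrix.one_apply_eq]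
      · rw [Matrix.one_apply_ne hfg]
        by_contra h0
        rcases Rhat_apply_ne_zero P hij h0 with rfl | h1
        · exact hfg rfl
        · apply hfg
          have : g = f ∘ Equiv.swap i j := by
            rw [h1, Function.comp_assoc]; simp [← Equiv.coe_trans]
          rw [this, hsw]
  | @trans l l' l'' X Y hX hY h h' =>
    have h2 := h' (hX.perm.nodup_iff.mp hl) (fun i hi j hj =>
      hf i (hX.perm.symm.subset hi) j (hX.perm.symm.subset hj))
    have h1 := h hl hf
    constructor
    · rw [Matrix.mul_apply]
      simp only [(h2 _).1]
      rw [← Matrix.mul_apply, one_mul, (h1 g).1]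
    · rw [Matrix.mul_apply]
      simp only [(h1 _).2]
      rw [← Matrix.mul_apply, mul_one, (h2 g).2]

/-- R-matrices only permute indices, so they preserve the span of the vectors without the first
index. There they act as the R-matrices of rank one less, since the coefficients see only the order
of the indices. -/
lemma Exch.restrict {l l' : List Λ}
    {X : Matrix (Λ → Fin (n + 2)) (Λ → Fin (n + 2)) K} (h : Exch P (n + 2) l l' X)
    (hl : l.Nodup) :
    Exch P (n + 1) l l' (X.submatrix (Fin.succ ∘ ·) (Fin.succ ∘ ·)) ∧
      ∀ f g, (¬ ∃ f' : Λ → Fin (n + 1), f = Fin.succ ∘ f') → X f (Fin.succ ∘ g) = 0 := by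
  have sinj : ∀ f g : Λ → Fin (n + 1), Fin.succ ∘ f = Fin.succ ∘ g ↔ f = g := fun f g =>
    (Fin.succ_injective _).comp_left.eq_iff
  induction h with
  | refl l =>
    refine ⟨?_, fun f g hf => Matrix.one_apply_ne fun h => hf ⟨g, h⟩⟩
    have : (1 : Matrix (Λ → Fin (n + 2)) (Λ → Fin (n + 2)) K).submatrix
        (fun f : Λ → Fin (n + 1) => Fin.succ ∘ f) (Fin.succ ∘ ·) = 1 :=
      Matrix.submatrix_one _ (Fin.succ_injective _).comp_left
    rw [this]; exact .refl l
  | swap l l' i j =>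
    have hij := nodup_swap_ne hl
    constructor
    · have : (Rhat P (n + 2) i j).submatrix (fun f : Λ → Fin (n + 1) => Fin.succ ∘ f)
          (Fin.succ ∘ ·) = Rhat P (n + 1) i j := by
        ext f g
        simp [Rhat, leg₂, RM, wR, gR, dl]
      rw [this]; exact .swap l l' i j
    · intro f g hf
      by_contra h0
      rcases Rhat_apply_ne_zero P hij h0 with h1 | h1
      · exact hf ⟨g, h1.symm⟩
      · refine hf ⟨g ∘ Equiv.swap i j, ?_⟩
        rw [← Function.comp_assoc, h1, Function.comp_assoc]; simp [← Equiv.coe_trans]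
  | @trans l l' l'' X Y hX hY h h' =>
    have h2 := h' (hX.perm.nodup_iff.mp hl)
    have h1 := h hl
    constructor
    · have : (Y * X).submatrix (fun f : Λ → Fin (n + 1) => Fin.succ ∘ f) (Fin.succ ∘ ·)
          = Y.submatrix (fun f : Λ → Fin (n + 1) => Fin.succ ∘ f) (Fin.succ ∘ ·)
            * X.submatrix (fun f : Λ → Fin (n + 1) => Fin.succ ∘ f) (Fin.succ ∘ ·) := by
        ext f g
        rw [Matrix.submatrix_apply, Matrix.mul_apply, Matrix.mul_apply]
        symm
        refine Fintype.sum_of_injective (fun f : Λ → Fin (n + 1) => Fin.succ ∘ f)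
          (Fin.succ_injective _).comp_left _ _ (fun k hk => ?_) fun k => rfl
        rw [h1.2 k g (fun ⟨f', hf'⟩ => hk ⟨f', hf'.symm⟩), mul_zero]
      rw [this]
      exact h1.1.trans h2.1
    · intro f g hf
      rw [Matrix.mul_apply]
      refine Finset.sum_eq_zero fun k _ => ?_
      by_cases hk : ∃ f' : Λ → Fin (n + 1), k = Fin.succ ∘ f'
      · obtain ⟨k', rfl⟩ := hk
        rw [h2.2 f k' hf, zero_mul]
      · rw [h1.2 k g hk, mul_zero]

/-! ### Exchange of the dressing -/

/-- A swap of two neighbouring labels is `Laux_exchange`. The normalization of `auxR` by `P.x p -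
P.x i` is the same in both orders and plays no part. -/
lemma Exch.chainR {l l' : List Λ} {X : Matrix (Λ → Fin N) (Λ → Fin N) K} (h : Exch P N l l' X)
    (hl : l.Nodup) (p : Λ) :
    diagHom K _ (Fin N) X * chainR P N p l = QLoop.chainR P N p l' * diagHom K _ (Fin N) X := by
  induction h with
  | refl l => rw [map_one, one_mul, mul_one]
  | swap l l' i j =>
    have hij := nodup_swap_ne hl
    have hij' : IsLocal [i, j] (Rhat P N i j) := isLocal_Rhat P hij (by simp) (by simp)
    have hc : ∀ k : List Λ, i ∉ k → j ∉ k →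
        Commute (diagHom K _ (Fin N) (Rhat P N i j)) (QLoop.chainR P N p k) := by
      intro k hi hj
      refine diagHom_commute fun a b => ?_
      have h1 : ∀ M, Commute (QLoop.chainR P N p k a b) (leg₂ i j M) := by
        intro M
        induction k generalizing a b with
        | nil => rw [QLoop.chainR, Matrix.one_apply]; split_ifs <;> simp
        | cons r k ih =>
          simp only [List.mem_cons, not_or] at hi hj
          rw [QLoop.chainR, Matrix.mul_apply]
          refine Commute.sum_left _ _ _ fun c _ => (ih hi.2 hj.2 a c).mul_left ?_
          rw [auxR_apply]
          exact (leg_commute_leg₂ hij (Ne.symm hi.1) (Ne.symm hj.1) _ _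
            fun _ _ _ _ => Commute.all _ _).smul_left _
      rw [Rhat_eq]; exact (h1 _).symm
    have e : diagHom K _ (Fin N) (Rhat P N i j) * (auxR P N p j * auxR P N p i)
        = auxR P N p i * auxR P N p j * diagHom K _ (Fin N) (Rhat P N i j) := by
      refine Matrix.ext fun a c => ?_
      rw [diagHom_mul_apply, mul_diagHom_apply, Matrix.mul_apply, Matrix.mul_apply]
      simp only [auxR_apply, smul_mul_smul_comm, ← Finset.smul_sum]
      rw [mul_smul_comm, smul_mul_assoc, mul_comm (P.x p - P.x j)⁻¹]
      congr 1
      have h := Laux_exchange (N := N) P.Q_ne_zero (P.x p) (P.x i) (P.x j) a c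
      have h' := congrArg (leg₂ i j) h
      have hsum : ∀ F : Fin N → Matrix (Fin N × Fin N) (Fin N × Fin N) K,
          leg₂ i j (∑ b, F b) = ∑ b, leg₂ i j (F b) := fun F => by
        simp only [leg₂_eq hij]
        ext f g
        simp only [embMat, Matrix.of_apply, Matrix.sum_apply]
        split_ifs <;> simp
      rw [leg₂_mul hij, leg₂_mul hij, hsum, hsum] at h'
      simp only [leg₂_mul hij, ← leg_eq_leg₂_left hij, ← leg_eq_leg₂_right hij] at h'
      rw [Rhat, smul_mul_assoc, mul_smul_comm, h']
    rw [List.nodup_append] at hl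
    obtain ⟨h1, h2, h3⟩ := hl
    simp only [List.nodup_cons, List.mem_cons, not_or] at h2
    have c1 := hc l (fun hk => h3 i hk i (by simp) rfl) (fun hk => h3 j hk j (by simp) rfl)
    have c2 := hc l' h2.1.2 h2.2.1
    simp only [chainR_append, QLoop.chainR]
    set D := diagHom K _ (Fin N) (Rhat P N i j)
    calc _ = D * QLoop.chainR P N p l' * (auxR P N p j * auxR P N p i) * QLoop.chainR P N p l := by
          simp only [mul_assoc]
      _ = QLoop.chainR P N p l' * (D * (auxR P N p j * auxR P N p i)) * QLoop.chainR P N p l := by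
          rw [c2.eq]; simp only [mul_assoc]
      _ = QLoop.chainR P N p l' * (auxR P N p i * auxR P N p j) * (D * QLoop.chainR P N p l) := by
          rw [e]; simp only [mul_assoc]
      _ = _ := by rw [c1.eq]; simp only [mul_assoc]
  | @trans l l' l'' X Y hX hY h h' =>
    rw [map_mul, mul_assoc, h hl, ← mul_assoc, h' (hX.perm.nodup_iff.mp hl), mul_assoc]

lemma Exch.dressD {l l' : List Λ} {X : Matrix (Λ → Fin N) (Λ → Fin N) K} (h : Exch P N l l' X)
    (hl : l.Nodup) (D : Λ → Matrix (Fin N) (Fin N) A) (p : Λ) (a b : Fin N) :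
    kHom K A _ X * dressD P l D p a b = QLoop.dressD P l' D p a b * kHom K A _ X := by
  have e := fun c => congrFun (congrFun (h.chainR hl p) c) b
  simp only [diagHom_mul_apply, mul_diagHom_apply] at e
  simp only [QLoop.dressD, Matrix.mul_apply, Finset.mul_sum, Finset.sum_mul, Matrix.map_apply]
  refine Finset.sum_congr rfl fun c _ => ?_
  rw [← mul_assoc, ← (diagHom_commute_kHom (D p a c) X).eq, mul_assoc, mul_assoc, ← map_mul, e,
    map_mul]

variable {B : Type u} [Ring B] [Algebra K B]

/-- Left multiplication by `y` is a linear intertwiner without any restriction on the subspace; the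
claim is its effect on `1`. -/
lemma BV_semiconj {U : Set Λ} {L L' : Λ → Matrix (Fin (n + 1)) (Fin (n + 1)) A} {y : A}
    (h : ∀ p ∈ U, ∀ a b, y * L p a b = L' p a b * y) {ls : Fin n → List Λ} (hls : Distinct ls)
    (hU : ∀ a, ∀ p ∈ ls a, p ∈ U) : y * BV P n ls L = BV P n ls L' * y := by
  have h' : Intertwines (LinearMap.mulLeft K y) (fun _ => ⊤) U L L' := fun S p hp _ w _ a b => by
    refine ⟨trivial, ?_⟩
    rw [LinearMap.mulLeft_apply, LinearMap.mulLeft_apply, ← mul_assoc, h p hp, mul_assoc]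
  have := (BV_intertwine (P := P) (S := ∅) h' hls hU (by simp) (w := 1) trivial).2
  simpa using this

lemma BV_commute {U : Set Λ} {L : Λ → Matrix (Fin (n + 1)) (Fin (n + 1)) A} {y : A}
    (h : ∀ p ∈ U, ∀ a b, Commute y (L p a b)) {ls : Fin n → List Λ} (hls : Distinct ls)
    (hU : ∀ a, ∀ p ∈ ls a, p ∈ U) : Commute y (BV P n ls L) :=
  BV_semiconj (fun p hp a b => (h p hp a b).eq) hls hU

/-- Here the intertwiner is the identity and only its invariant subspace matters. -/
lemma BV_mem {U : Set Λ} (W : Submodule K A) {L : Λ → Matrix (Fin (n + 1)) (Fin (n + 1)) A}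
    (h : ∀ p ∈ U, ∀ a b, ∀ w ∈ W, L p a b * w ∈ W) {ls : Fin n → List Λ} (hls : Distinct ls)
    (hU : ∀ a, ∀ p ∈ ls a, p ∈ U) {w : A} (hw : w ∈ W) : BV P n ls L * w ∈ W := by
  have h' : Intertwines (LinearMap.id : A →ₗ[K] A) (fun _ => W) U L L := fun S p hp _ w hw a b =>
    ⟨h p hp a b w hw, rfl⟩
  exact (BV_intertwine (P := P) (S := ∅) h' hls hU (by simp) hw).1

end Dressing

end

end QLoop

namespace QLoop

noncomputable section

set_option linter.unusedSectionVars false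

/-! ### Splitting of the first row -/

section RowSplit

universe u

variable {Λ : Type} [Fintype Λ] [DecidableEq Λ] {K : Type*} [Field K] {P : Par Λ K} {N n : ℕ}
  {A : Type u} [Ring A] [Algebra K A]

lemma legProd_mul {L L' : Λ → Matrix (Fin N) (Fin N) A}
    (hc : ∀ p p' a b c d, Commute (L' p a b) (L p' c d)) {l : List Λ} (hl : l.Nodup) :
    legProd (fun p => L p * L' p) l = legProd L l * legProd L' l := by
  induction l with
  | nil => simp [legProd]
  | cons i l ih =>
    obtain ⟨hi, hl'⟩ := List.nodup_cons.mp hl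
    have c : Commute (leg i (L' i)) (legProd L l) := by
      clear ih hl' hl
      induction l with
      | nil => exact Commute.one_right _
      | cons j l ih =>
        simp only [List.mem_cons, not_or] at hi
        rw [legProd_cons]
        exact (leg_commute_leg hi.1 _ _ fun a b c d => hc i j a b c d).mul_right (ih hi.2)
    rw [legProd_cons, legProd_cons, legProd_cons, leg_mul, ih hl']
    calc _ = leg i (L i) * (leg i (L' i) * legProd L l) * legProd L' l := by simp only [mul_assoc]
      _ = _ := by rw [c.eq]; simp only [mul_assoc]

lemma prod_diagHom {J : Type*} [Fintype J] [DecidableEq J] (l : List Λ) (x : Λ → A) :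
    (l.map fun p => diagHom K A J (x p)).prod = diagHom K A J (l.map x).prod := by
  induction l with
  | nil => simp
  | cons i l ih => rw [List.map_cons, List.prod_cons, ih, List.map_cons, List.prod_cons, map_mul]

/-- The index that vanishes exactly at the labels from the list `l`. -/
def rowIdx (n : ℕ) (l : List Λ) : Λ → Fin (n + 2) := fun r => if r ∈ l then 0 else 1

/-- The first row is read in the larger tensor space, where full `L`-matrices and their RLL
relations are available. Off the list `rowIdx` has the value `1 = Fin.succ 0`, so that the unused
factors, where the matrices are diagonal, match the index `0` of the smaller space. -/
lemma legProd_headB_apply (L : Λ → Matrix (Fin (n + 2)) (Fin (n + 2)) A) {l : List Λ}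
    (hl : l.Nodup) (h : Λ → Fin (n + 1)) :
    legProd (headB L) l 0 h = legProd L l (rowIdx n l) (Fin.succ ∘ h) := by
  rw [legProd_apply _ hl, legProd_apply _ hl]
  have h1 : (∀ r, r ∉ l → (0 : Λ → Fin (n + 1)) r = h r)
      ↔ ∀ r, r ∉ l → rowIdx n l r = (Fin.succ ∘ h) r := by
    refine forall₂_congr fun r hr => ?_
    rw [rowIdx, if_neg hr, ← Fin.succ_zero_eq_one, Function.comp_apply, Fin.succ_inj]
    rfl
  have h2 : (l.map fun p => headB L p ((0 : Λ → Fin (n + 1)) p) (h p))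
      = l.map fun p => L p (rowIdx n l p) ((Fin.succ ∘ h) p) :=
    List.map_congr_left fun p hp => by simp [headB, rowIdx, hp]
  simp only [h1, h2]

lemma kHom_prI_apply (l : List Λ) (I : Finset Λ) (X : Matrix (Λ → Fin (n + 1)) (Λ → Fin (n + 1)) A)
    (f g : Λ → Fin (n + 1)) (h : ∀ p ∈ l, (g p = 0 ↔ p ∈ I)) :
    (X * kHom K A (Λ → Fin (n + 1)) (prI K l I)) f g = X f g := by
  have : kHom K A (Λ → Fin (n + 1)) (prI K l I) = Matrix.diagonal fun f => algebraMap K A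
      (if ∀ p ∈ l, (f p = 0 ↔ p ∈ I) then 1 else 0) := by
    rw [kHom_eq, prI, pr, kMap, Matrix.diagonal_map (map_zero _)]; congr!
  rw [this, Matrix.mul_diagonal, if_pos h, map_one, mul_one]

lemma kHom_prI_apply_eq_zero (l : List Λ) (I : Finset Λ)
    (X : Matrix (Λ → Fin (n + 1)) (Λ → Fin (n + 1)) A)
    (f g : Λ → Fin (n + 1)) (h : ¬ ∀ p ∈ l, (g p = 0 ↔ p ∈ I)) :
    (X * kHom K A (Λ → Fin (n + 1)) (prI K l I)) f g = 0 := by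
  have : kHom K A (Λ → Fin (n + 1)) (prI K l I) = Matrix.diagonal fun f => algebraMap K A
      (if ∀ p ∈ l, (f p = 0 ↔ p ∈ I) then 1 else 0) := by
    rw [kHom_eq, prI, pr, kMap, Matrix.diagonal_map (map_zero _)]; congr!
  rw [this, Matrix.mul_diagonal, if_neg h, map_zero, mul_zero]

lemma nodup_headL_append_tailL {l : List Λ} (hl : l.Nodup) (I : Finset Λ) :
    (headL l I ++ tailL l I).Nodup := (headL_append_tailL_perm l I).nodup_iff.mpr hl

lemma tailL_append_headL_reverse_perm (l : List Λ) (I : Finset Λ) :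
    (tailL l I ++ (headL l I).reverse).Perm l :=
  (List.perm_append_comm.trans ((List.reverse_perm _).append_right _)).trans
    (headL_append_tailL_perm l I)

/-- The projection decides for each label whether the intermediate index is zero. A label in `I`
takes the corner of `L₂` followed by the first row of `L₁`; a label outside takes the first row of
`L₂` followed by the block of `L₁`. -/
lemma legProd_split_apply (L₁ L₂ : Λ → Matrix (Fin (n + 2)) (Fin (n + 2)) A) {l : List Λ}
    (hl : l.Nodup) (I : Finset Λ) (h : Λ → Fin (n + 1)) :
    (legProd L₂ (tailL l I ++ (headL l I).reverse) * kHom K A (Λ → Fin (n + 2)) (prI K l I)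
        * legProd L₁ (headL l I ++ tailL l I)) (rowIdx n l) (Fin.succ ∘ h)
      = (legProd (headB L₂) (tailL l I)
        * diagHom K A (Λ → Fin (n + 1)) ((headL l I).reverse.map fun p => L₂ p 0 0).prod
        * legProd (headB L₁) (headL l I) * legProd (blockD L₁) (tailL l I)) 0 h := by
  set H := headL l I with hH
  set T := tailL l I with hT
  have ndT : T.Nodup := hl.filter _
  have ndHT : (H ++ T).Nodup := nodup_headL_append_tailL hl I
  have ndTH : (T ++ H.reverse).Nodup := (tailL_append_headL_reverse_perm l I).nodup_iff.mpr hl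
  have memHT : ∀ r, r ∈ H ++ T ↔ r ∈ l := fun r => (headL_append_tailL_perm l I).mem_iff
  have memTH : ∀ r, r ∈ T ++ H.reverse ↔ r ∈ l := fun r =>
    (tailL_append_headL_reverse_perm l I).mem_iff
  set X : Λ → Matrix (Fin (n + 1)) (Fin (n + 1)) A :=
    fun p => if p ∈ I then headB L₁ p else blockD L₁ p with hX
  have eX : legProd (headB L₁) H * legProd (blockD L₁) T = legProd X (H ++ T) := by
    rw [legProd_append]
    congr 1
    · exact congrArg List.prod (List.map_congr_left fun p hp => by
        simp [hX, (mem_headL.mp hp).2])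
    · exact congrArg List.prod (List.map_congr_left fun p hp => by
        simp [hX, (mem_tailL.mp hp).2])
  rw [mul_assoc _ (legProd (headB L₁) H), eX, mul_assoc (legProd (headB L₂) T),
    Matrix.mul_apply, Matrix.mul_apply]
  simp only [diagHom_mul_apply]
  set a := (H.reverse.map fun p => L₂ p 0 0).prod with ha
  -- the index of the large space corresponding to `k`
  set φ : (Λ → Fin (n + 1)) → Λ → Fin (n + 2) :=
    fun k r => if r ∈ l ∧ r ∈ I then 0 else (k r).succ with hφ
  have hk0 : ∀ k, legProd (headB L₂) T 0 k * (a * legProd X (H ++ T) k h) ≠ 0 →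
      ∀ r, r ∉ T → k r = 0 := by
    intro k hk r hr
    by_contra h0
    apply hk
    rw [legProd_apply _ ndT, if_neg, zero_mul]
    exact fun H' => h0 (H' r hr).symm
  have hφpr : ∀ k, ∀ p ∈ l, (φ k p = 0 ↔ p ∈ I) := by
    intro k p hp
    simp only [hφ]
    by_cases hI : p ∈ I <;> simp [hI, hp]
  have key : ∀ k, (∀ r, r ∉ T → k r = 0) →
      legProd (headB L₂) T 0 k * (a * legProd X (H ++ T) k h)
        = (legProd L₂ (T ++ H.reverse) * kHom K A (Λ → Fin (n + 2)) (prI K l I)) (rowIdx n l) (φ k)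
          * legProd L₁ (H ++ T) (φ k) (Fin.succ ∘ h) := by
    intro k hk
    have c0 : ∀ r, r ∉ T → (0 : Λ → Fin (n + 1)) r = k r := fun r hr => (hk r hr).symm
    have c1 : ∀ r, r ∉ T ++ H.reverse → rowIdx n l r = φ k r := by
      intro r hr
      rw [memTH] at hr
      have : k r = 0 := hk r fun hT' => hr (mem_tailL.mp hT').1
      simp [rowIdx, hφ, hr, this]
    rw [kHom_prI_apply _ _ _ _ _ (hφpr k), legProd_apply _ ndT, legProd_apply _ ndTH,
      legProd_apply _ ndHT, legProd_apply _ ndHT, if_pos c0, if_pos c1,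
      (List.map_append : List.map (fun p => L₂ p (rowIdx n l p) (φ k p)) (T ++ H.reverse) = _),
      List.prod_append, mul_assoc]
    congr 1
    · refine congrArg List.prod (List.map_congr_left fun p hp => ?_)
      have hp' := mem_tailL.mp hp
      simp [headB, rowIdx, hφ, hp'.1, hp'.2]
    congr 1
    · refine congrArg List.prod (List.map_congr_left fun p hp => ?_)
      have hp' := mem_headL.mp (List.mem_reverse.mp hp)
      simp [rowIdx, hφ, hp'.1, hp'.2]
    have hcond : (∀ r, r ∉ H ++ T → k r = h r)
        ↔ ∀ r, r ∉ H ++ T → φ k r = (Fin.succ ∘ h) r := by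
      refine forall₂_congr fun r hr => ?_
      rw [memHT] at hr
      simp [hφ, hr]
    simp only [hcond]
    split_ifs
    · refine congrArg List.prod (List.map_congr_left fun p hp => ?_)
      have hpl := (memHT p).mp hp
      by_cases hI : p ∈ I
      · have : k p = 0 := hk p fun hT' => (mem_tailL.mp hT').2 hI
        simp [hX, hφ, hI, hpl, headB, this]
      · simp [hX, hφ, hI, blockD]
    · rfl
  symm
  refine Finset.sum_bij_ne_zero (fun k _ _ => φ k) (fun _ _ _ => Finset.mem_univ _) ?_ ?_ ?_
  · intro k _ hk k' _ hk' e
    funext r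
    by_cases hr : r ∈ T
    · have hr' := mem_tailL.mp hr
      have := congrFun e r
      simpa [hφ, hr'.2] using this
    · rw [hk0 k hk r hr, hk0 k' hk' r hr]
  · intro g _ hg
    have hpr : ∀ p ∈ l, (g p = 0 ↔ p ∈ I) := by
      by_contra hne
      rw [kHom_prI_apply_eq_zero _ _ _ _ _ hne, zero_mul] at hg
      exact hg rfl
    have hrow : ∀ r, r ∉ l → g r = 1 := by
      intro r hr
      by_contra hne
      rw [kHom_prI_apply _ _ _ _ _ hpr, legProd_apply _ ndTH, if_neg, zero_mul] at hg
      · exact hg rfl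
      · intro H'
        have := H' r (by rwa [memTH])
        rw [rowIdx, if_neg hr] at this
        exact hne this.symm
    set k : Λ → Fin (n + 1) := fun r => if h0 : g r = 0 then 0 else (g r).pred h0 with hk
    have hkφ : φ k = g := by
      funext r
      simp only [hφ]
      by_cases hr : r ∈ l
      · by_cases hI : r ∈ I
        · rw [if_pos ⟨hr, hI⟩, (hpr r hr).mpr hI]
        · have : g r ≠ 0 := fun h0 => hI ((hpr r hr).mp h0)
          simp [hI, hk, this]
      · simp [hr, hk, hrow r hr]
    have hk00 : ∀ r, r ∉ T → k r = 0 := by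
      intro r hr
      by_cases hrl : r ∈ l
      · have hI : r ∈ I := by
          by_contra hI; exact hr (mem_tailL.mpr ⟨hrl, hI⟩)
        simp [hk, (hpr r hrl).mpr hI]
      · simp [hk, hrow r hrl]
    refine ⟨k, Finset.mem_univ _, ?_, hkφ⟩
    rw [key k hk00, hkφ]
    exact hg
  · intro k _ hk
    exact key k (hk0 k hk)

/-- The first row of the product of two commuting families. -/
lemma exists_headB_split {U : Set Λ} {L₁ L₂ : Λ → Matrix (Fin (n + 2)) (Fin (n + 2)) A}
    (h₁ : RLL P U L₁) (h₂ : RLL P U L₂)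
    (hc : ∀ p p' a b c d, Commute (L₁ p a b) (L₂ p' c d)) {l : List Λ} (hl : l.Nodup)
    (hU : ∀ p ∈ l, p ∈ U) :
    ∃ X : Finset Λ → Matrix (Λ → Fin (n + 1)) (Λ → Fin (n + 1)) K,
      (∀ I, Exch P (n + 1) l (headL l I ++ tailL l I) (X I)) ∧
      ∀ h, legProd (headB fun p => L₂ p * L₁ p) l 0 h
        = ∑ I ∈ l.toFinset.powerset, (blockCoeff P l I)⁻¹ • (legProd (headB L₂) (tailL l I)
        * diagHom K A (Λ → Fin (n + 1)) ((headL l I).reverse.map fun p => L₂ p 0 0).prod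
        * legProd (headB L₁) (headL l I) * legProd (blockD L₁) (tailL l I)
        * kHom K A (Λ → Fin (n + 1)) (X I)) 0 h := by
  obtain ⟨G, X, hG, hX, e⟩ := exists_resolution (P := P) (m := n + 1) hl
  refine ⟨fun I => (X I).submatrix (Fin.succ ∘ ·) (Fin.succ ∘ ·), fun I =>
    ((hX I).restrict hl).1, fun h => ?_⟩
  rw [legProd_headB_apply _ hl, legProd_mul hc hl]
  -- The resolution of the identity is inserted between the two products; its left factor is moved
  -- to the left through `L₂`, its right factor to the right through `L₁`.
  have e' : legProd L₂ l * legProd L₁ l = ∑ I ∈ l.toFinset.powerset, (blockCoeff P l I)⁻¹ •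
      (kHom K A (Λ → Fin (n + 2)) (G I) * (legProd L₂ (tailL l I ++ (headL l I).reverse) * kHom K A (Λ → Fin (n + 2)) (prI K l I)
        * legProd L₁ (headL l I ++ tailL l I)) * kHom K A (Λ → Fin (n + 2)) (X I)) := by
    conv_lhs => rw [← mul_one (legProd L₂ l), ← map_one (kHom K A _), e]
    rw [map_sum, Finset.mul_sum, Finset.sum_mul]
    refine Finset.sum_congr rfl fun I _ => ?_
    have g1 := (hG I).legProd ((tailL_append_headL_reverse_perm l I).nodup_iff.mpr hl)
      (fun p hp => hU p ((tailL_append_headL_reverse_perm l I).mem_iff.mp hp)) h₂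
    have g2 := (hX I).legProd hl hU h₁
    rw [← kHom_eq] at g1 g2
    rw [map_smul, map_mul, map_mul, mul_smul_comm, smul_mul_assoc]
    congr 1
    calc _ = (legProd L₂ l * kHom K A (Λ → Fin (n + 2)) (G I)) * kHom K A (Λ → Fin (n + 2)) (prI K l I)
          * (kHom K A (Λ → Fin (n + 2)) (X I) * legProd L₁ l) := by simp only [mul_assoc]
      _ = _ := by rw [← g1, g2]; simp only [mul_assoc]
  rw [e', Matrix.sum_apply]
  refine Finset.sum_congr rfl fun I _ => ?_
  rw [Matrix.smul_apply]
  congr 1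
  -- The row index is constant on the labels, so `G I` acts on it as the identity.
  have hrow : ∀ i ∈ tailL l I ++ (headL l I).reverse, ∀ j ∈ tailL l I ++ (headL l I).reverse,
      rowIdx n l i = rowIdx n l j := by
    intro i hi j hj
    rw [(tailL_append_headL_reverse_perm l I).mem_iff] at hi hj
    simp [rowIdx, hi, hj]
  have hGrow := fun g => ((hG I).const_apply
    ((tailL_append_headL_reverse_perm l I).nodup_iff.mpr hl) hrow g).1
  rw [mul_assoc, Matrix.mul_apply, Finset.sum_eq_single (rowIdx n l)]
  · rw [kHom_apply, hGrow, Matrix.one_apply_eq, map_one, one_mul, Matrix.mul_apply,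
      Matrix.mul_apply]
    symm
    -- The column has positive indices, hence only positive intermediate indices contribute, and `X
    -- I` is replaced by its restriction.
    refine Fintype.sum_of_injective (fun f : Λ → Fin (n + 1) => Fin.succ ∘ f)
      (Fin.succ_injective _).comp_left _ _ (fun k hk => ?_) fun k => ?_
    · rw [kHom_apply, ((hX I).restrict hl).2 k h (fun ⟨f', hf'⟩ => hk ⟨f', hf'.symm⟩), map_zero,
        mul_zero]
    · rw [legProd_split_apply L₁ L₂ hl I k]
      rfl
  · intro k _ hk
    rw [kHom_apply, hGrow, Matrix.one_apply_ne (Ne.symm hk), map_zero, zero_mul]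
  · simp

end RowSplit

end

end QLoop

namespace QLoop

noncomputable section

set_option linter.unusedSectionVars false

/-! ### Singular vectors -/

section Singular

universe u

variable {Λ : Type} [Fintype Λ] [DecidableEq Λ] {K : Type*} [Field K] {P : Par Λ K} {N n : ℕ}
  {A : Type u} [Ring A] [Algebra K A]

/-- `M` acts on `v` by an upper triangular matrix with the eigenvalues `l` on the diagonal. -/
def IsSing (M : Matrix (Fin N) (Fin N) A) (l : Fin N → K) (v : A) : Prop :=
  (∀ a b, a < b → M b a * v = 0) ∧ ∀ a, M a a * v = l a • v

/-- In each summand one factor is below the diagonal unless all indices agree, and commutativity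
allows that factor to reach `v` first. -/
lemma IsSing.mul {M M' : Matrix (Fin N) (Fin N) A} {l l' : Fin N → K} {v : A}
    (h : IsSing M l v) (h' : IsSing M' l' v) (hc : ∀ a b c d, Commute (M a b) (M' c d)) :
    IsSing (M * M') (fun a => l a * l' a) v := by
  constructor
  · intro a b hab
    rw [Matrix.mul_apply, Finset.sum_mul]
    refine Finset.sum_eq_zero fun c _ => ?_
    rcases lt_or_ge a c with hc' | hc'
    · rw [mul_assoc, h'.1 a c hc', mul_zero]
    · rw [(hc _ _ _ _).eq, mul_assoc, h.1 c b (hc'.trans_lt hab), mul_zero]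
  · intro a
    rw [Matrix.mul_apply, Finset.sum_mul, Finset.sum_eq_single a]
    · rw [mul_assoc, h'.2, mul_smul_comm, h.2, smul_smul, mul_comm]
    · intro c _ hca
      rcases lt_or_gt_of_ne hca with hc' | hc'
      · rw [(hc _ _ _ _).eq, mul_assoc, h.1 c a hc', mul_zero]
      · rw [mul_assoc, h'.1 a c hc', mul_zero]
    · simp

lemma IsSing.block {M : Matrix (Fin (N + 1)) (Fin (N + 1)) A} {l : Fin (N + 1) → K} {v : A}
    (h : IsSing M l v) : IsSing (M.submatrix Fin.succ Fin.succ) (fun a => l a.succ) v :=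
  ⟨fun _ _ hab => h.1 _ _ (Fin.succ_lt_succ_iff.mpr hab), fun a => h.2 a.succ⟩

lemma isSing_one (v : A) : IsSing (1 : Matrix (Fin N) (Fin N) A) (fun _ => (1 : K)) v :=
  ⟨fun a b hab => by rw [Matrix.one_apply_ne hab.ne', zero_mul], fun a => by simp⟩

lemma diagHom_mul_single {J : Type*} [Fintype J] [DecidableEq J] (a v : A) (i j : J) :
    diagHom K A J a * Matrix.single i j v = Matrix.single i j (a * v) := by
  ext f g
  rw [diagHom_mul_apply, Matrix.single_apply, Matrix.single_apply]
  split_ifs <;> simp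

lemma IsSing.diag {M : Matrix (Fin N) (Fin N) A} {l : Fin N → K} {v : A}
    (h : IsSing M l v) {J : Type*} [Fintype J] [DecidableEq J] (i j : J) :
    IsSing (M.map (diagHom K A J)) l (Matrix.single i j v) := by
  refine ⟨fun a b hab => ?_, fun a => ?_⟩
  · rw [Matrix.map_apply, diagHom_mul_single, h.1 a b hab, Matrix.single_zero]
  · rw [Matrix.map_apply, diagHom_mul_single, h.2, Matrix.smul_single]

lemma kHom_mul_single {J : Type*} [Fintype J] [DecidableEq J] {X : Matrix J J K} {i : J} {c : K}
    (h : ∀ f, X f i = if f = i then c else 0) (j : J) (v : A) :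
    kHom K A J X * Matrix.single i j v = c • Matrix.single i j v := by
  refine Matrix.ext fun f g => ?_
  by_cases hg : g = j
  · subst hg
    rw [mul_single_apply, kHom_apply, h, Matrix.smul_apply, Matrix.single_apply]
    by_cases hf : f = i
    · simp [hf, Algebra.smul_def]
    · simp [hf, Ne.symm hf]
  · rw [Matrix.smul_apply, Matrix.mul_apply]
    simp [Ne.symm hg]

lemma leg_apply_zero {M : Matrix (Fin (n + 1)) (Fin (n + 1)) K} {c : K}
    (h : ∀ a, M a 0 = if a = 0 then c else 0) (i : Λ) (f : Λ → Fin (n + 1)) :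
    leg i M f 0 = if f = 0 then c else 0 := by
  simp only [leg, Matrix.of_apply, Pi.zero_apply, h]
  by_cases hf : f = 0
  · subst hf; simp
  · rw [if_neg hf]
    split_ifs with h1 h2
    · exact absurd (funext fun r => by
        by_cases hr : r = i
        · rw [hr, h2]; rfl
        · rw [h1 r hr]; rfl) hf
    · rfl
    · rfl

variable (P) in
/-- The eigenvalues of `auxR`. -/
def auxEig (p i : Λ) : K := (P.Q * P.x p - P.Q⁻¹ * P.x i) / (P.x p - P.x i)

/-- The first basis vector is singular for the R-matrix regarded as an `L`-operator. With the
normalization by `P.x p - P.x i` all its eigenvalues but the first are `1`. -/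
lemma isSing_auxR {p i : Λ} (hpi : p ≠ i) (j : Λ → Fin (n + 1)) (v : A) :
    IsSing ((auxR P (n + 1) p i).map (kHom K A (Λ → Fin (n + 1))))
      (fun a => if a = 0 then auxEig P p i else 1) (Matrix.single 0 j v) := by
  have hx := sub_ne_zero.mpr (P.x_ne p i hpi)
  constructor
  · intro a b hab
    rw [Matrix.map_apply, auxR_apply, map_smul, smul_mul_assoc,
      kHom_mul_single (c := (0 : K)), zero_smul, smul_zero]
    refine leg_apply_zero (fun c => ?_) i
    have hb : b ≠ 0 := ((Fin.zero_le a).trans_lt hab).ne'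
    simp [Laux, RM, dl, hab.ne', hb]
  · intro a
    rw [Matrix.map_apply, auxR_apply, map_smul, smul_mul_assoc,
      kHom_mul_single (c := wR P.Q (P.x p) (P.x i) a 0), smul_smul]
    · congr 1
      show _ = if a = 0 then _ else _
      by_cases ha : a = 0
      · rw [if_pos ha, wR, if_pos ha, auxEig, div_eq_inv_mul]
      · rw [if_neg ha, wR, if_neg ha, inv_mul_cancel₀ hx]
    · refine leg_apply_zero (fun c => ?_) i
      by_cases hc : c = 0
      · subst hc
        by_cases ha : a = 0 <;> simp [Laux, RM, dl, ha, gR]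
      · by_cases ha : a = 0 <;> simp [Laux, RM, dl, ha, hc, gR]

variable (P) in
/-- The eigenvalues of `chainR`. -/
def chainEig (l : List Λ) (p : Λ) (a : Fin (n + 1)) : K :=
  if a = 0 then (l.map fun i => auxEig P p i).prod else 1

lemma isSing_chainR {p : Λ} {l : List Λ} (hl : l.Nodup) (hp : p ∉ l) (j : Λ → Fin (n + 1)) (v : A) :
    IsSing ((chainR P (n + 1) p l).map (kHom K A (Λ → Fin (n + 1)))) (chainEig P l p)
      (Matrix.single 0 j v) := by
  induction l with
  | nil =>
    have : chainEig (n := n) P [] p = fun _ => 1 := by funext a; simp [chainEig]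
    rw [this, chainR, Matrix.map_one _ (map_zero _) (map_one _)]
    exact isSing_one _
  | cons i l ih =>
    simp only [List.mem_cons, not_or] at hp
    obtain ⟨hi, hl⟩ := List.nodup_cons.mp hl
    have := (ih hl hp.2).mul (isSing_auxR hp.1 j v) fun a b c d => by
      exact (commute_chainR_auxR hi p p a b c d).map (kHom K A (Λ → Fin (n + 1)))
    rw [chainR, Matrix.map_mul]
    convert this using 1
    funext a
    by_cases ha : a = 0 <;> simp [chainEig, ha, mul_comm]

lemma isSing_dressD {D : Λ → Matrix (Fin (n + 1)) (Fin (n + 1)) A} {p : Λ} {d : Fin (n + 1) → K}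
    {v : A} (h : IsSing (D p) d v) {l : List Λ} (hl : l.Nodup) (hp : p ∉ l)
    (j : Λ → Fin (n + 1)) :
    IsSing (dressD P l D p) (fun a => d a * chainEig P l p a) (Matrix.single 0 j v) :=
  (h.diag 0 j).mul (isSing_chainR hl hp j v) fun _ _ _ _ => diagHom_commute_kHom _ _

lemma legProd_mul_single {L : Λ → Matrix (Fin (n + 1)) (Fin (n + 1)) A} {d : Λ → K} {v : A}
    {l : List Λ} (h : ∀ p ∈ l, (∀ b, b ≠ 0 → L p b 0 * v = 0) ∧ L p 0 0 * v = d p • v)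
    (j : Λ → Fin (n + 1)) :
    legProd L l * Matrix.single 0 j v = (l.map d).prod • Matrix.single 0 j v := by
  induction l with
  | nil => simp [legProd]
  | cons p l ih =>
    rw [legProd_cons, mul_assoc, ih fun r hr => h r (by simp [hr]), mul_smul_comm, List.map_cons,
      List.prod_cons, mul_comm (d p), ← smul_smul]
    congr 1
    have hp := h p (by simp)
    refine Matrix.ext fun f g => ?_
    rw [leg_mul_apply, Matrix.smul_apply, Matrix.single_apply]
    by_cases hf : (0 : Λ → Fin (n + 1)) = f ∧ j = g
    · rw [if_pos hf, Finset.sum_eq_single 0]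
      · obtain ⟨rfl, rfl⟩ := hf
        have : Function.update (0 : Λ → Fin (n + 1)) p 0 = 0 := Function.update_eq_self _ _
        rw [this, Matrix.single_apply, if_pos ⟨rfl, rfl⟩]
        exact hp.2
      · intro b _ hb
        rw [Matrix.single_apply, if_neg, mul_zero]
        intro h'
        exact hb (by simpa using (congrFun h'.1 p).symm)
      · simp
    · rw [if_neg hf, smul_zero]
      refine Finset.sum_eq_zero fun b _ => ?_
      rw [Matrix.single_apply]
      split_ifs with h'
      · have hb : b = 0 := by simpa using (congrFun h'.1 p).symm
        have hfp : f p ≠ 0 := by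
          intro h0
          apply hf
          refine ⟨?_, h'.2⟩
          rw [h'.1, hb, ← h0, Function.update_eq_self]
        rw [hb, hp.1 _ hfp]
      · rw [mul_zero]

end Singular

/-! ### Exchange relations for the blocks of `L` -/

section Moves

universe u

variable {Λ : Type} [Fintype Λ] [DecidableEq Λ] {K : Type*} [Field K] {P : Par Λ K} {N n : ℕ}
  {A : Type u} [Ring A] [Algebra K A] {B : Type u} [Ring B] [Algebra K B]

/-- The relation which moves the entries of the first column to the right. -/
lemma IsRLL.column {p r : Λ} (hpr : p ≠ r) {M M' : Matrix (Fin (n + 1)) (Fin (n + 1)) A}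
    (h : IsRLL P.Q (P.x p) (P.x r) M M') (a b : Fin (n + 1)) (c : Fin n) :
    M' b 0 * M a c.succ = (P.x p - P.x r)⁻¹ • (wR P.Q (P.x p) (P.x r) a b • (M a c.succ * M' b 0)
      + gR P.Q (P.x p) (P.x r) a b • (M b c.succ * M' a 0)
      - gR P.Q (P.x p) (P.x r) 0 c.succ • (M' b c.succ * M a 0)) := by
  have h' := isRLL_iff.mp h a b c.succ 0
  rw [h', add_sub_cancel_right, wR, if_neg (Fin.succ_ne_zero c), smul_smul,
    inv_mul_cancel₀ (sub_ne_zero.mpr (P.x_ne p r hpr)), one_smul]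

lemma diagHom_commute_leg {a : A} {p : Λ} {M : Matrix (Fin N) (Fin N) A}
    (h : ∀ b c, Commute a (M b c)) : Commute (diagHom K A (Λ → Fin N) a) (leg p M) :=
  diagHom_commute fun f g => by
    simp only [leg, Matrix.of_apply]
    split_ifs
    · exact h _ _
    · exact Commute.zero_right _

lemma diagHom_eq_leg (p : Λ) (a : A) :
    diagHom K A (Λ → Fin N) a = leg p (diagHom K A (Fin N) a) := by
  refine Matrix.ext fun f g => ?_
  rw [diagHom_apply, diagHom_apply]
  simp only [leg, Matrix.of_apply, Matrix.diagonal_apply]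
  by_cases h : f = g
  · subst h; simp
  · rw [if_neg h]
    by_cases h' : ∀ r, r ≠ p → f r = g r
    · have : f p ≠ g p := fun hp => h (funext fun r => by
        by_cases hr : r = p
        · rw [hr, hp]
        · exact h' r hr)
      rw [if_pos h', if_neg this]
    · rw [if_neg h']

/-- The relation between an `L`-matrix in a tensor factor and the dressing by this factor. -/
lemma leg_dress_comm {p j : Λ} {M M' : Matrix (Fin N) (Fin N) A}
    (h : IsRLL P.Q (P.x p) (P.x j) M M') :
    diagHom K (Matrix (Λ → Fin N) (Λ → Fin N) A) (Fin N) (leg j M')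
        * (M.map (diagHom K A (Λ → Fin N)) * (auxR P N p j).map (kHom K A (Λ → Fin N)))
      = (auxR P N p j).map (kHom K A (Λ → Fin N)) * M.map (diagHom K A (Λ → Fin N))
        * diagHom K (Matrix (Λ → Fin N) (Λ → Fin N) A) (Fin N) (leg j M') := by
  refine Matrix.ext fun a b => ?_
  rw [diagHom_mul_apply, mul_diagHom_apply, Matrix.mul_apply, Matrix.mul_apply]
  simp only [Matrix.map_apply, auxR_apply, map_smul, mul_smul_comm, smul_mul_assoc,
    ← Finset.smul_sum]
  congr 1
  have hk : ∀ X : Matrix (Fin N) (Fin N) K, kHom K A (Λ → Fin N) (leg j X)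
      = leg j (X.map (algebraMap K A)) := fun X => leg_map _ (map_zero _) _ _
  simp only [hk, diagHom_eq_leg j, ← leg_mul]
  have hsum : ∀ F : Fin N → Matrix (Fin N) (Fin N) A, ∑ c, leg j (F c) = leg j (∑ c, F c) :=
    fun F => (map_sum (legHom (K := K) A j) F Finset.univ).symm
  rw [hsum, hsum, ← leg_mul, ← leg_mul]
  congr 1
  refine Matrix.ext fun e f => ?_
  have h' := congrFun (congrFun h (a, e)) (b, f)
  rw [rllL_apply, rllR_apply] at h'
  rw [Finset.mul_sum, Finset.sum_mul, Matrix.sum_apply, Matrix.sum_apply]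
  simp only [Laux]
  have e1 : ∀ c, ((Matrix.of fun c_1 d => RM N P.Q (P.x p) (P.x j) (a, c_1) (c, d)).map
      (algebraMap K A) * diagHom K A (Fin N) (M c b) * M') e f
      = ∑ g, RM N P.Q (P.x p) (P.x j) (a, e) (c, g) • (M c b * M' g f) := by
    intro c
    rw [Matrix.mul_apply]
    refine Finset.sum_congr rfl fun g _ => ?_
    rw [mul_diagHom_apply, Matrix.map_apply, Matrix.of_apply, mul_assoc, ← Algebra.smul_def]
  have e2 : ∀ c, (M' * (diagHom K A (Fin N) (M a c) * (Matrix.of fun c_1 d =>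
      RM N P.Q (P.x p) (P.x j) (c, c_1) (b, d)).map (algebraMap K A))) e f
      = ∑ g, RM N P.Q (P.x p) (P.x j) (c, g) (b, f) • (M' e g * M a c) := by
    intro c
    rw [Matrix.mul_apply]
    refine Finset.sum_congr rfl fun g _ => ?_
    rw [diagHom_mul_apply, Matrix.map_apply, Matrix.of_apply, ← mul_assoc, ← Algebra.commutes,
      ← Algebra.smul_def]
  refine (Finset.sum_congr rfl fun c _ => e2 c).trans
    (h'.symm.trans (Finset.sum_congr rfl fun c _ => ?_))
  rw [← e1 c]
  rfl

/-- `leg_dress_comm` repeated along the list: passing the product of the `D i` interchanges `D p`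
with the R-matrices dressing it. The dressing can thereby be shifted from one side of `D p` to the
other. -/
lemma legProd_dress_comm {U : Set Λ} {D : Λ → Matrix (Fin N) (Fin N) A} (hD : RLL P U D)
    {l : List Λ} (hl : l.Nodup) (hU : ∀ i ∈ l, i ∈ U) {p : Λ} (hpU : p ∈ U) (hp : p ∉ l) :
    diagHom K (Matrix (Λ → Fin N) (Λ → Fin N) A) (Fin N) (legProd D l)
        * ((D p).map (diagHom K A (Λ → Fin N)) * (chainR P N p l).map (kHom K A (Λ → Fin N)))
      = (chainR P N p l).map (kHom K A (Λ → Fin N)) * (D p).map (diagHom K A (Λ → Fin N))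
        * diagHom K (Matrix (Λ → Fin N) (Λ → Fin N) A) (Fin N) (legProd D l) := by
  induction l with
  | nil => simp [legProd, chainR, Matrix.map_one _ (map_zero _) (map_one _)]
  | cons j l ih =>
    obtain ⟨hj, hl'⟩ := List.nodup_cons.mp hl
    simp only [List.mem_cons, not_or] at hp
    replace ih := ih hl' (fun i hi => hU i (by simp [hi])) hp.2
    have e := leg_dress_comm (hD p hpU j (hU j (by simp)) hp.1)
    have c1 : Commute (diagHom K (Matrix (Λ → Fin N) (Λ → Fin N) A) (Fin N) (legProd D l))
        ((auxR P N p j).map (kHom K A (Λ → Fin N))) := by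
      refine diagHom_commute fun a b => ?_
      clear ih hU hl hl' e
      induction l with
      | nil => exact Commute.one_left _
      | cons i l ih =>
        simp only [List.mem_cons, not_or] at hj hp
        rw [legProd_cons]
        exact (commute_auxR_leg hj.1 p a b _).symm.mul_left (ih hj.2 ⟨hp.1, hp.2.2⟩)
    have c2 : Commute (diagHom K (Matrix (Λ → Fin N) (Λ → Fin N) A) (Fin N) (leg j (D j)))
        ((chainR P N p l).map (kHom K A (Λ → Fin N))) :=
      diagHom_commute fun a b => (commute_chainR_leg hj p a b _).symm
    rw [legProd_cons, chainR, Matrix.map_mul, map_mul]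
    set X := diagHom K (Matrix (Λ → Fin N) (Λ → Fin N) A) (Fin N) (legProd D l)
    set Y := diagHom K (Matrix (Λ → Fin N) (Λ → Fin N) A) (Fin N) (leg j (D j))
    set C := (chainR P N p l).map (kHom K A (Λ → Fin N))
    set R := (auxR P N p j).map (kHom K A (Λ → Fin N))
    set M := (D p).map (diagHom K A (Λ → Fin N))
    calc _ = Y * (X * (M * C)) * R := by simp only [mul_assoc]
      _ = Y * C * M * (X * R) := by rw [ih]; simp only [mul_assoc]
      _ = C * (Y * (M * R)) * X := by rw [c1.eq, c2.eq]; simp only [mul_assoc]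
      _ = _ := by rw [e]; simp only [mul_assoc]

/-- A product uses its label only once, in the left factor; the right factor must therefore preserve
every `W S` without releasing a label. -/
lemma Intertwines.mul {T : A →ₗ[K] B} {W : Set Λ → Submodule K A} {U : Set Λ}
    {L M : Λ → Matrix (Fin N) (Fin N) A} {L' M' : Λ → Matrix (Fin N) (Fin N) B}
    (h : Intertwines T W U L L') (h' : ∀ S, Intertwines T (fun _ => W S) U M M') :
    Intertwines T W U (fun p => L p * M p) fun p => L' p * M' p := by
  intro S p hp hpS w hw a b
  have h1 := fun c => h' (insert p S) ∅ p hp (by simp) w hw c b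
  have h2 := fun c => h S p hp hpS _ (h1 c).1 a c
  change (L p * M p) a b * w ∈ W S ∧ T ((L p * M p) a b * w) = (L' p * M' p) a b * T w
  rw [Matrix.mul_apply, Matrix.mul_apply, Finset.sum_mul, Finset.sum_mul, map_sum]
  simp only [mul_assoc]
  exact ⟨Submodule.sum_mem _ fun c _ => (h2 c).1, Finset.sum_congr rfl fun c _ => by
    rw [(h2 c).2, (h1 c).2]⟩

/-- The vectors annihilated by the first column of `L r` for all `r ∈ S`. -/
def colKer (K : Type*) [Field K] {A : Type u} [Ring A] [Algebra K A]
    (L : Λ → Matrix (Fin (n + 1)) (Fin (n + 1)) A) (S : Set Λ) : Submodule K A where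
  carrier := {w | ∀ r ∈ S, ∀ a : Fin n, L r a.succ 0 * w = 0}
  add_mem' h h' r hr a := by rw [mul_add, h r hr a, h' r hr a, add_zero]
  zero_mem' _ _ _ := mul_zero _
  smul_mem' c w h r hr a := by rw [mul_smul_comm, h r hr a, smul_zero]

/-- By `IsRLL.column` a first-column entry of `L r` moves to the right of the block of `L p`, and
every resulting term ends with a first-column entry, below the corner, of `L r` or `L p`. Hence `w`
must be annihilated for the label `p` as well. The coefficient has the denominator `P.x p - P.x r`,
so `p` has to be different from the labels in `S`. -/
lemma blockD_mem_colKer {U : Set Λ} {L : Λ → Matrix (Fin (n + 2)) (Fin (n + 2)) A}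
    (hL : RLL P U L) {S : Set Λ} (hS : S ⊆ U) {p : Λ} (hp : p ∈ U) (hpS : p ∉ S) {w : A}
    (hw : w ∈ colKer K L (insert p S)) (a b : Fin (n + 1)) :
    blockD L p a b * w ∈ colKer K L S := by
  intro r hr c
  have hpr : p ≠ r := fun h => hpS (h ▸ hr)
  have hwr := hw r (Set.mem_insert_of_mem p hr)
  have hwp := hw p (Set.mem_insert p S)
  rw [blockD, Matrix.submatrix_apply, ← mul_assoc, (hL p hp r (hS hr) hpr).column hpr,
    smul_mul_assoc, sub_mul, add_mul, smul_mul_assoc, smul_mul_assoc, smul_mul_assoc, mul_assoc,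
    mul_assoc, mul_assoc, hwr, hwr, hwp]
  simp

/-- The two unwanted terms of `IsRLL.column` end with first-column entries below the corner and
vanish on `w`. The coefficient of the remaining term is `1`, because a corner and a block entry have
unequal row indices. -/
lemma corner_mul_blockD {U : Set Λ} {L : Λ → Matrix (Fin (n + 2)) (Fin (n + 2)) A}
    (hL : RLL P U L) {p i : Λ} (hp : p ∈ U) (hi : i ∈ U) (hpi : p ≠ i) {w : A}
    (hw : w ∈ colKer K L {p, i}) (a b : Fin (n + 1)) :
    L i 0 0 * (blockD L p a b * w) = blockD L p a b * (L i 0 0 * w) := by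
  have hwi := hw i (by simp)
  have hwp := hw p (by simp)
  rw [blockD, Matrix.submatrix_apply, ← mul_assoc, (hL p hp i hi hpi).column hpi,
    smul_mul_assoc, sub_mul, add_mul, smul_mul_assoc, smul_mul_assoc, smul_mul_assoc, mul_assoc,
    mul_assoc, mul_assoc, hwi, hwp, mul_zero, mul_zero, smul_zero, smul_zero, sub_zero, add_zero,
    wR, if_neg (Fin.succ_ne_zero a), smul_smul,
    inv_mul_cancel₀ (sub_ne_zero.mpr (P.x_ne p i hpi)), one_smul]

end Moves

end

end QLoop

namespace QLoop

noncomputable section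

set_option linter.unusedSectionVars false

/-! ### Splitting of nested Bethe vectors -/

section Split

universe u

variable {Λ : Type} [Fintype Λ] [DecidableEq Λ] {K : Type*} [Field K] {P : Par Λ K} {N n : ℕ}
  {A : Type u} [Ring A] [Algebra K A]

/-- The matrices acting only in the tensor factors from `S`. -/
def legSupp (K : Type*) [Field K] (A : Type u) [Ring A] [Algebra K A] (N : ℕ) (S : Set Λ) :
    Subalgebra K (Matrix (Λ → Fin N) (Λ → Fin N) A) where
  carrier := {X | ∀ f g, X f g ≠ 0 → ∀ r, r ∉ S → f r = g r}
  mul_mem' {X Y} hX hY f g h r hr := by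
    rw [Matrix.mul_apply] at h
    obtain ⟨k, _, hk⟩ := Finset.exists_ne_zero_of_sum_ne_zero h
    rw [hX f k (left_ne_zero_of_mul hk) r hr, hY k g (right_ne_zero_of_mul hk) r hr]
  add_mem' {X Y} hX hY f g h r hr := by
    by_cases h' : X f g = 0
    · exact hY f g (fun h0 => h (by rw [Matrix.add_apply, h', h0, add_zero])) r hr
    · exact hX f g h' r hr
  algebraMap_mem' c f g h r _ := by
    by_cases hfg : f = g
    · rw [hfg]
    · exact absurd (Matrix.algebraMap_matrix_apply (r := c) (i := f) (j := g) |>.trans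
        (if_neg hfg)) h

lemma leg_mem_legSupp {S : Set Λ} {i : Λ} (hi : i ∈ S) (M : Matrix (Fin N) (Fin N) A) :
    leg i M ∈ legSupp K A N S := by
  intro f g h r hr
  simp only [leg, Matrix.of_apply] at h
  by_contra hne
  rw [if_neg] at h
  · exact h rfl
  · exact fun H => hne (H r fun e => hr (e ▸ hi))

lemma legProd_mem_legSupp {S : Set Λ} (L : Λ → Matrix (Fin N) (Fin N) A) {l : List Λ}
    (hl : ∀ i ∈ l, i ∈ S) : legProd L l ∈ legSupp K A N S := by
  refine Subalgebra.list_prod_mem _ fun X hX => ?_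
  obtain ⟨p, hp, rfl⟩ := List.mem_map.mp hX
  exact leg_mem_legSupp (hl p hp) _

lemma diagHom_mem_legSupp (S : Set Λ) (a : A) :
    diagHom K A (Λ → Fin N) a ∈ legSupp K A N S := by
  intro f g h r _
  by_cases hfg : f = g
  · rw [hfg]
  · exact absurd (Matrix.diagonal_apply_ne _ hfg) h

lemma kHom_mem_legSupp {S : Set Λ} {X : Matrix (Λ → Fin N) (Λ → Fin N) K}
    (h : X ∈ legSupp K K N S) : kHom K A (Λ → Fin N) X ∈ legSupp K A N S := by
  intro f g h'
  exact h f g fun h0 => h' (by rw [kHom_apply, h0, map_zero])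

lemma chainR_mem_legSupp {S : Set Λ} (p : Λ) {l : List Λ} (hl : ∀ i ∈ l, i ∈ S) (a b : Fin N) :
    chainR P N p l a b ∈ legSupp K K N S := by
  induction l generalizing a b with
  | nil =>
    rw [chainR, Matrix.one_apply]
    split_ifs
    · exact one_mem _
    · exact zero_mem _
  | cons i l ih =>
    rw [chainR, Matrix.mul_apply]
    refine sum_mem fun c _ => mul_mem (ih (fun j hj => hl j (by simp [hj])) a c) ?_
    rw [auxR_apply]
    exact Subalgebra.smul_mem _ (leg_mem_legSupp (hl i (by simp)) _) _

lemma dressD_apply (l : List Λ) (D : Λ → Matrix (Fin N) (Fin N) A) (p : Λ) (a b : Fin N) :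
    dressD P l D p a b = ∑ c, diagHom K A (Λ → Fin N) (D p a c)
      * kHom K A (Λ → Fin N) (chainR P N p l c b) := by
  rw [dressD, Matrix.mul_apply]; rfl

/-- A dressed Bethe vector acts nontrivially only in the dressing factors. This will separate the
head from the tail contribution at the corner. -/
lemma BV_dressD_mem_legSupp {S : Set Λ} {l : List Λ} (hl : ∀ i ∈ l, i ∈ S)
    (D : Λ → Matrix (Fin (n + 1)) (Fin (n + 1)) A) {ls : Fin n → List Λ} (hls : Distinct ls) :
    BV P n ls (dressD P l D) ∈ legSupp K A (n + 1) S := by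
  have := BV_mem (P := P) (U := Set.univ) (Subalgebra.toSubmodule (legSupp K A (n + 1) S))
    (L := dressD P l D) (w := 1) (fun p _ a b w hw => by
      rw [Subalgebra.mem_toSubmodule] at hw ⊢
      refine mul_mem ?_ hw
      rw [dressD_apply]
      exact sum_mem fun c _ => mul_mem (diagHom_mem_legSupp _ _)
        (kHom_mem_legSupp (chainR_mem_legSupp p hl c b))) hls (by simp)
    (one_mem (legSupp K A (n + 1) S))
  rwa [mul_one] at this

/-- Matrices acting in disjoint sets of tensor factors multiply entrywise at the corner. -/
lemma legSupp_mul_apply {S T : Set Λ} (hST : ∀ i ∈ S, i ∉ T)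
    {X Y : Matrix (Λ → Fin (n + 1)) (Λ → Fin (n + 1)) A} (hX : X ∈ legSupp K A (n + 1) S)
    (hY : Y ∈ legSupp K A (n + 1) T) : (X * Y) 0 0 = X 0 0 * Y 0 0 := by
  rw [Matrix.mul_apply, Finset.sum_eq_single 0]
  · intro f _ hf
    by_contra h
    refine hf (funext fun r => ?_)
    by_cases hr : r ∈ S
    · exact hY f 0 (right_ne_zero_of_mul h) r (hST r hr)
    · exact (hX 0 f (left_ne_zero_of_mul h) r hr).symm
  · simp

lemma commute_dressD_dressD {D D' : Λ → Matrix (Fin N) (Fin N) A}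
    (hc : ∀ p p' a b c d, Commute (D p a b) (D' p' c d)) {l l' : List Λ} (h : ∀ j ∈ l', j ∉ l)
    (p p' : Λ) (a b c d : Fin N) :
    Commute (dressD P l D p a b) (dressD P l' D' p' c d) := by
  rw [dressD_apply, dressD_apply]
  refine Commute.sum_left _ _ _ fun e _ => Commute.sum_right _ _ _ fun f _ => ?_
  refine Commute.mul_left (Commute.mul_right ?_ ?_) (Commute.mul_right ?_ ?_)
  · exact (hc p p' a e c f).map (diagHom K A (Λ → Fin N))
  · exact diagHom_commute_kHom _ _
  · exact (diagHom_commute_kHom _ _).symm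
  · exact (commute_chainR_chainR h p p' e b f d).map (kHom K A (Λ → Fin N))

lemma commute_legProd_right {X : Matrix (Λ → Fin N) (Λ → Fin N) A}
    {L : Λ → Matrix (Fin N) (Fin N) A} {l : List Λ} (h : ∀ i ∈ l, Commute X (leg i (L i))) :
    Commute X (legProd L l) :=
  Commute.list_prod_right _ _ fun Y hY => by
    obtain ⟨p, hp, rfl⟩ := List.mem_map.mp hY
    exact h p hp

lemma commute_legProd_dressD {D B : Λ → Matrix (Fin N) (Fin N) A}
    (hc : ∀ p p' a b c d, Commute (D p a b) (B p' c d)) {l l' : List Λ} (h : ∀ j ∈ l', j ∉ l)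
    (p : Λ) (a b : Fin N) : Commute (legProd B l') (dressD P l D p a b) := by
  rw [dressD_apply]
  refine Commute.sum_right _ _ _ fun e _ => Commute.mul_right ?_ ?_
  · exact (commute_legProd_right fun i _ => diagHom_commute_leg fun c d => hc _ _ _ _ _ _).symm
  · exact (commute_legProd_right fun i hi => commute_chainR_leg (h i hi) p e b _).symm

lemma commute_legProd_legProd {B B' : Λ → Matrix (Fin N) (Fin N) A}
    (hc : ∀ p p' a b c d, Commute (B p a b) (B' p' c d)) {l l' : List Λ} (h : ∀ j ∈ l', j ∉ l) :
    Commute (legProd B l) (legProd B' l') :=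
  commute_legProd_right fun i hi => (commute_legProd_right fun j hj =>
    leg_commute_leg (fun e : i = j => h i hi (e ▸ hj)) _ _ fun a b c d => (hc j i c d a b).symm).symm

variable {U : Set Λ} {L₁ L₂ : Λ → Matrix (Fin (n + 2)) (Fin (n + 2)) A}

lemma mul_mem_colKer_of_commute {L : Λ → Matrix (Fin (n + 1)) (Fin (n + 1)) A} {S : Set Λ} {y w : A}
    (h : ∀ r a b, Commute y (L r a b)) (hw : w ∈ colKer K L S) : y * w ∈ colKer K L S := by
  intro r hr a
  rw [← mul_assoc, ← (h r a.succ 0).eq, mul_assoc, hw r hr a, mul_zero]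

lemma insert_inter_of_mem {U : Set Λ} {p : Λ} (hp : p ∈ U) (S : Set Λ) :
    insert p S ∩ U = insert p (S ∩ U) := Set.insert_inter_of_mem hp

/-- On singular vectors, the nested Bethe vectors of the block of `L₂ L₁` are those of the product
of the blocks. -/
lemma BV_blockD_mul (h₂ : RLL P U L₂) (hc : ∀ p p' a b c d, Commute (L₁ p a b) (L₂ p' c d))
    {l₂ : Λ → Fin (n + 2) → K} {v : A} (hv₂ : ∀ p ∈ U, IsSing (L₂ p) (l₂ p) v)
    (m : List Λ) {ls : Fin n → List Λ} (hls : Distinct ls) (hU : ∀ a, ∀ p ∈ ls a, p ∈ U) :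
    BV P n ls (dressD P m (blockD fun p => L₂ p * L₁ p)) * Matrix.single 0 0 v
      = BV P n ls (dressD P m fun p => blockD L₂ p * blockD L₁ p) * Matrix.single 0 0 v := by
  -- The identity map intertwines the two families where the first columns of `L₂` vanish for the
  -- labels not yet used. The families differ by a term through the index `0`, in which a
  -- first-column entry of `L₂` can be brought next to the vector.
  have h : Intertwines (LinearMap.id : A →ₗ[K] A) (fun S => colKer K L₂ (S ∩ U)) U
      (blockD fun p => L₂ p * L₁ p) (fun p => blockD L₂ p * blockD L₁ p) := by
    intro S p hp hpS w hw a b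
    simp only [insert_inter_of_mem hp] at hw
    have e : (blockD fun p => L₂ p * L₁ p) p a b * w
        = (blockD L₂ p * blockD L₁ p : Matrix (Fin (n + 1)) (Fin (n + 1)) A) a b * w := by
      rw [blockD, Matrix.submatrix_apply, Matrix.mul_apply, Matrix.mul_apply, Fin.sum_univ_succ,
        add_mul, ← (hc p p 0 b.succ a.succ 0).eq, mul_assoc, hw p (Set.mem_insert _ _) a, mul_zero,
        zero_add]
      rfl
    refine ⟨?_, e⟩
    rw [e, Matrix.mul_apply, Finset.sum_mul]
    refine Submodule.sum_mem _ fun c _ => ?_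
    rw [mul_assoc]
    exact blockD_mem_colKer h₂ Set.inter_subset_right hp (fun h => hpS h.1)
      (mul_mem_colKer_of_commute (fun r a b => hc _ _ _ _ _ _) hw) a c
  have := (BV_intertwine (P := P) (h.dressD (P := P) m) hls (S := ∅) hU (by simp)
    (w := Matrix.single 0 0 v) ?_).2
  · have e : (LinearMap.id : A →ₗ[K] A).mapMatrix (m := Λ → Fin (n + 1)) (n := Λ → Fin (n + 1))
        = LinearMap.id := by ext; rfl
    rwa [e] at this
  · intro f g
    rw [Matrix.single_apply]
    split_ifs
    · exact fun r hr a => (hv₂ r hr.2).1 0 a.succ a.succ_pos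
    · exact Submodule.zero_mem _

/-- The blocks of `L₁` move through the next nesting level and distribute the dressing. -/
lemma legProd_blockD_mul_BV {D₁ D₂ : Λ → Matrix (Fin (n + 1)) (Fin (n + 1)) A} (h₁ : RLL P U D₁)
    (hc : ∀ p p' a b c d, Commute (D₁ p a b) (D₂ p' c d)) {H T : List Λ} (hT : T.Nodup)
    (hTH : ∀ j ∈ T, j ∉ H) (hTU : ∀ i ∈ T, i ∈ U) {ls : Fin n → List Λ} (hls : Distinct ls)
    (hU : ∀ a, ∀ p ∈ ls a, p ∈ U) (hlT : ∀ a, ∀ p ∈ ls a, p ∉ T) :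
    legProd D₁ T * BV P n ls (dressD P (H ++ T) fun p => D₂ p * D₁ p)
      = BV P n ls (fun p => dressD P T D₂ p * dressD P H D₁ p) * legProd D₁ T := by
  refine BV_semiconj (U := {p | p ∈ U ∧ p ∉ T}) (fun p hp a b => ?_) hls
    fun a p hp => ⟨hU a p hp, hlT a p hp⟩
  set J := Λ → Fin (n + 1)
  set y := legProd D₁ T
  have e1 := legProd_dress_comm h₁ hT hTU hp.1 hp.2
  have c1 : Commute (diagHom K (Matrix J J A) (Fin (n + 1)) y) ((D₂ p).map (diagHom K A J)) :=
    diagHom_commute fun c d => (commute_legProd_right fun i _ =>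
      diagHom_commute_leg (K := K) fun a' b' => (hc i p a' b' c d).symm).symm
  have c2 : Commute (diagHom K (Matrix J J A) (Fin (n + 1)) y)
      ((chainR P (n + 1) p H).map (kHom K A J)) :=
    diagHom_commute fun c d => (commute_legProd_right fun i hi =>
      commute_chainR_leg (hTH i hi) p c d _).symm
  have e : diagHom K (Matrix J J A) (Fin (n + 1)) y
        * dressD P (H ++ T) (fun p => D₂ p * D₁ p) p
      = (dressD P T D₂ p * dressD P H D₁ p) * diagHom K (Matrix J J A) (Fin (n + 1)) y := by
    unfold dressD
    rw [chainR_append, Matrix.map_mul, Matrix.map_mul]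
    set Y := diagHom K (Matrix J J A) (Fin (n + 1)) y
    set E₁ := (D₁ p).map (diagHom K A J)
    set E₂ := (D₂ p).map (diagHom K A J)
    set CT := (chainR P (n + 1) p T).map (kHom K A J)
    set CH := (chainR P (n + 1) p H).map (kHom K A J)
    -- In `chainR` the later part `T` of the list stands to the left, next to `E₁`. Passing `Y`
    -- interchanges these two, so that `CT` joins `E₂` while `CH` stays with `E₁`.
    calc _ = Y * E₂ * (E₁ * CT) * CH := by simp only [mul_assoc]
      _ = E₂ * (Y * (E₁ * CT)) * CH := by rw [c1.eq]; simp only [mul_assoc]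
      _ = E₂ * (CT * E₁) * (Y * CH) := by rw [e1]; simp only [mul_assoc]
      _ = _ := by rw [c2.eq]; simp only [mul_assoc]
  have := congrFun (congrFun e a) b
  rwa [diagHom_mul_apply, mul_diagHom_apply] at this

/-- The corners of `L₂` move through the next nesting level. -/
lemma corner_mul_BV (h₂ : RLL P U L₂) (hc : ∀ p p' a b c d, Commute (L₁ p a b) (L₂ p' c d))
    {l₂ : Λ → Fin (n + 2) → K} {v : A} (hv₂ : ∀ p ∈ U, IsSing (L₂ p) (l₂ p) v) (H T : List Λ)
    {m : List Λ} (hm : ∀ i ∈ m, i ∈ U) {ls : Fin n → List Λ} (hls : Distinct ls)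
    (hU : ∀ a, ∀ p ∈ ls a, p ∈ U) (hlm : ∀ a, ∀ p ∈ ls a, p ∉ m) :
    diagHom K A (Λ → Fin (n + 1)) (m.map fun p => L₂ p 0 0).prod
        * (BV P n ls (fun p => dressD P T (blockD L₂) p * dressD P H (blockD L₁) p)
          * Matrix.single 0 0 v)
      = (m.map fun p => l₂ p 0).prod • (BV P n ls (fun p => dressD P T (blockD L₂) p
          * dressD P H (blockD L₁) p) * Matrix.single 0 0 v) := by
  induction m with
  | nil => simp
  | cons i m ih =>
    have hi : i ∈ U := hm i (by simp)
    rw [List.map_cons, List.prod_cons, List.map_cons, List.prod_cons, map_mul, mul_assoc,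
      ih (fun j hj => hm j (by simp [hj])) (fun a p hp h => hlm a p hp (by simp [h])),
      mul_smul_comm, mul_comm (l₂ i 0), ← smul_smul]
    congr 1
    -- The label `i` is never used up by the Bethe vector, so the kernel condition for it is kept
    -- throughout; `corner_mul_blockD` needs it for both labels.
    have k₂ : Intertwines (LinearMap.mulLeft K (L₂ i 0 0)) (fun S => colKer K L₂ (insert i S ∩ U))
        {p | p ∈ U ∧ p ≠ i} (blockD L₂) (blockD L₂) := by
      intro S p hp hpS w hw a b
      simp only [insert_inter_of_mem hi, insert_inter_of_mem hp.1] at hw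
      rw [Set.insert_comm] at hw
      refine ⟨?_, ?_⟩
      · simp only [insert_inter_of_mem hi]
        refine blockD_mem_colKer h₂ (Set.insert_subset hi Set.inter_subset_right) hp.1 ?_ hw a b
        rintro (h | h)
        · exact hp.2 h
        · exact hpS h.1
      · exact corner_mul_blockD h₂ hp.1 hi hp.2 (fun r hr => hw r (by
          rcases hr with rfl | rfl <;> simp)) a b
    have k₁ : ∀ S : Set Λ, Intertwines (LinearMap.mulLeft K (L₂ i 0 0))
        (fun _ => colKer K L₂ (insert i S ∩ U)) {p | p ∈ U ∧ p ≠ i} (blockD L₁) (blockD L₁) := by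
      intro S _ p hp _ w hw a b
      refine ⟨mul_mem_colKer_of_commute (fun r a b => hc _ _ _ _ _ _) hw, ?_⟩
      rw [LinearMap.mulLeft_apply, LinearMap.mulLeft_apply, ← mul_assoc, ← mul_assoc]
      exact congrArg (· * w) (hc p i a.succ b.succ 0 0).symm.eq
    have k := (k₂.dressD (P := P) T).mul fun S => (k₁ S).dressD (P := P) H
    have e := (BV_intertwine (P := P) k hls (S := ∅)
      (fun a p hp => ⟨hU a p hp, fun h => hlm a p hp (by simp [h])⟩) (by simp)
      (w := Matrix.single 0 0 v) ?_).2
    · have e0 : ∀ X : Matrix (Λ → Fin (n + 1)) (Λ → Fin (n + 1)) A,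
          (LinearMap.mulLeft K (L₂ i 0 0)).mapMatrix X
            = diagHom K A (Λ → Fin (n + 1)) (L₂ i 0 0) * X := fun X => by
        ext f g
        rw [diagHom_mul_apply]; rfl
      rw [e0, e0, diagHom_mul_single, (hv₂ i hi).2 0, ← Matrix.smul_single, mul_smul_comm] at e
      exact e
    · intro f g
      rw [Matrix.single_apply]
      split_ifs
      · exact fun r hr a => (hv₂ r hr.2).1 0 a.succ a.succ_pos
      · exact Submodule.zero_mem _

lemma sum_piFinset_succ {M β : Type*} [AddCommMonoid M] [DecidableEq β] {n : ℕ}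
    (s : Fin (n + 1) → Finset β) (F : (Fin (n + 1) → β) → M) :
    ∑ I ∈ Fintype.piFinset s, F I
      = ∑ x ∈ s 0, ∑ I ∈ Fintype.piFinset fun a : Fin n => s a.succ, F (Fin.cons x I) := by
  rw [← Finset.sum_product']
  refine Finset.sum_bij' (fun I _ => (I 0, fun a => I a.succ)) (fun y _ => Fin.cons y.1 y.2)
    ?_ ?_ ?_ ?_ ?_
  · intro I hI
    rw [Fintype.mem_piFinset] at hI
    simp [hI]
  · rintro ⟨x, I⟩ h
    rw [Finset.mem_product, Fintype.mem_piFinset] at h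
    rw [Fintype.mem_piFinset]
    exact Fin.cases h.1 h.2
  · exact fun I _ => Fin.cons_self_tail I
  · exact fun _ _ => rfl
  · exact fun I _ => by rw [show Fin.cons (I 0) (fun a : Fin n => I a.succ) = I from
      Fin.cons_self_tail I]

variable (P) in
/-- The coefficients of the coproduct formula. -/
def splitCoeff : (n : ℕ) → (Fin n → List Λ) → (Fin n → Finset Λ) → (Λ → Fin (n + 1) → K) →
    (Λ → Fin (n + 1) → K) → K
  | 0, _, _, _, _ => 1
  | n + 1, ls, I, d₁, d₂ =>
    (blockCoeff P (ls 0) (I 0))⁻¹ * (((tailL (ls 0) (I 0)).map fun p => d₁ p 1).prod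
      * ((headL (ls 0) (I 0)).reverse.map fun p => d₂ p 0).prod
      * splitCoeff n (fun a => ls a.succ) (fun a => I a.succ)
        (fun p a => d₁ p a.succ * chainEig P (headL (ls 0) (I 0)) p a)
        (fun p a => d₂ p a.succ * chainEig P (tailL (ls 0) (I 0)) p a))

/-- The coproduct formula for nested Bethe vectors. -/
theorem BV_mul {n : ℕ} {A : Type u} [Ring A] [Algebra K A] {U : Set Λ}
    {L₁ L₂ : Λ → Matrix (Fin (n + 1)) (Fin (n + 1)) A} (h₁ : RLL P U L₁) (h₂ : RLL P U L₂)
    (hc : ∀ p p' a b c d, Commute (L₁ p a b) (L₂ p' c d)) {d₁ d₂ : Λ → Fin (n + 1) → K} {v : A}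
    (hv₁ : ∀ p ∈ U, IsSing (L₁ p) (d₁ p) v) (hv₂ : ∀ p ∈ U, IsSing (L₂ p) (d₂ p) v)
    {ls : Fin n → List Λ} (hls : Distinct ls) (hU : ∀ a, ∀ p ∈ ls a, p ∈ U) :
    BV P n ls (fun p => L₂ p * L₁ p) * v
      = ∑ I ∈ Fintype.piFinset fun a => (ls a).toFinset.powerset, splitCoeff P n ls I d₁ d₂ •
        (BV P n (fun a => headL (ls a) (I a)) L₁ * BV P n (fun a => tailL (ls a) (I a)) L₂ * v) := by
  induction n generalizing A U with
  | zero => simp [BV, splitCoeff]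
  | succ n ih =>
    set l := ls 0 with hl_def
    have hl : l.Nodup := hls.nodup 0
    have hlU : ∀ p ∈ l, p ∈ U := hU 0
    set ls' : Fin n → List Λ := fun a => ls a.succ with hls'_def
    have hls' : Distinct ls' := hls.tail
    have hU' : ∀ a, ∀ p ∈ ls' a, p ∈ U := fun a => hU a.succ
    have hdis : ∀ a, ∀ p ∈ ls' a, p ∉ l := fun a p hp => hls.disjoint _ _ (Fin.succ_ne_zero a) p hp
    obtain ⟨X, hX, hsplit⟩ := exists_headB_split h₁ h₂ hc hl hlU
    rw [sum_piFinset_succ]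
    -- The vector of the next level: `v` together with the first basis vector in every tensor
    -- factor. It is singular for the dressed blocks.
    set v' : Matrix (Λ → Fin (n + 1)) (Λ → Fin (n + 1)) A := Matrix.single 0 0 v with hv'
    have e0 : BV P (n + 1) ls (fun p => L₂ p * L₁ p) * v
        = (legProd (headB fun p => L₂ p * L₁ p) l *
          (BV P n ls' (dressD P l (blockD fun p => L₂ p * L₁ p)) * v') : Matrix (Λ → Fin (n + 1)) (Λ → Fin (n + 1)) A) 0 0 := by
      rw [← mul_assoc, hv', mul_single_apply, BV]
    have e1 : (legProd (headB fun p => L₂ p * L₁ p) l *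
          (BV P n ls' (dressD P l (blockD fun p => L₂ p * L₁ p)) * v') : Matrix (Λ → Fin (n + 1)) (Λ → Fin (n + 1)) A) 0 0
        = ∑ I ∈ l.toFinset.powerset, (blockCoeff P l I)⁻¹ • (legProd (headB L₂) (tailL l I)
        * diagHom K A (Λ → Fin (n + 1)) ((headL l I).reverse.map fun p => L₂ p 0 0).prod
        * legProd (headB L₁) (headL l I) * legProd (blockD L₁) (tailL l I)
        * kHom K A (Λ → Fin (n + 1)) (X I)
        * (BV P n ls' (dressD P l (blockD fun p => L₂ p * L₁ p)) * v') : Matrix (Λ → Fin (n + 1)) (Λ → Fin (n + 1)) A) 0 0 := by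
      rw [Matrix.mul_apply]
      simp only [hsplit, Finset.sum_mul, smul_mul_assoc]
      rw [Finset.sum_comm]
      simp only [← Finset.smul_sum, ← Matrix.mul_apply]
    rw [e0, e1]
    refine Finset.sum_congr rfl fun I _ => ?_
    set H := headL l I with hH
    set T := tailL l I with hT
    have ndH : H.Nodup := hl.filter _
    have ndT : T.Nodup := hl.filter _
    have hTH : ∀ j ∈ T, j ∉ H := fun j hj hj' => (mem_tailL.mp hj).2 (mem_headL.mp hj').2
    have hHl : ∀ j ∈ H, j ∈ l := fun j hj => (mem_headL.mp hj).1
    have hTl : ∀ j ∈ T, j ∈ l := fun j hj => (mem_tailL.mp hj).1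
    -- The labels of this level now dress the matrices of the next one, and the dressing eigenvalues
    -- `auxEig` are meaningful only for other labels.
    set W : Set Λ := {p | p ∈ U ∧ p ∉ l} with hW
    have hWU : ∀ a, ∀ p ∈ ls' a, p ∈ W := fun a p hp => ⟨hU' a p hp, hdis a p hp⟩
    set M₁ := dressD P H (blockD L₁) with hM₁
    set M₂ := dressD P T (blockD L₂) with hM₂
    -- the exchange matrix
    have s1 : kHom K A (Λ → Fin (n + 1)) (X I) * (BV P n ls' (dressD P l (blockD fun p => L₂ p * L₁ p)) * v')
        = BV P n ls' (dressD P (H ++ T) (blockD fun p => L₂ p * L₁ p)) * v' := by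
      have k1 := BV_semiconj (P := P) (U := U) (ls := ls') (fun p _ a b =>
        (hX I).dressD hl (blockD fun p => L₂ p * L₁ p) p a b) hls' hU'
      have k2 : kHom K A (Λ → Fin (n + 1)) (X I) * v' = v' := by
        rw [hv', kHom_mul_single (c := (1 : K)), one_smul]
        intro f
        rw [((hX I).const_apply hl (f := 0) (fun _ _ _ _ => rfl) f).2, Matrix.one_apply]
      rw [← mul_assoc, k1, mul_assoc, k2]
    have s2 : BV P n ls' (dressD P (H ++ T) (blockD fun p => L₂ p * L₁ p)) * v'
        = BV P n ls' (dressD P (H ++ T) fun p => blockD L₂ p * blockD L₁ p) * v' :=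
      BV_blockD_mul h₂ hc hv₂ _ hls' hU'
    -- From here on the dressing is split: `L₁` carries the R-matrices of `H` and `L₂` those of `T`,
    -- so the induction hypothesis applies to two commuting families.
    have s3 : legProd (blockD L₁) T
          * BV P n ls' (dressD P (H ++ T) fun p => blockD L₂ p * blockD L₁ p)
        = BV P n ls' (fun p => M₂ p * M₁ p) * legProd (blockD L₁) T :=
      legProd_blockD_mul_BV h₁.block (fun p p' a b c d => hc _ _ _ _ _ _) ndT hTH
        (fun i hi => hlU i (hTl i hi)) hls' hU' fun a p hp h => hdis a p hp (hTl p h)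
    have s4 : legProd (blockD L₁) T * v' = (T.map fun p => d₁ p 1).prod • v' := by
      refine legProd_mul_single (fun p hp => ?_) 0
      have hp' := (hv₁ p (hlU p (hTl p hp))).block
      exact ⟨fun b hb => hp'.1 0 b (Fin.pos_of_ne_zero hb), hp'.2 0⟩
    have s5 : diagHom K A (Λ → Fin (n + 1)) (H.reverse.map fun p => L₂ p 0 0).prod
          * (BV P n ls' (fun p => M₂ p * M₁ p) * v')
        = (H.reverse.map fun p => d₂ p 0).prod • (BV P n ls' (fun p => M₂ p * M₁ p) * v') :=
      corner_mul_BV h₂ hc hv₂ H T (fun i hi => hlU i (hHl i (List.mem_reverse.mp hi))) hls' hU'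
        fun a p hp h => hdis a p hp (hHl p (List.mem_reverse.mp h))
    have hcM : ∀ p p' a b c d, Commute (M₁ p a b) (M₂ p' c d) :=
      commute_dressD_dressD (fun p p' a b c d => hc _ _ _ _ _ _) hTH
    have s6 := ih (U := W) (L₁ := M₁) (L₂ := M₂) (v := v')
      (fun p hp p' hp' => h₁.block.dress ndH p hp.1 p' hp'.1)
      (fun p hp p' hp' => h₂.block.dress ndT p hp.1 p' hp'.1) hcM
      (fun p hp => isSing_dressD (P := P) (hv₁ p hp.1).block ndH (fun h => hp.2 (hHl p h)) 0)
      (fun p hp => isSing_dressD (P := P) (hv₂ p hp.1).block ndT (fun h => hp.2 (hTl p h)) 0)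
      hls' hWU
    have hB : ∀ p p' a b c d, Commute (headB L₁ p a b) (blockD L₂ p' c d) := by
      intro p p' a b c d
      simp only [headB, Matrix.of_apply]
      split_ifs
      · exact hc _ _ _ _ _ _
      · exact Commute.zero_left _
    have hB' : ∀ p p' a b c d, Commute (blockD L₁ p a b) (headB L₂ p' c d) := by
      intro p p' a b c d
      simp only [headB, Matrix.of_apply]
      split_ifs
      · exact hc _ _ _ _ _ _
      · exact Commute.zero_right _
    have hBB : ∀ p p' a b c d, Commute (headB L₁ p a b) (headB L₂ p' c d) := by
      intro p p' a b c d
      simp only [headB, Matrix.of_apply]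
      split_ifs
      · exact hc _ _ _ _ _ _
      · exact Commute.zero_right _
      · exact Commute.zero_left _
      · exact Commute.zero_left _
    have cA : Commute (diagHom K A (Λ → Fin (n + 1)) (H.reverse.map fun p => L₂ p 0 0).prod)
        (legProd (headB L₁) H) := by
      refine commute_legProd_right fun i _ => diagHom_commute_leg fun b c => ?_
      refine Commute.list_prod_left _ _ fun y hy => ?_
      obtain ⟨p, _, rfl⟩ := List.mem_map.mp hy
      simp only [headB, Matrix.of_apply]
      split_ifs
      · exact (hc _ _ _ _ _ _).symm
      · exact Commute.zero_right _
    have cB : Commute (legProd (headB L₁) H) (legProd (headB L₂) T) :=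
      commute_legProd_legProd hBB hTH
    have s7 : legProd (headB L₂) T * diagHom K A (Λ → Fin (n + 1)) (H.reverse.map fun p => L₂ p 0 0).prod
        * legProd (headB L₁) H * legProd (blockD L₁) T * kHom K A (Λ → Fin (n + 1)) (X I)
        * (BV P n ls' (dressD P l (blockD fun p => L₂ p * L₁ p)) * v')
        = ((T.map fun p => d₁ p 1).prod * (H.reverse.map fun p => d₂ p 0).prod) •
          (legProd (headB L₂) T * legProd (headB L₁) H
            * (BV P n ls' (fun p => M₂ p * M₁ p) * v')) := by
      set a := diagHom K A (Λ → Fin (n + 1)) (H.reverse.map fun p => L₂ p 0 0).prod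
      set B₂ := legProd (headB L₂) T
      set B₁ := legProd (headB L₁) H
      set D₁ := legProd (blockD L₁) T
      calc _ = B₂ * a * B₁ * D₁ * (kHom K A (Λ → Fin (n + 1)) (X I)
            * (BV P n ls' (dressD P l (blockD fun p => L₂ p * L₁ p)) * v')) := by
            simp only [mul_assoc]
        _ = B₂ * (a * B₁) * (D₁ * BV P n ls' (dressD P (H ++ T)
            fun p => blockD L₂ p * blockD L₁ p) * v') := by
            rw [s1, s2]; simp only [mul_assoc]
        _ = B₂ * B₁ * (a * (BV P n ls' (fun p => M₂ p * M₁ p) * (D₁ * v'))) := by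
            rw [s3, cA.eq]; simp only [mul_assoc]
        _ = _ := by rw [s4, mul_smul_comm, mul_smul_comm, s5, smul_smul, mul_smul_comm]
    rw [s7, s6, Matrix.smul_apply, Finset.mul_sum, Matrix.sum_apply, Finset.smul_sum,
      Finset.smul_sum]
    refine Finset.sum_congr rfl fun I' hI' => ?_
    rw [Fintype.mem_piFinset] at hI'
    have dH : Distinct fun a => headL (ls' a) (I' a) :=
      ⟨fun a => (hls'.nodup a).filter _, fun a b hab p hp hp' =>
        hls'.disjoint a b hab p (mem_headL.mp hp).1 (mem_headL.mp hp').1⟩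
    have dT : Distinct fun a => tailL (ls' a) (I' a) :=
      ⟨fun a => (hls'.nodup a).filter _, fun a b hab p hp hp' =>
        hls'.disjoint a b hab p (mem_tailL.mp hp).1 (mem_tailL.mp hp').1⟩
    have cC : Commute (legProd (headB L₂) T) (BV P n (fun a => headL (ls' a) (I' a)) M₁) :=
      BV_commute (U := Set.univ) (fun p _ a b => commute_legProd_dressD hB' hTH p a b) dH (by simp)
    have fin : legProd (headB L₂) T * legProd (headB L₁) H
        * (BV P n (fun a => headL (ls' a) (I' a)) M₁
          * BV P n (fun a => tailL (ls' a) (I' a)) M₂ * v')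
        = (legProd (headB L₁) H * BV P n (fun a => headL (ls' a) (I' a)) M₁)
          * (legProd (headB L₂) T * BV P n (fun a => tailL (ls' a) (I' a)) M₂) * v' := by
      rw [← cB.eq]
      calc _ = legProd (headB L₁) H * (legProd (headB L₂) T
            * BV P n (fun a => headL (ls' a) (I' a)) M₁)
            * BV P n (fun a => tailL (ls' a) (I' a)) M₂ * v' := by simp only [mul_assoc]
        _ = _ := by rw [cC.eq]; simp only [mul_assoc]
    -- The head part acts in the factors from `H` and the tail part in those from `T`, so the corner
    -- of their product is the product of the corners, and each corner is a Bethe vector of the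
    -- original level.
    have hP : legProd (headB L₁) H * BV P n (fun a => headL (ls' a) (I' a)) M₁
        ∈ legSupp K A (n + 1) {p | p ∈ H} :=
      mul_mem (legProd_mem_legSupp _ fun _ h => h) (BV_dressD_mem_legSupp (fun _ h => h) _ dH)
    have hQ : legProd (headB L₂) T * BV P n (fun a => tailL (ls' a) (I' a)) M₂
        ∈ legSupp K A (n + 1) {p | p ∈ T} :=
      mul_mem (legProd_mem_legSupp _ fun _ h => h) (BV_dressD_mem_legSupp (fun _ h => h) _ dT)
    rw [mul_smul_comm, fin, Matrix.smul_apply, hv', mul_single_apply,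
      legSupp_mul_apply (fun i hi hi' => hTH i hi' hi) hP hQ, smul_smul, smul_smul,
      mul_assoc (blockCoeff P l I)⁻¹]
    simp only [splitCoeff, BV, Fin.cons_zero, Fin.cons_succ]
    rfl

end Split

end

end QLoop

namespace QLoop

noncomputable section

set_option linter.unusedSectionVars false

/-! ### Nested Bethe vectors as matrix entries -/

section Nesting

universe u

variable {Λ : Type} [Fintype Λ] [DecidableEq Λ] {K : Type*} [Field K] {P : Par Λ K} {N n m : ℕ}
  {A : Type u} [Ring A] [Algebra K A]

/-! #### Two copies of the tensor product -/

open Classical in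
/-- A pair of indices, of which the first one is read at the places from `S` and the second one
at the other places. -/
def doubleEval (N : ℕ) (S : Set Λ) : PartialEval ((Λ → Fin N) × (Λ → Fin N)) (Λ → Fin N) where
  ev γ r := if r ∈ S then γ.1 r else γ.2 r
  rel γ γ' := (∀ r, r ∉ S → γ.1 r = γ'.1 r) ∧ ∀ r, r ∈ S → γ.2 r = γ'.2 r
  ins γ b := (fun r => if r ∈ S then b r else γ.1 r, fun r => if r ∈ S then γ.2 r else b r)
  rel_equiv := ⟨fun _ => ⟨fun _ _ => rfl, fun _ _ => rfl⟩,
    fun h => ⟨fun r hr => (h.1 r hr).symm, fun r hr => (h.2 r hr).symm⟩,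
    fun h h' => ⟨fun r hr => (h.1 r hr).trans (h'.1 r hr),
      fun r hr => (h.2 r hr).trans (h'.2 r hr)⟩⟩
  rel_ins γ b := ⟨fun r hr => by simp [hr], fun r hr => by simp [hr]⟩
  ev_ins γ b := by
    funext r
    by_cases hr : r ∈ S <;> simp [hr]
  ins_ev γ γ' h := by
    refine Prod.ext (funext fun r => ?_) (funext fun r => ?_)
    · by_cases hr : r ∈ S
      · simp [hr]
      · simp [hr, h.1 r hr]
    · by_cases hr : r ∈ S
      · simp [hr, h.2 r hr]
      · simp [hr]

/-- The matrix `X` acts as the matrix of matrices `Y`, whose outer indices are those from `S`. -/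
def Matches (S : Set Λ) (X : Matrix (Λ → Fin N) (Λ → Fin N) A)
    (Y : Matrix (Λ → Fin N) (Λ → Fin N) (Matrix (Λ → Fin N) (Λ → Fin N) A)) : Prop :=
  ∀ g g' i i', Y g g' i i' = embMat (doubleEval N S) X (g, i) (g', i')

lemma Matches.mul {S : Set Λ} {X X' : Matrix (Λ → Fin N) (Λ → Fin N) A}
    {Y Y' : Matrix (Λ → Fin N) (Λ → Fin N) (Matrix (Λ → Fin N) (Λ → Fin N) A)}
    (h : Matches S X Y) (h' : Matches S X' Y') : Matches S (X * X') (Y * Y') := by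
  intro g g' i i'
  rw [embMat_mul, Matrix.mul_apply, Matrix.mul_apply, Matrix.sum_apply, Fintype.sum_prod_type]
  refine Finset.sum_congr rfl fun k _ => ?_
  rw [Matrix.mul_apply]
  exact Finset.sum_congr rfl fun k' _ => by rw [h, h']

lemma matches_one (S : Set Λ) :
    Matches (A := A) S (1 : Matrix (Λ → Fin N) (Λ → Fin N) A) 1 := by
  intro g g' i i'
  rw [embMat_one, Matrix.one_apply, Matrix.one_apply]
  by_cases h : g = g'
  · by_cases h' : i = i' <;> simp [h, h', Matrix.one_apply]
  · simp [h]

lemma Matches.list_prod {S : Set Λ} {ι : Type*} {l : List ι}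
    {X : ι → Matrix (Λ → Fin N) (Λ → Fin N) A}
    {Y : ι → Matrix (Λ → Fin N) (Λ → Fin N) (Matrix (Λ → Fin N) (Λ → Fin N) A)}
    (h : ∀ i ∈ l, Matches S (X i) (Y i)) : Matches S (l.map X).prod (l.map Y).prod := by
  induction l with
  | nil => exact matches_one S
  | cons i l ih =>
    rw [List.map_cons, List.prod_cons, List.map_cons, List.prod_cons]
    exact (h i (by simp)).mul (ih fun j hj => h j (by simp [hj]))

/-- Agreement in the unread copies together with agreement of the read values on `Z` is sorted by
copy. This describes matrices acting in a few factors, `Z` being the complement of these. -/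
lemma doubleEval_cond {S : Set Λ} {Z : Λ → Prop} {g g' i i' : Λ → Fin N} :
    ((doubleEval N S).rel (g, i) (g', i') ∧
      ∀ r, Z r → (doubleEval N S).ev (g, i) r = (doubleEval N S).ev (g', i') r) ↔
    (∀ r, (r ∈ S → Z r) → g r = g' r) ∧ ∀ r, (r ∉ S → Z r) → i r = i' r := by
  simp only [doubleEval]
  constructor
  · rintro ⟨⟨h1, h2⟩, h3⟩
    refine ⟨fun r hr => ?_, fun r hr => ?_⟩
    · by_cases hS : r ∈ S
      · simpa [hS] using h3 r (hr hS)
      · exact h1 r hS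
    · by_cases hS : r ∈ S
      · exact h2 r hS
      · simpa [hS] using h3 r (hr hS)
  · rintro ⟨h1, h2⟩
    refine ⟨⟨fun r hr => h1 r fun h => absurd h hr, fun r hr => h2 r fun h => absurd hr h⟩,
      fun r hr => ?_⟩
    rw [h1 r fun _ => hr, h2 r fun _ => hr]

lemma doubleEval_ev_mem {S : Set Λ} {p : Λ} (hp : p ∈ S) (g i : Λ → Fin N) :
    (doubleEval N S).ev (g, i) p = g p := if_pos hp

lemma doubleEval_ev_not_mem {S : Set Λ} {p : Λ} (hp : p ∉ S) (g i : Λ → Fin N) :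
    (doubleEval N S).ev (g, i) p = i p := if_neg hp

open Classical in
lemma embMat_doubleEval_leg {S : Set Λ} {p : Λ} (M : Matrix (Fin N) (Fin N) A)
    (g g' i i' : Λ → Fin N) : embMat (doubleEval N S) (leg p M) (g, i) (g', i')
      = if (∀ r, (r ∈ S → r ≠ p) → g r = g' r) ∧ ∀ r, (r ∉ S → r ≠ p) → i r = i' r then
        M ((doubleEval N S).ev (g, i) p) ((doubleEval N S).ev (g', i') p) else 0 := by
  simp only [embMat, leg, Matrix.of_apply]
  by_cases h : (∀ r, (r ∈ S → r ≠ p) → g r = g' r) ∧ ∀ r, (r ∉ S → r ≠ p) → i r = i' r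
  · have h' := doubleEval_cond.mpr h
    rw [if_pos h, if_pos h'.1, if_pos h'.2]
  · rw [if_neg h]
    split_ifs with h1 h2
    · exact absurd (doubleEval_cond.mp ⟨h1, h2⟩) h
    · rfl
    · rfl

open Classical in
lemma embMat_doubleEval_leg₂ {S : Set Λ} {p p' : Λ}
    (M : Matrix (Fin N × Fin N) (Fin N × Fin N) A)
    (g g' i i' : Λ → Fin N) : embMat (doubleEval N S) (leg₂ p p' M) (g, i) (g', i')
      = if (∀ r, (r ∈ S → r ≠ p ∧ r ≠ p') → g r = g' r) ∧
          ∀ r, (r ∉ S → r ≠ p ∧ r ≠ p') → i r = i' r then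
        M ((doubleEval N S).ev (g, i) p, (doubleEval N S).ev (g, i) p')
          ((doubleEval N S).ev (g', i') p, (doubleEval N S).ev (g', i') p') else 0 := by
  simp only [embMat, leg₂, Matrix.of_apply, ← and_imp]
  by_cases h : (∀ r, (r ∈ S → r ≠ p ∧ r ≠ p') → g r = g' r) ∧
      ∀ r, (r ∉ S → r ≠ p ∧ r ≠ p') → i r = i' r
  · have h' := doubleEval_cond.mpr h
    rw [if_pos h, if_pos h'.1, if_pos h'.2]
  · rw [if_neg h]
    split_ifs with h1 h2
    · exact absurd (doubleEval_cond.mp ⟨h1, h2⟩) h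
    · rfl
    · rfl

lemma matches_leg_inner {S : Set Λ} {p : Λ} (hp : p ∉ S) (M : Matrix (Fin N) (Fin N) A) :
    Matches S (leg p M) (diagHom K (Matrix (Λ → Fin N) (Λ → Fin N) A) (Λ → Fin N) (leg p M)) := by
  intro g g' i i'
  have h1 : (∀ r, (r ∈ S → r ≠ p) → g r = g' r) ↔ g = g' :=
    ⟨fun h => funext fun r => h r fun hr e => hp (e ▸ hr), fun h r _ => congrFun h r⟩
  have h2 : (∀ r, (r ∉ S → r ≠ p) → i r = i' r) ↔ ∀ r, r ≠ p → i r = i' r :=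
    forall_congr' fun r => ⟨fun h hr => h fun _ => hr, fun h hr => h fun e => hr (e ▸ hp) e⟩
  rw [embMat_doubleEval_leg, doubleEval_ev_not_mem hp, doubleEval_ev_not_mem hp, diagHom_apply,
    Matrix.diagonal_apply]
  simp only [h1, h2, ite_and]
  split_ifs with h h'
  · exact if_pos h'
  · exact if_neg h'
  · rfl

lemma matches_leg_outer {S : Set Λ} {p : Λ} (hp : p ∈ S) (M : Matrix (Fin N) (Fin N) A) :
    Matches S (leg p M) (leg p (M.map (diagHom K A (Λ → Fin N)))) := by
  intro g g' i i'
  have h1 : (∀ r, (r ∉ S → r ≠ p) → i r = i' r) ↔ i = i' :=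
    ⟨fun h => funext fun r => h r fun hr e => hr (e ▸ hp), fun h r _ => congrFun h r⟩
  have h2 : (∀ r, (r ∈ S → r ≠ p) → g r = g' r) ↔ ∀ r, r ≠ p → g r = g' r :=
    forall_congr' fun r => ⟨fun h hr => h fun _ => hr, fun h hr => h fun e => hr (e ▸ hp) e⟩
  rw [embMat_doubleEval_leg, doubleEval_ev_mem hp, doubleEval_ev_mem hp]
  simp only [h1, h2, ite_and, leg, Matrix.of_apply]
  split_ifs with h h'
  · rw [Matrix.map_apply, diagHom_apply, Matrix.diagonal_apply, if_pos h']
  · rw [Matrix.map_apply, diagHom_apply, Matrix.diagonal_apply, if_neg h']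
  · rfl

lemma kHom_leg₂ (p p' : Λ) (M : Matrix (Fin N × Fin N) (Fin N × Fin N) K) :
    kHom K A (Λ → Fin N) (leg₂ p p' M) = leg₂ p p' (M.map (algebraMap K A)) :=
  leg₂_map _ (map_zero _) _ _ _

lemma matches_kHom_leg₂_outer {S : Set Λ} {p p' : Λ} (hp : p ∈ S) (hp' : p' ∈ S)
    (M : Matrix (Fin N × Fin N) (Fin N × Fin N) K) :
    Matches S (kHom K A (Λ → Fin N) (leg₂ p p' M))
      (kHom K (Matrix (Λ → Fin N) (Λ → Fin N) A) (Λ → Fin N) (leg₂ p p' M)) := by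
  intro g g' i i'
  have h1 : (∀ r, (r ∉ S → r ≠ p ∧ r ≠ p') → i r = i' r) ↔ i = i' :=
    ⟨fun h => funext fun r => h r fun hr => ⟨fun e => hr (e ▸ hp), fun e => hr (e ▸ hp')⟩,
      fun h r _ => congrFun h r⟩
  have h2 : (∀ r, (r ∈ S → r ≠ p ∧ r ≠ p') → g r = g' r)
      ↔ ∀ r, r ≠ p → r ≠ p' → g r = g' r :=
    forall_congr' fun r => ⟨fun h hr hr' => h fun _ => ⟨hr, hr'⟩, fun h hr =>
      h (fun e => (hr (e ▸ hp)).1 e) fun e => (hr (e ▸ hp')).2 e⟩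
  rw [kHom_leg₂, kHom_leg₂, embMat_doubleEval_leg₂]
  simp only [h1, h2, ite_and, leg₂, Matrix.of_apply, doubleEval_ev_mem hp, doubleEval_ev_mem hp']
  split_ifs with h h'
  · rw [Matrix.map_apply, Matrix.algebraMap_matrix_apply, if_pos h', Matrix.map_apply]
  · rw [Matrix.map_apply, Matrix.algebraMap_matrix_apply, if_neg h']
  · rfl

variable (P) in
/-- The R-matrix acting in the tensor factors `j`, `p`, in the normalization of `auxR`. -/
def Rtil (N : ℕ) (j p : Λ) : Matrix (Λ → Fin N) (Λ → Fin N) K :=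
  (P.x j - P.x p)⁻¹ • leg₂ j p (RM N P.Q (P.x j) (P.x p))

lemma Rtil_eq (N : ℕ) (j p : Λ) : Rtil P N j p
    = leg₂ j p ((P.x j - P.x p)⁻¹ • RM N P.Q (P.x j) (P.x p)) := by
  rw [leg₂_smul, Rtil]

/-- An R-matrix joining an outer and an inner factor is, from the outside, a one-factor matrix whose
entries act in the inner factor: exactly a dressing factor. -/
lemma matches_Rtil {S : Set Λ} {j p : Λ} (hj : j ∈ S) (hp : p ∉ S) :
    Matches S (kHom K A (Λ → Fin N) (Rtil P N j p))
      (leg j ((auxR P N j p).map (kHom K A (Λ → Fin N)))) := by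
  intro g g' i i'
  have h1 : (∀ r, (r ∈ S → r ≠ j ∧ r ≠ p) → g r = g' r) ↔ ∀ r, r ≠ j → g r = g' r :=
    forall_congr' fun r => ⟨fun h hr => h fun hS => ⟨hr, fun e => hp (e ▸ hS)⟩,
      fun h hr => h fun e => (hr (e ▸ hj)).1 e⟩
  have h2 : (∀ r, (r ∉ S → r ≠ j ∧ r ≠ p) → i r = i' r) ↔ ∀ r, r ≠ p → i r = i' r :=
    forall_congr' fun r => ⟨fun h hr => h fun hS => ⟨fun e => hS (e ▸ hj), hr⟩,
      fun h hr => h fun e => (hr (e ▸ hp)).2 e⟩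
  rw [Rtil_eq, kHom_leg₂, embMat_doubleEval_leg₂]
  simp only [h1, h2, ite_and, leg, Matrix.of_apply, doubleEval_ev_mem hj, doubleEval_ev_not_mem hp]
  split_ifs with h h'
  · rw [Matrix.map_apply, kHom_apply, auxR_apply, Matrix.smul_apply]
    simp only [leg, Matrix.of_apply, if_pos h', Laux, Matrix.map_apply, Matrix.smul_apply]
  · rw [Matrix.map_apply, kHom_apply, auxR_apply, Matrix.smul_apply]
    simp only [leg, Matrix.of_apply, if_neg h', smul_zero, map_zero]
  · rfl

/-! #### Products of R-matrices -/

variable (P) in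
/-- The product of the normalized R-matrices of a list. -/
def hatProd (N : ℕ) : List Λ → Matrix (Λ → Fin N) (Λ → Fin N) K
  | [] => 1
  | i :: l => thruInv P N i l * hatProd N l

variable (P) in
/-- The product of the matrices `Rtil` of `p` and the members of a list. -/
def tilRow (N : ℕ) (p : Λ) (l : List Λ) : Matrix (Λ → Fin N) (Λ → Fin N) K :=
  (l.map fun j => Rtil P N j p).prod

variable (P) in
/-- The product of the matrices `Rtil` of the members of two lists. -/
def tilProd (N : ℕ) (l l' : List Λ) : Matrix (Λ → Fin N) (Λ → Fin N) K :=
  (l.map fun p => tilRow P N p l').prod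

/-- The concatenation of a family of lists. -/
def flat : {n : ℕ} → (Fin n → List Λ) → List Λ
  | 0, _ => []
  | _ + 1, ls => ls 0 ++ flat fun a => ls a.succ

variable (P) in
/-- The ordered product of the R-matrices of a family of lists. -/
def nestR (N : ℕ) : {n : ℕ} → (Fin n → List Λ) → Matrix (Λ → Fin N) (Λ → Fin N) K
  | 0, _ => 1
  | _ + 1, ls => hatProd P N (ls 0) * tilProd P N (ls 0) (flat fun a => ls a.succ)
      * nestR N fun a => ls a.succ

lemma mem_flat {ls : Fin n → List Λ} {p : Λ} : p ∈ flat ls ↔ ∃ a, p ∈ ls a := by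
  induction n with
  | zero => simp [flat]
  | succ n ih => rw [flat, List.mem_append, ih, Fin.exists_fin_succ]

lemma Distinct.nodup_flat {ls : Fin n → List Λ} (h : Distinct ls) : (flat ls).Nodup := by
  induction n with
  | zero => simp [flat]
  | succ n ih =>
    rw [flat, List.nodup_append]
    refine ⟨h.nodup 0, ih h.tail, fun p hp p' hp' e => ?_⟩
    obtain ⟨a, ha⟩ := mem_flat.mp hp'
    exact h.disjoint _ _ (Fin.succ_ne_zero a) p' ha (e ▸ hp)

lemma exch_hatProd (l : List Λ) : Exch P N l.reverse l (hatProd P N l) := by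
  induction l with
  | nil => exact .refl _
  | cons i l ih =>
    rw [List.reverse_cons]
    have := ih.append [] [i]
    rw [List.nil_append, List.nil_append] at this
    exact this.trans (exch_thruInv P N i l)

lemma isLocal_Rtil {l : List Λ} {i j : Λ} (hij : i ≠ j) (hi : i ∈ l) (hj : j ∈ l) :
    IsLocal l (Rtil P N i j) := by
  rw [Rtil_eq]; exact .leg₂ i j hi hj hij _

lemma IsLocal.list_prod {l : List Λ} {ι : Type*} {l' : List ι}
    {X : ι → Matrix (Λ → Fin N) (Λ → Fin N) K} (h : ∀ i ∈ l', IsLocal l (X i)) :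
    IsLocal l (l'.map X).prod := by
  induction l' with
  | nil => exact .one
  | cons i l' ih =>
    rw [List.map_cons, List.prod_cons]
    exact .mul _ _ (h i (by simp)) (ih fun j hj => h j (by simp [hj]))

lemma isLocal_tilRow {p : Λ} {l : List Λ} (hp : p ∉ l) : IsLocal (p :: l) (tilRow P N p l) :=
  IsLocal.list_prod fun j hj => isLocal_Rtil (fun e => hp (e ▸ hj)) (by simp [hj]) (by simp)

lemma isLocal_tilCol {j : Λ} {l : List Λ} (hj : j ∉ l) :
    IsLocal (j :: l) (l.map fun p => Rtil P N j p).prod :=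
  IsLocal.list_prod fun p hp => isLocal_Rtil (fun e => hj (e ▸ hp)) (by simp) (by simp [hp])

/-- The double product is arranged by rows; R-matrices with no common label commute, which lets the
column of `j` be collected on the left. -/
lemma tilProd_cons_right {l l' : List Λ} {j : Λ} (hl : l.Nodup) (hj : j ∉ l')
    (hl' : ∀ p ∈ l, p ∉ j :: l') :
    tilProd P N l (j :: l') = (l.map fun p => Rtil P N j p).prod * tilProd P N l l' := by
  induction l with
  | nil => simp [tilProd]
  | cons p l ih =>
    obtain ⟨hp, hl⟩ := List.nodup_cons.mp hl
    have hp' := hl' p (by simp)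
    simp only [List.mem_cons, not_or] at hp'
    have c : Commute (tilRow P N p l') (l.map fun p => Rtil P N j p).prod := by
      refine Commute.list_prod_right _ _ fun Y hY => ?_
      obtain ⟨r, hr, rfl⟩ := List.mem_map.mp hY
      have hr' := hl' r (by simp [hr])
      simp only [List.mem_cons, not_or] at hr'
      rw [Rtil_eq]
      refine (isLocal_tilRow hp'.2).commute_leg₂ (Ne.symm hr'.1) ?_ ?_ _
      · simp [Ne.symm hp'.1, hj]
      · simp only [List.mem_cons, not_or]
        exact ⟨fun e => hp (e ▸ hr), hr'.2⟩
    have ih := ih hl fun r hr => hl' r (by simp [hr])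
    unfold tilProd at ih ⊢
    rw [List.map_cons, List.prod_cons, ih, List.map_cons, List.prod_cons, List.map_cons,
      List.prod_cons]
    have e : tilRow P N p (j :: l') = Rtil P N j p * tilRow P N p l' := by simp [tilRow]
    rw [e]
    set C := (l.map fun p => Rtil P N j p).prod
    calc _ = Rtil P N j p * (tilRow P N p l' * C) * (l.map fun p => tilRow P N p l').prod := by
          simp only [mul_assoc]
      _ = _ := by rw [c.eq]; simp only [mul_assoc]

/-! #### Restriction to the indices without the first value -/

/-- `X'` is the restriction of `X` to the span of the basis vectors with positive indices. -/
def Restricts (X : Matrix (Λ → Fin (m + 1)) (Λ → Fin (m + 1)) K)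
    (X' : Matrix (Λ → Fin m) (Λ → Fin m) K) : Prop :=
  (∀ f g, X (Fin.succ ∘ f) (Fin.succ ∘ g) = X' f g) ∧
    ∀ f g, (¬ ∃ f' : Λ → Fin m, f = Fin.succ ∘ f') → X f (Fin.succ ∘ g) = 0

lemma restricts_one : Restricts (1 : Matrix (Λ → Fin (m + 1)) (Λ → Fin (m + 1)) K) 1 := by
  refine ⟨fun f g => ?_, fun f g hf => Matrix.one_apply_ne fun h => hf ⟨g, h⟩⟩
  rw [Matrix.one_apply, Matrix.one_apply]
  simp only [(Fin.succ_injective _).comp_left.eq_iff]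

lemma Restricts.mul_apply {X : Matrix (Λ → Fin (m + 1)) (Λ → Fin (m + 1)) K}
    {X' : Matrix (Λ → Fin m) (Λ → Fin m) K} (h : Restricts X X')
    (Y : Matrix (Λ → Fin (m + 1)) (Λ → Fin (m + 1)) A) (f : Λ → Fin (m + 1)) (g : Λ → Fin m) :
    (Y * kHom K A (Λ → Fin (m + 1)) X) f (Fin.succ ∘ g)
      = ∑ k : Λ → Fin m, Y f (Fin.succ ∘ k) * algebraMap K A (X' k g) := by
  rw [Matrix.mul_apply]
  symm
  refine Fintype.sum_of_injective (fun f : Λ → Fin m => Fin.succ ∘ f)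
    (Fin.succ_injective _).comp_left _ _ (fun k hk => ?_) fun k => ?_
  · rw [kHom_apply, h.2 k g (fun ⟨f', hf'⟩ => hk ⟨f', hf'.symm⟩), map_zero, mul_zero]
  · rw [kHom_apply, h.1]

lemma Restricts.mul {X Y : Matrix (Λ → Fin (m + 1)) (Λ → Fin (m + 1)) K}
    {X' Y' : Matrix (Λ → Fin m) (Λ → Fin m) K} (hX : Restricts X X') (hY : Restricts Y Y') :
    Restricts (X * Y) (X' * Y') := by
  have e : ∀ f g, (X * Y) f (Fin.succ ∘ g) = ∑ k : Λ → Fin m, X f (Fin.succ ∘ k) * Y' k g :=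
    fun f g => by
      have := hY.mul_apply X f g
      rwa [kHom_eq, kMap, Algebra.algebraMap_self, RingHom.coe_id, Matrix.map_id] at this
  refine ⟨fun f g => ?_, fun f g hf => ?_⟩
  · rw [e, Matrix.mul_apply]
    exact Finset.sum_congr rfl fun k _ => by rw [hX.1]
  · rw [e]
    exact Finset.sum_eq_zero fun k _ => by rw [hX.2 f k hf, zero_mul]

/-- As in `Exch.restrict`: the R-matrix permutes indices, and its coefficients depend only on their
order. The scalar is arbitrary, so both normalizations are covered. -/
lemma restricts_leg₂ {i j : Λ} (hij : i ≠ j) (c Q u v : K) :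
    Restricts (c • leg₂ i j (RM (m + 1) Q u v)) (c • leg₂ i j (RM m Q u v)) := by
  constructor
  · intro f g
    simp [leg₂, RM, wR, gR, dl]
  · intro f g hf
    rw [Matrix.smul_apply]
    by_contra h0
    rcases leg₂_RM_apply_ne_zero hij (right_ne_zero_of_smul h0) with h1 | h1
    · exact hf ⟨g, h1.symm⟩
    · refine hf ⟨g ∘ Equiv.swap i j, ?_⟩
      rw [← Function.comp_assoc, h1, Function.comp_assoc]; simp [← Equiv.coe_trans]

lemma Restricts.list_prod {ι : Type*} {l : List ι}
    {X : ι → Matrix (Λ → Fin (m + 1)) (Λ → Fin (m + 1)) K}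
    {X' : ι → Matrix (Λ → Fin m) (Λ → Fin m) K} (h : ∀ i ∈ l, Restricts (X i) (X' i)) :
    Restricts (l.map X).prod (l.map X').prod := by
  induction l with
  | nil => exact restricts_one
  | cons i l ih =>
    rw [List.map_cons, List.prod_cons, List.map_cons, List.prod_cons]
    exact (h i (by simp)).mul (ih fun j hj => h j (by simp [hj]))

lemma restricts_thruInv {k : Λ} {l : List Λ} (hk : k ∉ l) :
    Restricts (thruInv P (m + 1) k l) (thruInv P m k l) := by
  induction l with
  | nil => exact restricts_one
  | cons j l ih =>
    simp only [List.mem_cons, not_or] at hk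
    exact (restricts_leg₂ (Ne.symm hk.1) _ _ _ _).mul (ih hk.2)

lemma restricts_hatProd {l : List Λ} (hl : l.Nodup) :
    Restricts (hatProd P (m + 1) l) (hatProd P m l) := by
  induction l with
  | nil => exact restricts_one
  | cons j l ih =>
    obtain ⟨hj, hl⟩ := List.nodup_cons.mp hl
    exact (restricts_thruInv hj).mul (ih hl)

lemma restricts_tilProd {l l' : List Λ} (h : ∀ p ∈ l, p ∉ l') :
    Restricts (tilProd P (m + 1) l l') (tilProd P m l l') :=
  Restricts.list_prod fun p hp => Restricts.list_prod fun j hj =>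
    restricts_leg₂ (fun e : j = p => h p hp (e ▸ hj)) _ _ _ _

lemma Distinct.not_mem_flat {ls : Fin (n + 1) → List Λ} (h : Distinct ls) :
    ∀ p ∈ ls 0, p ∉ flat fun a => ls a.succ := by
  intro p hp hp'
  obtain ⟨a, ha⟩ := mem_flat.mp hp'
  exact h.disjoint _ _ (Fin.succ_ne_zero a) p ha hp

lemma restricts_nestR {ls : Fin n → List Λ} (h : Distinct ls) :
    Restricts (nestR P (m + 1) ls) (nestR P m ls) := by
  induction n with
  | zero => exact restricts_one
  | succ n ih =>
    exact ((restricts_hatProd (h.nodup 0)).mul (restricts_tilProd h.not_mem_flat)).mul (ih h.tail)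

lemma matches_kHom_nestR {S : Set Λ} {ls : Fin n → List Λ} (h : Distinct ls)
    (hS : ∀ a, ∀ p ∈ ls a, p ∈ S) :
    Matches S (kHom K A (Λ → Fin N) (nestR P N ls))
      (kHom K (Matrix (Λ → Fin N) (Λ → Fin N) A) (Λ → Fin N) (nestR P N ls)) := by
  induction n with
  | zero =>
    simp only [nestR, map_one]
    exact matches_one S
  | succ n ih =>
    have h1 : ∀ l : List Λ, l.Nodup → (∀ p ∈ l, p ∈ S) →
        Matches S (kHom K A (Λ → Fin N) (hatProd P N l))
          (kHom K (Matrix (Λ → Fin N) (Λ → Fin N) A) (Λ → Fin N) (hatProd P N l)) := by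
      intro l hl hlS
      induction l with
      | nil =>
        simp only [hatProd, map_one]
        exact matches_one S
      | cons i l ih =>
        obtain ⟨hi, hl₁⟩ := List.nodup_cons.mp hl
        simp only [hatProd, map_mul]
        refine Matches.mul ?_ (ih hl₁ fun p hp => hlS p (by simp [hp]))
        have hi' := hlS i (by simp)
        have hl' : ∀ p ∈ l, p ∈ S := fun p hp => hlS p (by simp [hp])
        clear ih hl hl₁ hlS hi
        induction l with
        | nil =>
          simp only [thruInv, map_one]
          exact matches_one S
        | cons j l ih =>
          simp only [thruInv, map_mul, Rhat_eq]
          exact (matches_kHom_leg₂_outer (hl' j (by simp)) hi' _).mul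
            (ih fun p hp => hl' p (by simp [hp]))
    simp only [nestR, map_mul]
    refine ((h1 _ (h.nodup 0) (hS 0)).mul ?_).mul (ih h.tail fun a => hS a.succ)
    unfold tilProd tilRow
    rw [map_list_prod, map_list_prod, List.map_map, List.map_map]
    refine Matches.list_prod fun p hp => ?_
    simp only [Function.comp_apply]
    rw [map_list_prod, map_list_prod, List.map_map, List.map_map]
    refine Matches.list_prod fun j hj => ?_
    obtain ⟨a, ha⟩ := mem_flat.mp hj
    simp only [Function.comp_apply, Rtil_eq]
    exact matches_kHom_leg₂_outer (hS _ j ha) (hS 0 p hp) _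

/-! #### The nesting -/

/-- The list is reversed because `chainR` multiplies the later members of its list on the left. -/
lemma matches_dressD {S : Set Λ} {j : Λ} (hj : j ∈ S) {l : List Λ} (hl : ∀ p ∈ l, p ∉ S)
    (D : Λ → Matrix (Fin N) (Fin N) A) :
    Matches S (leg j (D j) * kHom K A (Λ → Fin N) (l.map fun p => Rtil P N j p).prod)
      (leg j (dressD P l.reverse D j)) := by
  rw [dressD, leg_mul]
  refine (matches_leg_outer hj _).mul ?_
  induction l with
  | nil =>
    simp only [List.map_nil, List.prod_nil, map_one, List.reverse_nil, chainR]
    rw [Matrix.map_one _ (map_zero _) (map_one _), leg_one]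
    exact matches_one S
  | cons p l ih =>
    rw [List.map_cons, List.prod_cons, map_mul, List.reverse_cons, chainR_append, Matrix.map_mul,
      leg_mul]
    refine Matches.mul ?_ (ih fun r hr => hl r (by simp [hr]))
    rw [chainR, chainR, one_mul]
    exact matches_Rtil hj (hl p (by simp))

/-- The R-matrices are regrouped by columns, and each column is moved to the `L`-matrix with the
same label, past the `L`-matrices of the other labels. What results is a product of dressed
matrices. -/
lemma matches_legProd_dressD {S : Set Λ} {l l' : List Λ} (hl : l.Nodup) (hl' : l'.Nodup)
    (hS : ∀ p ∈ l, p ∉ S) (hS' : ∀ j ∈ l', j ∈ S) (D : Λ → Matrix (Fin N) (Fin N) A) :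
    Matches S (legProd D l' * kHom K A (Λ → Fin N) (tilProd P N l l'))
      (legProd (dressD P l.reverse D) l') := by
  have e : legProd D l' * kHom K A (Λ → Fin N) (tilProd P N l l')
      = (l'.map fun j => leg j (D j)
        * kHom K A (Λ → Fin N) (l.map fun p => Rtil P N j p).prod).prod := by
    induction l' with
    | nil =>
      have : tilProd P N l ([] : List Λ) = 1 := by
        unfold tilProd tilRow
        simp
      rw [this, map_one]; simp [legProd]
    | cons j l' ih =>
      obtain ⟨hj, hl'⟩ := List.nodup_cons.mp hl'
      have ih := ih hl' fun i hi => hS' i (by simp [hi])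
      have hjl : j ∉ l := fun h => hS j h (hS' j (by simp))
      have c : Commute (kHom K A (Λ → Fin N) (l.map fun p => Rtil P N j p).prod)
          (legProd D l') := by
        refine (isLocal_tilCol hjl).commute_legProd (fun i hi h => ?_) D
        rcases List.mem_cons.mp h with rfl | h
        · exact hj hi
        · exact hS i h (hS' i (by simp [hi]))
      rw [tilProd_cons_right hl hj fun p hp h => hS p hp (hS' p h), map_mul, legProd_cons,
        List.map_cons, List.prod_cons, ← ih]
      calc _ = leg j (D j) * (legProd D l' * kHom K A (Λ → Fin N)
            (l.map fun p => Rtil P N j p).prod) * kHom K A (Λ → Fin N) (tilProd P N l l') := by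
            simp only [mul_assoc]
        _ = _ := by rw [← c.eq]; simp only [mul_assoc]
  rw [e]
  exact Matches.list_prod fun j hj => matches_dressD (hS' j hj) hS D

lemma matches_legProd_inner {S : Set Λ} {l : List Λ} (hS : ∀ p ∈ l, p ∉ S)
    (B : Λ → Matrix (Fin N) (Fin N) A) :
    Matches S (legProd B l)
      (diagHom K (Matrix (Λ → Fin N) (Λ → Fin N) A) (Λ → Fin N) (legProd B l)) := by
  unfold legProd
  rw [← prod_diagHom]
  exact Matches.list_prod fun p hp => matches_leg_inner (hS p hp) _

/-- The nested Bethe vector is a matrix entry of a product of `L`-matrices and R-matrices. -/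
theorem legProd_mul_nestR_apply {n : ℕ} {A : Type u} [Ring A] [Algebra K A] {U : Set Λ}
    {L : Λ → Matrix (Fin (n + 1)) (Fin (n + 1)) A} (hL : RLL P U L) {ls : Fin n → List Λ}
    (hls : Distinct ls) (hU : ∀ a, ∀ p ∈ ls a, p ∈ U) {c s : Λ → Fin (n + 1)}
    (hcs : ∀ a, ∀ p ∈ ls a, c p = a.castSucc ∧ s p = a.succ)
    (hcs' : ∀ p, (∀ a, p ∉ ls a) → c p = 1 ∧ s p = 1) :
    (legProd L (flat ls) * kHom K A (Λ → Fin (n + 1)) (nestR P (n + 1) ls)) c s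
      = BV P n (fun a => (ls a).reverse) L := by
  induction n generalizing A with
  | zero =>
    have hc : c = s := funext fun r => Subsingleton.elim (α := Fin 1) _ _
    simp [flat, legProd, nestR, BV, hc]
  | succ n ih =>
    set l := ls 0 with hl_def
    set ls' : Fin n → List Λ := fun a => ls a.succ with hls'_def
    set l' := flat ls' with hl'_def
    have hl : l.Nodup := hls.nodup 0
    have hl' : l'.Nodup := hls.tail.nodup_flat
    have hdis : ∀ p ∈ l, p ∉ l' := hls.not_mem_flat
    have hrev : ∀ p, p ∈ l.reverse ↔ p ∈ l := fun p => List.mem_reverse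
    -- The R-matrices within the first level are moved to the far left, which reverses the order of
    -- its `L`-matrices. There they act on the row index `c`, constant on this level, and disappear
    -- (`e2`).
    have e1 : legProd L (flat ls) * kHom K A (Λ → Fin (n + 2)) (nestR P (n + 2) ls)
        = kHom K A (Λ → Fin (n + 2)) (hatProd P (n + 2) l) * (legProd L (l.reverse ++ l')
          * kHom K A (Λ → Fin (n + 2)) (tilProd P (n + 2) l l' * nestR P (n + 2) ls')) := by
      have hX := exch_hatProd (P := P) (N := n + 2) l
      have h1 := hX.legProd (List.nodup_reverse.mpr hl)
        (fun p hp => hU 0 p ((hrev p).mp hp)) hL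
      have h2 := (hX.isLocal (List.nodup_reverse.mpr hl)).commute_legProd (l' := l')
        (fun i hi h => hdis i ((hrev i).mp h) hi) L
      rw [← kHom_eq] at h1 h2
      rw [flat, nestR, legProd_append, legProd_append, map_mul, map_mul, map_mul]
      calc _ = legProd L l * (legProd L l' * kHom K A (Λ → Fin (n + 2)) (hatProd P (n + 2) l))
            * (kHom K A (Λ → Fin (n + 2)) (tilProd P (n + 2) l l')
              * kHom K A (Λ → Fin (n + 2)) (nestR P (n + 2) ls')) := by
              simp only [mul_assoc]; rfl
        _ = (legProd L l * kHom K A (Λ → Fin (n + 2)) (hatProd P (n + 2) l)) * legProd L l'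
            * (kHom K A (Λ → Fin (n + 2)) (tilProd P (n + 2) l l')
              * kHom K A (Λ → Fin (n + 2)) (nestR P (n + 2) ls')) := by
              rw [← h2.eq]; simp only [mul_assoc]
        _ = _ := by rw [← h1]; simp only [mul_assoc]
    have hc0 : ∀ p ∈ l, c p = 0 := fun p hp => (hcs 0 p hp).1
    have e2 : (legProd L (flat ls) * kHom K A (Λ → Fin (n + 2)) (nestR P (n + 2) ls)) c s
        = (legProd L (l.reverse ++ l') * kHom K A (Λ → Fin (n + 2))
          (tilProd P (n + 2) l l' * nestR P (n + 2) ls')) c s := by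
      rw [e1, Matrix.mul_apply, Finset.sum_eq_single c]
      · rw [kHom_apply, ((exch_hatProd (P := P) (N := n + 2) l).const_apply
          (List.nodup_reverse.mpr hl) (fun i hi j hj => by
            rw [hc0 i ((hrev i).mp hi), hc0 j ((hrev j).mp hj)]) c).1, Matrix.one_apply_eq, map_one,
          one_mul]
      · intro k _ hk
        rw [kHom_apply, ((exch_hatProd (P := P) (N := n + 2) l).const_apply
          (List.nodup_reverse.mpr hl) (fun i hi j hj => by
            rw [hc0 i ((hrev i).mp hi), hc0 j ((hrev j).mp hj)]) k).1,
          Matrix.one_apply_ne (Ne.symm hk), map_zero, zero_mul]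
      · simp
    -- the indices on the next level
    have key : ∀ p, p ∈ l ∨ (∃ a, p ∈ ls' a) ∨ ∀ a, p ∉ ls a := by
      intro p
      by_cases h : ∃ a, p ∈ ls a
      · obtain ⟨a, ha⟩ := h
        rcases Fin.eq_zero_or_eq_succ a with rfl | ⟨b, rfl⟩
        · exact Or.inl ha
        · exact Or.inr (Or.inl ⟨b, ha⟩)
      · exact Or.inr (Or.inr fun a ha => h ⟨a, ha⟩)
    have hs0 : ∀ p, s p ≠ 0 := by
      intro p
      rcases key p with h | ⟨a, h⟩ | h
      · rw [(hcs 0 p h).2]; exact Fin.succ_ne_zero _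
      · rw [(hcs a.succ p h).2]; exact Fin.succ_ne_zero _
      · rw [(hcs' p h).2]; exact Fin.succ_ne_zero (0 : Fin (n + 1))
    set s' : Λ → Fin (n + 1) := fun p => (s p).pred (hs0 p) with hs'
    have hss' : s = Fin.succ ∘ s' := by funext p; simp [hs']
    set c' : Λ → Fin (n + 1) := fun p => if h : c p = 0 then 0 else (c p).pred h with hc'
    have hcc' : ∀ p, p ∉ l → c p = (c' p).succ := by
      intro p hp
      have : c p ≠ 0 := by
        rcases key p with h | ⟨a, h⟩ | h
        · exact absurd h hp
        · rw [(hcs a.succ p h).1, Fin.castSucc_ne_zero_iff]; exact Fin.succ_ne_zero a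
        · rw [(hcs' p h).1]; exact Fin.succ_ne_zero (0 : Fin (n + 1))
      simp [hc', this]
    have hc'0 : ∀ p, p ∉ l' → c' p = 0 := by
      intro p hp
      rcases key p with h | ⟨a, h⟩ | h
      · simp [hc', hc0 p h]
      · exact absurd (mem_flat.mpr ⟨a, h⟩) hp
      · have := (hcs' p h).1
        have h1 : c p = Fin.succ (0 : Fin (n + 1)) := this
        simp [hc', h1]
    have hs'0 : ∀ p, p ∉ l' → s' p = 0 := by
      intro p hp
      have h1 : s p = Fin.succ (0 : Fin (n + 1)) := by
        rcases key p with h | ⟨a, h⟩ | h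
        · exact (hcs 0 p h).2
        · exact absurd (mem_flat.mpr ⟨a, h⟩) hp
        · exact (hcs' p h).2
      simp [hs', h1]
    have hcs1 : ∀ a, ∀ p ∈ ls' a, c' p = a.castSucc ∧ s' p = a.succ := by
      intro a p hp
      have hp' : p ∉ l := fun h => hdis p h (mem_flat.mpr ⟨a, hp⟩)
      refine ⟨Fin.succ_injective _ ?_, Fin.succ_injective _ ?_⟩
      · rw [← hcc' p hp', (hcs a.succ p hp).1, Fin.succ_castSucc]
      · rw [← (hcs a.succ p hp).2, hss']; rfl
    have nd : (l.reverse ++ l').Nodup := by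
      rw [List.nodup_append]
      exact ⟨List.nodup_reverse.mpr hl, hl', fun p hp p' hp' e =>
        hdis p ((hrev p).mp hp) (e ▸ hp')⟩
    -- At the first level the row index is `0` and the column index positive, which gives the first
    -- row without its corner. At the later levels both are positive, which gives the block.
    have e3 : ∀ k : Λ → Fin (n + 1), legProd L (l.reverse ++ l') c (Fin.succ ∘ k)
        = (legProd (headB L) l.reverse * legProd (blockD L) l') c' k := by
      intro k
      set X : Λ → Matrix (Fin (n + 1)) (Fin (n + 1)) A :=
        fun p => if p ∈ l then headB L p else blockD L p with hX
      have eX : legProd (headB L) l.reverse * legProd (blockD L) l'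
          = legProd X (l.reverse ++ l') := by
        rw [legProd_append]
        congr 1
        · exact congrArg List.prod (List.map_congr_left fun p hp => by
            simp [hX, (hrev p).mp hp])
        · exact congrArg List.prod (List.map_congr_left fun p hp => by
            have : p ∉ l := fun h => hdis p h hp
            simp [hX, this])
      rw [eX, legProd_apply _ nd, legProd_apply _ nd]
      have hcond : (∀ r, r ∉ l.reverse ++ l' → c r = (Fin.succ ∘ k) r)
          ↔ ∀ r, r ∉ l.reverse ++ l' → c' r = k r := by
        refine forall₂_congr fun r hr => ?_
        rw [List.mem_append, not_or, hrev] at hr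
        rw [hcc' r hr.1, Function.comp_apply, Fin.succ_inj]
      simp only [hcond]
      split_ifs
      · refine congrArg List.prod (List.map_congr_left fun p hp => ?_)
        rw [List.mem_append, hrev] at hp
        by_cases h : p ∈ l
        · have : c' p = 0 := hc'0 p (hdis p h)
          simp [hX, h, headB, this, hc0 p h]
        · simp [hX, h, blockD, hcc' p h]
      · rfl
    have e4 : (legProd L (flat ls) * kHom K A (Λ → Fin (n + 2)) (nestR P (n + 2) ls)) c s
        = (legProd (headB L) l.reverse * (legProd (blockD L) l'
          * kHom K A (Λ → Fin (n + 1)) (tilProd P (n + 1) l l')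
          * kHom K A (Λ → Fin (n + 1)) (nestR P (n + 1) ls'))) c' s' := by
      have hR : Restricts (tilProd P (n + 2) l l' * nestR P (n + 2) ls')
          (tilProd P (n + 1) l l' * nestR P (n + 1) ls') :=
        (restricts_tilProd hdis).mul (restricts_nestR hls.tail)
      rw [e2, hss', hR.mul_apply]
      simp only [e3]
      rw [mul_assoc, ← map_mul, ← mul_assoc, Matrix.mul_apply (M := legProd (headB L) l.reverse
        * legProd (blockD L) l')]
      rfl
    set S : Set Λ := {p | p ∈ l'} with hS
    -- The places of the later levels are taken as outer indices and those of the first level as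
    -- inner ones, so R-matrices between them become the dressing of the next level.
    have hM := (matches_legProd_inner (K := K) (S := S) (l := l.reverse)
      (fun p hp => hdis p ((hrev p).mp hp)) (headB L)).mul
      ((matches_legProd_dressD (P := P) (S := S) hl hl' hdis (fun j hj => hj) (blockD L)).mul
        (matches_kHom_nestR (P := P) (A := A) (S := S) hls.tail
          fun a p hp => mem_flat.mpr ⟨a, hp⟩))
    classical
    set c'' : Λ → Fin (n + 1) := fun p => if p ∈ l' then c' p else 1 with hc''
    set s'' : Λ → Fin (n + 1) := fun p => if p ∈ l' then s' p else 1 with hs''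
    have e5 := ih (A := Matrix (Λ → Fin (n + 1)) (Λ → Fin (n + 1)) A)
      (L := dressD P l.reverse (blockD L)) (hL.block.dress (List.nodup_reverse.mpr hl)) hls.tail
      (fun a => hU a.succ) (c := c'') (s := s'')
      (fun a p hp => by
        have hp' : p ∈ l' := mem_flat.mpr ⟨a, hp⟩
        simp only [hc'', hs'', if_pos hp']
        exact hcs1 a p hp)
      (fun p hp => by
        have hp' : p ∉ l' := fun h => by
          obtain ⟨a, ha⟩ := mem_flat.mp h
          exact hp a ha
        simp [hc'', hs'', hp'])
    have e6 := hM c'' s'' 0 0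
    rw [diagHom_mul_apply, e5] at e6
    have hev : ∀ (f f'' : Λ → Fin (n + 1)), (∀ p, p ∉ l' → f p = 0) →
        (∀ p, p ∈ l' → f'' p = f p) → (doubleEval (n + 1) S).ev (f'', 0) = f := by
      intro f f'' hf hf''
      funext p
      by_cases hp : p ∈ l'
      · simp [doubleEval, hS, hp, hf'' p hp]
      · simp [doubleEval, hS, hp, hf p hp]
    rw [e4, BV]
    refine Eq.trans ?_ e6.symm
    simp only [embMat, Matrix.of_apply]
    rw [if_pos, hev c' c'' hc'0 (fun p hp => by simp [hc'', hp]),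
      hev s' s'' hs'0 (fun p hp => by simp [hs'', hp])]
    refine ⟨fun r hr => ?_, fun r _ => rfl⟩
    have hr' : r ∉ l' := hr
    simp [hc'', hs'', hr']

end Nesting

end

end QLoop

namespace QLoop

noncomputable section

set_option linter.unusedSectionVars false

/-! ### Entries of the R-matrix -/

section Entries

variable {R : Type*} [CommRing R] [Algebra ℂ R] {N : ℕ} {q : ℂ}

lemma rMatHom_apply (u v : R) (a b c d : Fin N) :
    rMatHom N q u v (a, b) (c, d)
      = (if a = b then q • u - q⁻¹ • v else u - v) * ((if a = c then 1 else 0) * if b = d then 1 else 0)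
        + (if a = b then 0 else if a < b then (q - q⁻¹) • u else (q - q⁻¹) • v)
          * ((if a = d then 1 else 0) * if b = c then 1 else 0) := by
  have h1 : ∀ e f : Fin N → Fin N → R, (∑ x, ∑ y ∈ Finset.Ioi x, (e x y + f x y))
      = ∑ x, ∑ y ∈ Finset.Ioi x, e x y + ∑ x, ∑ y ∈ Finset.Ioi x, f x y := fun e f => by
    simp only [Finset.sum_add_distrib]
  have h2 : ∀ (C : Prop) [Decidable C] (x y : Fin N) (r : R),
      (∑ i, ∑ j ∈ Finset.Ioi i, if C ∧ i = x ∧ j = y then r else 0)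
        = if C ∧ x < y then r else 0 := fun C _ x y r => by
    rw [Finset.sum_eq_single x (fun i _ hi => Finset.sum_eq_zero fun j _ => if_neg fun h => hi h.2.1)
      (by simp)]
    by_cases hxy : x < y
    · rw [Finset.sum_eq_single y (fun j _ hj => if_neg fun h => hj h.2.2) (by simp [hxy])]
      simp [hxy]
    · rw [if_neg fun h => hxy h.2]
      refine Finset.sum_eq_zero fun j hj => if_neg fun h => hxy ?_
      rw [← h.2.2]
      exact Finset.mem_Ioi.mp hj
  have h2' : ∀ (C : Prop) [Decidable C] (x y : Fin N) (r : R),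
      (∑ i, ∑ j ∈ Finset.Ioi i, if C ∧ j = x ∧ i = y then r else 0)
        = if C ∧ y < x then r else 0 := fun C _ x y r => by
    simp only [and_comm (a := _ = x)]
    exact h2 C y x r
  have h0 : (∑ i : Fin N, if (i = a ∧ i = c) ∧ i = b ∧ i = d then (1 : R) else 0)
      = if a = c ∧ a = b ∧ a = d then 1 else 0 := by
    rw [Finset.sum_eq_single a (fun i _ hi => if_neg fun h => hi h.1.1) (by simp)]
    simp
  have hE : ∀ x y z w : Fin N, (matUnit N R x y ⊗ₖ matUnit N R z w) (a, b) (c, d)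
      = if (x = a ∧ y = c) ∧ z = b ∧ w = d then 1 else 0 := fun x y z w => by
    rw [Matrix.kroneckerMap_apply]
    simp only [matUnit, Matrix.single, Matrix.of_apply, ite_zero_mul_ite_zero, one_mul]
  have e1 : ∀ i j : Fin N, ((i = a ∧ i = c) ∧ j = b ∧ j = d) ↔ (a = c ∧ b = d) ∧ i = a ∧ j = b :=
    fun i j => by grind
  have e3 : ∀ i j : Fin N, ((i = a ∧ j = c) ∧ j = b ∧ i = d) ↔ (a = d ∧ b = c) ∧ i = a ∧ j = b :=
    fun i j => by grind
  have h3 : ∀ (w : R) (p : Fin N → Fin N → Prop) [∀ i j, Decidable (p i j)],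
      (∑ i, ∑ j ∈ Finset.Ioi i, w • (if p i j then (1 : R) else 0))
        = ∑ i, ∑ j ∈ Finset.Ioi i, if p i j then w else 0 := fun w p _ => by
    simp only [smul_eq_mul, mul_ite, mul_one, mul_zero]
  have h4 : ∀ (p p' : Prop) [Decidable p] [Decidable p'] (r : R),
      (if p' then if p then r else 0 else 0) = if p ∧ p' then r else 0 := fun p p' _ _ r => by
    by_cases hp : p <;> by_cases hp' : p' <;> simp [hp, hp']
  simp only [rMatHom, Matrix.add_apply, Matrix.smul_apply, Matrix.sum_apply, hE, h0, h1]
  simp only [h3, e1, e3, h2, h2']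
  rcases lt_trichotomy a b with h | h | h
  · simp only [h, h.ne, h.not_gt, and_true, and_false, false_and, if_true, if_false, smul_eq_mul,
      mul_zero, zero_add, add_zero, mul_ite, mul_one, smul_ite, smul_zero, h4]
  · subst h
    simp only [lt_irrefl, and_false, if_true, if_false, smul_eq_mul, mul_zero, add_zero, true_and,
      mul_ite, mul_one, smul_zero, h4, ite_self]
  · simp only [h, h.ne', h.not_gt, and_true, and_false, false_and, if_false, smul_eq_mul,
      mul_zero, zero_add, mul_ite, mul_one, smul_ite, smul_zero,
      h4]

/-- The field of series as the field of scalars: the R-matrix with constant quantum parameter. -/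
lemma rMatHom_eq_RM {σ : Type*} [Fintype σ] [LinearOrder σ] (u v : Ser σ ℂ) :
    rMatHom N q u v = RM N (HahnSeries.C q) u v := by
  ext ⟨a, b⟩ ⟨c, d⟩
  rw [rMatHom_apply]
  simp only [RM, Matrix.of_apply, wR, gR, dl, ← map_inv₀, ← map_sub, HahnSeries.C_mul_eq_smul]

end Entries

/-! ### Series with coefficients in an algebra as an algebra over the field of scalar series -/

section SerAlgebra

variable {σ : Type*} [Fintype σ] [LinearOrder σ] {B : Type*} [Ring B] [Algebra ℂ B]

lemma scal_coeff (x : Ser σ ℂ) (a : Expo σ) :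
    (scal B x).coeff a = algebraMap ℂ B (x.coeff a) := rfl

lemma commute_of_coeff {B : Type*} [Ring B] {x y : Ser σ B}
    (h : ∀ a b, Commute (x.coeff a) (y.coeff b)) : Commute x y := by
  refine HahnSeries.ext (funext fun a => ?_)
  rw [HahnSeries.coeff_mul, HahnSeries.coeff_mul]
  refine Finset.sum_nbij' (fun ij => (ij.2, ij.1)) (fun ij => (ij.2, ij.1)) ?_ ?_ ?_ ?_ ?_
  · simp only [Finset.mem_antidiagonal]
    exact fun ij h => ⟨h.2.1, h.1, by rw [add_comm]; exact h.2.2⟩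
  · simp only [Finset.mem_antidiagonal]
    exact fun ij h => ⟨h.2.1, h.1, by rw [add_comm]; exact h.2.2⟩
  · exact fun _ _ => rfl
  · exact fun _ _ => rfl
  · exact fun ij _ => (h ij.1 ij.2).eq

/-- The algebra structure over the field of scalar series. -/
instance (priority := low) serAlgebra : Algebra (Ser σ ℂ) (Ser σ B) :=
  (scal B).toAlgebra' fun _ _ => commute_of_coeff fun _ _ => Algebra.commutes _ _

lemma ser_smul_def (x : Ser σ ℂ) (y : Ser σ B) : x • y = scal B x * y := rfl

lemma scal_single (a : Expo σ) (c : ℂ) :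
    scal B (HahnSeries.single a c) = HahnSeries.single a (algebraMap ℂ B c) :=
  HahnSeries.map_single (algebraMap ℂ B).toMonoidWithZeroHom.toZeroHom

lemma single_smul_coeff (a b : Expo σ) (c : ℂ) (y : Ser σ B) :
    (HahnSeries.single a c • y : Ser σ B).coeff b = c • y.coeff (b - a) := by
  rw [ser_smul_def, scal_single, HahnSeries.coeff_single_mul, Algebra.smul_def]

lemma tvar_ne_zero (p : σ) : tvar p ≠ 0 := HahnSeries.single_ne_zero one_ne_zero

lemma tvar_inv (p : σ) : (tvar p)⁻¹ = HahnSeries.single (toLex (Pi.single p 1)) 1 := by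
  refine inv_eq_of_mul_eq_one_right ?_
  rw [tvar, HahnSeries.single_mul_single, ← toLex_add, neg_add_cancel, one_mul]
  rfl

lemma neg_single_injective : Function.Injective fun p : σ => (toLex (-Pi.single p 1) : Expo σ) := by
  intro p p' h
  by_contra hp
  have := congrFun (toLex.injective h) p
  simp [hp] at this

/-- The variables as spectral parameters. -/
def serPar {Λ : Type} {q : ℂ} (hq : q ≠ 0) {s : Λ → σ} (hs : Function.Injective s) :
    Par Λ (Ser σ ℂ) where
  Q := HahnSeries.C q
  x p := tvar (s p)
  Q_ne_zero := HahnSeries.C_ne_zero hq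
  x_ne i j hij h := by
    have := congrArg (fun x => HahnSeries.coeff x (toLex (-Pi.single (s i) 1))) h
    simp only [tvar, HahnSeries.coeff_single_same] at this
    rw [HahnSeries.coeff_single_of_ne fun e => hij (hs (neg_single_injective e))] at this
    exact one_ne_zero this
  -- Genericity of the formal variables: the coefficient of the variable at `i` in this expression
  -- is `q`, which is not zero.
  Qx_ne i j hij h := by
    have := congrArg (fun x => HahnSeries.coeff x (toLex (-Pi.single (s i) 1))) h
    simp only [tvar, ← map_inv₀, HahnSeries.C_mul_eq_smul, HahnSeries.coeff_sub,
      HahnSeries.coeff_smul, HahnSeries.coeff_single_same] at this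
    rw [HahnSeries.coeff_single_of_ne fun e => hij (hs (neg_single_injective e))] at this
    simp [hq] at this

end SerAlgebra

end

end QLoop

namespace QLoop

noncomputable section

set_option linter.unusedSectionVars false

/-! ### The RLL relation for the generating series -/

section SeriesRLL

variable {σ : Type*} [Fintype σ] [LinearOrder σ] {B : Type*} [Ring B]

/-- The exponent of `t_p^{-r} t_p'^{-s}`. -/
def expo₂ (p p' : σ) (r s : ℤ) : Expo σ := toLex (Pi.single p r + Pi.single p' s)

lemma expo₂_comm (p p' : σ) (r s : ℤ) : expo₂ p p' r s = expo₂ p' p s r := by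
  rw [expo₂, expo₂, add_comm]

lemma expo₂_inj {p p' : σ} (hp : p ≠ p') {r s r' s' : ℤ} (h : expo₂ p p' r s = expo₂ p p' r' s') :
    r = r' ∧ s = s' := by
  have h' := toLex.injective h
  have h1 := congrFun h' p
  have h2 := congrFun h' p'
  simp only [Pi.add_apply, Pi.single_eq_same, Pi.single_eq_of_ne hp, Pi.single_eq_of_ne hp.symm,
    add_zero, zero_add] at h1 h2
  exact ⟨h1, h2⟩

lemma expo₂_sub_left (p p' : σ) (r s : ℤ) :
    expo₂ p p' r s - toLex (Pi.single p 1) = expo₂ p p' (r - 1) s := by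
  rw [expo₂, expo₂, ← toLex_sub, Pi.single_sub]
  congr 1
  abel

lemma expo₂_sub_right (p p' : σ) (r s : ℤ) :
    expo₂ p p' r s - toLex (Pi.single p' 1) = expo₂ p p' r (s - 1) := by
  rw [expo₂_comm, expo₂_sub_left, expo₂_comm]

/-- `F` is the series obtained from `G` by the substitution `x = t_p⁻¹`, `y = t_p'⁻¹`. -/
structure Represents (p p' : σ) (F : Ser σ B) (G : PS2 B) : Prop where
  coeff : ∀ r s : ℕ, F.coeff (expo₂ p p' r s) = PowerSeries.coeff r (PowerSeries.coeff s G)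
  coeff_eq_zero : ∀ a, (∀ r s : ℕ, a ≠ expo₂ p p' r s) → F.coeff a = 0

variable {p p' : σ} {F F' : Ser σ B} {G G' : PS2 B}

lemma Represents.unique (h : Represents p p' F G) (h' : Represents p p' F' G) : F = F' := by
  refine HahnSeries.ext (funext fun a => ?_)
  by_cases ha : ∀ r s : ℕ, a ≠ expo₂ p p' r s
  · rw [h.coeff_eq_zero a ha, h'.coeff_eq_zero a ha]
  · push Not at ha
    obtain ⟨r, s, rfl⟩ := ha
    rw [h.coeff, h'.coeff]

lemma Represents.add (h : Represents p p' F G) (h' : Represents p p' F' G') :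
    Represents p p' (F + F') (G + G') where
  coeff r s := by simp only [HahnSeries.coeff_add, h.coeff, h'.coeff, map_add]
  coeff_eq_zero a ha := by
    rw [HahnSeries.coeff_add, h.coeff_eq_zero a ha, h'.coeff_eq_zero a ha, add_zero]

variable [Algebra ℂ B]

lemma mapPS2_smul_psY (c : ℂ) : mapPS2 (algebraMap ℂ B) (c • psY)
    = PowerSeries.X * PowerSeries.C (PowerSeries.C (algebraMap ℂ B c)) := by
  have : c • psY = PowerSeries.X * PowerSeries.C (PowerSeries.C c) := by
    refine PowerSeries.ext fun s => PowerSeries.ext fun r => ?_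
    rw [mul_comm, PowerSeries.coeff_C_mul, PowerSeries.coeff_C_mul]
    rfl
  rw [this, mapPS2, map_mul, PowerSeries.map_X, PowerSeries.map_C, PowerSeries.map_C]

lemma mapPS2_smul_psX (c : ℂ) : mapPS2 (algebraMap ℂ B) (c • psX)
    = PowerSeries.C (PowerSeries.X * PowerSeries.C (algebraMap ℂ B c)) := by
  have : c • psX = PowerSeries.C (PowerSeries.X * PowerSeries.C c) := by
    rw [mul_comm]
    refine PowerSeries.ext fun s => PowerSeries.ext fun r => ?_
    change c • PowerSeries.coeff r (PowerSeries.coeff s psX) = _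
    rw [psX, PowerSeries.coeff_C, PowerSeries.coeff_C]
    split_ifs
    · rw [PowerSeries.coeff_C_mul, smul_eq_mul]
    · simp
  rw [this, mapPS2, PowerSeries.map_C, map_mul, PowerSeries.map_X, PowerSeries.map_C]

/-- Multiplication by a monomial shifts exponents. In the boundary case `s = 0` the shifted exponent
is negative and lies outside the support, just as the coefficient of a multiple of the variable
vanishes. -/
lemma Represents.smul_right (hp : p ≠ p') (h : Represents p p' F G) (c : ℂ) :
    Represents p p' ((HahnSeries.single (toLex (Pi.single p' 1)) c : Ser σ ℂ) • F)
      (mapPS2 (algebraMap ℂ B) (c • psY) * G) where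
  coeff r s := by
    rw [single_smul_coeff, expo₂_sub_right, mapPS2_smul_psY, mul_assoc]
    rcases s with - | s
    · rw [PowerSeries.coeff_zero_X_mul, map_zero, h.coeff_eq_zero, smul_zero]
      intro r' s' he
      have := (expo₂_inj hp he).2
      omega
    · rw [PowerSeries.coeff_succ_X_mul, PowerSeries.coeff_C_mul, PowerSeries.coeff_C_mul,
        ← h.coeff, Algebra.smul_def]
      simp
  coeff_eq_zero a ha := by
    rw [single_smul_coeff, h.coeff_eq_zero, smul_zero]
    intro r s he
    refine ha r (s + 1 : ℕ) ?_
    rw [sub_eq_iff_eq_add.mp he, expo₂, expo₂, ← toLex_add, add_assoc, ← Pi.single_add]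
    simp

lemma Represents.smul_left (hp : p ≠ p') (h : Represents p p' F G) (c : ℂ) :
    Represents p p' ((HahnSeries.single (toLex (Pi.single p 1)) c : Ser σ ℂ) • F)
      (mapPS2 (algebraMap ℂ B) (c • psX) * G) where
  coeff r s := by
    rw [single_smul_coeff, expo₂_sub_left, mapPS2_smul_psX, PowerSeries.coeff_C_mul, mul_assoc]
    rcases r with - | r
    · rw [PowerSeries.coeff_zero_X_mul, h.coeff_eq_zero, smul_zero]
      intro r' s' he
      have := (expo₂_inj hp he).1
      omega
    · rw [PowerSeries.coeff_succ_X_mul, PowerSeries.coeff_C_mul,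
        ← h.coeff, Algebra.smul_def]
      simp
  coeff_eq_zero a ha := by
    rw [single_smul_coeff, h.coeff_eq_zero, smul_zero]
    intro r s he
    refine ha (r + 1 : ℕ) s ?_
    rw [sub_eq_iff_eq_add.mp he, expo₂, expo₂, ← toLex_add, add_right_comm, ← Pi.single_add]
    simp

/-- Multiplication by a linear polynomial in `t_p⁻¹` and `t_p'⁻¹`. -/
lemma Represents.linear_smul (hp : p ≠ p') (h : Represents p p' F G) (c d : ℂ) :
    Represents p p' ((c • (tvar p')⁻¹ + d • (tvar p)⁻¹ : Ser σ ℂ) • F)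
      (mapPS2 (algebraMap ℂ B) (c • psY + d • psX) * G) := by
  have e : ∀ (r : σ) (c : ℂ), c • (tvar r)⁻¹ = (HahnSeries.single (toLex (Pi.single r 1)) c : Ser σ ℂ) :=
    fun r c => by
      rw [tvar_inv]
      refine HahnSeries.ext (funext fun a => ?_)
      rw [HahnSeries.coeff_smul, HahnSeries.coeff_single, HahnSeries.coeff_single]
      split_ifs <;> simp
  rw [e, e, ser_smul_def, map_add, map_add, add_mul, add_mul]
  exact (h.smul_right hp c).add (h.smul_left hp d)

lemma seriesAt_coeff (c : ℕ → B) (r : ℕ) :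
    (seriesAt p c).coeff (toLex (Pi.single p (r : ℤ))) = c r :=
  HahnSeries.embDomain_coeff (f := expoEmb p)

lemma seriesAt_coeff_of_ne (c : ℕ → B) {a : Expo σ} (ha : ∀ r : ℕ, a ≠ toLex (Pi.single p (r : ℤ))) :
    (seriesAt p c).coeff a = 0 :=
  HahnSeries.embDomain_of_notMem_range (f := expoEmb p) fun ⟨r, h⟩ => ha r h.symm

lemma seriesAt_mul_coeff_eq_zero (c d : ℕ → B) {a : Expo σ}
    (ha : ∀ r s : ℕ, a ≠ expo₂ p p' r s) : (seriesAt p c * seriesAt p' d).coeff a = 0 := by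
  rw [HahnSeries.coeff_mul]
  refine Finset.sum_eq_zero fun ij hij => ?_
  by_contra h
  obtain ⟨r, hr⟩ : ∃ r : ℕ, ij.1 = toLex (Pi.single p (r : ℤ)) := by
    by_contra! h'
    rw [seriesAt_coeff_of_ne c h', zero_mul] at h
    exact h rfl
  obtain ⟨s, hs⟩ : ∃ s : ℕ, ij.2 = toLex (Pi.single p' (s : ℤ)) := by
    by_contra! h'
    rw [seriesAt_coeff_of_ne d h', mul_zero] at h
    exact h rfl
  refine ha r s ?_
  rw [← (Finset.mem_antidiagonal.mp hij).2.2, hr, hs]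
  rfl

lemma seriesAt_mul_coeff (hp : p ≠ p') (c d : ℕ → B) (r s : ℕ) :
    (seriesAt p c * seriesAt p' d).coeff (expo₂ p p' r s) = c r * d s := by
  rw [HahnSeries.coeff_mul, Finset.sum_eq_single (toLex (Pi.single p (r : ℤ)), toLex (Pi.single p' (s : ℤ)))]
  · rw [seriesAt_coeff, seriesAt_coeff]
  · intro ij hij hne
    by_contra h
    obtain ⟨r', hr⟩ : ∃ r : ℕ, ij.1 = toLex (Pi.single p (r : ℤ)) := by
      by_contra! h'
      rw [seriesAt_coeff_of_ne c h', zero_mul] at h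
      exact h rfl
    obtain ⟨s', hs⟩ : ∃ s : ℕ, ij.2 = toLex (Pi.single p' (s : ℤ)) := by
      by_contra! h'
      rw [seriesAt_coeff_of_ne d h', mul_zero] at h
      exact h rfl
    have h' := (Finset.mem_antidiagonal.mp hij).2.2
    rw [hr, hs] at h'
    obtain ⟨h1, h2⟩ := expo₂_inj (r := r') (s := s') (r' := r) (s' := s) hp h'
    exact hne (Prod.ext (by rw [hr, h1]) (by rw [hs, h2]))
  · intro h
    have : (seriesAt p c).coeff (toLex (Pi.single p (r : ℤ))) = 0
        ∨ (seriesAt p' d).coeff (toLex (Pi.single p' (s : ℤ))) = 0 := by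
      by_contra! h'
      exact h (Finset.mem_antidiagonal.mpr ⟨h'.1, h'.2, rfl⟩)
    rcases this with h' | h'
    · rw [h', zero_mul]
    · rw [h', mul_zero]

lemma represents_mul (hp : p ≠ p') (c d : ℕ → B) :
    Represents p p' (seriesAt p c * seriesAt p' d)
      (PowerSeries.C (PowerSeries.mk c) * PowerSeries.map PowerSeries.C (PowerSeries.mk d)) where
  coeff r s := by
    rw [seriesAt_mul_coeff hp, PowerSeries.coeff_C_mul, PowerSeries.coeff_map,
      PowerSeries.coeff_mul_C, PowerSeries.coeff_mk, PowerSeries.coeff_mk]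
  coeff_eq_zero a ha := seriesAt_mul_coeff_eq_zero _ _ ha

lemma represents_mul' (hp : p ≠ p') (c d : ℕ → B) :
    Represents p p' (seriesAt p' d * seriesAt p c)
      (PowerSeries.map PowerSeries.C (PowerSeries.mk d) * PowerSeries.C (PowerSeries.mk c)) where
  coeff r s := by
    rw [expo₂_comm, seriesAt_mul_coeff hp.symm, PowerSeries.coeff_mul_C, PowerSeries.coeff_map,
      PowerSeries.coeff_C_mul, PowerSeries.coeff_mk, PowerSeries.coeff_mk]
  coeff_eq_zero a ha := seriesAt_mul_coeff_eq_zero _ _ fun r s => by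
    rw [expo₂_comm]
    exact ha s r

/-- The homogeneous R-matrix has degree one in the spectral parameters. -/
lemma IsRLL.rescale {K A : Type*} [Field K] [Ring A] [Algebra K A] {N : ℕ} {Q u v c : K} (hc : c ≠ 0)
    {M M' : Matrix (Fin N) (Fin N) A} (h : IsRLL Q (c * u) (c * v) M M') : IsRLL Q u v M M' := by
  have hw : ∀ a b : Fin N, wR Q (c * u) (c * v) a b = c * wR Q u v a b := fun a b => by
    simp only [wR]
    split_ifs <;> ring
  have hg : ∀ a b : Fin N, gR Q (c * u) (c * v) a b = c * gR Q u v a b := fun a b => by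
    simp only [gR]
    split_ifs <;> ring
  rw [isRLL_iff] at h ⊢
  intro a b a' b'
  have := h a b a' b'
  simp only [hw, hg, mul_smul, ← smul_add] at this
  have := congrArg (c⁻¹ • ·) this
  simpa only [inv_smul_smul₀ hc] using this

end SeriesRLL

end

end QLoop

namespace QLoop

noncomputable section

set_option linter.unusedSectionVars false

/-! ### From the defining relations to RLL relations in Hahn series -/

section SeriesRLL

variable {σ : Type*} [Fintype σ] [LinearOrder σ] {B : Type*} [Ring B] [Algebra ℂ B] {N : ℕ} {q : ℂ}

lemma mapPS2_central (z : PS2 ℂ) (G : PS2 B) : Commute (mapPS2 (algebraMap ℂ B) z) G := by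
  have h := mapPS2_commute (Algebra.ofId ℂ B) (AlgHom.id ℂ B) (fun a b => Algebra.commutes a b) z G
  have e : mapPS2 ((AlgHom.id ℂ B : B →ₐ[ℂ] B) : B →+* B) G = G :=
    PowerSeries.ext fun s => PowerSeries.ext fun r => mapPS2_coeff _ _ _ _
  rwa [e] at h

lemma rllLeft_apply (u v : PS2 ℂ) (l l' : Fin N → Fin N → ℕ → B) (a b a' b' : Fin N) :
    rllLeft (rMatHom N q u v) l l' (a, b) (a', b')
      = mapPS2 (algebraMap ℂ B) (if a = b then q • u - q⁻¹ • v else u - v)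
          * (serX l a a' * serY l' b b')
        + mapPS2 (algebraMap ℂ B) (if a = b then 0 else if a < b then (q - q⁻¹) • u else (q - q⁻¹) • v)
          * (serX l b a' * serY l' a b') := by
  have h1 : (serX l ⊗ₖ (1 : Matrix (Fin N) (Fin N) (PS2 B))) * (1 ⊗ₖ serY l') = Matrix.of fun i j =>
      serX l i.1 j.1 * serY l' i.2 j.2 := by
    ext1 ⟨i, j⟩ ⟨k, m⟩
    simp [Matrix.mul_apply, Fintype.sum_prod_type, Matrix.one_apply]
  rw [rllLeft, mul_assoc, h1, Matrix.mul_apply, Fintype.sum_prod_type]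
  simp only [scalarPS2, Matrix.map_apply, rMatHom_apply, Matrix.of_apply, map_add, map_mul, add_mul,
    Finset.sum_add_distrib]
  congr 1
  · rw [Finset.sum_eq_single a, Finset.sum_eq_single b]
    · simp
    · intro f _ hf; simp [hf.symm]
    · simp
    · intro e _ he; simp [he.symm]
    · simp
  · rw [Finset.sum_eq_single b, Finset.sum_eq_single a]
    · simp
    · intro f _ hf; simp [hf.symm]
    · simp
    · intro e _ he; simp [he.symm]
    · simp

lemma rllRight_apply (u v : PS2 ℂ) (l l' : Fin N → Fin N → ℕ → B) (a b a' b' : Fin N) :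
    rllRight (rMatHom N q u v) l l' (a, b) (a', b')
      = mapPS2 (algebraMap ℂ B) (if a' = b' then q • u - q⁻¹ • v else u - v)
          * (serY l' b b' * serX l a a')
        + mapPS2 (algebraMap ℂ B) (if b' = a' then 0 else if b' < a' then (q - q⁻¹) • u else (q - q⁻¹) • v)
          * (serY l' b a' * serX l a b') := by
  have h1 : ((1 : Matrix (Fin N) (Fin N) (PS2 B)) ⊗ₖ serY l') * (serX l ⊗ₖ 1) = Matrix.of fun i j =>
      serY l' i.2 j.2 * serX l i.1 j.1 := by
    ext1 ⟨i, j⟩ ⟨k, m⟩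
    simp [Matrix.mul_apply, Fintype.sum_prod_type, Matrix.one_apply]
  rw [rllRight, h1, Matrix.mul_apply, Fintype.sum_prod_type]
  simp only [scalarPS2, Matrix.map_apply, Matrix.of_apply, ← (mapPS2_central _ _).eq]
  simp only [rMatHom_apply, map_add, map_mul, add_mul, Finset.sum_add_distrib]
  congr 1
  · rw [Finset.sum_eq_single a', Finset.sum_eq_single b']
    · simp
    · intro f _ hf; simp [hf]
    · simp
    · intro e _ he; simp [he]
    · simp
  · rw [Finset.sum_eq_single b', Finset.sum_eq_single a']
    · simp
    · intro f _ hf; simp [hf]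
    · simp
    · intro e _ he; simp [he]
    · simp

/-- The RLL relation for the series `L(t_p)`, `L(t_p')`. -/
theorem isRLL_seriesAt {p p' : σ} (hp : p ≠ p') {l l' : Fin N → Fin N → ℕ → B}
    (h : rllLeft (rMatHom N q psY psX) l l' = rllRight (rMatHom N q psY psX) l l') :
    IsRLL (HahnSeries.C q : Ser σ ℂ) (tvar p) (tvar p')
      (Matrix.of fun a b => (seriesAt p (l a b) : Ser σ B))
      (Matrix.of fun a b => (seriesAt p' (l' a b) : Ser σ B)) := by
  -- The factor turns `tvar p`, `tvar p'` into `(tvar p')⁻¹`, `(tvar p)⁻¹`, the variables `y`, `x`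
  -- of the defining relation. The coefficients become linear in the inverse variables, and both
  -- sides represent the same double power series.
  refine IsRLL.rescale (c := (tvar p)⁻¹ * (tvar p')⁻¹)
    (mul_ne_zero (inv_ne_zero (tvar_ne_zero p)) (inv_ne_zero (tvar_ne_zero p'))) ?_
  have e1 : (tvar p)⁻¹ * (tvar p')⁻¹ * tvar p = (tvar p')⁻¹ := by
    rw [mul_right_comm, inv_mul_cancel₀ (tvar_ne_zero p), one_mul]
  have e2 : (tvar p)⁻¹ * (tvar p')⁻¹ * tvar p' = (tvar p)⁻¹ := by
    rw [mul_assoc, inv_mul_cancel₀ (tvar_ne_zero p'), mul_one]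
  rw [e1, e2, isRLL_iff]
  intro a b a' b'
  have h' := congrFun₂ h (a, b) (a', b')
  rw [rllLeft_apply, rllRight_apply] at h'
  have h0 : ∀ x : Ser σ ℂ, (0 : ℂ) • x = 0 := fun x => zero_smul ℂ x
  have hn : ∀ (c : ℂ) (x : Ser σ ℂ), (-c) • x = -(c • x) := fun c x => neg_smul c x
  have h1 : ∀ x : Ser σ ℂ, (1 : ℂ) • x = x := fun x => one_smul ℂ x
  have hw : ∀ (a b : Fin N) {F : Ser σ B} {G : PS2 B}, Represents p p' F G →
      Represents p p' (wR (HahnSeries.C q) (tvar p')⁻¹ (tvar p)⁻¹ a b • F)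
        (mapPS2 (algebraMap ℂ B) (if a = b then q • psY - q⁻¹ • psX else psY - psX) * G) := by
    intro a b F G hF
    have := hF.linear_smul hp (if a = b then q else 1) (if a = b then -q⁻¹ else -1)
    convert this using 2
    · simp only [wR, ← map_inv₀, HahnSeries.C_mul_eq_smul]
      split_ifs <;> simp [sub_eq_add_neg, hn, h1]
    · split_ifs <;> simp [sub_eq_add_neg]
  have hg : ∀ (a b : Fin N) {F : Ser σ B} {G : PS2 B}, Represents p p' F G →
      Represents p p' (gR (HahnSeries.C q) (tvar p')⁻¹ (tvar p)⁻¹ a b • F)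
        (mapPS2 (algebraMap ℂ B) (if a = b then 0 else if a < b then (q - q⁻¹) • psY
          else (q - q⁻¹) • psX) * G) := by
    intro a b F G hF
    have := hF.linear_smul hp (if a = b then 0 else if a < b then q - q⁻¹ else 0)
      (if a = b then 0 else if a < b then 0 else q - q⁻¹)
    convert this using 2
    · simp only [gR, ← map_inv₀, ← map_sub, HahnSeries.C_mul_eq_smul]
      split_ifs <;> simp [h0]
    · split_ifs <;> simp
  have hL := (hw a b (represents_mul hp (l a a') (l' b b'))).add
    (hg a b (represents_mul hp (l b a') (l' a b')))
  have hR := (hw a' b' (represents_mul' hp (l a a') (l' b b'))).add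
    (hg b' a' (represents_mul' hp (l a b') (l' b a')))
  simp only [serX, serY] at h'
  rw [h'] at hL
  exact hL.unique hR

/-- The generating matrices of the generators, mapped to an algebra, satisfy the RLL relations. -/
lemma rll_minus (φ : Uminus N q →ₐ[ℂ] B) :
    rllLeft (rMatHom N q psY psX) (fun a b s => φ (Lm N q a b s)) (fun a b s => φ (Lm N q a b s))
      = rllRight (rMatHom N q psY psX) (fun a b s => φ (Lm N q a b s))
        (fun a b s => φ (Lm N q a b s)) := by
  -- The relation is known in the whole algebra and descends to the subalgebra since the inclusion
  -- is injective on coefficients.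
  have h : rllLeft (rMatHom N q psY psX) (Lm N q) (Lm N q)
      = rllRight (rMatHom N q psY psX) (Lm N q) (Lm N q) := by
    have h0 := (satisfiesRel_Lgen N q).rll_minus_minus
    have e : Lgen N q Sgn.minus = fun a b s => (Uminus N q).val (Lm N q a b s) := rfl
    rw [e, ← rllLeft_map, ← rllRight_map] at h0
    refine Matrix.ext fun i j => PowerSeries.ext fun s => PowerSeries.ext fun r => ?_
    have := congrArg (fun x => PowerSeries.coeff r (PowerSeries.coeff s x)) (congrFun₂ h0 i j)
    simp only [Matrix.map_apply, mapPS2_coeff] at this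
    exact Subtype.val_injective this
  rw [← rllLeft_map, ← rllRight_map, h]

end SeriesRLL

end

end QLoop

namespace QLoop

noncomputable section

set_option linter.unusedSectionVars false

/-! ### Products over the pairs of members of a list -/

section PairProd

variable {ι Λ M : Type*} [Monoid M]

/-- The ordered product over the pairs of members of a list. -/
def pairProd (F : ι → ι → M) : List ι → M
  | [] => 1
  | p :: l => (l.map (F p)).prod * pairProd F l

lemma map_pairProd {M' : Type*} [Monoid M'] (φ : M →* M') (F : ι → ι → M) (l : List ι) :
    φ (pairProd F l) = pairProd (fun p j => φ (F p j)) l := by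
  induction l with
  | nil => exact map_one φ
  | cons p l ih => rw [pairProd, pairProd, map_mul, ih, map_list_prod, List.map_map]; rfl

lemma pairProd_map (g : ι → Λ) (F : Λ → Λ → M) (l : List ι) :
    pairProd F (l.map g) = pairProd (fun p j => F (g p) (g j)) l := by
  induction l with
  | nil => rfl
  | cons p l ih => rw [List.map_cons, pairProd, pairProd, ih, List.map_map]; rfl

/-- The members `l₀` already passed stay in the inner product but contribute `1`, being smaller than
the current one. Keeping them in the statement makes the induction work. -/
lemma prod_if_lt_eq_pairProd [LinearOrder ι] (F : ι → ι → M) (l₀ l : List ι)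
    (h : (l₀ ++ l).Pairwise (· < ·)) :
    (l.map fun p => ((l₀ ++ l).map fun p' => if p < p' then F p p' else 1).prod).prod
      = pairProd F l := by
  induction l generalizing l₀ with
  | nil => rfl
  | cons p l ih =>
    rw [List.map_cons, List.prod_cons, pairProd]
    rw [← List.singleton_append, ← List.append_assoc] at h ⊢
    rw [ih _ h]
    congr 1
    obtain ⟨h1, h2, h3⟩ := List.pairwise_append.mp h
    rw [List.map_append, List.prod_append, List.prod_eq_one, one_mul]
    · refine congrArg List.prod (List.map_congr_left fun j hj => if_pos ?_)
      exact h3 p (by simp) j hj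
    · intro x hx
      obtain ⟨j, hj, rfl⟩ := List.mem_map.mp hx
      refine if_neg ?_
      rcases List.mem_append.mp hj with hj | hj
      · exact ((List.pairwise_append.mp h1).2.2 j hj p (by simp)).not_gt
      · rw [List.mem_singleton.mp hj]; exact lt_irrefl p

lemma orderedProd_eq_pairProd [Fintype ι] [LinearOrder ι] (F : ι → ι → M) :
    (orderedProd fun p : ι => orderedProd fun p' : ι => if p < p' then F p p' else 1)
      = pairProd F (Finset.univ.sort (· ≤ ·)) :=
  prod_if_lt_eq_pairProd F [] _ (Finset.sortedLT_sort _).pairwise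

lemma pairProd_append_comm {M : Type*} [CommMonoid M] (F : ι → ι → M) (l l' : List ι) :
    pairProd F (l ++ l')
      = pairProd F l * (l.map fun p => (l'.map (F p)).prod).prod * pairProd F l' := by
  induction l with
  | nil => simp [pairProd]
  | cons p l ih =>
    rw [List.cons_append, pairProd, ih, pairProd, List.map_append, List.prod_append, List.map_cons,
      List.prod_cons]
    ac_rfl

lemma pairProd_ofFn {M : Type*} [CommMonoid M] (F : ι → ι → M) {k : ℕ} (g : Fin k → ι) :
    pairProd F (List.ofFn g) = ∏ i, ∏ j ∈ Finset.Ioi i, F (g i) (g j) := by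
  induction k with
  | zero => simp [pairProd]
  | succ k ih =>
    rw [List.ofFn_succ, pairProd, ih, Fin.prod_univ_succ, Fin.prod_Ioi_zero, List.map_ofFn,
      List.prod_ofFn]
    simp only [Fin.prod_Ioi_succ]
    rfl

lemma prod_map_flat {Λ : Type} {M : Type*} [CommMonoid M] {n : ℕ} {ζ : Fin n → ℕ}
    (g : (a : Fin n) → Fin (ζ a) → Λ) (f : Λ → M) :
    ((flat fun a => List.ofFn (g a)).map f).prod = ∏ a, ∏ i, f (g a i) := by
  induction n with
  | zero => simp [flat]
  | succ n ih =>
    rw [flat, List.map_append, List.prod_append, ih fun a => g a.succ, List.map_ofFn, List.prod_ofFn,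
      Fin.prod_univ_succ]
    rfl

lemma pairProd_flat_ofFn {Λ : Type} {M : Type*} [CommMonoid M] {n : ℕ} {ζ : Fin n → ℕ}
    (g : (a : Fin n) → Fin (ζ a) → Λ) (F : Λ → Λ → M) :
    pairProd F (flat fun a => List.ofFn (g a))
      = (∏ a, ∏ i, ∏ j ∈ Finset.Ioi i, F (g a i) (g a j))
        * ∏ a, ∏ b ∈ Finset.Ioi a, ∏ i, ∏ j, F (g a i) (g b j) := by
  induction n with
  | zero => simp [flat, pairProd]
  | succ n ih =>
    rw [flat, pairProd_append_comm, ih fun a => g a.succ, pairProd_ofFn]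
    simp only [prod_map_flat fun a : Fin n => g a.succ]
    rw [List.map_ofFn, List.prod_ofFn, Fin.prod_univ_succ, Fin.prod_univ_succ, Fin.prod_Ioi_zero]
    simp only [Fin.prod_Ioi_succ, Function.comp_apply]
    rw [Finset.prod_comm]
    ac_rfl

end PairProd

/-! ### Lists of the places -/

section Places

variable {n : ℕ}

lemma pairwise_flat {Λ : Type} [Fintype Λ] [DecidableEq Λ] {r : Λ → Λ → Prop} {ls : Fin n → List Λ}
    (h : ∀ a, (ls a).Pairwise r) (h' : ∀ a b, a < b → ∀ p ∈ ls a, ∀ j ∈ ls b, r p j) :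
    (flat ls).Pairwise r := by
  induction n with
  | zero => simp [flat]
  | succ n ih =>
    rw [flat, List.pairwise_append]
    refine ⟨h 0, ih (fun a => h a.succ) fun a b hab => h' _ _ (Fin.succ_lt_succ_iff.mpr hab),
      fun p hp j hj => ?_⟩
    obtain ⟨a, ha⟩ := mem_flat.mp hj
    exact h' 0 a.succ (Fin.succ_pos a) p hp j ha

lemma map_flat {Λ Λ' : Type} (f : Λ → Λ') (ls : Fin n → List Λ) :
    (flat ls).map f = flat fun a => (ls a).map f := by
  induction n with
  | zero => rfl
  | succ n ih => rw [flat, List.map_append, ih, flat]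

lemma sort_univ_pos (ξ : Fin n → ℕ) :
    (Finset.univ : Finset (Pos ξ)).sort (· ≤ ·) = flat fun a => List.ofFn fun i => pos a i := by
  have hs : (flat fun a => List.ofFn fun i : Fin (ξ a) => pos a i).Pairwise (· < ·) := by
    refine pairwise_flat (fun a => ?_) fun a b hab p hp j hj => ?_
    · rw [List.pairwise_ofFn]
      exact fun i j hij => Sigma.Lex.right _ _ hij
    · obtain ⟨i, rfl⟩ := (List.mem_ofFn' _ _).mp hp
      obtain ⟨i', rfl⟩ := (List.mem_ofFn' _ _).mp hj
      exact Sigma.Lex.left _ _ hab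
  refine List.Perm.eq_of_pairwise' (r := (· ≤ ·)) ?_ ?_ ?_
  · exact Finset.pairwise_sort _ _
  · exact hs.imp le_of_lt
  · refine (List.perm_ext_iff_of_nodup (Finset.sort_nodup _ _) (hs.imp ne_of_lt)).mpr fun p => ?_
    simp only [Finset.mem_sort, Finset.mem_univ, true_iff, mem_flat]
    exact ⟨p.color, (List.mem_ofFn' _ _).mpr ⟨(ofLex p).2, rfl⟩⟩

end Places

/-! ### The R-matrices of a family of lists -/

section NestR

variable {Λ : Type} [Fintype Λ] [DecidableEq Λ] {K : Type*} [Field K] {P : Par Λ K} {N n : ℕ}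

lemma list_prod_smul {A : Type*} [Ring A] [Algebra K A] {ι : Type*} (c : ι → K) (M : ι → A)
    (l : List ι) : (l.map fun j => c j • M j).prod = (l.map c).prod • (l.map M).prod := by
  induction l with
  | nil => simp
  | cons j l ih =>
    rw [List.map_cons, List.prod_cons, ih, List.map_cons, List.prod_cons, List.map_cons,
      List.prod_cons, smul_mul_smul_comm]

lemma thruInv_eq (k : Λ) (l : List Λ) : thruInv P N k l = (l.map fun j => Rhat P N j k).prod := by
  induction l with
  | nil => rfl
  | cons j l ih => rw [thruInv, ih, List.map_cons, List.prod_cons]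

lemma commute_tilRow_hatProd {i : Λ} {l l' : List Λ} (hl : l.Nodup) (hi : i ∉ l)
    (hi' : i ∉ l') (h : ∀ p ∈ l, p ∉ l') : Commute (tilRow P N i l') (hatProd P N l) := by
  refine (Commute.list_prod_right _ _ fun Y hY => ?_).symm
  obtain ⟨j, hj, rfl⟩ := List.mem_map.mp hY
  rw [Rtil_eq]
  exact ((exch_hatProd l).isLocal (List.nodup_reverse.mpr hl)).commute_leg₂ (fun e : j = i => hi' (e ▸ hj))
    (fun h' => h j (by simpa using h') hj) (by simpa using hi) _

/-- In the lexicographic product the R-matrices of `i` with its own level precede those of `i` with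
the later levels. The latter share no label with the remaining R-matrices of the first level, so
they pass these and the two kinds separate. -/
lemma pairProd_append_eq {F : Λ → Λ → Matrix (Λ → Fin N) (Λ → Fin N) K} {κ : Λ → Λ → K}
    {l l' : List Λ} {X : Matrix (Λ → Fin N) (Λ → Fin N) K} (hl : l.Nodup) (hdis : ∀ p ∈ l, p ∉ l')
    (h1 : ∀ p ∈ l, ∀ j ∈ l, p ≠ j → F p j = κ p j • Rhat P N j p)
    (h2 : ∀ p ∈ l, ∀ j ∈ l', F p j = κ p j • Rtil P N j p)
    (hX : pairProd F l' = pairProd κ l' • X) :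
    pairProd F (l ++ l') = pairProd κ (l ++ l') • (hatProd P N l * tilProd P N l l' * X) := by
  induction l with
  | nil => simpa [hatProd, tilProd] using hX
  | cons i l ih =>
    obtain ⟨hi, hl⟩ := List.nodup_cons.mp hl
    have e1 : (l.map (F i)).prod = (l.map (κ i)).prod • thruInv P N i l := by
      rw [thruInv_eq, ← list_prod_smul]
      refine congrArg List.prod (List.map_congr_left fun j hj => ?_)
      exact h1 i (by simp) j (by simp [hj]) fun e => hi (e ▸ hj)
    have e2 : (l'.map (F i)).prod = (l'.map (κ i)).prod • tilRow P N i l' := by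
      rw [tilRow, ← list_prod_smul]
      exact congrArg List.prod (List.map_congr_left fun j hj => h2 i (by simp) j hj)
    have c := commute_tilRow_hatProd (P := P) (N := N) hl hi (hdis i (by simp))
      fun p hp => hdis p (by simp [hp])
    have e3 : tilProd P N (i :: l) l' = tilRow P N i l' * tilProd P N l l' := by
      rw [tilProd, List.map_cons, List.prod_cons]; rfl
    rw [List.cons_append, pairProd, ih hl (fun p hp => hdis p (by simp [hp]))
      (fun p hp j hj => h1 p (by simp [hp]) j (by simp [hj]))
      (fun p hp => h2 p (by simp [hp])), List.map_append, List.prod_append, e1, e2, pairProd,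
      List.map_append, List.prod_append, smul_mul_smul_comm, smul_mul_smul_comm, hatProd, e3]
    congr 1
    calc thruInv P N i l * tilRow P N i l' * (hatProd P N l * tilProd P N l l' * X)
        = thruInv P N i l * (tilRow P N i l' * hatProd P N l) * (tilProd P N l l' * X) := by
          simp only [mul_assoc]
      _ = _ := by rw [c.eq]; simp only [mul_assoc]

lemma pairProd_flat {F : Λ → Λ → Matrix (Λ → Fin N) (Λ → Fin N) K} {κ : Λ → Λ → K}
    {ls : Fin n → List Λ} (hls : Distinct ls)
    (h1 : ∀ a, ∀ p ∈ ls a, ∀ j ∈ ls a, p ≠ j → F p j = κ p j • Rhat P N j p)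
    (h2 : ∀ a b, a < b → ∀ p ∈ ls a, ∀ j ∈ ls b, F p j = κ p j • Rtil P N j p) :
    pairProd F (flat ls) = pairProd κ (flat ls) • nestR P N ls := by
  induction n with
  | zero => simp [flat, pairProd, nestR]
  | succ n ih =>
    rw [flat, nestR]
    refine pairProd_append_eq (hls.nodup 0) hls.not_mem_flat (h1 0) (fun p hp j hj => ?_)
      (ih hls.tail (fun a => h1 a.succ) fun a b hab => h2 _ _ (Fin.succ_lt_succ_iff.mpr hab))
    obtain ⟨a, ha⟩ := mem_flat.mp hj
    exact h2 0 a.succ (Fin.succ_pos a) p hp j ha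

end NestR

/-! ### Relabelling of tensor factors -/

section Relabel

variable {ι Λ : Type*} [Fintype ι] [DecidableEq ι] [Fintype Λ] [DecidableEq Λ] {N : ℕ}

open Classical in
/-- The part of an index that is read off at the places in the image of `g`. -/
def relabelEval (N : ℕ) {g : ι → Λ} (hg : Function.Injective g) :
    PartialEval (Λ → Fin N) (ι → Fin N) where
  ev f p := f (g p)
  rel f f' := ∀ r, (∀ p, g p ≠ r) → f r = f' r
  ins f b r := if h : ∃ p, g p = r then b h.choose else f r
  rel_equiv := ⟨fun _ _ _ => rfl, fun h r hr => (h r hr).symm,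
    fun h h' r hr => (h r hr).trans (h' r hr)⟩
  rel_ins f b r hr := by beta_reduce; rw [dif_neg (not_exists.mpr hr)]
  ev_ins f b := funext fun p => by
    have h : ∃ p', g p' = g p := ⟨p, rfl⟩
    beta_reduce
    rw [dif_pos h, hg h.choose_spec]
  ins_ev f f' h := funext fun r => by
    by_cases hr : ∃ p, g p = r
    · rw [dif_pos hr]
      exact congrArg f' hr.choose_spec
    · rw [dif_neg hr, h r (not_exists.mp hr)]

variable {A : Type*} [Ring A] {g : ι → Λ} (hg : Function.Injective g)

lemma relabelEval_apply_iff {f f' : Λ → Fin N} {Z : ι → Prop} {Z' : Λ → Prop}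
    (hZ : ∀ p, Z' (g p) ↔ Z p) (hZ' : ∀ r, (∀ p, g p ≠ r) → Z' r) :
    ((relabelEval N hg).rel f f' ∧ ∀ r, Z r → (relabelEval N hg).ev f r = (relabelEval N hg).ev f' r)
      ↔ ∀ r, Z' r → f r = f' r := by
  constructor
  · rintro ⟨h1, h2⟩ r hr
    by_cases h : ∃ p, g p = r
    · obtain ⟨p, rfl⟩ := h
      exact h2 p ((hZ p).mp hr)
    · exact h1 r (not_exists.mp h)
  · exact fun h => ⟨fun r hr => h r (hZ' r hr), fun p hp => h (g p) ((hZ p).mpr hp)⟩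

lemma embMat_relabelEval_leg (p : ι) (M : Matrix (Fin N) (Fin N) A) :
    embMat (relabelEval N hg) (leg p M) = leg (g p) M := by
  classical
  refine Matrix.ext fun f f' => ?_
  have h := relabelEval_apply_iff hg (f := f) (f' := f') (Z := fun r => r ≠ p)
    (Z' := fun r => r ≠ g p) (fun r => hg.ne_iff) (fun r hr => (hr p).symm)
  simp only [embMat, leg, Matrix.of_apply, ← ite_and]
  split_ifs with h1 h2 h2
  · rfl
  · exact absurd (h.mp h1) h2
  · exact absurd (h.mpr h2) h1
  · rfl

lemma embMat_relabelEval_leg₂ (p p' : ι) (M : Matrix (Fin N × Fin N) (Fin N × Fin N) A) :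
    embMat (relabelEval N hg) (leg₂ p p' M) = leg₂ (g p) (g p') M := by
  classical
  refine Matrix.ext fun f f' => ?_
  have h := relabelEval_apply_iff hg (f := f) (f' := f') (Z := fun r => r ≠ p ∧ r ≠ p')
    (Z' := fun r => r ≠ g p ∧ r ≠ g p') (fun r => and_congr hg.ne_iff hg.ne_iff)
    (fun r hr => ⟨(hr p).symm, (hr p').symm⟩)
  simp only [and_imp] at h
  simp only [embMat, leg₂, Matrix.of_apply, ← ite_and]
  split_ifs with h1 h2 h2
  · rfl
  · exact absurd (h.mp h1) h2
  · exact absurd (h.mpr h2) h1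
  · rfl

/-- The relabelling of tensor factors. -/
def relabelHom (N : ℕ) (A : Type*) [Ring A] :
    Matrix (ι → Fin N) (ι → Fin N) A →+* Matrix (Λ → Fin N) (Λ → Fin N) A where
  toFun := embMat (relabelEval N hg)
  map_one' := embMat_one _
  map_mul' := embMat_mul _
  map_zero' := by ext; simp [embMat]
  map_add' := embMat_add _

lemma relabelHom_apply {X : Matrix (ι → Fin N) (ι → Fin N) A} {f f' : Λ → Fin N}
    (h : ∀ r, (∀ p, g p ≠ r) → f r = f' r) :
    relabelHom hg N A X f f' = X (fun p => f (g p)) (fun p => f' (g p)) :=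
  if_pos h

end Relabel

end

end QLoop

namespace QLoop

noncomputable section

set_option linter.unusedSectionVars false

/-! ### The weight function as a nested Bethe vector -/

section WeightFunction

universe u

variable {Λ : Type} [Fintype Λ] [DecidableEq Λ] {σ : Type*} [Fintype σ] [LinearOrder σ]
  {n : ℕ} {q : ℂ} {A B : Type*} [Ring A] [Algebra ℂ A] [Ring B] [Algebra ℂ B]

/-- Coefficientwise application of a homomorphism to series. -/
def mapSer (φ : A →ₐ[ℂ] B) : Ser σ A →+* Ser σ B where
  toFun x := x.map φ
  map_one' := HahnSeries.map_one (φ : A →+* B).toMonoidWithZeroHom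
  map_mul' _ _ := HahnSeries.map_mul (φ : A →+* B).toNonUnitalRingHom
  map_zero' := by ext; simp
  map_add' _ _ := by ext; simp

lemma mapSer_coeff (φ : A →ₐ[ℂ] B) (x : Ser σ A) (a : Expo σ) :
    (mapSer φ x).coeff a = φ (x.coeff a) := rfl

lemma mapSer_scal (φ : A →ₐ[ℂ] B) (x : Ser σ ℂ) : mapSer φ (scal A x) = scal B x :=
  HahnSeries.ext (funext fun _ => φ.commutes _)

lemma seriesAt_coeff_eq (p : σ) (c : ℕ → A) (a : Expo σ) (d : A)
    (h : ∀ r : ℕ, a = toLex (Pi.single p (r : ℤ)) → d = c r)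
    (h' : (∀ r : ℕ, a ≠ toLex (Pi.single p (r : ℤ))) → d = 0) : (seriesAt p c).coeff a = d := by
  by_cases ha : ∀ r : ℕ, a ≠ toLex (Pi.single p (r : ℤ))
  · rw [seriesAt_coeff_of_ne c ha, h' ha]
  · push Not at ha
    obtain ⟨r, rfl⟩ := ha
    rw [seriesAt_coeff, h r rfl]

lemma mapSer_seriesAt (φ : A →ₐ[ℂ] B) (p : σ) (c : ℕ → A) :
    mapSer φ (seriesAt p c) = seriesAt p fun k => φ (c k) := by
  refine HahnSeries.ext (funext fun a => ?_)
  symm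
  refine seriesAt_coeff_eq _ _ _ _ (fun r hr => ?_) fun h => ?_
  · rw [hr, mapSer_coeff, seriesAt_coeff]
  · rw [mapSer_coeff, seriesAt_coeff_of_ne c h, map_zero]

/-- The generating matrices of the generators, mapped to an algebra. -/
def genL (φ : Uminus (n + 1) q →ₐ[ℂ] B) (s : Λ → σ) (p : Λ) :
    Matrix (Fin (n + 1)) (Fin (n + 1)) (Ser σ B) :=
  Matrix.of fun a b => seriesAt (s p) fun k => φ (Lm (n + 1) q a b k)

lemma genL_eq (φ : Uminus (n + 1) q →ₐ[ℂ] B) (s : Λ → σ) (p : Λ) :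
    genL φ s p = (LmMat (n + 1) q (s p)).map (mapSer φ) :=
  Matrix.ext fun _ _ => (mapSer_seriesAt _ _ _).symm

lemma rll_genL (hq : q ≠ 0) (φ : Uminus (n + 1) q →ₐ[ℂ] B) {s : Λ → σ} (hs : Function.Injective s)
    (U : Set Λ) : RLL (serPar hq hs) U (genL φ s) :=
  fun _ _ _ _ h => isRLL_seriesAt (hs.ne h) (rll_minus φ)

/-- The ratio of the R-matrices in the definition of the weight function and the normalized
R-matrices. -/
def rRatio (q : ℂ) {ζ : Fin n → ℕ} (t : Pos ζ → σ) (p p' : Pos ζ) : Ser σ ℂ :=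
  (if p.color = p'.color then q • tvar (t p') - q⁻¹ • tvar (t p) else tvar (t p') - tvar (t p))
    / tvar (t p)

/-- The factor in the definition of the weight function is the inverse of the scalars by which its
R-matrices differ from `Rhat` (same level) and `Rtil` (different levels). -/
lemma bFactor_mul (hq : q ≠ 0) {ζ : Fin n → ℕ} {t : Pos ζ → σ} (ht : Function.Injective t) :
    bFactor q t * pairProd (rRatio q t) (Finset.univ.sort (· ≤ ·)) = 1 := by
  have h2 : ∀ p p' : Pos ζ, p ≠ p' → tvar (t p') - tvar (t p) ≠ 0 := fun p p' hp =>
    sub_ne_zero.mpr ((serPar hq ht).x_ne p' p hp.symm)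
  have h1 : ∀ p p' : Pos ζ, p ≠ p' → q • tvar (t p') - q⁻¹ • tvar (t p) ≠ 0 := fun p p' hp => by
    have := (serPar hq ht).Qx_ne p' p hp.symm
    simpa only [serPar, ← map_inv₀, HahnSeries.C_mul_eq_smul] using this
  have hne : ∀ (a b : Fin n) (i : Fin (ζ a)) (j : Fin (ζ b)), a ≠ b → pos a i ≠ pos b j :=
    fun a b i j hab e => hab (congrArg Pos.color e)
  have hne' : ∀ (a : Fin n) (i j : Fin (ζ a)), i ≠ j → pos a i ≠ pos a j :=
    fun a i j hij e => hij (eq_of_heq (Sigma.mk.inj (toLex.injective e)).2)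
  rw [sort_univ_pos, pairProd_flat_ofFn, bFactor, mul_mul_mul_comm]
  have e1 : (∏ a, ∏ j : Fin (ζ a), ∏ i ∈ Finset.Iio j,
      tvar (t (pos a i)) / (q • tvar (t (pos a j)) - q⁻¹ • tvar (t (pos a i))))
      = ∏ a, ∏ i : Fin (ζ a), ∏ j ∈ Finset.Ioi i,
        tvar (t (pos a i)) / (q • tvar (t (pos a j)) - q⁻¹ • tvar (t (pos a i))) :=
    Finset.prod_congr rfl fun a _ => Finset.prod_comm' (by simp)
  have e2 : (∏ b, ∏ a ∈ Finset.Iio b, ∏ i : Fin (ζ a), ∏ j : Fin (ζ b),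
      tvar (t (pos a i)) / (tvar (t (pos b j)) - tvar (t (pos a i))))
      = ∏ a, ∏ b ∈ Finset.Ioi a, ∏ i : Fin (ζ a), ∏ j : Fin (ζ b),
      tvar (t (pos a i)) / (tvar (t (pos b j)) - tvar (t (pos a i))) :=
    Finset.prod_comm' (by simp)
  rw [e1, e2]
  simp only [← Finset.prod_mul_distrib]
  refine Finset.prod_eq_one fun a _ => ?_
  rw [Finset.prod_eq_one, Finset.prod_eq_one, one_mul]
  · refine fun b hb => Finset.prod_eq_one fun i _ => Finset.prod_eq_one fun j _ => ?_
    have hab := (Finset.mem_Ioi.mp hb).ne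
    rw [rRatio, if_neg (show (pos a i).color ≠ (pos b j).color from hab),
      div_mul_div_cancel₀ (h2 _ _ (hne a b i j hab)), div_self (tvar_ne_zero _)]
  · refine fun i _ => Finset.prod_eq_one fun j hj => ?_
    have hij := (Finset.mem_Ioi.mp hj).ne
    rw [rRatio, if_pos (show (pos a i).color = (pos a j).color from rfl),
      div_mul_div_cancel₀ (h1 _ _ (hne' a i j hij)), div_self (tvar_ne_zero _)]

/-- `lowerMat` is a single matrix unit of the tensor space, so the trace picks out the transposed
entry. -/
lemma trace_mul_lowerMat {ζ : Fin n → ℕ} (X : Matrix (Pos ζ → Fin (n + 1)) (Pos ζ → Fin (n + 1)) A) :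
    Matrix.trace (X * lowerMat ζ A) = X (fun p => p.color.castSucc) (fun p => p.color.succ) := by
  classical
  rw [Matrix.trace, Finset.sum_eq_single fun p : Pos ζ => p.color.castSucc]
  · rw [Matrix.diag_apply, Matrix.mul_apply, Finset.sum_eq_single fun p : Pos ζ => p.color.succ]
    · rw [lowerMat, Matrix.of_apply, if_pos fun p => ⟨rfl, rfl⟩, mul_one]
    · intro f _ hf
      rw [lowerMat, Matrix.of_apply, if_neg fun h => hf (funext fun p => (h p).1), mul_zero]
    · simp
  · intro g _ hg
    rw [Matrix.diag_apply, Matrix.mul_apply]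
    refine Finset.sum_eq_zero fun f _ => ?_
    rw [lowerMat, Matrix.of_apply, if_neg fun h => hg (funext fun p => (h p).2), mul_zero]
  · simp

lemma rMat_div (u v : Ser σ ℂ) (hv : v ≠ 0) (N : ℕ) :
    rMat N q (u / v) = v⁻¹ • RM N (HahnSeries.C q) u v := by
  rw [rMat, rMatHom_eq_RM]
  refine Matrix.ext fun i j => ?_
  have hw : ∀ a b : Fin N, wR (HahnSeries.C q : Ser σ ℂ) (u / v) 1 a b = v⁻¹ * wR (HahnSeries.C q) u v a b :=
    fun a b => by
      simp only [wR]
      split_ifs <;> field_simp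
  have hg : ∀ a b : Fin N, gR (HahnSeries.C q : Ser σ ℂ) (u / v) 1 a b = v⁻¹ * gR (HahnSeries.C q) u v a b :=
    fun a b => by
      simp only [gR]
      split_ifs
      · rw [mul_zero]
      · field_simp
      · field_simp
  simp only [RM, Matrix.smul_apply, Matrix.of_apply, hw, hg, smul_eq_mul]
  ring

lemma mul_kHom_smul_apply {K A J : Type*} [Field K] [Ring A] [Algebra K A] [Fintype J] [DecidableEq J]
    (Y : Matrix J J A) (c : K) (X : Matrix J J K) (i j : J) :
    (Y * kHom K A J (c • X)) i j = algebraMap K A c * (Y * kHom K A J X) i j := by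
  rw [map_smul, mul_smul_comm, Matrix.smul_apply, Algebra.smul_def]

lemma smul_Rhat {K : Type*} [Field K] {P : Par Λ K} {i j : Λ} (hij : i ≠ j) (c : K) (N : ℕ) :
    ((P.Q * P.x i - P.Q⁻¹ * P.x j) / c) • Rhat P N i j
      = leg₂ i j (c⁻¹ • RM N P.Q (P.x i) (P.x j)) := by
  rw [Rhat, smul_smul, div_eq_inv_mul, mul_assoc, mul_inv_cancel₀ (P.Qx_ne i j hij), mul_one, leg₂_smul]

lemma smul_Rtil {K : Type*} [Field K] {P : Par Λ K} {i j : Λ} (hij : i ≠ j) (c : K) (N : ℕ) :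
    ((P.x i - P.x j) / c) • Rtil P N i j = leg₂ i j (c⁻¹ • RM N P.Q (P.x i) (P.x j)) := by
  rw [Rtil, smul_smul, div_eq_inv_mul, mul_assoc, mul_inv_cancel₀ (sub_ne_zero.mpr (P.x_ne i j hij)),
    mul_one, leg₂_smul]

lemma leg₂_rMat_eq_Rhat (hq : q ≠ 0) {s : Λ → σ} (hs : Function.Injective s) {p p' : Λ} (h : p' ≠ p)
    (N : ℕ) : leg₂ p' p (rMat N q (tvar (s p') / tvar (s p)))
      = ((q • tvar (s p') - q⁻¹ • tvar (s p)) / tvar (s p)) • Rhat (serPar hq hs) N p' p := by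
  have e := congrArg₂ (· - ·) (HahnSeries.C_mul_eq_smul (r := q) (x := tvar (s p')))
    (HahnSeries.C_mul_eq_smul (r := q⁻¹) (x := tvar (s p)))
  rw [map_inv₀] at e
  rw [rMat_div _ _ (tvar_ne_zero _), ← e]
  exact (smul_Rhat (P := serPar hq hs) h (tvar (s p)) N).symm

lemma leg₂_rMat_eq_Rtil (hq : q ≠ 0) {s : Λ → σ} (hs : Function.Injective s) {p p' : Λ} (h : p' ≠ p)
    (N : ℕ) : leg₂ p' p (rMat N q (tvar (s p') / tvar (s p)))
      = ((tvar (s p') - tvar (s p)) / tvar (s p)) • Rtil (serPar hq hs) N p' p := by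
  rw [rMat_div _ _ (tvar_ne_zero _)]
  exact (smul_Rtil (P := serPar hq hs) h (tvar (s p)) N).symm

lemma mem_ofFn_pos {ζ : Fin n → ℕ} {g : Pos ζ → Λ} {a : Fin n} {p : Λ} :
    p ∈ List.ofFn (fun i => g (pos a i)) ↔ ∃ i, g (pos a i) = p :=
  List.mem_ofFn' _ _

lemma distinct_ofFn_pos {ζ : Fin n → ℕ} {g : Pos ζ → Λ} (hg : Function.Injective g) :
    Distinct fun a => List.ofFn fun i => g (pos a i) := by
  refine ⟨fun a => ?_, fun a b hab p hp hp' => ?_⟩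
  · refine List.nodup_ofFn.mpr fun i j hij => ?_
    exact eq_of_heq (Sigma.mk.inj (toLex.injective (hg hij))).2
  · obtain ⟨i, rfl⟩ := mem_ofFn_pos.mp hp
    obtain ⟨j, hj⟩ := mem_ofFn_pos.mp hp'
    exact hab (congrArg Pos.color (hg hj)).symm

lemma map_sort_univ_pos {ζ : Fin n → ℕ} (g : Pos ζ → Λ) :
    (Finset.univ.sort (· ≤ ·)).map g = flat fun a => List.ofFn fun i => g (pos a i) := by
  rw [sort_univ_pos, map_flat]
  congr 1
  funext a
  rw [List.map_ofFn]
  rfl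

/-- The R-matrices of the weight function as matrices acting in tensor factors labelled by `Λ`. -/
lemma relabel_rProd (hq : q ≠ 0) {s : Λ → σ} (hs : Function.Injective s) {ζ : Fin n → ℕ}
    {g : Pos ζ → Λ} (hg : Function.Injective g) :
    relabelHom hg (n + 1) (Ser σ ℂ) (rProd q fun p => s (g p))
      = pairProd (rRatio q fun p => s (g p)) (Finset.univ.sort (· ≤ ·)) •
        nestR (serPar hq hs) (n + 1) fun a => List.ofFn fun i => g (pos a i) := by
  classical
  set ls : Fin n → List Λ := fun a => List.ofFn fun i => g (pos a i) with hls_def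
  set F : Λ → Λ → Matrix (Λ → Fin (n + 1)) (Λ → Fin (n + 1)) (Ser σ ℂ) := fun p p' =>
    leg₂ p' p (rMat (n + 1) q (tvar (s p') / tvar (s p))) with hF
  have e0 : rProd q (fun p => s (g p)) = pairProd (fun p p' : Pos ζ =>
      leg₂ p' p (rMat (n + 1) q (tvar (s (g p')) / tvar (s (g p))))) (Finset.univ.sort (· ≤ ·)) :=
    orderedProd_eq_pairProd _
  -- The ratio depends on colors, which labels outside the image of `g` lack; the value `1` there is
  -- arbitrary.
  obtain ⟨κ, hκ⟩ : ∃ κ : Λ → Λ → Ser σ ℂ, ∀ p p', κ (g p) (g p') = rRatio q (fun p => s (g p)) p p' := by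
    refine ⟨fun x y => if h : ∃ p p', g p = x ∧ g p' = y then
      rRatio q (fun p => s (g p)) h.choose h.choose_spec.choose else 1, fun p p' => ?_⟩
    have h : ∃ r r', g r = g p ∧ g r' = g p' := ⟨p, p', rfl, rfl⟩
    beta_reduce
    rw [dif_pos h]
    congr 1
    · exact hg h.choose_spec.choose_spec.1
    · exact hg h.choose_spec.choose_spec.2
  have e1 := map_pairProd (relabelHom hg (n + 1) (Ser σ ℂ)).toMonoidHom (fun p p' : Pos ζ =>
      leg₂ p' p (rMat (n + 1) q (tvar (s (g p')) / tvar (s (g p))))) (Finset.univ.sort (· ≤ ·))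
  have e2 : pairProd (rRatio q fun p => s (g p)) (Finset.univ.sort (· ≤ ·)) = pairProd κ (flat ls) := by
    rw [← map_sort_univ_pos, pairProd_map]
    congr 1
    funext p p'
    exact (hκ p p').symm
  have e3 : pairProd F (flat ls) = pairProd κ (flat ls) • nestR (serPar hq hs) (n + 1) ls := by
    refine pairProd_flat (distinct_ofFn_pos hg) (fun a p hp j hj hpj => ?_)
      fun a b hab p hp j hj => ?_
    · obtain ⟨i, rfl⟩ := mem_ofFn_pos.mp hp
      obtain ⟨i', rfl⟩ := mem_ofFn_pos.mp hj
      rw [hκ, rRatio, if_pos (show (pos a i).color = (pos a i').color from rfl)]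
      exact leg₂_rMat_eq_Rhat hq hs hpj.symm _
    · obtain ⟨i, rfl⟩ := mem_ofFn_pos.mp hp
      obtain ⟨i', rfl⟩ := mem_ofFn_pos.mp hj
      have hne : (pos a i).color ≠ (pos b i').color := hab.ne
      rw [hκ, rRatio, if_neg hne]
      exact leg₂_rMat_eq_Rtil hq hs (fun e => hne (congrArg Pos.color (hg e)).symm) _
  rw [e0, e2, ← e3, ← map_sort_univ_pos, pairProd_map]
  refine e1.trans ?_
  congr 1
  funext p p'
  exact embMat_relabelEval_leg₂ hg p' p _

/-- The weight function is a nested Bethe vector. -/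
theorem mapSer_bSer {B : Type u} [Ring B] [Algebra ℂ B] (hq : q ≠ 0)
    (φ : Uminus (n + 1) q →ₐ[ℂ] B) {s : Λ → σ} (hs : Function.Injective s)
    {ζ : Fin n → ℕ} {g : Pos ζ → Λ} (hg : Function.Injective g) :
    mapSer φ (bSer q fun p => s (g p)) = BV (serPar hq hs) n
      (fun a => (List.ofFn fun i => g (pos a i)).reverse) (genL φ s) := by
  set t : Pos ζ → σ := fun p => s (g p) with ht_def
  have ht : Function.Injective t := hs.comp hg
  set P := serPar hq hs with hP
  set ls : Fin n → List Λ := fun a => List.ofFn fun i => g (pos a i) with hls_def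
  classical
  have hls : Distinct ls := distinct_ofFn_pos hg
  have hflat : (Finset.univ.sort (· ≤ ·)).map g = flat ls := map_sort_univ_pos g
  have hR := relabel_rProd hq hs hg
  rw [← ht_def, ← hP, ← hls_def] at hR
  -- The row and column of the trace, extended to all labels by the value `1` that
  -- `legProd_mul_nestR_apply` expects at unused places.
  set c : Λ → Fin (n + 1) := fun x => if h : ∃ p, g p = x then h.choose.color.castSucc else 1
    with hc
  set c' : Λ → Fin (n + 1) := fun x => if h : ∃ p, g p = x then h.choose.color.succ else 1
    with hc'
  have hcg : ∀ p, c (g p) = p.color.castSucc := fun p => by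
    have h : ∃ p', g p' = g p := ⟨p, rfl⟩
    rw [hc]
    beta_reduce
    rw [dif_pos h, hg h.choose_spec]
  have hcg' : ∀ p, c' (g p) = p.color.succ := fun p => by
    have h : ∃ p', g p' = g p := ⟨p, rfl⟩
    rw [hc']
    beta_reduce
    rw [dif_pos h, hg h.choose_spec]
  have key := legProd_mul_nestR_apply (rll_genL hq φ hs Set.univ) hls (fun _ _ _ => trivial)
    (c := c) (s := c') (fun a p hp => by
      obtain ⟨i, rfl⟩ := mem_ofFn_pos.mp hp
      exact ⟨hcg _, hcg' _⟩)
    (fun p hp => by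
      have : ¬ ∃ p', g p' = p := by
        rintro ⟨p', rfl⟩
        exact hp p'.color (mem_ofFn_pos.mpr ⟨(ofLex p').2, rfl⟩)
      exact ⟨dif_neg this, dif_neg this⟩)
  rw [← hP] at key
  rw [← key, bSer, map_mul, mapSer_scal]
  have e4 : mapSer φ (bHat q t) = Matrix.trace
      (orderedProd (fun p : Pos ζ => leg p (genL φ s (g p)))
        * (rProd q t).map (scal B) * lowerMat ζ (Ser σ B)) := by
    have e0 : (orderedProd (fun p : Pos ζ => leg p (LmMat (n + 1) q (t p)))).map (mapSer φ)
        = orderedProd (fun p : Pos ζ => leg p (genL φ s (g p))) := by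
      refine (map_list_prod (mapSer φ).mapMatrix _).trans (congrArg List.prod ?_)
      rw [List.map_map]
      refine List.map_congr_left fun p _ => ?_
      rw [genL_eq]
      exact leg_map _ (map_zero _) _ _
    have e1 : ((rProd q t).map (scal (Uminus (n + 1) q))).map (mapSer φ)
        = (rProd q t).map (scal B) := Matrix.ext fun _ _ => mapSer_scal _ _
    have e2 : (lowerMat ζ (Ser σ (Uminus (n + 1) q))).map (mapSer φ) = lowerMat ζ (Ser σ B) := by
      refine Matrix.ext fun f f' => ?_
      rw [Matrix.map_apply, lowerMat, lowerMat, Matrix.of_apply, Matrix.of_apply,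
        apply_ite (mapSer φ), map_one, map_zero]
    rw [bHat, ← e0, ← e1, ← e2, ← Matrix.map_mul, ← Matrix.map_mul]
    exact AddMonoidHom.map_trace (mapSer φ).toAddMonoidHom _
  rw [e4, trace_mul_lowerMat]
  have e5 : (orderedProd (fun p : Pos ζ => leg p (genL φ s (g p)))
        * (rProd q t).map (scal B)) (fun p => p.color.castSucc) (fun p => p.color.succ)
      = relabelHom hg (n + 1) (Ser σ B) (orderedProd (fun p : Pos ζ => leg p (genL φ s (g p)))
        * (rProd q t).map (scal B)) c c' := by
    rw [relabelHom_apply]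
    · simp only [hcg, hcg']
    · intro r hr
      have : ¬ ∃ p', g p' = r := not_exists.mpr hr
      rw [hc, hc']
      beta_reduce
      rw [dif_neg this, dif_neg this]
  have e6 : relabelHom hg (n + 1) (Ser σ B) (orderedProd (fun p : Pos ζ => leg p (genL φ s (g p))))
      = legProd (genL φ s) (flat ls) := by
    rw [legProd, ← hflat, List.map_map]
    refine (map_list_prod (relabelHom hg (n + 1) (Ser σ B)) _).trans (congrArg List.prod ?_)
    rw [List.map_map]
    exact List.map_congr_left fun p _ => embMat_relabelEval_leg hg p _
  have e7 : relabelHom hg (n + 1) (Ser σ B) ((rProd q t).map (scal B))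
      = kHom (Ser σ ℂ) (Ser σ B) (Λ → Fin (n + 1))
        (pairProd (rRatio q t) (Finset.univ.sort (· ≤ ·)) • nestR P (n + 1) ls) := by
    rw [← hR]
    exact (embMat_map _ _ (map_zero _) _).symm
  rw [e5, map_mul, e6, e7, mul_kHom_smul_apply, ← mul_assoc]
  have e8 : scal B (bFactor q t) * algebraMap (Ser σ ℂ) (Ser σ B)
      (pairProd (rRatio q t) (Finset.univ.sort (· ≤ ·))) = 1 := by
    refine ((scal B).map_mul _ _).symm.trans ?_
    rw [bFactor_mul hq ht, map_one]
  rw [e8, one_mul]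

end WeightFunction

end

end QLoop

namespace QLoop

noncomputable section

set_option linter.unusedSectionVars false

/-! ### Series of operators applied to vectors -/

section Evaluation

variable {σ : Type*} [Fintype σ] [LinearOrder σ] {n : ℕ} {q : ℂ}
  {V : Type*} [AddCommGroup V] [Module ℂ V] {W : Type*} [AddCommGroup W] [Module ℂ W]

/-- A series of operators applied to a vector. -/
def evalSer (v : V) (X : Ser σ (Module.End ℂ V)) : VSer σ V :=
  HahnModule.of ℂ (X.map (LinearMap.applyₗ (R := ℂ) v : Module.End ℂ V →ₗ[ℂ] V))

lemma evalSer_coeff (v : V) (X : Ser σ (Module.End ℂ V)) (a : Expo σ) :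
    ((HahnModule.of ℂ).symm (evalSer v X)).coeff a = X.coeff a v := rfl

lemma vser_ext {x y : VSer σ V} (h : ∀ a, ((HahnModule.of ℂ).symm x).coeff a
    = ((HahnModule.of ℂ).symm y).coeff a) : x = y :=
  HahnModule.ext _ _ (funext h)

lemma evalSer_sum {ι : Type*} (s : Finset ι) (v : V) (X : ι → Ser σ (Module.End ℂ V)) :
    evalSer v (∑ i ∈ s, X i) = ∑ i ∈ s, evalSer v (X i) := by
  classical
  induction s using Finset.induction_on with
  | empty => exact vser_ext fun a => rfl
  | insert i s hi ih =>
    rw [Finset.sum_insert hi, Finset.sum_insert hi, ← ih]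
    exact vser_ext fun a => rfl

lemma evalSer_mul_C {v : V} (X : Ser σ (Module.End ℂ V)) {e : Module.End ℂ V} (he : e v = v) :
    evalSer v (X * HahnSeries.C e) = evalSer v X := by
  refine vser_ext fun a => ?_
  rw [evalSer_coeff, evalSer_coeff, HahnSeries.C_apply, HahnSeries.coeff_mul_single_zero,
    Module.End.mul_apply, he]

lemma evalSer_smul (v : V) (c : Ser σ ℂ) (X : Ser σ (Module.End ℂ V)) :
    evalSer v (c • X) = c • evalSer v X := by
  refine vser_ext fun a => ?_
  have h1 : (scal (Module.End ℂ V) c).support ⊆ c.support := fun b hb hc => hb (by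
    rw [scal_coeff, hc, map_zero])
  have h2 : ((HahnModule.of ℂ).symm (evalSer v X)).support ⊆ X.support := fun b hb hc => hb (by
    rw [evalSer_coeff, hc, LinearMap.zero_apply])
  rw [evalSer_coeff, ser_smul_def, HahnSeries.coeff_mul_left' c.isPWO_support h1,
    HahnModule.coeff_smul_right X.isPWO_support h2, LinearMap.sum_apply]
  exact Finset.sum_congr rfl fun ij _ => rfl

lemma weightFn_eq (ρ : Uminus (n + 1) q →ₐ[ℂ] Module.End ℂ V) {ζ : Fin n → ℕ} (t : Pos ζ → σ)
    (v : V) : weightFn ρ t v = evalSer v (mapSer ρ (bSer q t)) := rfl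

/-- Both sides are convolutions with equal terms, but over different finite sets, cut out by the
supports of different series. Each is compared with the sum over the supports of `x` and `y`, where
the additional terms vanish. -/
lemma evalSer_tmul (ρ₁ : Uminus (n + 1) q →ₐ[ℂ] Module.End ℂ V)
    (ρ₂ : Uminus (n + 1) q →ₐ[ℂ] Module.End ℂ W) (v : V) (w : W) (x y : Ser σ (Uminus (n + 1) q)) :
    evalSer (v ⊗ₜ[ℂ] w) (mapSer ((Module.End.rTensorAlgHom ℂ V W).comp ρ₁) x
        * mapSer ((Module.End.lTensorAlgHom ℂ W V).comp ρ₂) y)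
      = tmulSer (evalSer v (mapSer ρ₁ x)) (evalSer w (mapSer ρ₂ y)) := by
  refine vser_ext fun a => ?_
  have h1 : (mapSer ((Module.End.rTensorAlgHom ℂ V W).comp ρ₁) x).support ⊆ x.support :=
    fun b hb hc => hb (by rw [mapSer_coeff, hc, map_zero])
  have h2 : (mapSer ((Module.End.lTensorAlgHom ℂ W V).comp ρ₂) y).support ⊆ y.support :=
    fun b hb hc => hb (by rw [mapSer_coeff, hc, map_zero])
  rw [evalSer_coeff, HahnSeries.coeff_mul, LinearMap.sum_apply]
  change _ = ∑ ij ∈ Finset.antidiagonal _ _ a, _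
  have key : ∀ ij : Expo σ × Expo σ,
      ((mapSer ((Module.End.rTensorAlgHom ℂ V W).comp ρ₁) x).coeff ij.1
        * (mapSer ((Module.End.lTensorAlgHom ℂ W V).comp ρ₂) y).coeff ij.2) (v ⊗ₜ[ℂ] w)
      = (ρ₁ (x.coeff ij.1) v) ⊗ₜ[ℂ] (ρ₂ (y.coeff ij.2) w) := fun ij => by
    rw [mapSer_coeff, mapSer_coeff]
    rfl
  simp only [key]
  have k1 : ∑ ij ∈ Finset.antidiagonal
      (mapSer ((Module.End.rTensorAlgHom ℂ V W).comp ρ₁) x).isPWO_support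
      (mapSer ((Module.End.lTensorAlgHom ℂ W V).comp ρ₂) y).isPWO_support a,
      (ρ₁ (x.coeff ij.1) v) ⊗ₜ[ℂ] (ρ₂ (y.coeff ij.2) w)
      = ∑ ij ∈ Finset.antidiagonal x.isPWO_support y.isPWO_support a,
        (ρ₁ (x.coeff ij.1) v) ⊗ₜ[ℂ] (ρ₂ (y.coeff ij.2) w) := by
    refine Finset.sum_subset (fun ij h => ?_) fun ij h h' => ?_
    · rw [Finset.mem_antidiagonal] at h ⊢
      exact ⟨h1 h.1, h2 h.2.1, h.2.2⟩
    · rw [← key]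
      rw [Finset.mem_antidiagonal] at h h'
      by_contra hne
      refine h' ⟨fun h0 => hne ?_, fun h0 => hne ?_, h.2.2⟩
      · rw [h0, zero_mul, LinearMap.zero_apply]
      · rw [h0, mul_zero, LinearMap.zero_apply]
  rw [k1]
  symm
  refine Finset.sum_subset (fun ij h => ?_) fun ij h h' => ?_
  · rw [Finset.mem_antidiagonal] at h ⊢
    refine ⟨fun h0 => h.1 ?_, fun h0 => h.2.1 ?_, h.2.2⟩
    · rw [evalSer_coeff, mapSer_coeff, h0, map_zero, LinearMap.zero_apply]
    · rw [evalSer_coeff, mapSer_coeff, h0, map_zero, LinearMap.zero_apply]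
  · rw [Finset.mem_antidiagonal] at h h'
    by_contra hne
    refine h' ⟨fun h0 => hne ?_, fun h0 => hne ?_, h.2.2⟩
    · exact (congrArg (· ⊗ₜ[ℂ] _) h0).trans (TensorProduct.zero_tmul _ _)
    · exact (congrArg (_ ⊗ₜ[ℂ] ·) h0).trans (TensorProduct.tmul_zero _ _)

end Evaluation

/-! ### The coproduct of the generating series -/

section Coproduct

variable {Λ : Type} [Fintype Λ] [DecidableEq Λ] {σ : Type*} [Fintype σ] [LinearOrder σ]
  {n : ℕ} {q : ℂ} {B : Type*} [Ring B] [Algebra ℂ B]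

lemma seriesAt_mul_seriesAt (p : σ) (c d : ℕ → B) :
    (seriesAt p c * seriesAt p d : Ser σ B) = seriesAt p fun k =>
      ∑ ij ∈ Finset.HasAntidiagonal.antidiagonal k, c ij.1 * d ij.2 := by
  rw [seriesAt, seriesAt, ← HahnSeries.embDomain_mul, seriesAt]
  · congr 1
    refine HahnSeries.ext (funext fun k => ?_)
    refine HahnSeries.coeff_mul.trans ?_
    change ∑ ij ∈ Finset.antidiagonal _ _ k, c ij.1 * d ij.2
      = ∑ ij ∈ Finset.HasAntidiagonal.antidiagonal k, c ij.1 * d ij.2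
    refine Finset.sum_subset (fun ij h => ?_) fun ij h h' => ?_
    · exact Finset.HasAntidiagonal.mem_antidiagonal.mpr (Finset.mem_antidiagonal.mp h).2.2
    · by_contra hne
      refine h' (Finset.mem_antidiagonal.mpr ⟨fun h0 => hne ?_, fun h0 => hne ?_,
        Finset.HasAntidiagonal.mem_antidiagonal.mp h⟩)
      · exact (congrArg (· * d ij.2) h0).trans (zero_mul _)
      · exact (congrArg (c ij.1 * ·) h0).trans (mul_zero _)
  · intro x y
    change (toLex (Pi.single p ((x + y : ℕ) : ℤ)) : Expo σ)
      = toLex (Pi.single p (x : ℤ) + Pi.single p (y : ℤ))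
    rw [← Pi.single_add, Nat.cast_add]

lemma seriesAt_sum {ι : Type*} (s : Finset ι) (p : σ) (c : ι → ℕ → B) :
    ∑ i ∈ s, (seriesAt p (c i) : Ser σ B) = seriesAt p fun k => ∑ i ∈ s, c i k := by
  refine HahnSeries.ext (funext fun a => ?_)
  symm
  refine seriesAt_coeff_eq _ _ _ _ (fun r hr => ?_) fun h => ?_
  · rw [hr, HahnSeries.coeff_sum]
    exact Finset.sum_congr rfl fun i _ => seriesAt_coeff _ _
  · rw [HahnSeries.coeff_sum]
    exact Finset.sum_eq_zero fun i _ => seriesAt_coeff_of_ne _ h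

lemma commute_seriesAt {p p' : σ} {c d : ℕ → B} (h : ∀ i j, Commute (c i) (d j)) :
    Commute (seriesAt p c : Ser σ B) (seriesAt p' d) := by
  refine commute_of_coeff fun a b => ?_
  by_cases ha : ∀ r : ℕ, a ≠ toLex (Pi.single p (r : ℤ))
  · rw [seriesAt_coeff_of_ne c ha]
    exact Commute.zero_left _
  · by_cases hb : ∀ r : ℕ, b ≠ toLex (Pi.single p' (r : ℤ))
    · rw [seriesAt_coeff_of_ne d hb]
      exact Commute.zero_right _
    · push Not at ha hb
      obtain ⟨r, rfl⟩ := ha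
      obtain ⟨r', rfl⟩ := hb
      rw [seriesAt_coeff, seriesAt_coeff]
      exact h r r'

variable {V : Type*} [AddCommGroup V] [Module ℂ V] {W : Type*} [AddCommGroup W] [Module ℂ W]
  (ρ₁ : Uminus (n + 1) q →ₐ[ℂ] Module.End ℂ V) (ρ₂ : Uminus (n + 1) q →ₐ[ℂ] Module.End ℂ W)

lemma commute_rTensor_lTensor (x : Module.End ℂ V) (y : Module.End ℂ W) :
    Commute (Module.End.rTensorAlgHom ℂ V W x) (Module.End.lTensorAlgHom ℂ W V y) := by
  exact TensorProduct.ext' fun v w => rfl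

/-- In the coproduct the second tensor component carries the row index `a` and the first one the
column index `b`; hence the matrix of the second module stands on the left. -/
lemma genL_tensorRep (s : Λ → σ) : genL (tensorRep ρ₁ ρ₂) s
    = fun p => genL ((Module.End.lTensorAlgHom ℂ W V).comp ρ₂) s p
      * genL ((Module.End.rTensorAlgHom ℂ V W).comp ρ₁) s p := by
  funext p
  refine Matrix.ext fun a b => ?_
  rw [Matrix.mul_apply]
  simp only [genL, Matrix.of_apply, seriesAt_mul_seriesAt]
  rw [seriesAt_sum]
  congr 1
  funext k
  refine TensorProduct.ext' fun v w => ?_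
  rw [tensorRep_Lm, LinearMap.sum_apply]
  refine Finset.sum_congr rfl fun c _ => ?_
  rw [LinearMap.sum_apply, ← Finset.Nat.sum_antidiagonal_swap]
  exact Finset.sum_congr rfl fun ij _ => rfl

lemma isSing_genL {B : Type*} [Ring B] [Algebra ℂ B] (φ : Uminus (n + 1) q →ₐ[ℂ] B) (s : Λ → σ) (e : B)
    (l : Fin (n + 1) → ℕ → ℂ) (h : ∀ a b k, a < b → φ (Lm (n + 1) q b a k) * e = 0)
    (h' : ∀ a k, φ (Lm (n + 1) q a a k) * e = l a k • e) (p : Λ) :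
    IsSing (K := Ser σ ℂ) (genL φ s p) (fun a => seriesAt (s p) (l a)) (HahnSeries.C e) := by
  refine ⟨fun a b hab => HahnSeries.ext (funext fun x => ?_), fun a => HahnSeries.ext (funext fun x => ?_)⟩
  · rw [HahnSeries.C_apply, HahnSeries.coeff_mul_single_zero]
    by_cases hx : ∀ r : ℕ, x ≠ toLex (Pi.single (s p) (r : ℤ))
    · rw [genL, Matrix.of_apply, seriesAt_coeff_of_ne _ hx, zero_mul]
      rfl
    · push Not at hx
      obtain ⟨r, rfl⟩ := hx
      rw [genL, Matrix.of_apply, seriesAt_coeff, h a b r hab]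
      rfl
  · rw [ser_smul_def, HahnSeries.C_apply, HahnSeries.coeff_mul_single_zero,
      HahnSeries.coeff_mul_single_zero, scal_coeff, ← Algebra.smul_def]
    by_cases hx : ∀ r : ℕ, x ≠ toLex (Pi.single (s p) (r : ℤ))
    · rw [genL, Matrix.of_apply, seriesAt_coeff_of_ne _ hx, seriesAt_coeff_of_ne _ hx, zero_mul,
        zero_smul]
    · push Not at hx
      obtain ⟨r, rfl⟩ := hx
      rw [genL, Matrix.of_apply, seriesAt_coeff, seriesAt_coeff, h']

end Coproduct

end

end QLoop

namespace QLoop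

noncomputable section

set_option linter.unusedSectionVars false

/-! ### The weight function of a tensor product -/

section Tensor

variable {Λ : Type} [Fintype Λ] [DecidableEq Λ] {σ : Type*} [Fintype σ] [LinearOrder σ]
  {n : ℕ} {q : ℂ} {V : Type*} [AddCommGroup V] [Module ℂ V] {W : Type*} [AddCommGroup W] [Module ℂ W]

lemma exists_dual_eq_one {v : V} (hv : v ≠ 0) : ∃ f : Module.Dual ℂ V, f v = 1 := by
  have h : ¬ ∀ f : Module.Dual ℂ V, f v = 0 :=
    fun h => hv ((Module.forall_dual_apply_eq_zero_iff ℂ v).mp h)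
  push Not at h
  obtain ⟨f, hf⟩ := h
  exact ⟨(f v)⁻¹ • f, inv_mul_cancel₀ hf⟩

/-- The projection of `V ⊗ W` onto the line spanned by `v ⊗ w`. -/
lemma exists_rankOne {v : V} {w : W} (hv : v ≠ 0) (hw : w ≠ 0) :
    ∃ e : Module.End ℂ (V ⊗[ℂ] W), e (v ⊗ₜ w) = v ⊗ₜ w ∧
      ∀ x, ∃ c : ℂ, e x = c • v ⊗ₜ w := by
  obtain ⟨f, hf⟩ := exists_dual_eq_one hv
  obtain ⟨g, hg⟩ := exists_dual_eq_one hw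
  refine ⟨LinearMap.smulRight (LinearMap.mul' ℂ ℂ ∘ₗ TensorProduct.map f g) (v ⊗ₜ[ℂ] w), ?_,
    fun x => ⟨LinearMap.mul' ℂ ℂ (TensorProduct.map f g x), rfl⟩⟩
  rw [LinearMap.smulRight_apply, LinearMap.comp_apply, TensorProduct.map_tmul, hf, hg,
    LinearMap.mul'_apply, one_mul, one_smul]

/-- `BV_mul` for the two commuting actions on `V ⊗ W`. It needs a singular element of the algebra of
operators, not a vector. -/
lemma weightFn_tensorRep (hq : q ≠ 0) {ρ₁ : Uminus (n + 1) q →ₐ[ℂ] Module.End ℂ V}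
    {ρ₂ : Uminus (n + 1) q →ₐ[ℂ] Module.End ℂ W} {v₁ : V} {v₂ : W} {l₁ l₂ : Fin (n + 1) → ℕ → ℂ}
    (h₁ : IsWeightSingular ρ₁ v₁ l₁) (h₂ : IsWeightSingular ρ₂ v₂ l₂) {s : Λ → σ}
    (hs : Function.Injective s) {ζ : Fin n → ℕ} {g : Pos ζ → Λ} (hg : Function.Injective g)
    (ls : Fin n → List Λ) (hls : ls = fun a => (List.ofFn fun i => g (pos a i)).reverse) :
    weightFn (tensorRep ρ₁ ρ₂) (fun p => s (g p)) (v₁ ⊗ₜ[ℂ] v₂)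
      = ∑ I ∈ Fintype.piFinset fun a => (ls a).toFinset.powerset,
        splitCoeff (serPar hq hs) n ls I (fun p a => seriesAt (s p) (l₁ a))
          (fun p a => seriesAt (s p) (l₂ a)) •
        evalSer (v₁ ⊗ₜ[ℂ] v₂)
          (BV (serPar hq hs) n (fun a => headL (ls a) (I a))
              (genL ((Module.End.rTensorAlgHom ℂ V W).comp ρ₁) s)
            * BV (serPar hq hs) n (fun a => tailL (ls a) (I a))
              (genL ((Module.End.lTensorAlgHom ℂ W V).comp ρ₂) s)) := by
  -- The range of `e` is spanned by `v₁ ⊗ v₂`, so `e` inherits the singularity and the eigenvalues.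
  -- It fixes `v₁ ⊗ v₂`, so multiplying by it does not change evaluation there.
  obtain ⟨e, he, he'⟩ := exists_rankOne h₁.ne_zero h₂.ne_zero
  have hd : Distinct ls := by
    have h := distinct_ofFn_pos hg
    subst hls
    exact ⟨fun a => List.nodup_reverse.mpr (h.1 a), fun a b hab p hp hp' =>
      h.2 a b hab p (List.mem_reverse.mp hp) (List.mem_reverse.mp hp')⟩
  have s₁ : ∀ p ∈ (Set.univ : Set Λ), IsSing (K := Ser σ ℂ)
      (genL ((Module.End.rTensorAlgHom ℂ V W).comp ρ₁) s p)
      (fun a => seriesAt (s p) (l₁ a)) (HahnSeries.C e) := fun p _ => by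
    refine isSing_genL _ _ _ _ (fun a b k hab => LinearMap.ext fun x => ?_)
      (fun a k => LinearMap.ext fun x => ?_) _
    · obtain ⟨c, hc⟩ := he' x
      rw [Module.End.mul_apply, hc, map_smul]
      have : ((Module.End.rTensorAlgHom ℂ V W).comp ρ₁) (Lm (n + 1) q b a k) (v₁ ⊗ₜ[ℂ] v₂) = 0 :=
        (congrArg (· ⊗ₜ[ℂ] v₂) (h₁.singular a b k hab)).trans (TensorProduct.zero_tmul _ _)
      rw [this, smul_zero, LinearMap.zero_apply]
    · obtain ⟨c, hc⟩ := he' x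
      rw [Module.End.mul_apply, LinearMap.smul_apply, hc, map_smul, smul_comm]
      congr 1
      exact (congrArg (· ⊗ₜ[ℂ] v₂) (h₁.eigen a k)).trans (TensorProduct.smul_tmul' _ _ _).symm
  have s₂ : ∀ p ∈ (Set.univ : Set Λ), IsSing (K := Ser σ ℂ)
      (genL ((Module.End.lTensorAlgHom ℂ W V).comp ρ₂) s p)
      (fun a => seriesAt (s p) (l₂ a)) (HahnSeries.C e) := fun p _ => by
    refine isSing_genL _ _ _ _ (fun a b k hab => LinearMap.ext fun x => ?_)
      (fun a k => LinearMap.ext fun x => ?_) _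
    · obtain ⟨c, hc⟩ := he' x
      rw [Module.End.mul_apply, hc, map_smul]
      have : ((Module.End.lTensorAlgHom ℂ W V).comp ρ₂) (Lm (n + 1) q b a k) (v₁ ⊗ₜ[ℂ] v₂) = 0 :=
        (congrArg (v₁ ⊗ₜ[ℂ] ·) (h₂.singular a b k hab)).trans (TensorProduct.tmul_zero _ _)
      rw [this, smul_zero, LinearMap.zero_apply]
    · obtain ⟨c, hc⟩ := he' x
      rw [Module.End.mul_apply, LinearMap.smul_apply, hc, map_smul, smul_comm]
      congr 1
      exact (congrArg (v₁ ⊗ₜ[ℂ] ·) (h₂.eigen a k)).trans (TensorProduct.tmul_smul _ _ _)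
  have key := BV_mul (rll_genL hq ((Module.End.rTensorAlgHom ℂ V W).comp ρ₁) hs Set.univ)
    (rll_genL hq ((Module.End.lTensorAlgHom ℂ W V).comp ρ₂) hs Set.univ)
    (fun p p' a b c d => commute_seriesAt fun i j => commute_rTensor_lTensor _ _) s₁ s₂ hd
    (fun _ _ _ => trivial)
  rw [weightFn_eq, ← evalSer_mul_C _ he, mapSer_bSer hq _ hs hg, ← hls, genL_tensorRep, key, evalSer_sum]
  exact Finset.sum_congr rfl fun I _ => by rw [evalSer_smul, evalSer_mul_C _ he]

end Tensor

end

end QLoop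

namespace QLoop

noncomputable section

set_option linter.unusedSectionVars false

/-! ### The coefficients of the coproduct formula in closed form -/

section SplitCoeff

variable {Λ : Type} [Fintype Λ] [DecidableEq Λ] {K : Type*} [Field K] {P : Par Λ K}

/-- The weight `(Q⁻¹ x_i - Q x_j) / (x_i - x_j)`. -/
def wgt (P : Par Λ K) (i j : Λ) : K := (P.Q⁻¹ * P.x i - P.Q * P.x j) / (P.x i - P.x j)

/-- The inverse of `fR P j i` is `wgt P i j` after changing the sign of numerator and denominator.
-/
lemma blockCoeff_inv (l : List Λ) (I : Finset Λ) : (blockCoeff P l I)⁻¹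
    = ((headL l I).map fun i => ((tailL l I).map fun j => wgt P i j).prod).prod := by
  rw [blockCoeff, List.prod_inv, List.map_map]
  refine congrArg List.prod (List.map_congr_left fun i _ => ?_)
  rw [Function.comp_apply, List.prod_inv, List.map_map]
  refine congrArg List.prod (List.map_congr_left fun j _ => ?_)
  rw [Function.comp_apply, fR, inv_div, wgt, ← neg_sub (P.x i), ← neg_sub (P.Q⁻¹ * P.x i), neg_div_neg_eq]

lemma prod_map_ite {M : Type*} [CommMonoid M] (l : List Λ) (c : Prop) [Decidable c] (f : Λ → M) :
    (l.map fun p => if c then f p else 1).prod = if c then (l.map f).prod else 1 := by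
  split_ifs
  · rfl
  · simp

lemma prod_adjacent_succ {M : Type*} [CommMonoid M] {n : ℕ} (G : Fin (n + 1) → Fin (n + 1) → M) :
    ∏ a, ∏ b : Fin (n + 1) with b.val = a.val + 1, G a b
      = (∏ b : Fin n, if b.val = 0 then G 0 b.succ else 1)
        * ∏ a : Fin n, ∏ b : Fin n with b.val = a.val + 1, G a.succ b.succ := by
  simp only [Finset.prod_filter]
  rw [Fin.prod_univ_succ, Fin.prod_univ_succ, if_neg (by simp), one_mul]
  congr 1
  · exact Finset.prod_congr rfl fun b _ => if_congr (by simp) rfl rfl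
  · refine Finset.prod_congr rfl fun a _ => ?_
    rw [Fin.prod_univ_succ, if_neg (by simp), one_mul]
    exact Finset.prod_congr rfl fun b _ => if_congr (by simp) rfl rfl

/-- Dressing changes only the first eigenvalue of the next level. For `d₁` the first eigenvalue is
never used again, for `d₂` it is used only at the level immediately following. So cross factors join
just adjacent levels, the head of one with the tail of the preceding one. -/
lemma splitCoeff_eq {n : ℕ} (ls : Fin n → List Λ) (I : Fin n → Finset Λ) (d₁ d₂ : Λ → Fin (n + 1) → K) :
    splitCoeff P n ls I d₁ d₂
      = (∏ a, ((headL (ls a) (I a)).map fun i => ((tailL (ls a) (I a)).map fun j => wgt P i j).prod).prod)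
        * ((∏ a, ∏ b : Fin n with b.val = a.val + 1,
            ((headL (ls b) (I b)).map fun i => ((tailL (ls a) (I a)).map fun j => auxEig P i j).prod).prod)
          * ∏ a : Fin n, ((headL (ls a) (I a)).map fun i => d₂ i a.castSucc).prod
            * ((tailL (ls a) (I a)).map fun j => d₁ j a.succ).prod) := by
  induction n with
  | zero => simp [splitCoeff]
  | succ n ih =>
    rw [splitCoeff, ih, blockCoeff_inv, List.map_reverse, List.prod_reverse]
    have e1 : ∀ a : Fin n, ((tailL (ls a.succ) (I a.succ)).map fun j =>
        d₁ j a.succ.succ * chainEig P (headL (ls 0) (I 0)) j a.succ)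
        = (tailL (ls a.succ) (I a.succ)).map fun j => d₁ j a.succ.succ := fun a =>
      List.map_congr_left fun j _ => by rw [chainEig, if_neg (Fin.succ_ne_zero a), mul_one]
    have e2 : ∀ a : Fin n, ((headL (ls a.succ) (I a.succ)).map fun i =>
        d₂ i a.castSucc.succ * chainEig P (tailL (ls 0) (I 0)) i a.castSucc).prod
        = ((headL (ls a.succ) (I a.succ)).map fun i => d₂ i a.succ.castSucc).prod *
          if a.val = 0 then
            ((headL (ls a.succ) (I a.succ)).map fun i => ((tailL (ls 0) (I 0)).map fun j => auxEig P i j).prod).prod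
          else 1 := fun a => by
      rw [← prod_map_ite, ← List.prod_map_mul]
      refine congrArg List.prod (List.map_congr_left fun i _ => ?_)
      rw [chainEig, Fin.succ_castSucc]
      congr 1
      refine if_congr ?_ rfl rfl
      rw [Fin.ext_iff]
      simp
    simp only [e1, e2, prod_adjacent_succ, Finset.prod_mul_distrib]
    simp only [Fin.prod_univ_succ, Fin.castSucc_zero, Fin.succ_zero_eq_one]
    ring

end SplitCoeff

end

end QLoop

namespace QLoop

noncomputable section

set_option linter.unusedSectionVars false

/-! ### Symmetry of the nested Bethe vectors -/

section Symmetry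

universe u

variable {Λ : Type} [Fintype Λ] [DecidableEq Λ] {K : Type*} [Field K] {P : Par Λ K} {N n : ℕ}
  {A : Type u} [Ring A] [Algebra K A]

lemma exists_exch_of_perm {l l' : List Λ} (h : l.Perm l') :
    ∃ X : Matrix (Λ → Fin N) (Λ → Fin N) K, Exch P N l l' X := by
  induction h with
  | nil => exact ⟨1, .refl _⟩
  | cons x _ ih =>
    obtain ⟨X, hX⟩ := ih
    exact ⟨X, hX.cons x⟩
  | swap x y l => exact ⟨_, .swap [] l y x⟩
  | trans _ _ ih ih' =>
    obtain ⟨X, hX⟩ := ih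
    obtain ⟨Y, hY⟩ := ih'
    exact ⟨_, hX.trans hY⟩

lemma rowIdx_perm {l l' : List Λ} (h : l.Perm l') : rowIdx n l = rowIdx n l' := by
  funext r
  simp only [rowIdx, h.mem_iff]

/-- The exchange matrix is trivial on the left, where the row is constant on the labels, and
restricts to positive indices on the right. -/
lemma legProd_headB_exch {l l' : List Λ} {X : Matrix (Λ → Fin (n + 2)) (Λ → Fin (n + 2)) K}
    (hX : Exch P (n + 2) l l' X) (hl : l.Nodup) {U : Set Λ} (hU : ∀ p ∈ l, p ∈ U)
    {L : Λ → Matrix (Fin (n + 2)) (Fin (n + 2)) A} (hL : RLL P U L) (h : Λ → Fin (n + 1)) :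
    legProd (headB L) l 0 h = (legProd (headB L) l'
      * kHom K A (Λ → Fin (n + 1)) (X.submatrix (Fin.succ ∘ ·) (Fin.succ ∘ ·))) 0 h := by
  have hl' : l'.Nodup := hX.perm.nodup_iff.mp hl
  have e := hX.legProd hl hU hL
  rw [← kHom_eq] at e
  have e1 : (kHom K A (Λ → Fin (n + 2)) X * legProd L l) (rowIdx n l) (Fin.succ ∘ h)
      = legProd L l (rowIdx n l) (Fin.succ ∘ h) := by
    have hrow : ∀ i ∈ l, ∀ j ∈ l, rowIdx n l i = rowIdx n l j := fun i hi j hj => by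
      simp [rowIdx, hi, hj]
    rw [Matrix.mul_apply, Finset.sum_eq_single (rowIdx n l)]
    · rw [kHom_apply, (hX.const_apply hl hrow _).1, Matrix.one_apply_eq, map_one, one_mul]
    · intro k _ hk
      rw [kHom_apply, (hX.const_apply hl hrow _).1, Matrix.one_apply_ne (Ne.symm hk), map_zero,
        zero_mul]
    · simp
  rw [legProd_headB_apply _ hl, ← e1, e, rowIdx_perm hX.perm, Matrix.mul_apply, Matrix.mul_apply]
  symm
  refine Fintype.sum_of_injective (fun f : Λ → Fin (n + 1) => Fin.succ ∘ f)
    (Fin.succ_injective _).comp_left _ _ (fun k hk => ?_) fun k => ?_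
  · rw [kHom_apply, (hX.restrict hl).2 k h (fun ⟨f', hf'⟩ => hk ⟨f', hf'.symm⟩), map_zero, mul_zero]
  · rw [legProd_headB_apply _ hl']
    rfl

/-- The nested Bethe vectors are symmetric in the labels of each level. -/
theorem BV_perm {U : Set Λ} {L : Λ → Matrix (Fin (n + 1)) (Fin (n + 1)) A} (hL : RLL P U L)
    {ls ls' : Fin n → List Λ} (h : ∀ a, (ls a).Perm (ls' a)) (hls : Distinct ls)
    (hU : ∀ a, ∀ p ∈ ls a, p ∈ U) : BV P n ls L = BV P n ls' L := by
  induction n generalizing A with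
  | zero => rfl
  | succ n ih =>
    have hl := hls.nodup 0
    have hl' := (h 0).nodup_iff.mp hl
    obtain ⟨X, hX⟩ := exists_exch_of_perm (P := P) (N := n + 2) (h 0)
    obtain ⟨hY, -⟩ := hX.restrict hl
    set Y := X.submatrix (Fin.succ ∘ · : (Λ → Fin (n + 1)) → _) (Fin.succ ∘ ·) with hY_def
    have k1 := BV_semiconj (P := P) (U := U) (ls := fun a => ls a.succ)
      (fun p _ a b => hY.dressD hl (blockD L) p a b) hls.tail fun a => hU a.succ
    have k2 : BV P n (fun a => ls a.succ) (dressD P (ls' 0) (blockD L))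
        = BV P n (fun a => ls' a.succ) (dressD P (ls' 0) (blockD L)) :=
      ih (hL.block.dress hl') (fun a => h a.succ) hls.tail fun a => hU a.succ
    -- After reordering the row and the dressing, the exchange matrix ends up at the right, where it
    -- acts trivially on the constant column.
    have k3 : ∀ Z : Matrix (Λ → Fin (n + 1)) (Λ → Fin (n + 1)) A,
        (Z * kHom K A (Λ → Fin (n + 1)) Y) 0 0 = Z 0 0 := fun Z => by
      have hc := fun g => (hY.const_apply hl (f := 0) (fun _ _ _ _ => rfl) g).2
      rw [Matrix.mul_apply, Finset.sum_eq_single 0]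
      · rw [kHom_apply, hc, Matrix.one_apply_eq, map_one, mul_one]
      · intro k _ hk
        rw [kHom_apply, hc, Matrix.one_apply_ne hk, map_zero, mul_zero]
      · simp
    rw [BV, BV, ← k2, Matrix.mul_apply]
    simp only [legProd_headB_exch hX hl (hU 0) hL]
    rw [← Matrix.mul_apply, mul_assoc, ← hY_def, k1, ← mul_assoc, k3]

end Symmetry

end

end QLoop

namespace QLoop

noncomputable section

set_option linter.unusedSectionVars false

/-! ### The summands of the coproduct formula -/

section Lists

variable {Λ : Type} [Fintype Λ] [DecidableEq Λ] {M : Type*} [CommMonoid M] {k : ℕ}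

lemma prod_take_map_ofFn (w : Fin k → Λ) (F : Λ → M) (m : ℕ) :
    (((List.ofFn w).take m).map F).prod = ∏ i : Fin k with i.val < m, F (w i) := by
  rw [List.map_take, List.map_ofFn, List.prod_take_ofFn]
  rfl

lemma prod_drop_map_ofFn (w : Fin k → Λ) (F : Λ → M) (m : ℕ) :
    (((List.ofFn w).drop m).map F).prod = ∏ i : Fin k with m ≤ i.val, F (w i) := by
  induction k generalizing m with
  | zero => simp
  | succ k ih =>
    cases m with
    | zero => simp [List.prod_ofFn, Fin.prod_univ_succ]
    | succ m =>
      rw [List.ofFn_succ, List.drop_succ_cons, ih, Finset.prod_filter, Finset.prod_filter,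
        Fin.prod_univ_succ, if_neg (by simp), one_mul]
      exact Finset.prod_congr rfl fun i _ => if_congr (by simp) rfl rfl

lemma take_ofFn_eq (w : Fin k → Λ) {m : ℕ} (hm : m ≤ k) :
    (List.ofFn w).take m = List.ofFn fun i : Fin m => w (i.castLE hm) := by
  refine List.ext_getElem (by simp [hm]) fun i h h' => ?_
  simp

lemma drop_ofFn_eq (w : Fin k → Λ) (m : ℕ) :
    (List.ofFn w).drop m = List.ofFn fun i : Fin (k - m) => w ⟨m + i, Nat.add_lt_of_lt_sub' i.isLt⟩ := by
  refine List.ext_getElem (by simp) fun i h h' => ?_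
  simp

lemma headL_perm {l l₁ l₂ : List Λ} (h : l.Perm (l₁ ++ l₂)) (hl : l.Nodup) :
    (headL l l₁.toFinset).Perm l₁ := by
  have hd := List.nodup_append.mp (h.nodup_iff.mp hl)
  refine (h.filter _).trans ?_
  rw [List.filter_append, List.filter_eq_self.mpr (by simp), List.filter_eq_nil_iff.mpr, List.append_nil]
  intro p hp hp'
  exact hd.2.2 p (by simpa using hp') p hp rfl

lemma tailL_perm {l l₁ l₂ : List Λ} (h : l.Perm (l₁ ++ l₂)) (hl : l.Nodup) :
    (tailL l l₁.toFinset).Perm l₂ := by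
  have hd := List.nodup_append.mp (h.nodup_iff.mp hl)
  refine (h.filter _).trans ?_
  rw [List.filter_append, List.filter_eq_nil_iff.mpr (by simp), List.filter_eq_self.mpr, List.nil_append]
  intro p hp
  simpa using fun hp' => hd.2.2 p hp' p hp rfl

lemma ofFn_comp_perm (w : Fin k → Λ) (τ : Equiv.Perm (Fin k)) :
    (List.ofFn fun i => w (τ i)).Perm (List.ofFn w) :=
  Equiv.Perm.ofFn_comp_perm τ w

end Lists

/-! ### The scalar coefficients attached to permuted variables -/

section Summand

variable {σ : Type*} [Fintype σ] [LinearOrder σ]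
  {n : ℕ} {q : ℂ} {V : Type*} [AddCommGroup V] [Module ℂ V] {W : Type*} [AddCommGroup W] [Module ℂ W]
  {ξ : Fin n → ℕ}

/-- The places with a given superscript, in decreasing order. -/
def posL (ξ : Fin n → ℕ) (a : Fin n) : List (Pos ξ) := (List.ofFn fun i => pos a i).reverse

/-- The places permuted by `τ`. -/
def permL (a : Fin n) (τ : Equiv.Perm (Fin (ξ a))) : List (Pos ξ) := List.ofFn fun i => pos a (τ i)

/-- The labels of the first variables of the permuted collection. -/
def headSet (m : ℕ) (a : Fin n) (τ : Equiv.Perm (Fin (ξ a))) : Finset (Pos ξ) :=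
  ((permL a τ).take m).toFinset

lemma posL_perm (m : ℕ) (a : Fin n) (τ : Equiv.Perm (Fin (ξ a))) :
    (posL ξ a).Perm ((permL a τ).take m ++ (permL a τ).drop m) := by
  rw [List.take_append_drop]
  exact (List.reverse_perm _).trans (ofFn_comp_perm (fun i => pos a i) τ).symm

lemma distinct_posL (ξ : Fin n → ℕ) : Distinct (posL ξ) := by
  have h := distinct_ofFn_pos (ζ := ξ) (g := fun p => p) fun _ _ h => h
  exact ⟨fun a => List.nodup_reverse.mpr (h.1 a), fun a b hab p hp hp' =>
    h.2 a b hab p (List.mem_reverse.mp hp) (List.mem_reverse.mp hp')⟩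

lemma head_perm (m : ℕ) (a : Fin n) (τ : Equiv.Perm (Fin (ξ a))) :
    (headL (posL ξ a) (headSet m a τ)).Perm ((permL a τ).take m) :=
  headL_perm (posL_perm m a τ) ((distinct_posL ξ).1 a)

lemma tail_perm (m : ℕ) (a : Fin n) (τ : Equiv.Perm (Fin (ξ a))) :
    (tailL (posL ξ a) (headSet m a τ)).Perm ((permL a τ).drop m) :=
  tailL_perm (posL_perm m a τ) ((distinct_posL ξ).1 a)

lemma wgt_serPar {Λ : Type} (hq : q ≠ 0) {s : Λ → σ} (hs : Function.Injective s) (p p' : Λ) :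
    wgt (serPar hq hs) p p'
      = (q⁻¹ • tvar (s p) - q • tvar (s p')) / (tvar (s p) - tvar (s p')) := by
  have e := congrArg₂ (· - ·) (HahnSeries.C_mul_eq_smul (r := q⁻¹) (x := tvar (s p)))
    (HahnSeries.C_mul_eq_smul (r := q) (x := tvar (s p')))
  rw [map_inv₀] at e
  exact congrArg (· / _) e

lemma auxEig_serPar {Λ : Type} [Fintype Λ] [DecidableEq Λ] (hq : q ≠ 0) {s : Λ → σ} (hs : Function.Injective s)
    (p p' : Λ) : auxEig (serPar hq hs) p p'
      = (q • tvar (s p) - q⁻¹ • tvar (s p')) / (tvar (s p) - tvar (s p')) := by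
  have e := congrArg₂ (· - ·) (HahnSeries.C_mul_eq_smul (r := q) (x := tvar (s p)))
    (HahnSeries.C_mul_eq_smul (r := q⁻¹) (x := tvar (s p')))
  rw [map_inv₀] at e
  exact congrArg (· / _) e

lemma splitCoeff_headSet {K : Type*} [Field K] (P : Par (Pos ξ) K) (η : Sub ξ)
    (τ : (a : Fin n) → Equiv.Perm (Fin (ξ a))) (d₁ d₂ : Pos ξ → Fin (n + 1) → K) :
    splitCoeff P n (posL ξ) (fun a => headSet (η.val a) a (τ a)) d₁ d₂
      = (∏ a, ∏ i : Fin (ξ a) with i.val < η.val a, ∏ j : Fin (ξ a) with η.val a ≤ j.val,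
          wgt P (pos a (τ a i)) (pos a (τ a j)))
        * ((∏ a : Fin n, ∏ b : Fin n with b.val = a.val + 1,
            ∏ i : Fin (ξ b) with i.val < η.val b, ∏ j : Fin (ξ a) with η.val a ≤ j.val,
              auxEig P (pos b (τ b i)) (pos a (τ a j)))
          * ∏ a : Fin n, (∏ i : Fin (ξ a) with i.val < η.val a, d₂ (pos a (τ a i)) a.castSucc)
            * ∏ j : Fin (ξ a) with η.val a ≤ j.val, d₁ (pos a (τ a j)) a.succ) := by
  have hp : ∀ (F : Pos ξ → K) (a : Fin n),
      ((headL (posL ξ a) (headSet (η.val a) a (τ a))).map F).prod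
        = ∏ i : Fin (ξ a) with i.val < η.val a, F (pos a (τ a i)) := fun F a => by
    rw [((head_perm (η.val a) a (τ a)).map F).prod_eq, permL, prod_take_map_ofFn]
  have tp : ∀ (F : Pos ξ → K) (a : Fin n),
      ((tailL (posL ξ a) (headSet (η.val a) a (τ a))).map F).prod
        = ∏ i : Fin (ξ a) with η.val a ≤ i.val, F (pos a (τ a i)) := fun F a => by
    rw [((tail_perm (η.val a) a (τ a)).map F).prod_eq, permL, prod_drop_map_ofFn]
  rw [splitCoeff_eq]
  simp only [hp, tp]

variable (l₁ l₂ : Fin (n + 1) → ℕ → ℂ)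

lemma scalar_eq_splitCoeff (hq : q ≠ 0) {t : Pos ξ → σ} (ht : Function.Injective t) (η : Sub ξ)
    (τ : (a : Fin n) → Equiv.Perm (Fin (ξ a))) :
    wCross q η (permVars t τ) * bracketScalar q l₁ l₂ η (permVars t τ)
      = splitCoeff (serPar hq ht) n (posL ξ) (fun a => headSet (η.val a) a (τ a))
        (fun p a => seriesAt (t p) (l₁ a)) (fun p a => seriesAt (t p) (l₂ a)) := by
  rw [splitCoeff_headSet]
  simp only [wgt_serPar, auxEig_serPar]
  rfl

end Summand

end

end QLoop

namespace QLoop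

noncomputable section

set_option linter.unusedSectionVars false

/-! ### The summands as functions of the sets of leading labels -/

section Summand

variable {σ : Type*} [Fintype σ] [LinearOrder σ]
  {n : ℕ} {q : ℂ} {V : Type*} [AddCommGroup V] [Module ℂ V] {W : Type*} [AddCommGroup W] [Module ℂ W]
  {ξ : Fin n → ℕ} (ρ₁ : Uminus (n + 1) q →ₐ[ℂ] Module.End ℂ V)
  (ρ₂ : Uminus (n + 1) q →ₐ[ℂ] Module.End ℂ W) (v₁ : V) (v₂ : W) (l₁ l₂ : Fin (n + 1) → ℕ → ℂ)

/-- The summand of the coproduct formula given by the sets of labels of the first variables. -/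
def splitTerm (hq : q ≠ 0) {t : Pos ξ → σ} (ht : Function.Injective t) (I : Fin n → Finset (Pos ξ)) :
    VSer σ (V ⊗[ℂ] W) :=
  splitCoeff (serPar hq ht) n (posL ξ) I (fun p a => seriesAt (t p) (l₁ a))
      (fun p a => seriesAt (t p) (l₂ a)) •
    evalSer (v₁ ⊗ₜ[ℂ] v₂)
      (BV (serPar hq ht) n (fun a => headL (posL ξ a) (I a))
          (genL ((Module.End.rTensorAlgHom ℂ V W).comp ρ₁) t)
        * BV (serPar hq ht) n (fun a => tailL (posL ξ a) (I a))
          (genL ((Module.End.lTensorAlgHom ℂ W V).comp ρ₂) t))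

lemma Distinct.of_sub {Λ : Type} {ls ls' : Fin n → List Λ} (h : Distinct ls)
    (h' : ∀ a, (ls' a).Sublist (ls a)) : Distinct ls' :=
  ⟨fun a => (h.1 a).sublist (h' a), fun a b hab p hp hp' =>
    h.2 a b hab p ((h' a).subset hp) ((h' b).subset hp')⟩

lemma pos_injective (a : Fin n) : Function.Injective (pos a : Fin (ξ a) → Pos ξ) :=
  fun _ _ h => eq_of_heq (Sigma.mk.inj (toLex.injective h)).2

lemma place_injective {ζ : Fin n → ℕ} {f : (a : Fin n) → Fin (ζ a) → Fin (ξ a)}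
    (hf : ∀ a, Function.Injective (f a)) :
    Function.Injective fun p : Pos ζ => (pos p.color (f p.color (ofLex p).2) : Pos ξ) := by
  rintro ⟨a, i⟩ ⟨b, j⟩ h
  have hab : a = b := congrArg Pos.color h
  subst hab
  exact congrArg (pos a) (hf a (pos_injective a h))

/-- By `BV_perm` the order of the variables inside the weight function is immaterial; only the set
of leading labels remains. -/
lemma mapSer_bSer_head {B : Type*} [Ring B] [Algebra ℂ B] (φ : Uminus (n + 1) q →ₐ[ℂ] B)
    (hq : q ≠ 0) {t : Pos ξ → σ} (ht : Function.Injective t) (η : Sub ξ)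
    (τ : (a : Fin n) → Equiv.Perm (Fin (ξ a))) :
    mapSer φ (bSer q (headVars η (permVars t τ)))
      = BV (serPar hq ht) n (fun a => headL (posL ξ a) (headSet (η.val a) a (τ a))) (genL φ t) := by
  have hη : ∀ a, η.val a ≤ ξ a := fun a => Nat.lt_succ_iff.mp (η a).isLt
  have hg := place_injective (ζ := η.val) (ξ := ξ) (f := fun a i => τ a (i.castLE (hη a)))
    fun a i j h => Fin.castLE_injective (hη a) ((τ a).injective h)
  refine (mapSer_bSer hq φ ht hg).trans (BV_perm (U := Set.univ) (rll_genL hq φ ht _) (fun a => ?_)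
    ?_ fun _ _ _ => trivial).symm
  · refine (head_perm (η.val a) a (τ a)).trans ?_
    rw [permL, take_ofFn_eq _ (hη a)]
    exact (List.reverse_perm _).symm
  · exact (distinct_posL ξ).of_sub fun a => List.filter_sublist

lemma mapSer_bSer_tail {B : Type*} [Ring B] [Algebra ℂ B] (φ : Uminus (n + 1) q →ₐ[ℂ] B)
    (hq : q ≠ 0) {t : Pos ξ → σ} (ht : Function.Injective t) (η : Sub ξ)
    (τ : (a : Fin n) → Equiv.Perm (Fin (ξ a))) :
    mapSer φ (bSer q (tailVars η (permVars t τ)))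
      = BV (serPar hq ht) n (fun a => tailL (posL ξ a) (headSet (η.val a) a (τ a))) (genL φ t) := by
  have hg := place_injective (ζ := ξ - η.val) (ξ := ξ)
    (f := fun a i => τ a ⟨η.val a + i, Nat.add_lt_of_lt_sub' i.isLt⟩)
    fun a i j h => Fin.ext (Nat.add_left_cancel (Fin.val_eq_of_eq ((τ a).injective h)))
  refine (mapSer_bSer hq φ ht hg).trans (BV_perm (U := Set.univ) (rll_genL hq φ ht _) (fun a => ?_)
    ?_ fun _ _ _ => trivial).symm
  · refine (tail_perm (η.val a) a (τ a)).trans ?_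
    rw [permL, drop_ofFn_eq]
    exact (List.reverse_perm _).symm
  · exact (distinct_posL ξ).of_sub fun a => List.filter_sublist

/-- The crucial consequence of symmetry: once multiplied by the crossing weights, the bracket
depends on `τ` only through the sets of leading labels. -/
lemma wCross_smul_bracket (hq : q ≠ 0) {t : Pos ξ → σ} (ht : Function.Injective t) (η : Sub ξ)
    (τ : (a : Fin n) → Equiv.Perm (Fin (ξ a))) :
    wCross q η (permVars t τ) • bracket ρ₁ ρ₂ v₁ v₂ l₁ l₂ η (permVars t τ)
      = splitTerm ρ₁ ρ₂ v₁ v₂ l₁ l₂ hq ht fun a => headSet (η.val a) a (τ a) := by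
  rw [splitTerm, ← scalar_eq_splitCoeff, ← mapSer_bSer_head, ← mapSer_bSer_tail, evalSer_tmul,
    bracket, weightFn_eq, weightFn_eq]
  exact (mul_smul (wCross q η (permVars t τ)) (bracketScalar q l₁ l₂ η (permVars t τ))
    (tmulSer (weightFn ρ₁ (headVars η (permVars t τ)) v₁) (weightFn ρ₂ (tailVars η (permVars t τ)) v₂))).symm

lemma weightFn_eq_sum (hq : q ≠ 0) (h₁ : IsWeightSingular ρ₁ v₁ l₁) (h₂ : IsWeightSingular ρ₂ v₂ l₂)
    {t : Pos ξ → σ} (ht : Function.Injective t) :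
    weightFn (tensorRep ρ₁ ρ₂) t (v₁ ⊗ₜ[ℂ] v₂)
      = ∑ I ∈ Fintype.piFinset fun a => (posL ξ a).toFinset.powerset,
        splitTerm ρ₁ ρ₂ v₁ v₂ l₁ l₂ hq ht I :=
  weightFn_tensorRep hq h₁ h₂ ht (g := fun p => p) (fun _ _ h => h) (posL ξ) rfl

end Summand

end

end QLoop

namespace QLoop

noncomputable section

set_option linter.unusedSectionVars false

/-! ### Sums over arrangements -/

section Lagrange

open Polynomial in
/-- A partial fraction identity. -/
lemma sum_prod_div_sub {K : Type*} [Field K] [DecidableEq K] (α β : K) (T : Finset K) (h0 : (0 : K) ∉ T) :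
    (α - β) * ∑ x ∈ T, ∏ y ∈ T.erase x, (α * x - β * y) / (x - y) = α ^ T.card - β ^ T.card := by
  set f : K[X] := ∏ y ∈ T, (C α * X - C (β * y)) with hf
  have hdeg : ∀ y ∈ T, (C α * X - C (β * y)).natDegree ≤ 1 := fun y _ => by
    rw [sub_eq_add_neg, ← C_neg]
    exact natDegree_linear_le
  have hnat : f.natDegree ≤ T.card := by
    refine (natDegree_prod_le _ _).trans ?_
    simpa using Finset.sum_le_sum hdeg
  have hfd : f.degree < (insert 0 T).card := by
    rw [Finset.card_insert_of_notMem h0]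
    exact (natDegree_le_iff_degree_le.mp hnat).trans_lt (by exact_mod_cast Nat.lt_succ_self _)
  have hc : f.coeff T.card = α ^ T.card := by
    have := coeff_prod_of_natDegree_le T (fun y => C α * X - C (β * y)) 1 hdeg
    rw [mul_one] at this
    rw [hf, this]
    simp
  -- The leading coefficient of `∏ (α X - β y)` is computed by interpolation at `T` and the extra
  -- node `0`. The node `0` contributes `β ^ T.card`; at `x ∈ T` the factor with `y = x` is `(α - β)
  -- x`, whose `x` cancels against the difference `x - 0`.
  have key := Lagrange.coeff_eq_sum (s := insert 0 T) (v := id) Function.injective_id.injOn hfd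
  rw [Finset.card_insert_of_notMem h0, Nat.add_sub_cancel, hc, Finset.sum_insert h0,
    Finset.erase_insert h0] at key
  have e0 : f.eval (id 0) / ∏ y ∈ T, (id 0 - id y) = β ^ T.card := by
    rw [hf, eval_prod, ← Finset.prod_div_distrib, ← Finset.prod_const]
    refine Finset.prod_congr rfl fun y hy => ?_
    have hy0 : y ≠ 0 := fun e => h0 (e ▸ hy)
    simp [hy0]
  have e1 : ∀ x ∈ T, f.eval (id x) / ∏ y ∈ (insert 0 T).erase x, (id x - id y)
      = (α - β) * ∏ y ∈ T.erase x, (α * x - β * y) / (x - y) := fun x hx => by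
    have hx0 : x ≠ 0 := fun e => h0 (e ▸ hx)
    rw [Finset.erase_insert_of_ne hx0.symm, Finset.prod_insert (by simp [h0]), hf, eval_prod,
      ← Finset.mul_prod_erase T _ hx, Finset.prod_div_distrib]
    simp only [eval_sub, eval_mul, eval_C, eval_X, id, sub_zero]
    rw [mul_div_mul_comm, ← sub_mul, mul_div_assoc, div_self hx0, mul_one]
  rw [e0, Finset.sum_congr rfl e1, ← Finset.mul_sum] at key
  rw [key]
  ring

end Lagrange

/-! ### Lists as arrangements of finite sets, and permutations with prescribed leading set -/

section Arrangements

variable {Λ : Type} [DecidableEq Λ] {K : Type*} [CommSemiring K]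

/-- The arrangements of a finite set as lists without repetitions. -/
def arr (S : Finset Λ) : Finset (List Λ) := S.toList.permutations.toFinset

lemma mem_arr {S : Finset Λ} {l : List Λ} : l ∈ arr S ↔ l.Nodup ∧ l.toFinset = S := by
  rw [arr, List.mem_toFinset, List.mem_permutations]
  refine ⟨fun h => ⟨h.nodup_iff.mpr S.nodup_toList, ?_⟩, fun ⟨h, h'⟩ => ?_⟩
  · rw [List.toFinset_eq_of_perm _ _ h, Finset.toList_toFinset]
  · rw [← h']
    exact (List.toFinset_toList h).symm

lemma arr_empty : arr (∅ : Finset Λ) = {[]} := by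
  ext l
  rw [mem_arr, Finset.mem_singleton, List.toFinset_eq_empty_iff]
  exact ⟨fun h => h.2, fun h => ⟨h ▸ List.nodup_nil, h⟩⟩

lemma sum_arr {S : Finset Λ} (hS : S.Nonempty) (f : List Λ → K) :
    ∑ l ∈ arr S, f l = ∑ p ∈ S, ∑ l ∈ arr (S.erase p), f (p :: l) := by
  rw [Finset.sum_sigma']
  symm
  refine Finset.sum_bij (fun x _ => x.1 :: x.2) (fun x hx => ?_) (fun x _ y _ h => ?_)
    (fun l hl => ?_) fun _ _ => rfl
  · obtain ⟨hp, hl⟩ := Finset.mem_sigma.mp hx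
    obtain ⟨h1, h2⟩ := mem_arr.mp hl
    refine mem_arr.mpr ⟨List.nodup_cons.mpr ⟨fun h => ?_, h1⟩, ?_⟩
    · have := List.mem_toFinset.mpr h
      rw [h2] at this
      exact (Finset.mem_erase.mp this).1 rfl
    · rw [List.toFinset_cons, h2, Finset.insert_erase hp]
  · obtain ⟨h1, h2⟩ := List.cons.inj h
    exact Sigma.ext h1 (heq_of_eq h2)
  · obtain ⟨h1, h2⟩ := mem_arr.mp hl
    cases l with
    | nil =>
      rw [← h2] at hS
      exact absurd hS (by simp)
    | cons p l =>
      obtain ⟨h3, h4⟩ := List.nodup_cons.mp h1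
      refine ⟨⟨p, l⟩, Finset.mem_sigma.mpr ⟨?_, mem_arr.mpr ⟨h4, ?_⟩⟩, rfl⟩
      · rw [← h2]
        simp
      · rw [← h2, List.toFinset_cons, Finset.erase_insert]
        simpa using h3

lemma prod_map_eq_of_mem_arr {S : Finset Λ} {l : List Λ} (hl : l ∈ arr S) (f : Λ → K) :
    (l.map f).prod = ∏ p ∈ S, f p := by
  obtain ⟨h1, h2⟩ := mem_arr.mp hl
  rw [← h2, List.prod_toFinset _ h1]

/-- Splitting off the first member of an arrangement: its weight depends only on the set of the
others, so the inner sum is given by induction and the outer one by the hypothesis. -/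
lemma sum_arr_pairProd (w : Λ → Λ → K) (c : ℕ → K)
    (h : ∀ S : Finset Λ, S.Nonempty → ∑ p ∈ S, ∏ p' ∈ S.erase p, w p p' = c S.card) (S : Finset Λ) :
    ∑ l ∈ arr S, pairProd w l = ∏ i ∈ Finset.range S.card, c (i + 1) := by
  induction hk : S.card generalizing S with
  | zero =>
    rw [Finset.card_eq_zero.mp hk, arr_empty, Finset.sum_singleton, pairProd, Finset.prod_range_zero]
  | succ k ih =>
    have hS : S.Nonempty := Finset.card_pos.mp (by omega)
    rw [sum_arr hS, Finset.prod_range_succ, ← hk, ← h S hS, Finset.mul_sum]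
    refine Finset.sum_congr rfl fun p hp => ?_
    rw [← ih (S.erase p) (by rw [Finset.card_erase_of_mem hp, hk, Nat.add_sub_cancel]), Finset.sum_mul]
    refine Finset.sum_congr rfl fun l hl => ?_
    rw [pairProd, prod_map_eq_of_mem_arr hl, mul_comm]

lemma sum_arr_sorted {Λ : Type} [LinearOrder Λ] (S : Finset Λ) :
    ∑ l ∈ arr S, (if l.Pairwise (· < ·) then 1 else 0 : K) = 1 := by
  rw [Finset.sum_eq_single (S.sort (· ≤ ·))]
  · rw [if_pos]
    exact S.sortedLT_sort.pairwise
  · intro l hl hne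
    refine if_neg fun h => hne ?_
    obtain ⟨h1, h2⟩ := mem_arr.mp hl
    refine List.Perm.eq_of_pairwise' (r := (· < ·)) h S.sortedLT_sort.pairwise ?_
    rw [← h2]
    exact (List.toFinset_toList h1).symm.trans (Finset.sort_perm_toList _ _).symm
  · intro h
    exact absurd (mem_arr.mpr ⟨Finset.sort_nodup _ _, Finset.sort_toFinset _ _⟩) h

lemma exists_perm_ofFn {k : ℕ} {w : Fin k → Λ} (hw : Function.Injective w) {l : List Λ}
    (hl : l ∈ arr (Finset.univ.image w)) : ∃ τ : Equiv.Perm (Fin k), List.ofFn (fun i => w (τ i)) = l := by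
  obtain ⟨h1, h2⟩ := mem_arr.mp hl
  have hlen : l.length = k := by
    rw [← List.toFinset_card_of_nodup h1, h2, Finset.card_image_of_injective _ hw, Finset.card_univ,
      Fintype.card_fin]
  have hmem : ∀ i : Fin k, ∃ j, w j = l[i.val]'(hlen.symm ▸ i.isLt) := fun i => by
    have := List.mem_toFinset.mpr (l.getElem_mem (hlen.symm ▸ i.isLt : i.val < l.length))
    rw [h2] at this
    simpa using this
  choose f hf using hmem
  have hinj : Function.Injective f := fun i j hij => by
    have := (hf i).symm.trans ((congrArg w hij).trans (hf j))
    exact Fin.ext ((List.Nodup.getElem_inj_iff h1).mp this)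
  refine ⟨Equiv.ofBijective f (Finite.injective_iff_bijective.mp hinj), ?_⟩
  refine List.ext_getElem (by simp [hlen]) fun i h h' => ?_
  simp [hf]

/-- Summation over the permutations with given set of the first entries. -/
lemma sum_perm_fiber {k : ℕ} {w : Fin k → Λ} (hw : Function.Injective w) (F₁ F₂ : List Λ → K)
    {m : ℕ} {I : Finset Λ} (hI : I ⊆ Finset.univ.image w) (hm : I.card = m) :
    ∑ τ : Equiv.Perm (Fin k) with ((List.ofFn fun i => w (τ i)).take m).toFinset = I,
      F₁ ((List.ofFn fun i => w (τ i)).take m) * F₂ ((List.ofFn fun i => w (τ i)).drop m)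
    = (∑ l ∈ arr I, F₁ l) * ∑ l ∈ arr (Finset.univ.image w \ I), F₂ l := by
  rw [Finset.sum_mul_sum, ← Finset.sum_product']
  have hnd : ∀ τ : Equiv.Perm (Fin k), (List.ofFn fun i => w (τ i)).Nodup := fun τ =>
    List.nodup_ofFn.mpr (hw.comp τ.injective)
  have hset : ∀ τ : Equiv.Perm (Fin k), (List.ofFn fun i => w (τ i)).toFinset = Finset.univ.image w := by
    intro τ
    refine (List.toFinset_eq_of_perm _ _ (Equiv.Perm.ofFn_comp_perm τ w)).trans ?_
    ext p
    simp
  refine Finset.sum_bij (fun τ _ => ((List.ofFn fun i => w (τ i)).take m, (List.ofFn fun i => w (τ i)).drop m))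
    (fun τ hτ => ?_) (fun τ _ τ' _ h => ?_) (fun x hx => ?_) fun _ _ => rfl
  · have e := (Finset.mem_filter.mp hτ).2
    have h1 := hnd τ
    have h2 := hset τ
    rw [← List.take_append_drop m (List.ofFn fun i => w (τ i))] at h1 h2
    obtain ⟨h3, h4, h5⟩ := List.nodup_append.mp h1
    refine Finset.mem_product.mpr ⟨mem_arr.mpr ⟨h3, e⟩, mem_arr.mpr ⟨h4, ?_⟩⟩
    rw [← h2, List.toFinset_append, e, Finset.union_sdiff_left, Finset.sdiff_eq_self_iff_disjoint.mpr]
    rw [← e, Finset.disjoint_left]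
    intro p hp hp'
    exact h5 p (List.mem_toFinset.mp hp') p (List.mem_toFinset.mp hp) rfl
  · obtain ⟨h1, h2⟩ := Prod.mk.inj h
    have e : (List.ofFn fun i => w (τ i)) = List.ofFn fun i => w (τ' i) := by
      rw [← List.take_append_drop m (List.ofFn fun i => w (τ i)), h1, h2, List.take_append_drop]
    exact Equiv.ext fun i => hw (congrFun (List.ofFn_injective e) i)
  · obtain ⟨hx1, hx2⟩ := Finset.mem_product.mp hx
    obtain ⟨h1, h2⟩ := mem_arr.mp hx1
    obtain ⟨h3, h4⟩ := mem_arr.mp hx2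
    have hlen : x.1.length = m := by rw [← List.toFinset_card_of_nodup h1, h2, hm]
    have hx : x.1 ++ x.2 ∈ arr (Finset.univ.image w) := by
      refine mem_arr.mpr ⟨List.nodup_append.mpr ⟨h1, h3, fun p hp p' hp' e => ?_⟩, ?_⟩
      · subst e
        have hp'' := List.mem_toFinset.mpr hp'
        rw [h4] at hp''
        exact (Finset.mem_sdiff.mp hp'').2 (h2 ▸ List.mem_toFinset.mpr hp)
      · rw [List.toFinset_append, h2, h4, Finset.union_sdiff_of_subset hI]
    obtain ⟨τ, hτ⟩ := exists_perm_ofFn hw hx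
    refine ⟨τ, Finset.mem_filter.mpr ⟨Finset.mem_univ _, ?_⟩, ?_⟩
    · rw [hτ, List.take_left' hlen, h2]
    · rw [hτ, List.take_left' hlen, List.drop_left' hlen]

end Arrangements

end

end QLoop

namespace QLoop

noncomputable section

set_option linter.unusedSectionVars false

/-! ### Summation over the subsets of labels -/

section Fibers

lemma sum_pi_fiber {n : ℕ} {α : Fin n → Type} [∀ a, Fintype (α a)] {Λ : Type} [DecidableEq Λ]
    {K : Type*} [CommRing K] {M : Type*} [AddCommGroup M] [Module K M] (J : ∀ a, α a → Λ)
    (f : ∀ a, α a → K) (D : Fin n → Finset Λ) (c : Fin n → Λ → K) (hJ : ∀ a x, J a x ∈ D a)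
    (hc : ∀ a, ∀ I ∈ D a, ∑ x with J a x = I, f a x = c a I) (G : (Fin n → Λ) → M) :
    ∑ x : ∀ a, α a, (∏ a, f a (x a)) • G (fun a => J a (x a))
      = ∑ I ∈ Fintype.piFinset D, (∏ a, c a (I a)) • G I := by
  classical
  have e : ∀ I ∈ Fintype.piFinset D, (∏ a, c a (I a)) • G I
      = ∑ x : ∀ a, α a with (fun a => J a (x a)) = I, (∏ a, f a (x a)) • G (fun a => J a (x a)) := by
    intro I hI
    rw [Finset.prod_congr rfl fun a _ => (hc a (I a) (Fintype.mem_piFinset.mp hI a)).symm,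
      Finset.prod_univ_sum, Finset.sum_smul]
    refine Finset.sum_congr ?_ fun x hx => ?_
    · ext x
      simp [funext_iff]
    · rw [(Finset.mem_filter.mp hx).2]
  rw [Finset.sum_congr rfl e]
  exact (Finset.sum_fiberwise_of_maps_to (fun x _ => Fintype.mem_piFinset.mpr fun a => hJ a (x a)) _).symm

lemma sum_piFinset_powerset {n : ℕ} {Λ : Type} [DecidableEq Λ] {M : Type*} [AddCommMonoid M]
    (ξ : Fin n → ℕ) (S : Fin n → Finset Λ) (hS : ∀ a, (S a).card = ξ a) (G : (Fin n → Finset Λ) → M) :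
    ∑ η : Sub ξ, ∑ I ∈ Fintype.piFinset fun a => (S a).powersetCard (η.val a), G I
      = ∑ I ∈ Fintype.piFinset fun a => (S a).powerset, G I := by
  classical
  -- Families of subsets are grouped by their cardinalities. `Fin.ofNat` reduces modulo `ξ a + 1`,
  -- which has no effect on a cardinality at most `ξ a`.
  rw [← Finset.sum_fiberwise (Fintype.piFinset fun a => (S a).powerset)
    (fun I => (fun a => Fin.ofNat (ξ a + 1) (I a).card : Sub ξ))]
  refine Finset.sum_congr rfl fun η _ => Finset.sum_congr ?_ fun _ _ => rfl
  ext I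
  have hc : ∀ a, I a ⊆ S a → (I a).card < ξ a + 1 := fun a h =>
    Nat.lt_succ_of_le ((Finset.card_le_card h).trans (hS a).le)
  rw [Finset.mem_filter, Fintype.mem_piFinset, Fintype.mem_piFinset]
  simp only [Finset.mem_powersetCard, Finset.mem_powerset]
  constructor
  · intro h
    refine ⟨fun a => (h a).1, funext fun a => Fin.ext ?_⟩
    rw [Fin.val_ofNat, Nat.mod_eq_of_lt (hc a (h a).1), (h a).2]
    rfl
  · rintro ⟨h, rfl⟩ a
    refine ⟨h a, ?_⟩
    change _ = (Fin.ofNat (ξ a + 1) (I a).card).val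
    rw [Fin.val_ofNat, Nat.mod_eq_of_lt (hc a (h a))]

end Fibers

/-! ### The sum of the weights over the choice of the first label -/

section Weights

variable {K : Type*} [Field K] {Λ : Type} [DecidableEq Λ]

/-- `sum_prod_div_sub` with `α = Q⁻¹`, `β = Q` at the distinct nonzero points `P.x p`; the result is
a `q`-number. -/
lemma sum_prod_wgt (P : Par Λ K) (hx : ∀ p, P.x p ≠ 0) (hQ : P.Q - P.Q⁻¹ ≠ 0) (S : Finset Λ) :
    ∑ p ∈ S, ∏ p' ∈ S.erase p, wgt P p p'
      = (P.Q ^ S.card - P.Q⁻¹ ^ S.card) / (P.Q - P.Q⁻¹) := by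
  classical
  have hinj : Function.Injective P.x := fun p p' h => by
    by_contra hne
    exact P.x_ne p p' hne h
  have key := sum_prod_div_sub P.Q⁻¹ P.Q (S.image P.x) (fun h => by
    obtain ⟨p, _, hp⟩ := Finset.mem_image.mp h
    exact hx p hp)
  rw [Finset.card_image_of_injective _ hinj, Finset.sum_image fun _ _ _ _ h => hinj h] at key
  have e : ∀ p ∈ S, ∏ y ∈ (S.image P.x).erase (P.x p), (P.Q⁻¹ * P.x p - P.Q * y) / (P.x p - y)
      = ∏ p' ∈ S.erase p, wgt P p p' := fun p _ => by
    rw [← Finset.image_erase hinj, Finset.prod_image fun _ _ _ _ h => hinj h]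
    rfl
  rw [Finset.sum_congr rfl e] at key
  rw [eq_div_iff hQ, ← neg_sub (P.Q⁻¹ ^ _), ← key]
  ring

end Weights

/-! ### Shuffles and sums over permutations of the places -/

section Places

variable {n : ℕ} {ξ : Fin n → ℕ}

lemma pos_lt_pos {a : Fin n} {i j : Fin (ξ a)} : (pos a i : Pos ξ) < pos a j ↔ i < j := by
  rw [pos, pos, Sigma.Lex.lt_def]
  exact ⟨fun h => h.elim (fun h => absurd h (lt_irrefl a)) fun ⟨_, h⟩ => h, fun h => Or.inr ⟨rfl, h⟩⟩

lemma pairwise_take_permL {m : ℕ} {a : Fin n} {τ : Equiv.Perm (Fin (ξ a))} (hm : m ≤ ξ a) :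
    ((permL a τ).take m).Pairwise (· < ·) ↔ ∀ i j : Fin (ξ a), i < j → j.val < m → τ i < τ j := by
  rw [permL, take_ofFn_eq _ hm, List.pairwise_ofFn]
  constructor
  · intro h i j hij hj
    exact pos_lt_pos.mp (h (i := ⟨i, (Fin.lt_def.mp hij).trans hj⟩) (j := ⟨j, hj⟩) hij)
  · intro h i j hij
    exact pos_lt_pos.mpr (h _ _ hij j.isLt)

lemma pairwise_drop_permL {m : ℕ} {a : Fin n} {τ : Equiv.Perm (Fin (ξ a))} :
    ((permL a τ).drop m).Pairwise (· < ·) ↔ ∀ i j : Fin (ξ a), i < j → m ≤ i.val → τ i < τ j := by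
  rw [permL, drop_ofFn_eq, List.pairwise_ofFn]
  constructor
  · intro h i j hij hi
    have hij' := Fin.lt_def.mp hij
    have := pos_lt_pos.mp (h (i := ⟨i - m, by omega⟩) (j := ⟨j - m, by omega⟩)
      (Fin.lt_def.mpr (by change i.val - m < j.val - m; omega)))
    have e1 : (⟨m + (i.val - m), by omega⟩ : Fin (ξ a)) = i := Fin.ext (by change m + (i.val - m) = i; omega)
    have e2 : (⟨m + (j.val - m), by omega⟩ : Fin (ξ a)) = j := Fin.ext (by change m + (j.val - m) = j; omega)
    rwa [e1, e2] at this
  · intro h i j hij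
    exact pos_lt_pos.mpr (h _ _ (Fin.lt_def.mpr (Nat.add_lt_add_left hij m)) (Nat.le_add_right _ _))

lemma mem_shuffles {η : Sub ξ} {τ : (a : Fin n) → Equiv.Perm (Fin (ξ a))} : τ ∈ shuffles η ↔
    ∀ a, ((permL a (τ a)).take (η.val a)).Pairwise (· < ·) ∧
      ((permL a (τ a)).drop (η.val a)).Pairwise (· < ·) := by
  rw [shuffles, Finset.mem_filter]
  have hη : ∀ a, η.val a ≤ ξ a := fun a => Nat.lt_succ_iff.mp (η a).isLt
  simp only [pairwise_take_permL (hη _), pairwise_drop_permL]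
  exact ⟨fun h a => ⟨fun i j hij hj => h.2 a i j hij (Or.inl hj), fun i j hij hi => h.2 a i j hij (Or.inr hi)⟩,
    fun h => ⟨Finset.mem_univ _, fun a i j hij h' => h'.elim ((h a).1 i j hij) ((h a).2 i j hij)⟩⟩

/-- The places with a given superscript. -/
def colorSet (ξ : Fin n → ℕ) (a : Fin n) : Finset (Pos ξ) := Finset.univ.image (pos a)

lemma card_colorSet (a : Fin n) : (colorSet ξ a).card = ξ a := by
  rw [colorSet, Finset.card_image_of_injective _ (pos_injective a), Finset.card_univ, Fintype.card_fin]

lemma posL_toFinset (a : Fin n) : (posL ξ a).toFinset = colorSet ξ a := by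
  ext p
  simp [posL, colorSet]

lemma headSet_mem {m : ℕ} {a : Fin n} (hm : m ≤ ξ a) (τ : Equiv.Perm (Fin (ξ a))) :
    headSet m a τ ∈ (colorSet ξ a).powersetCard m := by
  rw [Finset.mem_powersetCard]
  have hnd : (permL a τ).Nodup := List.nodup_ofFn.mpr ((pos_injective a).comp τ.injective)
  constructor
  · intro p hp
    obtain ⟨i, rfl⟩ := List.mem_ofFn.mp (List.mem_of_mem_take (List.mem_toFinset.mp hp))
    exact Finset.mem_image_of_mem _ (Finset.mem_univ _)
  · rw [headSet, List.toFinset_card_of_nodup (hnd.sublist (List.take_sublist _ _)), List.length_take, permL,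
      List.length_ofFn, min_eq_left hm]

/-- Summation over the permutations of the variables by the sets of labels of the first ones. -/
lemma sum_perm_eq {K : Type*} [CommRing K] {M : Type*} [AddCommGroup M] [Module K M] (η : Sub ξ)
    (F : List (Pos ξ) → K) (G : (Fin n → Finset (Pos ξ)) → M) (c : ℕ → K)
    (hF : ∀ S : Finset (Pos ξ), ∑ l ∈ arr S, F l = c S.card) :
    ∑ τ : (a : Fin n) → Equiv.Perm (Fin (ξ a)),
      (∏ a, F ((permL a (τ a)).take (η.val a)) * F ((permL a (τ a)).drop (η.val a))) •
        G (fun a => headSet (η.val a) a (τ a))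
    = ∑ I ∈ Fintype.piFinset fun a => (colorSet ξ a).powersetCard (η.val a),
      (∏ a, c (η.val a) * c (ξ a - η.val a)) • G I := by
  have hη : ∀ a, η.val a ≤ ξ a := fun a => Nat.lt_succ_iff.mp (η a).isLt
  refine sum_pi_fiber (fun a => headSet (η.val a) a)
    (fun a τ => F ((permL a τ).take (η.val a)) * F ((permL a τ).drop (η.val a))) _
    (fun a _ => c (η.val a) * c (ξ a - η.val a)) (fun a τ => headSet_mem (hη a) τ) (fun a I hI => ?_) G
  obtain ⟨h1, h2⟩ := Finset.mem_powersetCard.mp hI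
  refine (sum_perm_fiber (pos_injective a) F F h1 h2).trans ?_
  rw [hF, hF, h2]
  change c _ * c (colorSet ξ a \ I).card = _
  rw [Finset.card_sdiff_of_subset h1, h2, card_colorSet]

end Places

end

end QLoop

namespace QLoop

noncomputable section

set_option linter.unusedSectionVars false

/-! ### The two forms of the coproduct formula -/

section Final

variable {σ : Type*} [Fintype σ] [LinearOrder σ] {n : ℕ} {q : ℂ} {ξ : Fin n → ℕ}

/-- A pair of positions lies in the head, lies in the tail, or crosses from one to the other. -/
lemma pairProd_permL {K : Type*} [Field K] (P : Par (Pos ξ) K) (m : ℕ) (a : Fin n)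
    (τ : Equiv.Perm (Fin (ξ a))) :
    ∏ j : Fin (ξ a), ∏ i ∈ Finset.Iio j, wgt P (pos a (τ i)) (pos a (τ j))
      = (pairProd (wgt P) ((permL a τ).take m) * pairProd (wgt P) ((permL a τ).drop m))
        * ∏ i : Fin (ξ a) with i.val < m, ∏ j : Fin (ξ a) with m ≤ j.val,
          wgt P (pos a (τ i)) (pos a (τ j)) := by
  have e1 : ∏ j : Fin (ξ a), ∏ i ∈ Finset.Iio j, wgt P (pos a (τ i)) (pos a (τ j))
      = pairProd (wgt P) (permL a τ) := by
    rw [permL, pairProd_ofFn]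
    exact Finset.prod_comm' (by simp)
  have e2 : ∏ i : Fin (ξ a) with i.val < m, ∏ j : Fin (ξ a) with m ≤ j.val,
          wgt P (pos a (τ i)) (pos a (τ j))
      = (((permL a τ).take m).map fun p => (((permL a τ).drop m).map (wgt P p)).prod).prod := by
    rw [permL, prod_take_map_ofFn (fun i => pos a (τ i))]
    refine Finset.prod_congr rfl fun i _ => ?_
    rw [prod_drop_map_ofFn (fun i => pos a (τ i))]
  rw [e1, e2]
  conv_lhs => rw [← List.take_append_drop m (permL a τ), pairProd_append_comm]
  ring

lemma wProd_permVars (hq : q ≠ 0) {t : Pos ξ → σ} (ht : Function.Injective t) (η : Sub ξ)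
    (τ : (a : Fin n) → Equiv.Perm (Fin (ξ a))) :
    wProd q (permVars t τ) = (∏ a, pairProd (wgt (serPar hq ht)) ((permL a (τ a)).take (η.val a))
        * pairProd (wgt (serPar hq ht)) ((permL a (τ a)).drop (η.val a)))
      * wCross q η (permVars t τ) := by
  have e := Finset.prod_congr (rfl : (Finset.univ : Finset (Fin n)) = Finset.univ)
    fun a _ => pairProd_permL (serPar hq ht) (η.val a) a (τ a)
  rw [Finset.prod_mul_distrib] at e
  simp only [wgt_serPar] at e ⊢
  exact e

/-- Here the `q`-factorials arise: choosing the first label in all ways gives the `q`-number of the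
cardinality, and the rest follows recursively. The conditions on `q` ensure that `q - q⁻¹` is
invertible. -/
lemma sum_arr_wgt (hq₀ : q ≠ 0) (hq₁ : q ≠ 1) (hq₂ : q ≠ -1) {t : Pos ξ → σ}
    (ht : Function.Injective t) (S : Finset (Pos ξ)) :
    ∑ l ∈ arr S, pairProd (wgt (serPar hq₀ ht)) l = HahnSeries.C (qFact q S.card) := by
  have hne : q - q⁻¹ ≠ 0 := fun h => by
    have : (q - 1) * (q + 1) = 0 := by
      have h' : q * (q - q⁻¹) = 0 := by rw [h, mul_zero]
      rw [mul_sub, mul_inv_cancel₀ hq₀] at h'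
      linear_combination h'
    rcases mul_eq_zero.mp this with h | h
    · exact hq₁ (sub_eq_zero.mp h)
    · exact hq₂ (eq_neg_of_add_eq_zero_left h)
  have hQ : (HahnSeries.C q : Ser σ ℂ) - (HahnSeries.C q)⁻¹ ≠ 0 := by
    rw [← map_inv₀, ← map_sub]
    exact HahnSeries.C_ne_zero hne
  rw [sum_arr_pairProd _ (fun k => HahnSeries.C (qNum q k)), qFact, map_prod]
  intro S _
  rw [sum_prod_wgt (serPar hq₀ ht) (fun p => tvar_ne_zero _) hQ, qNum]
  change ((HahnSeries.C q : Ser σ ℂ) ^ S.card - (HahnSeries.C q)⁻¹ ^ S.card)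
    / (HahnSeries.C q - (HahnSeries.C q)⁻¹) = _
  simp only [← map_inv₀, ← map_pow, ← map_sub, ← map_div₀]

variable {V : Type*} [AddCommGroup V] [Module ℂ V] {W : Type*} [AddCommGroup W] [Module ℂ W]
  (ρ₁ : Uminus (n + 1) q →ₐ[ℂ] Module.End ℂ V)
  (ρ₂ : Uminus (n + 1) q →ₐ[ℂ] Module.End ℂ W) (v₁ : V) (v₂ : W) (l₁ l₂ : Fin (n + 1) → ℕ → ℂ)

lemma smul_vser (c : ℂ) (x : VSer σ V) : c • x = (HahnSeries.C c : Ser σ ℂ) • x :=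
  (HahnModule.single_zero_smul_eq_smul (Expo σ)).symm

lemma sum_shuffles (hq : q ≠ 0) {t : Pos ξ → σ} (ht : Function.Injective t) (η : Sub ξ) :
    ∑ τ ∈ shuffles η, wCross q η (permVars t τ) • bracket ρ₁ ρ₂ v₁ v₂ l₁ l₂ η (permVars t τ)
      = ∑ I ∈ Fintype.piFinset fun a => (colorSet ξ a).powersetCard (η.val a),
        splitTerm ρ₁ ρ₂ v₁ v₂ l₁ l₂ hq ht I := by
  classical
  -- The weight is the indicator of increasing lists. Every set has one increasing arrangement, so
  -- every family of subsets comes from exactly one shuffle.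
  have key := sum_perm_eq (K := Ser σ ℂ) η (fun l => if l.Pairwise (· < ·) then 1 else 0)
    (splitTerm ρ₁ ρ₂ v₁ v₂ l₁ l₂ hq ht) (fun _ => 1) fun S => sum_arr_sorted S
  simp only [one_mul, Finset.prod_const_one] at key
  simp only [wCross_smul_bracket ρ₁ ρ₂ v₁ v₂ l₁ l₂ hq ht]
  have e1 : ∀ x : VSer σ (V ⊗[ℂ] W), (1 : Ser σ ℂ) • x = x := fun x => one_smul (Ser σ ℂ) x
  have e0 : ∀ x : VSer σ (V ⊗[ℂ] W), (0 : Ser σ ℂ) • x = 0 := fun x => zero_smul (Ser σ ℂ) x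
  simp only [e1] at key
  rw [← key]
  symm
  refine (Finset.sum_subset (Finset.subset_univ (shuffles η)) fun τ _ hτ => ?_).symm.trans
    (Finset.sum_congr rfl fun τ hτ => ?_)
  · rw [mem_shuffles] at hτ
    push Not at hτ
    obtain ⟨a, ha⟩ := hτ
    rw [Finset.prod_eq_zero (Finset.mem_univ a), e0]
    by_cases h : ((permL a (τ a)).take (η.val a)).Pairwise (· < ·)
    · rw [if_neg (ha h), mul_zero]
    · rw [if_neg h, zero_mul]
  · rw [mem_shuffles] at hτ
    rw [Finset.prod_eq_one fun a _ => by rw [if_pos (hτ a).1, if_pos (hτ a).2, mul_one], e1]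

lemma qSymm_bracket (hq₀ : q ≠ 0) (hq₁ : q ≠ 1) (hq₂ : q ≠ -1) {t : Pos ξ → σ}
    (ht : Function.Injective t) (η : Sub ξ) :
    qSymm q (bracket ρ₁ ρ₂ v₁ v₂ l₁ l₂ η) t
      = (∏ a, qFact q (ξ a - η.val a) * qFact q (η.val a)) •
        ∑ I ∈ Fintype.piFinset fun a => (colorSet ξ a).powersetCard (η.val a),
          splitTerm ρ₁ ρ₂ v₁ v₂ l₁ l₂ hq₀ ht I := by
  -- The weights inside the head and inside the tail are summed over all arrangements of the two
  -- sets; the crossing weights are already part of `splitTerm`.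
  have key := sum_perm_eq (K := Ser σ ℂ) η (pairProd (wgt (serPar hq₀ ht)))
    (splitTerm ρ₁ ρ₂ v₁ v₂ l₁ l₂ hq₀ ht) (fun k => HahnSeries.C (qFact q k))
    (sum_arr_wgt hq₀ hq₁ hq₂ ht)
  have e : ∀ τ : (a : Fin n) → Equiv.Perm (Fin (ξ a)),
      wProd q (permVars t τ) • bracket ρ₁ ρ₂ v₁ v₂ l₁ l₂ η (permVars t τ)
      = (∏ a, pairProd (wgt (serPar hq₀ ht)) ((permL a (τ a)).take (η.val a))
        * pairProd (wgt (serPar hq₀ ht)) ((permL a (τ a)).drop (η.val a))) •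
        splitTerm ρ₁ ρ₂ v₁ v₂ l₁ l₂ hq₀ ht fun a => headSet (η.val a) a (τ a) := fun τ => by
    rw [← wCross_smul_bracket, wProd_permVars hq₀ ht η]
    exact mul_smul (_ : Ser σ ℂ) (_ : Ser σ ℂ) (bracket ρ₁ ρ₂ v₁ v₂ l₁ l₂ η (permVars t τ))
  refine (Finset.sum_congr rfl fun τ _ => e τ).trans (key.trans ?_)
  rw [smul_vser, Finset.smul_sum, map_prod]
  refine Finset.sum_congr rfl fun I _ => ?_
  congr 1
  exact Finset.prod_congr rfl fun a _ => by rw [map_mul, mul_comm]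

lemma prod_one_div_smul {M : Type*} [AddCommGroup M] [Module ℂ M] (c : Fin n → ℂ) (hc : ∀ a, c a ≠ 0)
    (x : M) : (∏ a, 1 / c a) • (∏ a, c a) • x = x := by
  rw [smul_smul, ← Finset.prod_mul_distrib, Finset.prod_eq_one fun a _ => one_div_mul_cancel (hc a),
    one_smul]

/-- The smaller `q`-factorial is a product of some of the factors of the larger one, so the
hypothesis for `ξ` permits all divisions in (i). -/
lemma qFact_ne_zero_of_le {m k : ℕ} (h : m ≤ k) (hk : qFact q k ≠ 0) : qFact q m ≠ 0 := by
  rw [qFact, Finset.prod_ne_zero_iff] at hk ⊢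
  exact fun i hi => hk i (Finset.mem_range.mpr ((Finset.mem_range.mp hi).trans_le h))

end Final

end

end QLoop


theorem theorem6p6 (n : ℕ) (q : ℂ) (hq₀ : q ≠ 0) (hq₁ : q ≠ 1) (hq₂ : q ≠ -1)
    {V₁ V₂ : Type*} [AddCommGroup V₁] [Module ℂ V₁] [AddCommGroup V₂] [Module ℂ V₂]
    (ρ₁ : QLoop.Uminus (n + 1) q →ₐ[ℂ] Module.End ℂ V₁)
    (ρ₂ : QLoop.Uminus (n + 1) q →ₐ[ℂ] Module.End ℂ V₂)
    (v₁ : V₁) (v₂ : V₂) (l₁ l₂ : Fin (n + 1) → ℕ → ℂ)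
    (h₁ : QLoop.IsWeightSingular ρ₁ v₁ l₁) (h₂ : QLoop.IsWeightSingular ρ₂ v₂ l₂)
    (ξ : Fin n → ℕ) {σ : Type*} [Fintype σ] [LinearOrder σ]
    (t : QLoop.Pos ξ → σ) (ht : Function.Injective t) :
    ((∀ a, QLoop.qFact q (ξ a) ≠ 0) →
      QLoop.weightFn (QLoop.tensorRep ρ₁ ρ₂) t (v₁ ⊗ₜ[ℂ] v₂) =
        ∑ η : QLoop.Sub ξ,
          (∏ a, 1 / (QLoop.qFact q (ξ a - η.val a) * QLoop.qFact q (η.val a))) •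
            QLoop.qSymm q (QLoop.bracket ρ₁ ρ₂ v₁ v₂ l₁ l₂ η) t) ∧
    QLoop.weightFn (QLoop.tensorRep ρ₁ ρ₂) t (v₁ ⊗ₜ[ℂ] v₂) =
      ∑ η : QLoop.Sub ξ, ∑ τ ∈ QLoop.shuffles η,
        QLoop.wCross q η (QLoop.permVars t τ) •
          QLoop.bracket ρ₁ ρ₂ v₁ v₂ l₁ l₂ η (QLoop.permVars t τ) := by
  -- The common source of both forms: the sum over families of subsets, grouped by cardinality `η`.
  -- For each `η`, (i) averages over all permutations and (ii) selects one permutation per family.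
  have key : QLoop.weightFn (QLoop.tensorRep ρ₁ ρ₂) t (v₁ ⊗ₜ[ℂ] v₂)
      = ∑ η : QLoop.Sub ξ, ∑ I ∈ Fintype.piFinset fun a => (QLoop.colorSet ξ a).powersetCard (η.val a),
        QLoop.splitTerm ρ₁ ρ₂ v₁ v₂ l₁ l₂ hq₀ ht I := by
    rw [QLoop.sum_piFinset_powerset ξ (QLoop.colorSet ξ) QLoop.card_colorSet,
      QLoop.weightFn_eq_sum _ _ _ _ _ _ hq₀ h₁ h₂ ht]
    simp only [QLoop.posL_toFinset]
  refine ⟨fun hξ => ?_, ?_⟩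
  · rw [key]
    refine Finset.sum_congr rfl fun η _ => ?_
    rw [QLoop.qSymm_bracket ρ₁ ρ₂ v₁ v₂ l₁ l₂ hq₀ hq₁ hq₂ ht]
    have hη : ∀ a, η.val a ≤ ξ a := fun a => Nat.lt_succ_iff.mp (η a).isLt
    exact (QLoop.prod_one_div_smul _ (fun a => mul_ne_zero
      (QLoop.qFact_ne_zero_of_le (Nat.sub_le _ _) (hξ a)) (QLoop.qFact_ne_zero_of_le (hη a) (hξ a))) _).symm
  · rw [key]
    exact Finset.sum_congr rfl fun η _ => (QLoop.sum_shuffles ρ₁ ρ₂ v₁ v₂ l₁ l₂ hq₀ ht η).symm
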